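/- **Setting.** Let $\mathbb H$ be a separable real Hilbert space and let $(A,\mathscr D(A))$ generate a $C_0$ contraction semigroup $(e^{At})_{t\ge0}$ on $\mathbb H$ such that every $e^{At}$ is injective and $\int_0^{t}\|e^{As}\|_{HS}^2\,ds<\infty$ for all $t>0$. Let $b:[0,\infty)\times\mathbb H\to\mathbb H$ and $\sigma:[0,\infty)\to\mathscr L(\mathbb H)$ be measurable and locally bounded, with $b_t$ Lipschitz locally uniformly in $t$. Assume: * (H1) $b_t\in C^2(\mathbb H)$; for all $t\ge0$, $x\in\mathbb H$ the operator $\nabla b_t(x)$ maps $\mathrm{Im}(e^{At})$ into itself; and $B_t(x):=e^{-At}\,\nabla b_t(x)\,e^{At}$ is a bounded operator, (Fréchet) differentiable in $x$, with $\sup_x\|B_t(x)\|\le K_1(t)$ and $\sup_x\|\nabla B_t(x)\|\le K_2(t)$ for some increasing $K_1,K_2\in C([0,\infty))$. * (H2) $\sigma_t$ is invertible, $\|\sigma_t\|\le\lambda_1(t)$ and $\|\sigma_t^{-1}\|\le\lambda_2(t)$ for some increasing $\lambda_1,\lambda_2\in C([0,\infty))$. Let $W$ be a cylindrical Brownian motion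 on $\mathbb H$ and $V$ an $\mathbb H$-valued càdlàg process with $V_0=0$, independent of $W$. Let $T>0$ and let $\ell:[0,\infty)\to[0,\infty)$ be a deterministic càdlàg increasing function with $\ell(0)=0$, $\ell(T)>0$ and only finitely many jumps on $[0,T]$, such that $$\int_{(0,T]}\big(\|e^{A(T-t)}\|_{HS}^2+\|e^{At}\|_{HS}^2\big)\,d\ell(t)<\infty. \qquad (*)$$ (Condition $(*)$ only guarantees that the stochastic integrals below exist; it holds automatically if $\dim\mathbb H<\infty$, and also if $\ell$ is a step function without a jump at $T$.) Let $x\in\mathbb H$ and let $X^\ell$ be a solution on $[0,T]$ of $$X^\ell_t=e^{At}x+\int_0^te^{A(t-s)}b_s(X^\ell_s)\,ds+\int_0^te^{A(t-s)}\sigma_s\,dW_{\ell(s)}+V_t ,$$ the equation being required, almost surely, at each $t\in[0,T]$ with $\int_{(0,t]}\|e^{A(t-s)}\|_{HS}^2\,d\ell(s)<\infty$ (every $t$ if $\dim\mathbb H<\infty$; in general almost every $t$, and $t=T$). For $0\le s\le t\le T$ let $J^\ell_{s,t}$ and $\tilde J^\ell_{s,t}$ be the $\mathscr L(\mathbb H)$-valued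 solutions (the second one in the mild sense) of $$\tfrac{d}{dt}J^\ell_{s,t}=B_t(X^\ell_t)J^\ell_{s,t},\qquad \tfrac{d}{dt}\tilde J^\ell_{s,t}=\big(A+\nabla b_t(X^\ell_t)\big)\tilde J^\ell_{s,t},\qquad J^\ell_{s,s}=\tilde J^\ell_{s,s}=I .$$ **Theorem.** For $v\in\mathbb H$ put $$M_T^{\ell,v}:=\frac1{\ell(T)}\bigg(\int_0^T\big\langle\sigma_t^{-1}e^{At}(J^\ell_{t,T})^{-1}v,\,dW_{\ell(t)}\big\rangle+\int_0^Td\ell(t)\int_t^T\mathrm{Tr}\Big\{u\mapsto\sigma_t^{-1}e^{At}(J^\ell_{t,r})^{-1}\big(\nabla_{\tilde J^\ell_{t,r}\sigma_tu}B_r\big)(X^\ell_r)\,(J^\ell_{r,T})^{-1}v\Big\}\,dr\bigg),$$ where $\nabla_wB_r$ is the derivative of $B_r$ in the direction $w$, and where, since $(J^\ell_{t,T})^{-1}=J^\ell_{0,t}(J^\ell_{0,T})^{-1}$, the first integral is understood as $\big\langle\int_0^T(\sigma_t^{-1}e^{At}J^\ell_{0,t})^*\,dW_{\ell(t)},\,(J^\ell_{0,T})^{-1}v\big\rangle$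 with an Itô integral with values in $\mathbb H$. (If $\ell$ is a step function with jump times $t_1<\dots<t_n$ and $\dim\mathbb H<\infty$, this is $\sum_i\langle\sigma_{t_i}^{-1}e^{At_i}(J^\ell_{t_i,T})^{-1}v,\,W_{\ell(t_i)}-W_{\ell(t_i-)}\rangle$.) Then the Itô integral exists, almost surely the trace series and the integrals in the second term converge absolutely, and for all $v\in\mathbb H$ and all $f\in C_b^1(\mathbb H)$ (bounded $C^1$ functions with bounded derivative) the random variable $f(X^\ell_T)M_T^{\ell,v}$ is integrable and $$P^\ell_T(\nabla_{e^{AT}v}f)(x)=\mathbb E\big[(\nabla_{e^{AT}v}f)(X^\ell_T)\big]=\mathbb E\big[f(X^\ell_T)\,M_T^{\ell,v}\big].$$ -/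

import Mathlib

open Set Filter Topology MeasureTheory ProbabilityTheory
open scoped NNReal ENNReal InnerProductSpace

noncomputable section

namespace SubordinateIBP

variable {Ω H ι : Type*} [NormedAddCommGroup H] [InnerProductSpace ℝ H]

/-! ### Hilbert-Schmidt norm, trace, contraction semigroups -/

/-- The square of the Hilbert-Schmidt norm of `L` (possibly `∞`), computed in an orthonormal
basis `e`; the value does not depend on `e`. -/
def hsNormSq (e : HilbertBasis ι ℝ H) (L : H →L[ℝ] H) : ℝ≥0∞ := ∑' i, ‖L (e i)‖ₑ ^ 2

/-- The trace of `L` in an orthonormal basis `e`; for trace class `L` it does not depend on `e`. -/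
def trace (e : HilbertBasis ι ℝ H) (L : H →L[ℝ] H) : ℝ := ∑' i, ⟪L (e i), e i⟫_ℝ

/-- `(S t)_{t ≥ 0}` is the `C₀` semigroup of contractions `e^{At}` generated by the (possibly
unbounded) linear operator `A`. Only times `t ≥ 0` matter. -/
structure IsContractionSemigroup (A : H →ₗ.[ℝ] H) (S : ℝ → H →L[ℝ] H) : Prop where
  zero : S 0 = 1
  add : ∀ s t, 0 ≤ s → 0 ≤ t → S (s + t) = (S s).comp (S t)
  continuousOn : ∀ x, ContinuousOn (fun t => S t x) (Ici 0)
  norm_le_one : ∀ t, 0 ≤ t → ‖S t‖ ≤ 1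
  mem_domain_iff : ∀ x, x ∈ A.domain ↔
    ∃ y, Tendsto (fun t : ℝ => t⁻¹ • (S t x - x)) (𝓝[>] 0) (𝓝 y)
  tendsto_generator : ∀ x : A.domain,
    Tendsto (fun t : ℝ => t⁻¹ • (S t (x : H) - (x : H))) (𝓝[>] 0) (𝓝 (A x))

/-! ### The coefficients -/

/-- Standing assumptions on the drift `b : [0,∞) × H → H` and on the noise coefficient
`σ : [0,∞) → L(H)`: measurable, locally bounded, and `b_t` Lipschitz locally uniformly in `t`. -/
structure StandingAssumptions [MeasurableSpace H] (b : ℝ → H → H) (σ : ℝ → H →L[ℝ] H) :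
    Prop where
  measurable_b : Measurable (fun p : ℝ≥0 × H => b p.1 p.2)
  bounded_b : ∀ R : ℝ, ∃ C : ℝ, ∀ t ∈ Icc 0 R, ∀ x : H, ‖x‖ ≤ R → ‖b t x‖ ≤ C
  lipschitz_b : ∀ R : ℝ, ∃ K : ℝ≥0, ∀ t ∈ Icc 0 R, LipschitzWith K (b t)
  measurable_σ : ∀ u : H, Measurable (fun t : ℝ≥0 => σ t u)
  bounded_σ : ∀ R : ℝ, ∃ C : ℝ, ∀ t ∈ Icc 0 R, ‖σ t‖ ≤ C

/-- Assumption (H1). Since `e^{At}` is injective, `e^{At} B_t(x) = ∇b_t(x) e^{At}` says exactly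
that `∇b_t(x)` leaves the range of `e^{At}` invariant and `B_t(x) = e^{-At} ∇b_t(x) e^{At}`. -/
structure AssumptionH1 (S : ℝ → H →L[ℝ] H) (b : ℝ → H → H) (B : ℝ → H → H →L[ℝ] H) :
    Prop where
  contDiff_b : ∀ t, 0 ≤ t → ContDiff ℝ 2 (b t)
  conj : ∀ t, 0 ≤ t → ∀ x, (S t).comp (B t x) = (fderiv ℝ (b t) x).comp (S t)
  differentiable_B : ∀ t, 0 ≤ t → Differentiable ℝ (B t)
  bounds : ∃ K₁ K₂ : ℝ → ℝ,
    MonotoneOn K₁ (Ici 0) ∧ ContinuousOn K₁ (Ici 0) ∧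
    MonotoneOn K₂ (Ici 0) ∧ ContinuousOn K₂ (Ici 0) ∧
    ∀ t, 0 ≤ t → ∀ x, ‖B t x‖ ≤ K₁ t ∧ ‖fderiv ℝ (B t) x‖ ≤ K₂ t

/-- Assumption (H2): `σ_t` is invertible with locally bounded norm and inverse. -/
structure AssumptionH2 (σ : ℝ → H →L[ℝ] H) : Prop where
  isUnit : ∀ t, 0 ≤ t → IsUnit (σ t)
  bounds : ∃ lam₁ lam₂ : ℝ → ℝ,
    MonotoneOn lam₁ (Ici 0) ∧ ContinuousOn lam₁ (Ici 0) ∧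
    MonotoneOn lam₂ (Ici 0) ∧ ContinuousOn lam₂ (Ici 0) ∧
    ∀ t, 0 ≤ t → ‖σ t‖ ≤ lam₁ t ∧ ‖Ring.inverse (σ t)‖ ≤ lam₂ t

/-! ### The noise -/

/-- `W` is a cylindrical Brownian motion on `H` with `W_0 = 0`: the family of real random variables
`W t u` (formally `⟨W_t, u⟩`) is centered Gaussian with covariance `min s t * ⟨u, v⟩`, and for each
`u` the real process `t ↦ W t u` has almost surely continuous paths. -/
structure IsCylindricalBrownian {_ : MeasurableSpace Ω} (W : ℝ≥0 → H → Ω → ℝ) (P : Measure Ω) :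
    Prop where
  measurable : ∀ t u, Measurable (W t u)
  isGaussian : IsGaussianProcess (fun p : ℝ≥0 × H => W p.1 p.2) P
  mean : ∀ t u, ∫ ω, W t u ω ∂P = 0
  cov : ∀ s t u v, ∫ ω, W s u ω * W t v ω ∂P = (min s t : ℝ≥0) * ⟪u, v⟫_ℝ
  continuous : ∀ u, ∀ᵐ ω ∂P, Continuous (fun t => W t u ω)

/-- `V` is an `H`-valued càdlàg process on `[0,∞)` with `V_0 = 0`. -/
structure IsCadlagProcess {_ : MeasurableSpace Ω} [MeasurableSpace H] (V : ℝ → Ω → H)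
    (P : Measure Ω) : Prop where
  measurable : ∀ t, 0 ≤ t → Measurable (V t)
  zero : ∀ᵐ ω ∂P, V 0 ω = 0
  cadlag : ∀ᵐ ω ∂P,
    (∀ t, 0 ≤ t → ContinuousWithinAt (fun s => V s ω) (Ici t) t) ∧
    ∀ t, 0 < t → ∃ l, Tendsto (fun s => V s ω) (𝓝[<] t) (𝓝 l)

/-- The σ-algebra generated by the cylindrical Brownian motion. -/
@[reducible] def sigmaW (W : ℝ≥0 → H → Ω → ℝ) : MeasurableSpace Ω :=
  ⨆ (t : ℝ≥0) (u : H), MeasurableSpace.comap (W t u) inferInstance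

/-- The σ-algebra generated by the process `V` on `[0,∞)`. -/
@[reducible] def sigmaV [MeasurableSpace H] (V : ℝ → Ω → H) : MeasurableSpace Ω :=
  ⨆ (t : ℝ) (_ : 0 ≤ t), MeasurableSpace.comap (V t) inferInstance

/-- The information available at time `t`: the noise `W` up to time `ℓ(t)` together with the
independent process `V`. -/
@[reducible] def history [MeasurableSpace H] (W : ℝ≥0 → H → Ω → ℝ) (V : ℝ → Ω → H)
    (ℓ : StieltjesFunction ℝ) (t : ℝ) : MeasurableSpace Ω :=
  (⨆ (r : ℝ≥0) (_ : r ≤ (ℓ t).toNNReal) (u : H), MeasurableSpace.comap (W r u) inferInstance) ⊔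
    sigmaV V

/-! ### Stochastic integrals with respect to `W_{ℓ(t)}` -/

/-- A simple `H`-valued integrand on `(0,T]`, `∑ⱼ 1_{(aⱼ, cⱼ]}(t) ξⱼ uⱼ`, with `ξⱼ` bounded and
known at time `aⱼ`. -/
structure SimpleIntegrand (H : Type*) (𝓕 : ℝ → MeasurableSpace Ω) (T : ℝ) where
  n : ℕ
  left : Fin n → ℝ
  right : Fin n → ℝ
  left_nonneg : ∀ j, 0 ≤ left j
  left_le_right : ∀ j, left j ≤ right j
  right_le : ∀ j, right j ≤ T
  coef : Fin n → Ω → ℝ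
  measurable_coef : ∀ j, Measurable[𝓕 (left j)] (coef j)
  bounded_coef : ∃ C : ℝ, ∀ j ω, |coef j ω| ≤ C
  dir : Fin n → H

/-- The value `Φ_t(ω)` of a simple integrand. -/
def SimpleIntegrand.val {𝓕 : ℝ → MeasurableSpace Ω} {T : ℝ} (Φ : SimpleIntegrand H 𝓕 T)
    (t : ℝ) (ω : Ω) : H :=
  ∑ j, (Ioc (Φ.left j) (Φ.right j)).indicator (fun _ => Φ.coef j ω • Φ.dir j) t

/-- The elementary integral `∑ⱼ ξⱼ ⟨W_{ℓ(cⱼ)} - W_{ℓ(aⱼ)}, uⱼ⟩` of a simple integrand. -/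
def SimpleIntegrand.stochInt {𝓕 : ℝ → MeasurableSpace Ω} {T : ℝ} (Φ : SimpleIntegrand H 𝓕 T)
    (W : ℝ≥0 → H → Ω → ℝ) (ℓ : StieltjesFunction ℝ) (ω : Ω) : ℝ :=
  ∑ j, Φ.coef j ω *
    (W (ℓ (Φ.right j)).toNNReal (Φ.dir j) ω - W (ℓ (Φ.left j)).toNNReal (Φ.dir j) ω)

/-- `I` is the real-valued Itô integral `∫_{(0,T]} ⟨φ_t, dW_{ℓ(t)}⟩`: the `L²(P)`-limit of the
elementary integrals of simple integrands converging to `φ` in `L²(dℓ ⊗ P)` on `(0,T] × Ω`. -/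
def IsItoIntegral {_ : MeasurableSpace Ω} [MeasurableSpace H] (W : ℝ≥0 → H → Ω → ℝ)
    (V : ℝ → Ω → H) (ℓ : StieltjesFunction ℝ) (P : Measure Ω) (T : ℝ) (φ : ℝ → Ω → H)
    (I : Ω → ℝ) : Prop :=
  AEStronglyMeasurable (fun p : ℝ × Ω => φ p.1 p.2) ((ℓ.measure.restrict (Ioc 0 T)).prod P) ∧
  MemLp I 2 P ∧
  ∃ Φ : ℕ → SimpleIntegrand H (history W V ℓ) T,
    Tendsto (fun n => ∫⁻ p, ‖(Φ n).val p.1 p.2 - φ p.1 p.2‖ₑ ^ 2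
      ∂((ℓ.measure.restrict (Ioc 0 T)).prod P)) atTop (𝓝 0) ∧
    Tendsto (fun n => eLpNorm (fun ω => (Φ n).stochInt W ℓ ω - I ω) 2 P) atTop (𝓝 0)

/-- `I` is the `H`-valued Itô integral `∫_{(0,T]} G_t dW_{ℓ(t)}` of the operator-valued process
`G`: it is an `H`-valued random variable with `⟨I, y⟩ = ∫_{(0,T]} ⟨G_t^* y, dW_{ℓ(t)}⟩` almost
surely, for every `y ∈ H`. -/
def IsItoIntegralH {_ : MeasurableSpace Ω} [CompleteSpace H] [MeasurableSpace H]
    (W : ℝ≥0 → H → Ω → ℝ) (V : ℝ → Ω → H) (ℓ : StieltjesFunction ℝ) (P : Measure Ω) (T : ℝ)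
    (G : ℝ → Ω → H →L[ℝ] H) (I : Ω → H) : Prop :=
  AEStronglyMeasurable I P ∧
  ∀ y : H, IsItoIntegral W V ℓ P T (fun t ω => ContinuousLinearMap.adjoint (G t ω) y)
    (fun ω => ⟪I ω, y⟫_ℝ)

/-! ### The equation and its linearizations -/

/-- `X` solves on `[0,T]` the equation
`X_t = e^{At} x + ∫_0^t e^{A(t-s)} b_s(X_s) ds + ∫_0^t e^{A(t-s)} σ_s dW_{ℓ(s)} + V_t`,
at every time `t` at which the stochastic convolution exists as an `H`-valued random variable, i.e.
`∫_{(0,t]} ‖e^{A(t-s)}‖_HS² dℓ(s) < ∞`. This is every `t` if `dim H < ∞`. If `dim H = ∞` it is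
almost every `t`; jump times of `ℓ` are excluded, as the jump of a cylindrical process
does not lie in `H`. -/
structure IsMildSolution {_ : MeasurableSpace Ω} [CompleteSpace H] [MeasurableSpace H]
    (e : HilbertBasis ι ℝ H) (W : ℝ≥0 → H → Ω → ℝ) (V : ℝ → Ω → H) (ℓ : StieltjesFunction ℝ)
    (P : Measure Ω) (S : ℝ → H →L[ℝ] H) (b : ℝ → H → H) (σ : ℝ → H →L[ℝ] H) (T : ℝ) (x : H)
    (X : ℝ → Ω → H) : Prop where
  aestronglyMeasurable : AEStronglyMeasurable (fun p : ℝ × Ω => X p.1 p.2)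
    ((volume.restrict (Icc 0 T)).prod P)
  integrable_drift : ∀ᵐ ω ∂P, IntegrableOn (fun s => b s (X s ω)) (Icc 0 T)
  equation : ∀ t ∈ Icc 0 T, ∫⁻ s in Ioc 0 t, hsNormSq e (S (t - s)) ∂ℓ.measure ≠ ∞ →
    ∃ Z : Ω → H, IsItoIntegralH W V ℓ P t (fun s _ => (S (t - s)).comp (σ s)) Z ∧
      ∀ᵐ ω ∂P, X t ω =
        S t x + (∫ s in (0 : ℝ)..t, S (t - s) (b s (X s ω))) + Z ω + V t ω

/-- `J s t`, `0 ≤ s ≤ t ≤ T`, solves `d/dt J_{s,t} = B_t(X_t) J_{s,t}`, `J_{s,s} = 1`, along the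
path `X` (in integrated form, pointwise on vectors). -/
def IsFlow (B : ℝ → H → H →L[ℝ] H) (T : ℝ) (X : ℝ → H) (J : ℝ → ℝ → H →L[ℝ] H) : Prop :=
  ∀ s ∈ Icc 0 T, ∀ u : H, ContinuousOn (fun t => J s t u) (Icc s T) ∧
    ∀ t ∈ Icc s T, IntervalIntegrable (fun r => B r (X r) (J s r u)) volume s t ∧
      J s t u = u + ∫ r in s..t, B r (X r) (J s r u)

/-- `Jt s t`, `0 ≤ s ≤ t ≤ T`, is the mild solution of
`d/dt Jt_{s,t} = (A + ∇b_t(X_t)) Jt_{s,t}`, `Jt_{s,s} = 1`, along the path `X`. -/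
def IsMildFlow (S : ℝ → H →L[ℝ] H) (b : ℝ → H → H) (T : ℝ) (X : ℝ → H)
    (Jt : ℝ → ℝ → H →L[ℝ] H) : Prop :=
  ∀ s ∈ Icc 0 T, ∀ u : H, ContinuousOn (fun t => Jt s t u) (Icc s T) ∧
    ∀ t ∈ Icc s T,
      IntervalIntegrable (fun r => S (t - r) (fderiv ℝ (b r) (X r) (Jt s r u))) volume s t ∧
      Jt s t u = S (t - s) u + ∫ r in s..t, S (t - r) (fderiv ℝ (b r) (X r) (Jt s r u))

/-! ### The weight -/

/-- The operator
`u ↦ σ_t⁻¹ e^{At} J_{t,r}⁻¹ (∇_{Jt_{t,r} σ_t u} B_r)(X_r) J_{r,T}⁻¹ v`. -/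
def correctionOp (S : ℝ → H →L[ℝ] H) (σ : ℝ → H →L[ℝ] H) (B : ℝ → H → H →L[ℝ] H) (T : ℝ)
    (X : ℝ → H) (J Jt : ℝ → ℝ → H →L[ℝ] H) (v : H) (t r : ℝ) : H →L[ℝ] H :=
  (Ring.inverse (σ t)).comp ((S t).comp ((Ring.inverse (J t r)).comp
    (((fderiv ℝ (B r) (X r)).flip (Ring.inverse (J r T) v)).comp ((Jt t r).comp (σ t)))))

/-- All series and integrals in the correction term
`∫_{(0,T]} dℓ(t) ∫_t^T Tr{...} dr` converge absolutely. -/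
def CorrectionConverges (e : HilbertBasis ι ℝ H) (ℓ : StieltjesFunction ℝ) (T : ℝ)
    (C : ℝ → ℝ → H →L[ℝ] H) : Prop :=
  (∀ t ∈ Ioc 0 T, ∀ r ∈ Icc t T, Summable (fun i => ⟪C t r (e i), e i⟫_ℝ)) ∧
  (∀ t ∈ Ioc 0 T, IntervalIntegrable (fun r => trace e (C t r)) volume t T) ∧
  IntegrableOn (fun t => ∫ r in t..T, trace e (C t r)) (Ioc 0 T) ℓ.measure

/-- The weight `M_T^{ℓ,v}`, where `I = ∫_0^T (σ_t⁻¹ e^{At} J_{0,t})^* dW_{ℓ(t)}`. As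
`J_{t,T}⁻¹ = J_{0,t} J_{0,T}⁻¹`, the integral `∫_0^T ⟨σ_t⁻¹ e^{At} J_{t,T}⁻¹ v, dW_{ℓ(t)}⟩` is
`⟨I, J_{0,T}⁻¹ v⟩`. -/
def weight (e : HilbertBasis ι ℝ H) (ℓ : StieltjesFunction ℝ) (S : ℝ → H →L[ℝ] H)
    (σ : ℝ → H →L[ℝ] H) (B : ℝ → H → H →L[ℝ] H) (T : ℝ) (X : ℝ → H)
    (J Jt : ℝ → ℝ → H →L[ℝ] H) (I : H) (v : H) : ℝ :=
  (ℓ T)⁻¹ * (⟪I, Ring.inverse (J 0 T) v⟫_ℝ +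
    ∫ t in Ioc 0 T, (∫ r in t..T, trace e (correctionOp S σ B T X J Jt v t r)) ∂ℓ.measure)

end SubordinateIBP

end

/-! The weight comes out of Gaussian integration by parts with respect to the noise, with everything
else frozen. Path by path the solution `X` is a function of its forcing
`Y_t = e^{At} x + ∫_0^t e^{A(t-s)} σ_s dW_{ℓ(s)} + V_t`, because the mild equation
`X_t = Y_t + ∫_0^t e^{A(t-s)} b_s(X_s) ds` is uniquely solvable; `Model` records this reduction. The
functional to be integrated by parts is not `f(X_T)` alone but `f(X_T) ⟨w', k_0⟩` (`ibpValue`),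
where `k` solves `k' = B(X) k` with `k_T = v`, so that `k_0 = J_{0,T}⁻¹ v`. When the forcing moves
in a direction `y`, the solution moves along the linearized equation (`Coeffs.hasDerivAt_mildSol`),
and `⟨w', k_0⟩` changes by an integral of `∇B` against `k` and a solution of the adjoint equation
(`Coeffs.hasDerivAt_backward`); `ibpDeriv` collects the two contributions.

*One increment.* Let `N = ⟨W_{ℓ(c)} - W_{ℓ(a)}, u⟩` have variance `v > 0`. The σ-algebra generated
by `V` and by the residuals of the noise after projection on `N` is independent of `N`
(`indep_complement`), contains the history up to time `a` (`history_le_complement`), and makes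
`Y - (N / v) y` measurable for `y_t = ∫_{(a,c] ∩ (0,t]} e^{A(t-s)} σ_s u dℓ(s)`
(`IsForcing.aestronglyMeasurable_complement`). Hence `X` is the value at `n = N / v` of a family of
solutions with forcing `Y' + n y`, where `Y'` is independent of `N`
(`Model.exists_solution_version`), and Stein's identity in the variable `N`
(`integral_mul_gaussianReal`) gives `Model.integral_mul_increment`. Linearity and Itô's isometry
extend this to stochastic integrals of bounded adapted integrands (`Model.integral_stochInt_mul`).

*The integrand of the weight.* For `h_t = σ_t⁻¹ e^{At} J_{0,t} w` the response of the solution is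
explicit: it is `ℓ(t) e^{At} J_{0,t} w` (`Model.isMildSol_shift`). This is where the relation
`e^{At} B_t = ∇b_t e^{At}` enters; it turns the linearized mild equation into the identity
`ℓ(t) J_{0,t} = ∫_0^t J_{0,s} dℓ(s) + ∫_0^t ℓ(r) B_r J_{0,r} dr`. Taking `w = w' = e_i` and summing
over an orthonormal basis, the terms with `f'` add up to `ℓ(T) f'(X_T) e^{AT} v`, the stochastic
integrals to `⟨∫ (σ_t⁻¹ e^{At} J_{0,t})^* dW_{ℓ(t)}, J_{0,T}⁻¹ v⟩`, and the terms with `∇B` to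
`∫_0^T ℓ(r) Tr(e^{Ar/2} C_r e^{Ar/2}) dr`, where `C_r w = (∇_w B_r)(X_r) J_{r,T}⁻¹ v`
(`corrTrace_eq_tsum`, `Model.integral_mul_backward`). Splitting `e^{Ar}` into two Hilbert-Schmidt
factors makes the trace absolutely convergent, with a bound integrable in `r`.

*The correction term.* The double integral in the weight has the same value. From
`J̃_{t,r} e^{At} = e^{Ar} J_{t,r}` (`mildFlow_comp`) and the cyclicity of the trace on products of
Hilbert-Schmidt operators, the trace in it equals `Tr(e^{Ar/2} C_r e^{Ar/2})` for every `t ≤ r`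
(`trace_correctionOp`), and for an integrand that depends on `r` only, `∫ dℓ(t) ∫_t^T dr` is
`∫_0^T ℓ(r) dr` (`stieltjes_integral_integral`).
-/

set_option linter.unusedSectionVars false

open Set Filter Topology MeasureTheory ProbabilityTheory
open scoped NNReal ENNReal InnerProductSpace

noncomputable section

namespace SubordinateIBP

/-! ### Integral inequalities and Volterra equations -/

theorem integral_mul_exp_two_mul (K a t : ℝ) :
    ∫ s in a..t, K * Real.exp (2 * K * (s - a)) = (Real.exp (2 * K * (t - a)) - 1) / 2 := by
  have h : ∀ s ∈ uIcc a t, HasDerivAt (fun s => Real.exp (2 * K * (s - a)) / 2)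
      (K * Real.exp (2 * K * (s - a))) s := by
    intro s _
    have h1 : HasDerivAt (fun s => 2 * K * (s - a)) (2 * K) s := by
      simpa using ((hasDerivAt_id s).sub_const a).const_mul (2 * K)
    exact (h1.exp.div_const 2).congr_deriv (by ring)
  rw [intervalIntegral.integral_eq_sub_of_hasDerivAt h
    (by apply Continuous.intervalIntegrable; fun_prop)]
  simp only [sub_self, mul_zero, Real.exp_zero]
  ring

/-- Grönwall's inequality in integral form, for a bounded function satisfying the inequality only
almost everywhere. -/
theorem gronwall_integral {φ : ℝ → ℝ} {a b K ε M : ℝ} (hK : 0 ≤ K) (hε : 0 ≤ ε)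
    (hφ : IntervalIntegrable φ volume a b)
    (hM : ∀ᵐ t, t ∈ Icc a b → φ t ≤ M)
    (h : ∀ᵐ t, t ∈ Icc a b → φ t ≤ ε + K * ∫ s in a..t, φ s) {t : ℝ} (ht : t ∈ Icc a b) :
    ε + K * ∫ s in a..t, φ s ≤ ε * Real.exp (2 * K * (t - a)) := by
  have key : ∀ n : ℕ, (∀ᵐ t, t ∈ Icc a b →
      φ t ≤ (ε + max M 0 * (1 / 2) ^ n) * Real.exp (2 * K * (t - a))) ∧
      ∀ t ∈ Icc a b, K * ∫ s in a..t, φ s ≤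
        (ε + max M 0 * (1 / 2) ^ n) * ((Real.exp (2 * K * (t - a)) - 1) / 2) := by
    have step : ∀ n : ℕ, (∀ᵐ t, t ∈ Icc a b →
        φ t ≤ (ε + max M 0 * (1 / 2) ^ n) * Real.exp (2 * K * (t - a))) →
        ∀ t ∈ Icc a b, K * ∫ s in a..t, φ s ≤
          (ε + max M 0 * (1 / 2) ^ n) * ((Real.exp (2 * K * (t - a)) - 1) / 2) := by
      intro n hn t ht
      rw [← integral_mul_exp_two_mul, ← intervalIntegral.integral_const_mul,
        ← intervalIntegral.integral_const_mul]
      apply intervalIntegral.integral_mono_ae_restrict ht.1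
      · exact (hφ.mono_set (by rw [uIcc_of_le ht.1, uIcc_of_le (ht.1.trans ht.2)]
                               exact Icc_subset_Icc_right ht.2)).const_mul K
      · apply Continuous.intervalIntegrable; fun_prop
      · rw [EventuallyLE, ae_restrict_iff' measurableSet_Icc]
        filter_upwards [hn] with s hs hs'
        have := hs ⟨hs'.1, hs'.2.trans ht.2⟩
        nlinarith
    intro n
    induction n with
    | zero =>
      have : ∀ᵐ t, t ∈ Icc a b →
          φ t ≤ (ε + max M 0 * (1 / 2) ^ 0) * Real.exp (2 * K * (t - a)) := by
        filter_upwards [hM] with t ht ht'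
        have h1 : 1 ≤ Real.exp (2 * K * (t - a)) :=
          Real.one_le_exp (mul_nonneg (by positivity) (by linarith [ht'.1]))
        have h2 := ht ht'
        have h3 : M ≤ max M 0 := le_max_left _ _
        have h4 : 0 ≤ max M 0 := le_max_right _ _
        rw [pow_zero, mul_one]
        nlinarith
      exact ⟨this, step 0 this⟩
    | succ n ih =>
      have : ∀ᵐ t, t ∈ Icc a b →
          φ t ≤ (ε + max M 0 * (1 / 2) ^ (n + 1)) * Real.exp (2 * K * (t - a)) := by
        filter_upwards [h] with t ht ht'
        have h1 : 1 ≤ Real.exp (2 * K * (t - a)) :=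
          Real.one_le_exp (mul_nonneg (by positivity) (by linarith [ht'.1]))
        have h2 := ht ht'
        have h3 := ih.2 t ht'
        have h4 : 0 ≤ max M 0 * (1 / 2) ^ n := by positivity
        rw [pow_succ]
        nlinarith
      exact ⟨this, step _ this⟩
  have hlim : Tendsto (fun n : ℕ => ε + (ε + max M 0 * (1 / 2) ^ n) *
      ((Real.exp (2 * K * (t - a)) - 1) / 2)) atTop
      (𝓝 (ε + (ε + max M 0 * 0) * ((Real.exp (2 * K * (t - a)) - 1) / 2))) := by
    have : Tendsto (fun n : ℕ => ((1 : ℝ) / 2) ^ n) atTop (𝓝 0) :=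
      tendsto_pow_atTop_nhds_zero_of_lt_one (by norm_num) (by norm_num)
    exact (((this.const_mul _).const_add _).mul_const _).const_add _
  have h1 : 1 ≤ Real.exp (2 * K * (t - a)) :=
    Real.one_le_exp (mul_nonneg (by positivity) (by linarith [ht.1]))
  calc ε + K * ∫ s in a..t, φ s
      ≤ ε + (ε + max M 0 * 0) * ((Real.exp (2 * K * (t - a)) - 1) / 2) :=
        ge_of_tendsto' hlim fun n => by linarith [(key n).2 t ht]
    _ ≤ _ := by nlinarith

/-- Grönwall's inequality backward in time. -/
theorem gronwall_integral_backward {φ : ℝ → ℝ} {a b K ε M : ℝ} (hK : 0 ≤ K) (hε : 0 ≤ ε)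
    (hφ : IntervalIntegrable φ volume a b)
    (hM : ∀ᵐ t, t ∈ Icc a b → φ t ≤ M)
    (h : ∀ᵐ t, t ∈ Icc a b → φ t ≤ ε + K * ∫ s in t..b, φ s) {t : ℝ} (ht : t ∈ Icc a b) :
    ε + K * ∫ s in t..b, φ s ≤ ε * Real.exp (2 * K * (b - t)) := by
  have hmem : ∀ s, s ∈ Icc a b → a + b - s ∈ Icc a b := fun s hs =>
    ⟨by linarith [hs.2], by linarith [hs.1]⟩
  have hmp : Measure.QuasiMeasurePreserving (fun s : ℝ => a + b - s) volume volume :=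
    (Measure.measurePreserving_sub_left volume (a + b)).quasiMeasurePreserving
  have hint : ∀ t, ∫ s in a..t, φ (a + b - s) = ∫ s in (a + b - t)..b, φ s := by
    intro t
    rw [intervalIntegral.integral_comp_sub_left (fun s => φ s) (a + b)]
    congr 1; ring
  have h1 := gronwall_integral (φ := fun s => φ (a + b - s)) (a := a) (b := b) (K := K) (ε := ε)
    (M := M) hK hε
    (by
      have := hφ.comp_sub_left (a + b)
      simp only [add_sub_cancel_left, add_sub_cancel_right] at this
      exact this.symm)
    (by filter_upwards [hmp.ae hM] with s hs hs' using hs (hmem s hs'))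
    (by
      filter_upwards [hmp.ae h] with s hs hs'
      rw [hint]
      exact hs (hmem s hs')) (hmem t ht)
  rw [hint] at h1
  simp only [sub_sub_cancel] at h1
  convert h1 using 3; ring

theorem measurable_intervalIntegral {α E : Type*} [MeasurableSpace α] [NormedAddCommGroup E]
    [NormedSpace ℝ E] [MeasurableSpace E] [BorelSpace E] [SecondCountableTopology E]
    {a b : α → ℝ} (ha : Measurable a) (hb : Measurable b) {f : α → ℝ → E}
    (hf : Measurable fun q : α × ℝ => f q.1 q.2) :
    Measurable fun x => ∫ s in a x..b x, f x s := by
  have hs : ∀ {a b : α → ℝ}, Measurable a → Measurable b →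
      MeasurableSet {q : α × ℝ | q.2 ∈ Ioc (a q.1) (b q.1)} := fun ha hb =>
    (measurableSet_lt (ha.comp measurable_fst) measurable_snd).inter
      (measurableSet_le measurable_snd (hb.comp measurable_fst))
  simp only [intervalIntegral]
  simp_rw [← integral_indicator measurableSet_Ioc]
  exact ((hf.indicator (hs ha hb)).stronglyMeasurable.integral_prod_right'.measurable).sub
    ((hf.indicator (hs hb ha)).stronglyMeasurable.integral_prod_right'.measurable)

/-- Solutions of Volterra equations `D_t = c_t + ∫_0^t Ψ(t, s, D_s) ds` that depend measurably on a
parameter `θ`. The Lipschitz and integrability conditions are only needed for the values of `θ` at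
which the equation is to be solved. -/
theorem exists_volterra {Θ E : Type*} [MeasurableSpace Θ] [NormedAddCommGroup E] [NormedSpace ℝ E]
    [CompleteSpace E] [MeasurableSpace E] [BorelSpace E] [SecondCountableTopology E]
    {T K : ℝ} (hK : 0 ≤ K) (Ψ : ℝ → ℝ → Θ → E → E)
    (hΨ : Measurable fun p : ℝ × ℝ × Θ × E => Ψ p.1 p.2.1 p.2.2.1 p.2.2.2)
    (c : ℝ → Θ → E) (hc : Measurable fun p : ℝ × Θ => c p.1 p.2) :
    ∃ D : ℝ → Θ → E, Measurable (fun p : ℝ × Θ => D p.1 p.2) ∧ ∀ θ M,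
      (∀ t ∈ Icc 0 T, ∀ s ∈ Icc 0 t, ∀ d d', ‖Ψ t s θ d - Ψ t s θ d'‖ ≤ K * ‖d - d'‖) →
      (∀ t ∈ Icc 0 T, IntervalIntegrable (fun s => Ψ t s θ (c s θ)) volume 0 t ∧
        ‖∫ s in (0 : ℝ)..t, Ψ t s θ (c s θ)‖ ≤ M) →
      ∀ t ∈ Icc 0 T, ‖D t θ - c t θ‖ ≤ 2 * M * Real.exp (2 * K * T) ∧
        IntervalIntegrable (fun s => Ψ t s θ (D s θ)) volume 0 t ∧
        D t θ = c t θ + ∫ s in (0 : ℝ)..t, Ψ t s θ (D s θ) := by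
  -- Picard iteration; the increments are bounded by `M 2⁻ⁿ exp (2 K t)`.
  let It : ℕ → ℝ → Θ → E := fun n => Nat.rec c
    (fun _ D t θ => c t θ + ∫ s in (0 : ℝ)..t, Ψ t s θ (D s θ)) n
  have It_succ : ∀ n t θ, It (n + 1) t θ = c t θ + ∫ s in (0 : ℝ)..t, Ψ t s θ (It n s θ) :=
    fun n t θ => rfl
  have hmeas : ∀ n, Measurable fun p : ℝ × Θ => It n p.1 p.2 := by
    intro n
    induction n with
    | zero => exact hc
    | succ n ih =>
      simp only [It_succ]
      refine hc.add ?_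
      refine measurable_intervalIntegral (a := fun _ => 0) (b := Prod.fst) measurable_const
        measurable_fst (f := fun (p : ℝ × Θ) s => Ψ p.1 s p.2 (It n s p.2)) ?_
      have : Measurable fun q : (ℝ × Θ) × ℝ => (q.1.1, q.2, q.1.2, It n q.2 q.1.2) := by
        have := ih.comp (f := fun q : (ℝ × Θ) × ℝ => (q.2, q.1.2)) (by fun_prop)
        exact measurable_fst.fst.prodMk (measurable_snd.prodMk
          (measurable_fst.snd.prodMk this))
      exact hΨ.comp this
  refine ⟨fun t θ => limUnder atTop (fun n => It n t θ), ?_, ?_⟩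
  · have := StronglyMeasurable.limUnder (l := atTop) (f := fun n (p : ℝ × Θ) => It n p.1 p.2)
      (fun n => (hmeas n).stronglyMeasurable)
    exact this.measurable
  intro θ M hlip hint
  rcases lt_or_ge T 0 with hT | hT
  · intro t ht; exact absurd (ht.1.trans ht.2) (not_le.2 hT)
  have hM0 : 0 ≤ M := (norm_nonneg _).trans (hint 0 ⟨le_rfl, hT⟩).2
  have hIm : ∀ n t, Measurable fun s => Ψ t s θ (It n s θ) := fun n t => by
    have h1 : Measurable fun s : ℝ => It n s θ :=
      (hmeas n).comp (measurable_id.prodMk measurable_const)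
    exact hΨ.comp (measurable_const.prodMk (measurable_id.prodMk (measurable_const.prodMk h1)))
  have hexp : ∀ t, 0 ≤ t → 1 ≤ Real.exp (2 * K * t) := fun t ht =>
    Real.one_le_exp (by positivity)
  -- integrability along a bounded perturbation of `c`
  have hbdd_int : ∀ (D : ℝ → E) (_ : ∀ t, AEStronglyMeasurable (fun s => Ψ t s θ (D s)) volume)
      (C : ℝ), (∀ s ∈ Icc 0 T, ‖D s - c s θ‖ ≤ C) → ∀ t ∈ Icc 0 T,
      IntervalIntegrable (fun s => Ψ t s θ (D s)) volume 0 t := by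
    intro D hD C hC t ht
    have h1 : IntervalIntegrable (fun s => Ψ t s θ (D s) - Ψ t s θ (c s θ)) volume 0 t := by
      refine (intervalIntegrable_const (c := K * C)).mono_fun' ?_ ?_
      · exact ((hD t).sub (hIm 0 t).aestronglyMeasurable).restrict
      · rw [EventuallyLE, ae_restrict_iff' measurableSet_uIoc]
        refine ae_of_all _ fun s hs => ?_
        rw [uIoc_of_le ht.1] at hs
        exact (hlip t ht s ⟨hs.1.le, hs.2⟩ _ _).trans
          (mul_le_mul_of_nonneg_left (hC s ⟨hs.1.le, hs.2.trans ht.2⟩) hK)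
    simpa using h1.add (hint t ht).1
  have key : ∀ n, (∀ t ∈ Icc 0 T, IntervalIntegrable (fun s => Ψ t s θ (It n s θ)) volume 0 t) ∧
      (∀ t ∈ Icc 0 T, ‖It n t θ - c t θ‖ ≤ 2 * M * (1 - (1 / 2) ^ n) * Real.exp (2 * K * t)) ∧
      ∀ t ∈ Icc 0 T, ‖It (n + 1) t θ - It n t θ‖ ≤ M * (1 / 2) ^ n * Real.exp (2 * K * t) := by
    intro n
    induction n with
    | zero =>
      refine ⟨fun t ht => (hint t ht).1, fun t ht => ?_, fun t ht => ?_⟩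
      · have : It 0 t θ = c t θ := rfl
        simp [this]
      · have : It 0 t θ = c t θ := rfl
        rw [It_succ, this, add_sub_cancel_left, pow_zero, mul_one]
        refine (hint t ht).2.trans ?_
        nlinarith [hexp t ht.1]
    | succ n ih =>
      obtain ⟨ih1, ih2, ih3⟩ := ih
      have h2 : ∀ t ∈ Icc 0 T,
          ‖It (n + 1) t θ - c t θ‖ ≤ 2 * M * (1 - (1 / 2) ^ (n + 1)) * Real.exp (2 * K * t) := by
        intro t ht
        calc ‖It (n + 1) t θ - c t θ‖ = ‖(It (n + 1) t θ - It n t θ) + (It n t θ - c t θ)‖ := by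
              rw [sub_add_sub_cancel]
          _ ≤ _ := norm_add_le _ _
          _ ≤ M * (1 / 2) ^ n * Real.exp (2 * K * t) +
              2 * M * (1 - (1 / 2) ^ n) * Real.exp (2 * K * t) := add_le_add (ih3 t ht) (ih2 t ht)
          _ = _ := by rw [pow_succ]; ring
      have h1 : ∀ t ∈ Icc 0 T,
          IntervalIntegrable (fun s => Ψ t s θ (It (n + 1) s θ)) volume 0 t := by
        refine hbdd_int _ (fun t => (hIm (n + 1) t).aestronglyMeasurable)
          (2 * M * Real.exp (2 * K * T)) fun s hs => (h2 s hs).trans ?_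
        have e1 : Real.exp (2 * K * s) ≤ Real.exp (2 * K * T) := by
          apply Real.exp_le_exp.2; nlinarith [hs.2]
        have e2 : (0 : ℝ) ≤ (1 / 2) ^ (n + 1) := by positivity
        calc _ ≤ 2 * M * 1 * Real.exp (2 * K * s) := by
              gcongr; linarith
          _ ≤ _ := by rw [mul_one]; gcongr
      refine ⟨h1, h2, fun t ht => ?_⟩
      rw [It_succ (n + 1), It_succ n, add_sub_add_left_eq_sub,
        ← intervalIntegral.integral_sub (h1 t ht) (ih1 t ht)]
      calc _ ≤ ∫ s in (0 : ℝ)..t, M * (1 / 2) ^ n * (K * Real.exp (2 * K * (s - 0))) := by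
            apply intervalIntegral.norm_integral_le_of_norm_le ht.1
            · refine ae_of_all _ fun s hs => ?_
              refine (hlip t ht s ⟨hs.1.le, hs.2⟩ _ _).trans ?_
              have := mul_le_mul_of_nonneg_left (ih3 s ⟨hs.1.le, hs.2.trans ht.2⟩) hK
              rw [sub_zero]; linarith
            · apply Continuous.intervalIntegrable; fun_prop
        _ = M * (1 / 2) ^ n * ((Real.exp (2 * K * t) - 1) / 2) := by
            rw [intervalIntegral.integral_const_mul, integral_mul_exp_two_mul, sub_zero]
        _ ≤ _ := by
            have : 0 ≤ M * (1 / 2) ^ n := by positivity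
            rw [pow_succ]; linarith
  have hcs : ∀ t ∈ Icc 0 T, ∀ n, dist (It n t θ) (It (n + 1) t θ) ≤
      M * Real.exp (2 * K * t) * (1 / 2) ^ n := by
    intro t ht n
    rw [dist_comm, dist_eq_norm]
    exact ((key n).2.2 t ht).trans (by linarith)
  have hlim : ∀ t ∈ Icc 0 T, Tendsto (fun n => It n t θ) atTop
      (𝓝 (limUnder atTop fun n => It n t θ)) := fun t ht =>
    (cauchySeq_of_le_geometric _ _ (by norm_num) (hcs t ht)).tendsto_limUnder
  have hbound : ∀ n, ∀ t ∈ Icc 0 T, ‖It n t θ - c t θ‖ ≤ 2 * M * Real.exp (2 * K * T) := by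
    intro n t ht
    refine ((key n).2.1 t ht).trans ?_
    have e1 : Real.exp (2 * K * t) ≤ Real.exp (2 * K * T) := by
      apply Real.exp_le_exp.2; nlinarith [ht.2]
    have e2 : (0 : ℝ) ≤ (1 / 2) ^ n := by positivity
    calc _ ≤ 2 * M * 1 * Real.exp (2 * K * t) := by gcongr; linarith
      _ ≤ _ := by rw [mul_one]; gcongr
  have hDbound : ∀ t ∈ Icc 0 T,
      ‖(limUnder atTop fun n => It n t θ) - c t θ‖ ≤ 2 * M * Real.exp (2 * K * T) := fun t ht =>
    le_of_tendsto ((hlim t ht).sub_const _).norm (Eventually.of_forall fun n => hbound n t ht)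
  intro t ht
  have hDm : ∀ t, Measurable (fun s => Ψ t s θ (limUnder atTop fun n => It n s θ)) := by
    intro t
    have := StronglyMeasurable.limUnder (l := atTop) (f := fun n (p : ℝ × Θ) => It n p.1 p.2)
      (fun n => (hmeas n).stronglyMeasurable)
    have h1 : Measurable fun s : ℝ => limUnder atTop fun n => It n s θ :=
      this.measurable.comp (measurable_id.prodMk measurable_const)
    exact hΨ.comp (measurable_const.prodMk (measurable_id.prodMk (measurable_const.prodMk h1)))
  refine ⟨hDbound t ht, hbdd_int _ (fun t => (hDm t).aestronglyMeasurable) _ hDbound t ht, ?_⟩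
  have h1 : Tendsto (fun n => ∫ s in (0 : ℝ)..t, Ψ t s θ (It n s θ)) atTop
      (𝓝 (∫ s in (0 : ℝ)..t, Ψ t s θ (limUnder atTop fun n => It n s θ))) := by
    apply intervalIntegral.tendsto_integral_filter_of_dominated_convergence
      (fun s => K * (2 * M * Real.exp (2 * K * T)) + ‖Ψ t s θ (c s θ)‖)
    · exact Eventually.of_forall fun n => (hIm n t).aestronglyMeasurable
    · refine Eventually.of_forall fun n => ae_of_all _ fun s hs => ?_
      rw [uIoc_of_le ht.1] at hs
      have hs' : s ∈ Icc 0 T := ⟨hs.1.le, hs.2.trans ht.2⟩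
      calc ‖Ψ t s θ (It n s θ)‖
          = ‖(Ψ t s θ (It n s θ) - Ψ t s θ (c s θ)) + Ψ t s θ (c s θ)‖ := by
            rw [sub_add_cancel]
        _ ≤ _ := norm_add_le _ _
        _ ≤ _ := add_le_add_left ((hlip t ht s ⟨hs.1.le, hs.2⟩ _ _).trans
            (mul_le_mul_of_nonneg_left (hbound n s hs') hK)) _
    · exact intervalIntegrable_const.add (hint t ht).1.norm
    · refine ae_of_all _ fun s hs => ?_
      rw [uIoc_of_le ht.1] at hs
      have hs' : s ∈ Icc 0 T := ⟨hs.1.le, hs.2.trans ht.2⟩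
      rw [tendsto_iff_norm_sub_tendsto_zero]
      have h0 := (tendsto_iff_norm_sub_tendsto_zero.1 (hlim s hs')).const_mul K
      rw [mul_zero] at h0
      exact squeeze_zero (fun _ => norm_nonneg _)
        (fun n => hlip t ht s ⟨hs.1.le, hs.2⟩ _ _) h0
  exact tendsto_nhds_unique ((tendsto_add_atTop_iff_nat 1).2 (hlim t ht)) (h1.const_add _)

/-! ### Integration by parts in time -/

section ByParts

variable {H : Type*} [NormedAddCommGroup H] [InnerProductSpace ℝ H]

/-- The product rule for the pairing of two absolutely continuous Hilbert space valued
functions, given through their densities. -/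
theorem inner_eq_add_integral [CompleteSpace H] {T : ℝ} (hT : 0 ≤ T) {p d α γ : ℝ → H}
    (hα : IntervalIntegrable α volume 0 T) (hγ : IntervalIntegrable γ volume 0 T)
    (hp : ∀ t ∈ Icc 0 T, p t = p 0 + ∫ s in (0 : ℝ)..t, α s)
    (hd : ∀ t ∈ Icc 0 T, d t = d 0 + ∫ s in (0 : ℝ)..t, γ s) :
    ⟪p T, d T⟫_ℝ = ⟪p 0, d 0⟫_ℝ + ∫ t in (0 : ℝ)..T, (⟪α t, d t⟫_ℝ + ⟪p t, γ t⟫_ℝ) := by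
  have hα' := (intervalIntegrable_iff_integrableOn_Ioc_of_le hT).1 hα
  have hγ' := (intervalIntegrable_iff_integrableOn_Ioc_of_le hT).1 hγ
  set μ := (volume : Measure ℝ).restrict (Ioc 0 T) with hμ
  have hF : Integrable (fun q : ℝ × ℝ => ⟪α q.1, γ q.2⟫_ℝ) (μ.prod μ) := by
    refine (hα'.norm.mul_prod hγ'.norm).mono' ?_ (ae_of_all _ fun q => norm_inner_le_norm _ _)
    exact (hα'.aestronglyMeasurable.comp_fst).inner (hγ'.aestronglyMeasurable.comp_snd)
  have hA : MeasurableSet {q : ℝ × ℝ | q.2 ≤ q.1} :=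
    measurableSet_le measurable_snd measurable_fst
  -- Fubini on the square `(0, T]²`, split into the triangles `s ≤ t` and `t < s`.
  have h1 : ∫ q, {q : ℝ × ℝ | q.2 ≤ q.1}.indicator (fun q => ⟪α q.1, γ q.2⟫_ℝ) q ∂(μ.prod μ) =
      ∫ t in (0 : ℝ)..T, ⟪α t, ∫ s in (0 : ℝ)..t, γ s⟫_ℝ := by
    rw [integral_prod _ (hF.indicator hA), intervalIntegral.integral_of_le hT]
    refine setIntegral_congr_fun measurableSet_Ioc fun t ht => ?_
    have : (fun s => {q : ℝ × ℝ | q.2 ≤ q.1}.indicator (fun q => ⟪α q.1, γ q.2⟫_ℝ) (t, s)) =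
        (Iic t).indicator (fun s => ⟪α t, γ s⟫_ℝ) := by
      ext s; simp [indicator]
    simp only [this]
    rw [integral_indicator measurableSet_Iic, hμ, Measure.restrict_restrict measurableSet_Iic,
      intervalIntegral.integral_of_le ht.1.le]
    have hset : Iic t ∩ Ioc 0 T = Ioc 0 t := by
      ext s; simp only [mem_inter_iff, mem_Iic, mem_Ioc]
      exact ⟨fun h => ⟨h.2.1, h.1⟩, fun h => ⟨h.2, h.1, h.2.trans ht.2⟩⟩
    rw [hset]
    exact integral_inner (hγ'.mono_set (Ioc_subset_Ioc_right ht.2)) _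
  have h2 : ∫ q, {q : ℝ × ℝ | q.2 ≤ q.1}ᶜ.indicator (fun q => ⟪α q.1, γ q.2⟫_ℝ) q ∂(μ.prod μ) =
      ∫ s in (0 : ℝ)..T, ⟪∫ t in (0 : ℝ)..s, α t, γ s⟫_ℝ := by
    rw [integral_prod_symm _ (hF.indicator hA.compl), intervalIntegral.integral_of_le hT]
    refine setIntegral_congr_fun measurableSet_Ioc fun s hs => ?_
    have : (fun t => {q : ℝ × ℝ | q.2 ≤ q.1}ᶜ.indicator (fun q => ⟪α q.1, γ q.2⟫_ℝ) (t, s)) =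
        (Iio s).indicator (fun t => ⟪α t, γ s⟫_ℝ) := by
      ext s; simp [indicator]
    simp only [this]
    rw [integral_indicator measurableSet_Iio, hμ, Measure.restrict_restrict measurableSet_Iio,
      intervalIntegral.integral_of_le hs.1.le, integral_Ioc_eq_integral_Ioo]
    have hset : Iio s ∩ Ioc 0 T = Ioo 0 s := by
      ext t; simp only [mem_inter_iff, mem_Iio, mem_Ioc, mem_Ioo]
      exact ⟨fun h => ⟨h.2.1, h.1⟩, fun h => ⟨h.2, h.1, h.2.le.trans hs.2⟩⟩
    rw [hset, real_inner_comm, ← integral_inner (hα'.mono_set fun t ht =>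
      ⟨ht.1, ht.2.le.trans hs.2⟩)]
    simp only [real_inner_comm]
  have h3 : ∫ q, ⟪α q.1, γ q.2⟫_ℝ ∂(μ.prod μ) =
      ⟪∫ t in (0 : ℝ)..T, α t, ∫ t in (0 : ℝ)..T, γ t⟫_ℝ := by
    rw [integral_prod _ hF, intervalIntegral.integral_of_le hT,
      intervalIntegral.integral_of_le hT, real_inner_comm, ← integral_inner hα']
    refine integral_congr_ae (ae_of_all _ fun t => ?_)
    change ∫ s, ⟪α t, γ s⟫_ℝ ∂μ = _
    rw [integral_inner hγ', real_inner_comm]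
  have h4 : ∫ q, ⟪α q.1, γ q.2⟫_ℝ ∂(μ.prod μ) =
      (∫ t in (0 : ℝ)..T, ⟪α t, ∫ s in (0 : ℝ)..t, γ s⟫_ℝ) +
      ∫ s in (0 : ℝ)..T, ⟪∫ t in (0 : ℝ)..s, α t, γ s⟫_ℝ := by
    rw [← h1, ← h2, ← integral_add (hF.indicator hA) (hF.indicator hA.compl)]
    refine integral_congr_ae (ae_of_all _ fun q => ?_)
    by_cases hq : q.2 ≤ q.1 <;> simp [indicator, hq]
  have hcont : ∀ {f : ℝ → H}, IntervalIntegrable f volume 0 T →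
      ContinuousOn (fun t => ∫ s in (0 : ℝ)..t, f s) (uIcc 0 T) := fun hf =>
    intervalIntegral.continuousOn_primitive_interval'
      (by simpa [uIcc_of_le hT] using hf) (by simp)
  have i1 : IntervalIntegrable (fun t => ⟪α t, ∫ s in (0 : ℝ)..t, γ s⟫_ℝ) volume 0 T := by
    obtain ⟨C, hC⟩ := (isCompact_uIcc (a := (0:ℝ)) (b := T)).exists_bound_of_continuousOn (hcont hγ)
    refine (hα.norm.mul_const C).mono_fun' ?_ ?_
    · exact hα.aestronglyMeasurable_restrict_uIoc.inner
        (((hcont hγ).mono uIoc_subset_uIcc).aestronglyMeasurable measurableSet_uIoc)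
    · rw [EventuallyLE, ae_restrict_iff' measurableSet_uIoc]
      exact ae_of_all _ fun t ht => (norm_inner_le_norm _ _).trans
        (mul_le_mul_of_nonneg_left (hC t (uIoc_subset_uIcc ht)) (norm_nonneg _))
  have i2 : IntervalIntegrable (fun t => ⟪∫ s in (0 : ℝ)..t, α s, γ t⟫_ℝ) volume 0 T := by
    obtain ⟨C, hC⟩ := (isCompact_uIcc (a := (0:ℝ)) (b := T)).exists_bound_of_continuousOn (hcont hα)
    refine (hγ.norm.const_mul C).mono_fun' ?_ ?_
    · exact (((hcont hα).mono uIoc_subset_uIcc).aestronglyMeasurable measurableSet_uIoc).inner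
        hγ.aestronglyMeasurable_restrict_uIoc
    · rw [EventuallyLE, ae_restrict_iff' measurableSet_uIoc]
      exact ae_of_all _ fun t ht => (norm_inner_le_norm _ _).trans
        (mul_le_mul_of_nonneg_right (hC t (uIoc_subset_uIcc ht)) (norm_nonneg _))
  have i3 : IntervalIntegrable (fun t => ⟪α t, d 0⟫_ℝ) volume 0 T :=
    ⟨hα.1.inner_const _, hα.2.inner_const _⟩
  have i4 : IntervalIntegrable (fun t => ⟪p 0, γ t⟫_ℝ) volume 0 T :=
    ⟨hγ.1.const_inner _, hγ.2.const_inner _⟩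
  have h5 : ∫ t in (0 : ℝ)..T, (⟪α t, d t⟫_ℝ + ⟪p t, γ t⟫_ℝ) =
      ∫ t in (0 : ℝ)..T, ((⟪α t, d 0⟫_ℝ + ⟪p 0, γ t⟫_ℝ) +
        (⟪α t, ∫ s in (0 : ℝ)..t, γ s⟫_ℝ + ⟪∫ s in (0 : ℝ)..t, α s, γ t⟫_ℝ)) := by
    refine intervalIntegral.integral_congr fun t ht => ?_
    rw [uIcc_of_le hT] at ht
    rw [hp t ht, hd t ht, inner_add_right, inner_add_left]
    ring
  have h6 : ∫ t in (0 : ℝ)..T, ⟪α t, d 0⟫_ℝ = ⟪∫ t in (0 : ℝ)..T, α t, d 0⟫_ℝ := by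
    rw [intervalIntegral.integral_of_le hT, intervalIntegral.integral_of_le hT, real_inner_comm,
      ← integral_inner hα']
    simp only [real_inner_comm]
  have h7 : ∫ t in (0 : ℝ)..T, ⟪p 0, γ t⟫_ℝ = ⟪p 0, ∫ t in (0 : ℝ)..T, γ t⟫_ℝ := by
    rw [intervalIntegral.integral_of_le hT, intervalIntegral.integral_of_le hT,
      ← integral_inner hγ']
  rw [h5, intervalIntegral.integral_add (i3.add i4) (i1.add i2),
    intervalIntegral.integral_add i3 i4, intervalIntegral.integral_add i1 i2, h6, h7, ← h4, h3,
    hp T ⟨hT, le_rfl⟩, hd T ⟨hT, le_rfl⟩]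
  simp only [inner_add_left, inner_add_right]
  ring

/-- Fubini's theorem on the triangle `0 < s ≤ r ≤ t` for `dℓ(s) dr`. -/
theorem stieltjes_integral_integral {E : Type*} [NormedAddCommGroup E] [NormedSpace ℝ E]
    [CompleteSpace E] (ℓ : StieltjesFunction ℝ) (hℓ0 : ℓ 0 = 0) {t : ℝ} (ht : 0 ≤ t) {β : ℝ → E}
    (hβ : IntervalIntegrable β volume 0 t) :
    IntegrableOn (fun s => ∫ r in s..t, β r) (Ioc 0 t) ℓ.measure ∧
    ∫ s in Ioc 0 t, (∫ r in s..t, β r) ∂ℓ.measure = ∫ r in (0 : ℝ)..t, ℓ r • β r := by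
  have hβ' := (intervalIntegrable_iff_integrableOn_Ioc_of_le ht).1 hβ
  set ν := ℓ.measure.restrict (Ioc 0 t) with hν
  have : IsFiniteMeasure ν := ⟨by
    rw [hν, Measure.restrict_apply_univ, ℓ.measure_Ioc]; exact ENNReal.ofReal_lt_top⟩
  set μ := (volume : Measure ℝ).restrict (Ioc 0 t) with hμ
  have hA : MeasurableSet {q : ℝ × ℝ | q.1 ≤ q.2} :=
    measurableSet_le measurable_fst measurable_snd
  have hF : Integrable ({q : ℝ × ℝ | q.1 ≤ q.2}.indicator (fun q => β q.2)) (ν.prod μ) :=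
    (hβ'.comp_snd ν).indicator hA
  have h1 : ∀ s ∈ Ioc 0 t, ∫ r, {q : ℝ × ℝ | q.1 ≤ q.2}.indicator (fun q => β q.2) (s, r) ∂μ =
      ∫ r in s..t, β r := by
    intro s hs
    have : (fun r => {q : ℝ × ℝ | q.1 ≤ q.2}.indicator (fun q => β q.2) (s, r)) =
        (Ici s).indicator β := by
      ext s; simp [indicator]
    rw [this, integral_indicator measurableSet_Ici, hμ,
      Measure.restrict_restrict measurableSet_Ici, intervalIntegral.integral_of_le hs.2,
      ← integral_Icc_eq_integral_Ioc]
    congr 2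
    ext r; simp only [mem_inter_iff, mem_Ici, mem_Ioc, mem_Icc]
    exact ⟨fun h => ⟨h.1, h.2.2⟩, fun h => ⟨h.1, hs.1.trans_le h.1, h.2⟩⟩
  constructor
  · refine (hF.integral_prod_left).congr ?_
    rw [EventuallyEq, hν, ae_restrict_iff' measurableSet_Ioc]
    exact ae_of_all _ fun s hs => h1 s hs
  · calc ∫ s in Ioc 0 t, (∫ r in s..t, β r) ∂ℓ.measure
        = ∫ s, ∫ r, {q : ℝ × ℝ | q.1 ≤ q.2}.indicator (fun q => β q.2) (s, r) ∂μ ∂ν :=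
          setIntegral_congr_fun measurableSet_Ioc fun s hs => (h1 s hs).symm
      _ = ∫ r, ∫ s, {q : ℝ × ℝ | q.1 ≤ q.2}.indicator (fun q => β q.2) (s, r) ∂ν ∂μ :=
          integral_integral_swap hF
      _ = _ := by
          rw [intervalIntegral.integral_of_le ht]
          refine setIntegral_congr_fun measurableSet_Ioc fun r hr => ?_
          have : (fun s => {q : ℝ × ℝ | q.1 ≤ q.2}.indicator (fun q => β q.2) (s, r)) =
              (Iic r).indicator (fun _ => β r) := by
            ext s; simp [indicator]
          simp only [this]
          rw [integral_indicator measurableSet_Iic, hν,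
            Measure.restrict_restrict measurableSet_Iic]
          have hset : Iic r ∩ Ioc 0 t = Ioc 0 r := by
            ext s; simp only [mem_inter_iff, mem_Iic, mem_Ioc]
            exact ⟨fun h => ⟨h.2.1, h.1⟩, fun h => ⟨h.2, h.1, h.2.trans hr.2⟩⟩
          rw [hset, setIntegral_const, measureReal_def, ℓ.measure_Ioc, hℓ0, sub_zero,
            ENNReal.toReal_ofReal (hℓ0 ▸ ℓ.mono hr.1.le)]

end ByParts

/-! ### Stein's identity -/

/-- Stein's identity for a centred Gaussian variable of variance `v`. -/
theorem integral_mul_gaussianReal {v : ℝ≥0} (hv : v ≠ 0) {g g' : ℝ → ℝ}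
    (hg : ∀ n, HasDerivAt g (g' n) n) {C : ℝ} (hC : ∀ n, |g n| ≤ C) (hC' : ∀ n, |g' n| ≤ C) :
    ∫ n, n * g n ∂gaussianReal 0 v = v * ∫ n, g' n ∂gaussianReal 0 v := by
  have hv0 : (0 : ℝ) < v := by positivity
  have hgc : Continuous g := continuous_iff_continuousAt.2 fun n => (hg n).continuousAt
  have hg'm : Measurable g' := by
    have : g' = deriv g := funext fun n => (hg n).deriv.symm
    rw [this]; exact measurable_deriv g
  have hpdf : ∀ n, HasDerivAt (gaussianPDFReal 0 v) (-(n / v) * gaussianPDFReal 0 v n) n := by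
    intro n
    unfold gaussianPDFReal
    have h1 : HasDerivAt (fun x : ℝ => -(x - 0) ^ 2 / (2 * v)) (-(n / v)) n := by
      have := (((hasDerivAt_id n).sub_const 0).pow 2).neg.div_const (2 * (v : ℝ))
      refine this.congr_deriv ?_
      simp; field_simp
    refine (h1.exp.const_mul ((√(2 * Real.pi * v))⁻¹)).congr_deriv ?_
    ring
  have hint1 : Integrable (gaussianPDFReal 0 v) := integrable_gaussianPDFReal 0 v
  have hid : Integrable (fun n : ℝ => n) (gaussianReal 0 v) :=
    (memLp_id_gaussianReal (μ := 0) (v := v) 1).integrable (by norm_num)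
  have hint2 : Integrable (fun n => gaussianPDFReal 0 v n * n) := by
    rw [gaussianReal_of_var_ne_zero _ hv, integrable_withDensity_iff (measurable_gaussianPDF 0 v)
      (ae_of_all _ fun _ => gaussianPDF_lt_top)] at hid
    simpa [toReal_gaussianPDF, mul_comm] using hid
  have key := integral_mul_deriv_eq_deriv_mul_of_integrable (u := g) (u' := g')
    (v := gaussianPDFReal 0 v) (v' := fun n => -(n / v) * gaussianPDFReal 0 v n)
    (fun n _ => hg n) (fun n _ => hpdf n) ?_ ?_ ?_
  · rw [integral_gaussianReal_eq_integral_smul hv, integral_gaussianReal_eq_integral_smul hv]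
    simp only [smul_eq_mul]
    have e1 : ∫ n, g n * (-(n / v) * gaussianPDFReal 0 v n) =
        -(v : ℝ)⁻¹ * ∫ n, gaussianPDFReal 0 v n * (n * g n) := by
      rw [← integral_const_mul]; congr 1; ext n; ring
    have e2 : ∫ n, g' n * gaussianPDFReal 0 v n = ∫ n, gaussianPDFReal 0 v n * g' n := by
      congr 1; ext n; ring
    rw [e1, e2] at key
    generalize (∫ n, gaussianPDFReal 0 v n * (n * g n)) = a at key ⊢
    generalize (∫ n, gaussianPDFReal 0 v n * g' n) = b at key ⊢
    field_simp at key
    linarith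
  · have : Integrable (fun n => (-(v : ℝ)⁻¹ * (gaussianPDFReal 0 v n * n)) * g n) :=
      (hint2.const_mul _).mul_bdd hgc.aestronglyMeasurable (ae_of_all _ hC)
    refine this.congr (ae_of_all _ fun n => ?_)
    simp only [Pi.mul_apply]; ring
  · exact (hint1.mul_bdd hg'm.aestronglyMeasurable (ae_of_all _ hC')).congr
      (ae_of_all _ fun n => by simp only [Pi.mul_apply]; ring)
  · exact (hint1.mul_bdd hgc.aestronglyMeasurable (ae_of_all _ hC)).congr
      (ae_of_all _ fun n => by simp only [Pi.mul_apply]; ring)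

/-! ### Measurability of operator-valued functions -/

section Measurability

variable {α ι H : Type*} [MeasurableSpace α] [NormedAddCommGroup H] [InnerProductSpace ℝ H]
  [MeasurableSpace H] [BorelSpace H] [SecondCountableTopology H]

theorem countable_hilbertBasis (e : HilbertBasis ι ℝ H) : Countable ι := by
  have hd : ∀ i j, i ≠ j → 1 < dist (e i) (e j) := by
    intro i j hij
    have h0 : ⟪e i, e j⟫_ℝ = 0 := e.orthonormal.2 hij
    have h1 : ‖e i - e j‖ * ‖e i - e j‖ = 2 := by
      rw [norm_sub_mul_self_real, h0, e.orthonormal.1 i, e.orthonormal.1 j]; norm_num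
    rw [dist_eq_norm]
    nlinarith [norm_nonneg (e i - e j)]
  have : (univ : Set ι).PairwiseDisjoint fun i => Metric.ball (e i) (1 / 2) := by
    intro i _ j _ hij
    refine Metric.ball_disjoint_ball ?_
    have := hd i j hij
    linarith
  have h := this.countable_of_isOpen (fun i _ => Metric.isOpen_ball)
    (fun i _ => ⟨e i, Metric.mem_ball_self (by norm_num)⟩)
  exact countable_univ_iff.1 h

theorem measurable_of_inner_basis (e : HilbertBasis ι ℝ H) {g : α → H}
    (h : ∀ i, Measurable fun a => ⟪e i, g a⟫_ℝ) : Measurable g := by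
  have := countable_hilbertBasis e
  have h1 : ∀ a, Tendsto (fun s : Finset ι => ∑ i ∈ s, ⟪e i, g a⟫_ℝ • e i) atTop (𝓝 (g a)) := by
    intro a
    have := e.hasSum_repr (g a)
    simpa only [HilbertBasis.repr_apply_apply, HasSum, SummationFilter.unconditional_filter]
      using this
  refine measurable_of_tendsto_metrizable' atTop
    (f := fun (s : Finset ι) a => ∑ i ∈ s, ⟪e i, g a⟫_ℝ • e i) (fun s => ?_)
    (tendsto_pi_nhds.2 h1)
  exact Finset.measurable_sum _ fun i _ => (h i).smul_const _

theorem measurable_clm_uncurry {A : α → H →L[ℝ] H} (h : ∀ u, Measurable fun a => A a u) :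
    Measurable fun p : α × H => A p.1 p.2 := by
  have := measurable_uncurry_of_continuous_of_measurable (u := fun (u : H) (a : α) => A a u)
    (fun a => (A a).continuous) h
  exact this.comp measurable_swap

theorem measurable_adjoint_apply [CompleteSpace H] (e : HilbertBasis ι ℝ H) {A : α → H →L[ℝ] H}
    (h : ∀ u, Measurable fun a => A a u) {g : α → H} (hg : Measurable g) :
    Measurable fun a => ContinuousLinearMap.adjoint (A a) (g a) := by
  refine measurable_of_inner_basis e fun i => ?_
  simp_rw [ContinuousLinearMap.adjoint_inner_right]
  exact (h _).inner hg

/-- If `O t` is injective for each `t` and `O (τ a) (g a)` depends measurably on `a`, then so does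
`g a` (Lusin–Souslin). -/
theorem measurable_of_injective_apply [CompleteSpace H] {O : ℝ≥0 → H → H}
    (hO : Measurable fun p : ℝ≥0 × H => O p.1 p.2) (hinj : ∀ t, Function.Injective (O t))
    {τ : α → ℝ≥0} (hτ : Measurable τ) {g : α → H} (h : Measurable fun a => O (τ a) (g a)) :
    Measurable g := by
  have hE : MeasurableEmbedding fun p : ℝ≥0 × H => (p.1, O p.1 p.2) := by
    refine Measurable.measurableEmbedding (measurable_fst.prodMk hO) ?_
    rintro ⟨t, x⟩ ⟨t', x'⟩ hp
    simp only [Prod.mk.injEq] at hp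
    obtain ⟨rfl, h2⟩ := hp
    exact Prod.ext rfl (hinj _ h2)
  have : Measurable fun a => (τ a, g a) := by
    rw [← hE.measurable_comp_iff]
    exact hτ.prodMk h
  exact this.snd

end Measurability

/-! ### Linear evolution equations -/

section LinSol

variable {H : Type*} [NormedAddCommGroup H] [InnerProductSpace ℝ H]

/-- `d` solves the linear equation `d' = A d` on `[a, b]`, in integrated form. -/
def IsLinSol (A : ℝ → H →L[ℝ] H) (a b : ℝ) (d : ℝ → H) : Prop :=
  IntervalIntegrable (fun r => A r (d r)) volume a b ∧
    ∀ t ∈ Icc a b, d t = d a + ∫ r in a..t, A r (d r)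

namespace IsLinSol

variable {A : ℝ → H →L[ℝ] H} {a b K : ℝ} {d d' : ℝ → H}

theorem intervalIntegrable (h : IsLinSol A a b d) {s t : ℝ} (hs : s ∈ Icc a b)
    (ht : t ∈ Icc a b) : IntervalIntegrable (fun r => A r (d r)) volume s t :=
  h.1.mono_set (by
    rw [uIcc_of_le (hs.1.trans hs.2)]
    exact uIcc_subset_Icc hs ht)

theorem sub_eq (h : IsLinSol A a b d) {s t : ℝ} (hs : s ∈ Icc a b) (ht : t ∈ Icc a b) :
    d t - d s = ∫ r in s..t, A r (d r) := by
  have ha : a ∈ Icc a b := ⟨le_rfl, hs.1.trans hs.2⟩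
  rw [h.2 t ht, h.2 s hs, add_sub_add_left_eq_sub, intervalIntegral.integral_interval_sub_left
    (h.intervalIntegrable ha ht) (h.intervalIntegrable ha hs)]

theorem mono (h : IsLinSol A a b d) {s t : ℝ} (hs : s ∈ Icc a b) (ht : t ∈ Icc a b) :
    IsLinSol A s t d :=
  ⟨h.intervalIntegrable hs ht, fun r hr => by
    rw [← h.sub_eq hs ⟨hs.1.trans hr.1, hr.2.trans ht.2⟩]; abel⟩

theorem congr_ae {A' : ℝ → H →L[ℝ] H} (h : IsLinSol A a b d) (hab : a ≤ b)
    (hA : ∀ᵐ t, t ∈ Icc a b → A t = A' t) : IsLinSol A' a b d := by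
  have hE : ∀ t ∈ Icc a b, ∀ᵐ r, r ∈ uIoc a t → A r (d r) = A' r (d r) := by
    intro t ht
    filter_upwards [hA] with r hr hr'
    rw [uIoc_of_le ht.1] at hr'
    rw [hr ⟨hr'.1.le, hr'.2.trans ht.2⟩]
  refine ⟨h.1.congr_ae ?_, fun t ht => ?_⟩
  · rw [EventuallyEq, ae_restrict_iff' measurableSet_uIoc]
    exact hE b ⟨hab, le_rfl⟩
  · rw [h.2 t ht, intervalIntegral.integral_congr_ae (hE t ht)]

theorem sub (h : IsLinSol A a b d) (h' : IsLinSol A a b d') :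
    IsLinSol A a b (fun t => d t - d' t) := by
  refine ⟨by simpa only [map_sub] using h.1.sub h'.1, fun t ht => ?_⟩
  have ha : a ∈ Icc a b := ⟨le_rfl, ht.1.trans ht.2⟩
  simp only [map_sub]
  rw [intervalIntegral.integral_sub (h.intervalIntegrable ha ht) (h'.intervalIntegrable ha ht),
    ← h.sub_eq ha ht, ← h'.sub_eq ha ht]
  abel

theorem continuousOn [CompleteSpace H] (h : IsLinSol A a b d) : ContinuousOn d (Icc a b) := by
  rcases lt_or_ge b a with hab | hab
  · rw [Icc_eq_empty (not_le.2 hab)]; exact continuousOn_empty _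
  have := intervalIntegral.continuousOn_primitive_interval' h.1 (left_mem_uIcc)
  rw [uIcc_of_le hab] at this
  exact (continuousOn_const.add this).congr fun t ht => h.2 t ht

theorem norm_le_left [CompleteSpace H] (h : IsLinSol A a b d) (hK : 0 ≤ K)
    (hA : ∀ t ∈ Icc a b, ‖A t‖ ≤ K) {t : ℝ} (ht : t ∈ Icc a b) :
    ‖d t‖ ≤ ‖d a‖ * Real.exp (2 * K * (t - a)) := by
  have hab := ht.1.trans ht.2
  have hc := h.continuousOn
  obtain ⟨M, hM⟩ := isCompact_Icc.exists_bound_of_continuousOn hc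
  have hin : IntervalIntegrable (fun t => ‖d t‖) volume a b :=
    (hc.norm.mono (by rw [uIcc_of_le hab])).intervalIntegrable
  have hineq : ∀ t ∈ Icc a b, ‖d t‖ ≤ ‖d a‖ + K * ∫ s in a..t, ‖d s‖ := by
    intro t ht
    rw [h.2 t ht, ← intervalIntegral.integral_const_mul]
    refine (norm_add_le _ _).trans (add_le_add_right ?_ _)
    refine intervalIntegral.norm_integral_le_of_norm_le ht.1 (ae_of_all _ fun r hr => ?_) ?_
    · exact (A r).le_of_opNorm_le (hA r ⟨hr.1.le, hr.2.trans ht.2⟩) _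
    · exact (hin.mono_set (by rw [uIcc_of_le ht.1, uIcc_of_le hab]
                              exact Icc_subset_Icc_right ht.2)).const_mul K
  exact (hineq t ht).trans (gronwall_integral hK (norm_nonneg _) hin (ae_of_all _ hM)
    (ae_of_all _ hineq) ht)

theorem norm_le_right [CompleteSpace H] (h : IsLinSol A a b d) (hK : 0 ≤ K)
    (hA : ∀ t ∈ Icc a b, ‖A t‖ ≤ K) {t : ℝ} (ht : t ∈ Icc a b) :
    ‖d t‖ ≤ ‖d b‖ * Real.exp (2 * K * (b - t)) := by
  have hab := ht.1.trans ht.2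
  have hc := h.continuousOn
  obtain ⟨M, hM⟩ := isCompact_Icc.exists_bound_of_continuousOn hc
  have hin : IntervalIntegrable (fun t => ‖d t‖) volume a b :=
    (hc.norm.mono (by rw [uIcc_of_le hab])).intervalIntegrable
  have hineq : ∀ t ∈ Icc a b, ‖d t‖ ≤ ‖d b‖ + K * ∫ s in t..b, ‖d s‖ := by
    intro t ht
    have : d t = d b - ∫ r in t..b, A r (d r) := by
      rw [← h.sub_eq ht ⟨hab, le_rfl⟩]; abel
    rw [this, ← intervalIntegral.integral_const_mul]
    refine (norm_sub_le _ _).trans (add_le_add_right ?_ _)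
    refine intervalIntegral.norm_integral_le_of_norm_le ht.2 (ae_of_all _ fun r hr => ?_) ?_
    · exact (A r).le_of_opNorm_le (hA r ⟨ht.1.trans hr.1.le, hr.2⟩) _
    · exact (hin.mono_set (by rw [uIcc_of_le ht.2, uIcc_of_le hab]
                              exact Icc_subset_Icc_left ht.1)).const_mul K
  exact (hineq t ht).trans (gronwall_integral_backward hK (norm_nonneg _) hin (ae_of_all _ hM)
    (ae_of_all _ hineq) ht)

theorem eq_of_left [CompleteSpace H] (h : IsLinSol A a b d) (h' : IsLinSol A a b d')
    (hA : ∀ t ∈ Icc a b, ‖A t‖ ≤ K) (h0 : d a = d' a) {t : ℝ} (ht : t ∈ Icc a b) :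
    d t = d' t := by
  have := (h.sub h').norm_le_left ((norm_nonneg _).trans (hA t ht)) hA ht
  rw [h0, sub_self, norm_zero, zero_mul] at this
  exact sub_eq_zero.1 (norm_le_zero_iff.1 this)

theorem eq_of_right [CompleteSpace H] (h : IsLinSol A a b d) (h' : IsLinSol A a b d')
    (hA : ∀ t ∈ Icc a b, ‖A t‖ ≤ K) (h0 : d b = d' b) {t : ℝ} (ht : t ∈ Icc a b) :
    d t = d' t := by
  have := (h.sub h').norm_le_right ((norm_nonneg _).trans (hA t ht)) hA ht
  rw [h0, sub_self, norm_zero, zero_mul] at this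
  exact sub_eq_zero.1 (norm_le_zero_iff.1 this)

/-- Solutions of `p' = -A^* p` and `d' = A d` have a constant pairing. -/
theorem inner_eq [CompleteSpace H] {T : ℝ} {p : ℝ → H}
    (hp : IsLinSol (fun r => -ContinuousLinearMap.adjoint (A r)) 0 T p)
    (hd : IsLinSol A 0 T d) {t : ℝ} (ht : t ∈ Icc 0 T) : ⟪p t, d t⟫_ℝ = ⟪p 0, d 0⟫_ℝ := by
  have h0 : (0 : ℝ) ∈ Icc 0 T := ⟨le_rfl, ht.1.trans ht.2⟩
  have := inner_eq_add_integral ht.1 (hp.mono h0 ht).1 (hd.mono h0 ht).1 (hp.mono h0 ht).2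
    (hd.mono h0 ht).2
  rw [this]
  simp [ContinuousLinearMap.adjoint_inner_left]

end IsLinSol

variable [CompleteSpace H] [MeasurableSpace H] [BorelSpace H] [SecondCountableTopology H]
  {Θ : Type*} [MeasurableSpace Θ]

/-- Solutions of the linear equation with a prescribed initial value, measurable jointly in time and
in a parameter. -/
theorem exists_isLinSol_left {T K : ℝ} (hT : 0 ≤ T) (hK : 0 ≤ K) {A : ℝ → Θ → H →L[ℝ] H}
    (hA : Measurable fun p : (ℝ × Θ) × H => A p.1.1 p.1.2 p.2)
    (hAK : ∀ t ∈ Icc 0 T, ∀ θ, ‖A t θ‖ ≤ K) {w : Θ → H} (hw : Measurable w) :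
    ∃ d : ℝ → Θ → H, Measurable (fun p : ℝ × Θ => d p.1 p.2) ∧
      ∀ θ, d 0 θ = w θ ∧ IsLinSol (fun t => A t θ) 0 T (fun t => d t θ) := by
  obtain ⟨d, hd, h⟩ := exists_volterra (T := T) hK (fun _ s θ x => A s θ x)
    (by
      have : Measurable fun p : ℝ × ℝ × Θ × H => ((p.2.1, p.2.2.1), p.2.2.2) := by fun_prop
      exact hA.comp this) (fun _ θ => w θ) (hw.comp measurable_snd)
  refine ⟨d, hd, fun θ => ?_⟩
  have h := h θ (K * ‖w θ‖ * T)
    (fun t ht s hs x y => by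
      rw [← map_sub]
      exact (A s θ).le_of_opNorm_le (hAK s ⟨hs.1, hs.2.trans ht.2⟩ θ) _)
    (fun t ht => by
      have hb : ∀ s ∈ uIoc 0 t, ‖A s θ (w θ)‖ ≤ K * ‖w θ‖ := by
        intro s hs
        rw [uIoc_of_le ht.1] at hs
        exact (A s θ).le_of_opNorm_le (hAK s ⟨hs.1.le, hs.2.trans ht.2⟩ θ) _
      refine ⟨?_, ?_⟩
      · refine (intervalIntegrable_const (c := K * ‖w θ‖)).mono_fun' ?_ ?_
        · have : Measurable fun s : ℝ => ((s, θ), w θ) := by fun_prop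
          exact (hA.comp this).aestronglyMeasurable
        · rw [EventuallyLE, ae_restrict_iff' measurableSet_uIoc]
          exact ae_of_all _ hb
      · refine (intervalIntegral.norm_integral_le_of_norm_le_const hb).trans ?_
        rw [sub_zero, abs_of_nonneg ht.1]
        exact mul_le_mul_of_nonneg_left ht.2 (by positivity))
  have h0 : d 0 θ = w θ := by simpa using (h 0 ⟨le_rfl, hT⟩).2.2
  refine ⟨h0, (h T ⟨hT, le_rfl⟩).2.1, fun t ht => ?_⟩
  simp only [h0]
  exact (h t ht).2.2

/-- Solutions of the linear equation with a prescribed terminal value, obtained from the forward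
equation by time reversal. -/
theorem exists_isLinSol_right {T K : ℝ} (hT : 0 ≤ T) (hK : 0 ≤ K) {A : ℝ → Θ → H →L[ℝ] H}
    (hA : Measurable fun p : (ℝ × Θ) × H => A p.1.1 p.1.2 p.2)
    (hAK : ∀ t ∈ Icc 0 T, ∀ θ, ‖A t θ‖ ≤ K) {w : Θ → H} (hw : Measurable w) :
    ∃ d : ℝ → Θ → H, Measurable (fun p : ℝ × Θ => d p.1 p.2) ∧
      ∀ θ, d T θ = w θ ∧ IsLinSol (fun t => A t θ) 0 T (fun t => d t θ) := by
  obtain ⟨d, hd, h⟩ := exists_isLinSol_left hT hK (A := fun t θ => -A (T - t) θ)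
    (by
      have : Measurable fun p : (ℝ × Θ) × H => ((T - p.1.1, p.1.2), p.2) := by fun_prop
      exact (hA.comp this).neg)
    (fun t ht θ => by
      rw [norm_neg]; exact hAK (T - t) ⟨by linarith [ht.2], by linarith [ht.1]⟩ θ) hw
  refine ⟨fun t => d (T - t), ?_, fun θ => ⟨by simpa using (h θ).1, ?_, fun t ht => ?_⟩⟩
  · have : Measurable fun p : ℝ × Θ => (T - p.1, p.2) := by fun_prop
    exact hd.comp this
  · have := ((h θ).2.1.comp_sub_left T).symm.neg
    simp only [sub_zero, sub_self, neg_apply, sub_sub_cancel] at this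
    refine this.congr fun r _ => ?_
    simp
  · have h1 := (h θ).2.sub_eq (s := T - t) (t := T) ⟨by linarith [ht.2], by linarith [ht.1]⟩
      ⟨hT, le_rfl⟩
    have h2 := intervalIntegral.integral_comp_sub_left (a := 0) (b := t)
      (fun s => -(A (T - s) θ) (d s θ)) T
    simp only [sub_sub_cancel, sub_zero] at h2
    simp only [neg_apply] at h1
    rw [← h2, intervalIntegral.integral_neg] at h1
    simp only [sub_zero]
    rw [← sub_eq_iff_eq_add', ← neg_sub, h1, neg_neg]

end LinSol

/-! ### Flows of linear equations -/

section Flow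

variable {H : Type*} [NormedAddCommGroup H] [InnerProductSpace ℝ H]

theorem ringInverse_apply_apply {M : H →L[ℝ] H} (h : IsUnit M) (u : H) :
    Ring.inverse M (M u) = u :=
  DFunLike.congr_fun (Ring.inverse_mul_cancel M h) u

theorem apply_ringInverse_apply {M : H →L[ℝ] H} (h : IsUnit M) (u : H) :
    M (Ring.inverse M u) = u :=
  DFunLike.congr_fun (Ring.mul_inverse_cancel M h) u

/-- `J s t` is the flow of the linear equation `d' = A d` on `[0, T]`. -/
def IsLinFlow (A : ℝ → H →L[ℝ] H) (T : ℝ) (J : ℝ → ℝ → H →L[ℝ] H) : Prop :=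
  ∀ s ∈ Icc 0 T, ∀ u : H, J s s u = u ∧ IsLinSol A s T (fun t => J s t u)

/-- Changing the path on a null set of times does not affect the flow along it. -/
theorem IsFlow.isLinFlow {B : ℝ → H → H →L[ℝ] H} {T : ℝ} {X : ℝ → H} {J : ℝ → ℝ → H →L[ℝ] H}
    (h : IsFlow B T X J) {A : ℝ → H →L[ℝ] H} (hA : ∀ᵐ t, t ∈ Icc 0 T → B t (X t) = A t) :
    IsLinFlow A T J := by
  intro s hs u
  obtain ⟨-, h⟩ := h s hs u
  have h0 : J s s u = u := by simpa using (h s ⟨le_rfl, hs.2⟩).2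
  have h1 : IsLinSol (fun r => B r (X r)) s T (fun t => J s t u) :=
    ⟨(h T ⟨hs.2, le_rfl⟩).1, fun t ht => by simp only [h0]; exact (h t ht).2⟩
  refine ⟨h0, h1.congr_ae hs.2 ?_⟩
  filter_upwards [hA] with t ht ht'
  exact ht ⟨hs.1.trans ht'.1, ht'.2⟩

namespace IsLinFlow

variable {A : ℝ → H →L[ℝ] H} {T K : ℝ} {J : ℝ → ℝ → H →L[ℝ] H} [CompleteSpace H]

theorem apply_eq (hJ : IsLinFlow A T J) (hAK : ∀ t ∈ Icc 0 T, ‖A t‖ ≤ K) {d : ℝ → H} {s t : ℝ}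
    (hs : 0 ≤ s) (hst : s ≤ t) (ht : t ≤ T) (hd : IsLinSol A s t d) :
    J s t (d s) = d t := by
  have h1 := (hJ s ⟨hs, hst.trans ht⟩ (d s)).2.mono (s := s) (t := t) ⟨le_rfl, hst.trans ht⟩
    ⟨hst, ht⟩
  exact h1.eq_of_left hd (fun r hr => hAK r ⟨hs.trans hr.1, hr.2.trans ht⟩)
    (hJ s ⟨hs, hst.trans ht⟩ (d s)).1 ⟨hst, le_rfl⟩

variable [MeasurableSpace H] [BorelSpace H] [SecondCountableTopology H]

/-- Injectivity is uniqueness of solutions with given terminal value, surjectivity is their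
existence. -/
theorem bijective (hJ : IsLinFlow A T J) (hA : Measurable fun p : ℝ × H => A p.1 p.2)
    (hAK : ∀ t ∈ Icc 0 T, ‖A t‖ ≤ K) {s t : ℝ} (hs : 0 ≤ s) (hst : s ≤ t) (ht : t ≤ T) :
    Function.Bijective (J s t) := by
  have hK : 0 ≤ K := (norm_nonneg _).trans (hAK s ⟨hs, hst.trans ht⟩)
  have hsT : s ∈ Icc 0 T := ⟨hs, hst.trans ht⟩
  constructor
  · refine (injective_iff_map_eq_zero _).2 fun u hu => ?_
    have h1 := (hJ s hsT u).2.mono (s := s) (t := t) ⟨le_rfl, hst.trans ht⟩ ⟨hst, ht⟩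
    have := h1.norm_le_right hK (fun r hr => hAK r ⟨hs.trans hr.1, hr.2.trans ht⟩)
      (t := s) ⟨le_rfl, hst⟩
    rw [hu, (hJ s hsT u).1, norm_zero, zero_mul] at this
    exact norm_le_zero_iff.1 this
  · intro v
    obtain ⟨k, -, hk⟩ := exists_isLinSol_right (Θ := Unit) (hs.trans hst) hK
      (A := fun r _ => A r) (w := fun _ => v)
      (by
        have : Measurable fun p : (ℝ × Unit) × H => (p.1.1, p.2) := by fun_prop
        exact hA.comp this)
      (fun r hr _ => hAK r ⟨hr.1, hr.2.trans ht⟩) measurable_const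
    obtain ⟨hk1, hk2⟩ := hk ()
    exact ⟨k s (), (hJ.apply_eq hAK hs hst ht
      (hk2.mono ⟨hs, hst⟩ ⟨hs.trans hst, le_rfl⟩)).trans hk1⟩

theorem isUnit (hJ : IsLinFlow A T J) (hA : Measurable fun p : ℝ × H => A p.1 p.2)
    (hAK : ∀ t ∈ Icc 0 T, ‖A t‖ ≤ K) {s t : ℝ} (hs : 0 ≤ s) (hst : s ≤ t) (ht : t ≤ T) :
    IsUnit (J s t) :=
  ContinuousLinearMap.isUnit_iff_bijective.2 (hJ.bijective hA hAK hs hst ht)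

theorem inverse_apply (hJ : IsLinFlow A T J) (hA : Measurable fun p : ℝ × H => A p.1 p.2)
    (hAK : ∀ t ∈ Icc 0 T, ‖A t‖ ≤ K) {d : ℝ → H} {s t : ℝ}
    (hs : 0 ≤ s) (hst : s ≤ t) (ht : t ≤ T) (hd : IsLinSol A s t d) :
    Ring.inverse (J s t) (d t) = d s := by
  rw [← hJ.apply_eq hAK hs hst ht hd, ringInverse_apply_apply (hJ.isUnit hA hAK hs hst ht)]

theorem norm_apply_le (hJ : IsLinFlow A T J) (hAK : ∀ t ∈ Icc 0 T, ‖A t‖ ≤ K) {s t : ℝ}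
    (hs : 0 ≤ s) (hst : s ≤ t) (ht : t ≤ T) : ‖J s t‖ ≤ Real.exp (2 * K * T) := by
  have hsT : s ∈ Icc 0 T := ⟨hs, hst.trans ht⟩
  have hK : 0 ≤ K := (norm_nonneg _).trans (hAK s hsT)
  refine ContinuousLinearMap.opNorm_le_bound _ (Real.exp_pos _).le fun u => ?_
  have := (hJ s hsT u).2.norm_le_left hK (fun r hr => hAK r ⟨hs.trans hr.1, hr.2⟩)
    (t := t) ⟨hst, ht⟩
  rw [(hJ s hsT u).1, mul_comm] at this
  refine this.trans (mul_le_mul_of_nonneg_right (Real.exp_le_exp.2 ?_) (norm_nonneg _))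
  nlinarith

theorem norm_inverse_le (hJ : IsLinFlow A T J) (hA : Measurable fun p : ℝ × H => A p.1 p.2)
    (hAK : ∀ t ∈ Icc 0 T, ‖A t‖ ≤ K) {s t : ℝ} (hs : 0 ≤ s) (hst : s ≤ t) (ht : t ≤ T) :
    ‖Ring.inverse (J s t)‖ ≤ Real.exp (2 * K * T) := by
  have hsT : s ∈ Icc 0 T := ⟨hs, hst.trans ht⟩
  have hK : 0 ≤ K := (norm_nonneg _).trans (hAK s hsT)
  refine ContinuousLinearMap.opNorm_le_bound _ (Real.exp_pos _).le fun v => ?_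
  obtain ⟨u, rfl⟩ := (hJ.bijective hA hAK hs hst ht).2 v
  rw [ringInverse_apply_apply (hJ.isUnit hA hAK hs hst ht)]
  have h1 := (hJ s hsT u).2.mono (s := s) (t := t) ⟨le_rfl, hst.trans ht⟩ ⟨hst, ht⟩
  have := h1.norm_le_right hK (fun r hr => hAK r ⟨hs.trans hr.1, hr.2.trans ht⟩)
    (t := s) ⟨le_rfl, hst⟩
  rw [(hJ s hsT u).1, mul_comm] at this
  refine this.trans (mul_le_mul_of_nonneg_right (Real.exp_le_exp.2 ?_) (norm_nonneg _))
  nlinarith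

/-- The solution `p` of the adjoint equation represents `z ↦ ⟨p_0, J_{0,t}⁻¹ z⟩`. -/
theorem inner_adjoint_sol (hJ : IsLinFlow A T J) (hA : Measurable fun p : ℝ × H => A p.1 p.2)
    (hAK : ∀ t ∈ Icc 0 T, ‖A t‖ ≤ K) {p : ℝ → H}
    (hp : IsLinSol (fun r => -ContinuousLinearMap.adjoint (A r)) 0 T p) {t : ℝ}
    (ht : t ∈ Icc 0 T) (z : H) : ⟪p t, z⟫_ℝ = ⟪p 0, Ring.inverse (J 0 t) z⟫_ℝ := by
  obtain ⟨u, rfl⟩ := (hJ.bijective hA hAK le_rfl ht.1 ht.2).2 z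
  have h0 : (0 : ℝ) ∈ Icc 0 T := ⟨le_rfl, ht.1.trans ht.2⟩
  rw [ringInverse_apply_apply (hJ.isUnit hA hAK le_rfl ht.1 ht.2), hp.inner_eq (hJ 0 h0 u).2 ht,
    (hJ 0 h0 u).1]

end IsLinFlow

end Flow

/-! ### Hilbert-Schmidt operators and traces -/

section HS

variable {ι H : Type*} [NormedAddCommGroup H] [InnerProductSpace ℝ H]

theorem enorm_sq_eq_tsum (e : HilbertBasis ι ℝ H) (x : H) :
    ‖x‖ₑ ^ 2 = ∑' i, ‖⟪e i, x⟫_ℝ‖ₑ ^ 2 := by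
  have h := e.hasSum_inner_mul_inner x x
  have h1 : ∀ i, ⟪x, e i⟫_ℝ * ⟪e i, x⟫_ℝ = ‖⟪e i, x⟫_ℝ‖ ^ 2 := fun i => by
    rw [real_inner_comm, Real.norm_eq_abs, sq_abs, sq]
  simp only [h1, real_inner_self_eq_norm_sq] at h
  have h2 : ∀ y : ℝ, ‖y‖ₑ ^ 2 = ENNReal.ofReal (‖y‖ ^ 2) := fun y => by
    rw [← ofReal_norm, ENNReal.ofReal_pow (norm_nonneg _)]
  simp only [h2]
  rw [← ENNReal.ofReal_tsum_of_nonneg (fun i => by positivity) h.summable, h.tsum_eq,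
    ENNReal.ofReal_pow (norm_nonneg _), ofReal_norm]

theorem hsNormSq_adjoint [CompleteSpace H] (e : HilbertBasis ι ℝ H) (L : H →L[ℝ] H) :
    hsNormSq e (ContinuousLinearMap.adjoint L) = hsNormSq e L := by
  unfold hsNormSq
  simp_rw [fun i => enorm_sq_eq_tsum e (ContinuousLinearMap.adjoint L (e i)),
    fun i => enorm_sq_eq_tsum e (L (e i))]
  rw [ENNReal.tsum_comm]
  congr 1; ext i; congr 1; ext j
  rw [ContinuousLinearMap.adjoint_inner_right, real_inner_comm]

theorem hsNormSq_comp_le_left (e : HilbertBasis ι ℝ H) (M L : H →L[ℝ] H) :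
    hsNormSq e (M.comp L) ≤ ‖M‖ₑ ^ 2 * hsNormSq e L := by
  unfold hsNormSq
  rw [← ENNReal.tsum_mul_left]
  refine ENNReal.tsum_le_tsum fun i => ?_
  rw [← mul_pow]
  gcongr
  exact M.le_opENorm _

theorem hsNormSq_comp_le_right [CompleteSpace H] (e : HilbertBasis ι ℝ H) (L M : H →L[ℝ] H) :
    hsNormSq e (L.comp M) ≤ ‖M‖ₑ ^ 2 * hsNormSq e L := by
  rw [← hsNormSq_adjoint, ContinuousLinearMap.adjoint_comp, ← hsNormSq_adjoint e L]
  refine (hsNormSq_comp_le_left e _ _).trans ?_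
  rw [← ofReal_norm, ContinuousLinearMap.adjoint.norm_map, ofReal_norm]

theorem summable_norm_sq (e : HilbertBasis ι ℝ H) {L : H →L[ℝ] H} (h : hsNormSq e L ≠ ∞) :
    Summable (fun i => ‖L (e i)‖ ^ 2) ∧ ∑' i, ‖L (e i)‖ ^ 2 = (hsNormSq e L).toReal := by
  have h2 : ∀ i, ‖L (e i)‖ₑ ^ 2 = ENNReal.ofReal (‖L (e i)‖ ^ 2) := fun i => by
    rw [← ofReal_norm, ENNReal.ofReal_pow (norm_nonneg _)]
  unfold hsNormSq at h ⊢
  have h3 := ENNReal.summable_toReal h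
  have h4 := ENNReal.tsum_toReal_eq (fun i => ENNReal.ne_top_of_tsum_ne_top h i)
  have h5 : ∀ i, (‖L (e i)‖ₑ ^ 2).toReal = ‖L (e i)‖ ^ 2 := fun i => by
    rw [h2, ENNReal.toReal_ofReal (by positivity)]
  simp only [h5] at h3 h4
  exact ⟨h3, h4.symm⟩

/-- For Hilbert-Schmidt `P` and `Q`, the trace of `P Q` converges absolutely. -/
theorem summable_inner_comp [CompleteSpace H] (e : HilbertBasis ι ℝ H) {P Q : H →L[ℝ] H}
    (hP : hsNormSq e P ≠ ∞) (hQ : hsNormSq e Q ≠ ∞) :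
    Summable (fun i => ‖⟪P.comp Q (e i), e i⟫_ℝ‖) ∧
    ∑' i, ‖⟪P.comp Q (e i), e i⟫_ℝ‖ ≤ (hsNormSq e P).toReal + (hsNormSq e Q).toReal := by
  have hP' : hsNormSq e (ContinuousLinearMap.adjoint P) ≠ ∞ := by rwa [hsNormSq_adjoint]
  obtain ⟨s1, t1⟩ := summable_norm_sq e hP'
  obtain ⟨s2, t2⟩ := summable_norm_sq e hQ
  have hle : ∀ i, ‖⟪P.comp Q (e i), e i⟫_ℝ‖ ≤
      ‖ContinuousLinearMap.adjoint P (e i)‖ ^ 2 + ‖Q (e i)‖ ^ 2 := by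
    intro i
    rw [ContinuousLinearMap.comp_apply, ← ContinuousLinearMap.adjoint_inner_right]
    refine (norm_inner_le_norm _ _).trans ?_
    nlinarith [sq_nonneg (‖Q (e i)‖ - ‖ContinuousLinearMap.adjoint P (e i)‖),
      sq_nonneg ‖Q (e i)‖, sq_nonneg ‖ContinuousLinearMap.adjoint P (e i)‖]
  have hs := Summable.of_nonneg_of_le (fun _ => norm_nonneg _) hle (s1.add s2)
  refine ⟨hs, (hs.tsum_le_tsum hle (s1.add s2)).trans ?_⟩
  rw [s1.tsum_add s2, t1, t2, hsNormSq_adjoint]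

/-- Cyclicity of the trace for products of two Hilbert-Schmidt operators: both sides are the same
absolutely convergent double series of products of entries. -/
theorem trace_comp_comm [CompleteSpace H] (e : HilbertBasis ι ℝ H) {P Q : H →L[ℝ] H}
    (hP : hsNormSq e P ≠ ∞) (hQ : hsNormSq e Q ≠ ∞) :
    trace e (P.comp Q) = trace e (Q.comp P) := by
  unfold trace
  let F : ι × ι → ℝ := fun q => ⟪e q.2, Q (e q.1)⟫_ℝ * ⟪P (e q.2), e q.1⟫_ℝ
  have hexp : ∀ (P Q : H →L[ℝ] H) i,
      HasSum (fun j => ⟪e j, Q (e i)⟫_ℝ * ⟪P (e j), e i⟫_ℝ) ⟪P.comp Q (e i), e i⟫_ℝ := by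
    intro P Q i
    have := e.hasSum_inner_mul_inner (Q (e i)) (ContinuousLinearMap.adjoint P (e i))
    simp only [ContinuousLinearMap.adjoint_inner_right] at this
    simpa only [real_inner_comm, ContinuousLinearMap.comp_apply] using this
  have hsum2 : ∀ {L : H →L[ℝ] H}, hsNormSq e L ≠ ∞ →
      Summable fun q : ι × ι => ⟪e q.2, L (e q.1)⟫_ℝ ^ 2 := by
    intro L hL
    have h1 : ∑' q : ι × ι, ‖⟪e q.2, L (e q.1)⟫_ℝ‖ₑ ^ 2 = hsNormSq e L := by
      rw [ENNReal.tsum_prod (f := fun i j => ‖⟪e j, L (e i)⟫_ℝ‖ₑ ^ 2)]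
      simp_rw [← enorm_sq_eq_tsum e]
      rfl
    rw [← h1] at hL
    refine (ENNReal.summable_toReal hL).congr fun q => ?_
    rw [ENNReal.toReal_pow, toReal_enorm, Real.norm_eq_abs, sq_abs]
  have hF : Summable F := by
    have h1 := hsum2 hQ
    have h2 := (hsum2 hP).prod_symm
    refine Summable.of_norm_bounded (h1.add h2) fun q => ?_
    simp only [F, Prod.fst_swap, Prod.snd_swap, norm_mul, Real.norm_eq_abs]
    rw [real_inner_comm (e q.1) (P (e q.2)), ← sq_abs ⟪e q.2, Q (e q.1)⟫_ℝ,
      ← sq_abs ⟪e q.1, P (e q.2)⟫_ℝ]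
    nlinarith [sq_nonneg (|⟪e q.2, Q (e q.1)⟫_ℝ| - |⟪e q.1, P (e q.2)⟫_ℝ|),
      sq_nonneg |⟪e q.2, Q (e q.1)⟫_ℝ|, sq_nonneg |⟪e q.1, P (e q.2)⟫_ℝ|]
  have h1 : ∀ i, ⟪P.comp Q (e i), e i⟫_ℝ = ∑' j, F (i, j) := fun i => (hexp P Q i).tsum_eq.symm
  have h2 : ∀ j, ⟪Q.comp P (e j), e j⟫_ℝ = ∑' i, F (i, j) := fun j => by
    rw [← (hexp Q P j).tsum_eq]
    refine tsum_congr fun i => ?_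
    simp only [F]
    rw [real_inner_comm (P (e j)), real_inner_comm (Q (e i)) (e j), mul_comm]
  simp_rw [h1, h2]
  exact (Summable.tsum_comm (f := fun i j => F (i, j)) hF).symm

end HS

/-! ### The coefficients on a bounded time interval -/

section Coeffs

variable {H : Type*} [NormedAddCommGroup H] [InnerProductSpace ℝ H] [MeasurableSpace H]

/-- The properties of the semigroup and of the drift that are used on the time interval `[0, T]`,
with a single constant `K` for all bounds. -/
structure Coeffs (S : ℝ → H →L[ℝ] H) (b : ℝ → H → H) (B : ℝ → H → H →L[ℝ] H) (T K : ℝ) :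
    Prop where
  T_nonneg : 0 ≤ T
  K_nonneg : 0 ≤ K
  S_zero : S 0 = 1
  S_add : ∀ s t, 0 ≤ s → 0 ≤ t → S (s + t) = (S s).comp (S t)
  S_norm : ∀ t, 0 ≤ t → ‖S t‖ ≤ 1
  S_cont : ∀ x, ContinuousOn (fun t => S t x) (Ici 0)
  b_meas : Measurable (fun p : ℝ≥0 × H => b p.1 p.2)
  b_lip : ∀ t ∈ Icc 0 T, ∀ x y, ‖b t x - b t y‖ ≤ K * ‖x - y‖
  b_diff : ∀ t, 0 ≤ t → Differentiable ℝ (b t)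
  B_meas : Measurable (fun p : (ℝ≥0 × H) × H => B p.1.1 p.1.2 p.2)
  B_diff : ∀ t, 0 ≤ t → Differentiable ℝ (B t)
  B_norm : ∀ t ∈ Icc 0 T, ∀ x, ‖B t x‖ ≤ K
  dB_norm : ∀ t ∈ Icc 0 T, ∀ x, ‖fderiv ℝ (B t) x‖ ≤ K
  conj : ∀ t, 0 ≤ t → ∀ x, (S t).comp (B t x) = (fderiv ℝ (b t) x).comp (S t)

/-- `X` solves the mild equation `X_t = c_t + ∫_a^t S_{t-s} ψ_s(X_s) ds` on `[a, b]`. -/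
def IsMildSol (S : ℝ → H →L[ℝ] H) (ψ : ℝ → H → H) (a b : ℝ) (c X : ℝ → H) : Prop :=
  IntervalIntegrable (fun s => ψ s (X s)) volume a b ∧
    ∀ t ∈ Icc a b, X t = c t + ∫ s in a..t, S (t - s) (ψ s (X s))

variable [BorelSpace H] [SecondCountableTopology H]

namespace Coeffs

variable {S : ℝ → H →L[ℝ] H} {b : ℝ → H → H} {B : ℝ → H → H →L[ℝ] H} {T K : ℝ}

theorem S_apply_le (hC : Coeffs S b B T K) {t : ℝ} (ht : 0 ≤ t) (x : H) : ‖S t x‖ ≤ ‖x‖ := by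
  simpa using (S t).le_of_opNorm_le (hC.S_norm t ht) x

theorem S_meas (hC : Coeffs S b B T K) : Measurable fun p : ℝ≥0 × H => S p.1 p.2 := by
  refine measurable_clm_uncurry (A := fun t : ℝ≥0 => S t) fun u => ?_
  exact ((hC.S_cont u).comp_continuous NNReal.continuous_coe fun t => t.2).measurable

theorem measurable_S_sub (hC : Coeffs S b B T K) {α : Type*} [MeasurableSpace α] {t : α → ℝ}
    (ht : Measurable t) {g : α → H} (hg : Measurable g) :
    Measurable fun a => S ((t a).toNNReal : ℝ) (g a) :=
  hC.S_meas.comp (f := fun a => ((t a).toNNReal, g a)) (ht.real_toNNReal.prodMk hg)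

theorem measurable_fderiv_apply (hb : Measurable (fun p : ℝ≥0 × H => b p.1 p.2))
    (hd : ∀ t, 0 ≤ t → Differentiable ℝ (b t)) :
    Measurable fun p : (ℝ≥0 × H) × H => fderiv ℝ (b p.1.1) p.1.2 p.2 := by
  refine measurable_of_tendsto_metrizable (f := fun (n : ℕ) (p : (ℝ≥0 × H) × H) =>
    (n : ℝ) • (b p.1.1 (p.1.2 + (n : ℝ)⁻¹ • p.2) - b p.1.1 p.1.2)) (fun n => ?_)
    (tendsto_pi_nhds.2 fun p => ?_)
  · have h1 := hb.comp (f := fun p : (ℝ≥0 × H) × H =>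
      (p.1.1, p.1.2 + (n : ℝ)⁻¹ • p.2)) (by fun_prop)
    have h2 := hb.comp (f := fun p : (ℝ≥0 × H) × H => p.1) (by fun_prop)
    exact (h1.sub h2).const_smul _
  · exact ((hd p.1.1 p.1.1.2 p.1.2).hasFDerivAt.lim_real p.2).comp
      tendsto_natCast_atTop_atTop

theorem db_meas (hC : Coeffs S b B T K) :
    Measurable fun p : (ℝ≥0 × H) × H => fderiv ℝ (b p.1.1) p.1.2 p.2 :=
  measurable_fderiv_apply hC.b_meas hC.b_diff

theorem mono (hC : Coeffs S b B T K) {t : ℝ} (ht : t ∈ Icc 0 T) : Coeffs S b B t K where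
  T_nonneg := ht.1
  K_nonneg := hC.K_nonneg
  S_zero := hC.S_zero
  S_add := hC.S_add
  S_norm := hC.S_norm
  S_cont := hC.S_cont
  b_meas := hC.b_meas
  b_lip s hs := hC.b_lip s ⟨hs.1, hs.2.trans ht.2⟩
  b_diff := hC.b_diff
  B_meas := hC.B_meas
  B_diff := hC.B_diff
  B_norm s hs := hC.B_norm s ⟨hs.1, hs.2.trans ht.2⟩
  dB_norm s hs := hC.dB_norm s ⟨hs.1, hs.2.trans ht.2⟩
  conj := hC.conj

theorem dB_meas (hC : Coeffs S b B T K) :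
    Measurable fun p : ((ℝ≥0 × H) × H) × H => fderiv ℝ (B p.1.1.1) p.1.1.2 p.1.2 p.2 := by
  refine measurable_of_tendsto_metrizable (f := fun (n : ℕ) (p : ((ℝ≥0 × H) × H) × H) =>
    (n : ℝ) • (B p.1.1.1 (p.1.1.2 + (n : ℝ)⁻¹ • p.1.2) p.2 - B p.1.1.1 p.1.1.2 p.2))
    (fun n => ?_) (tendsto_pi_nhds.2 fun p => ?_)
  · have h1 := hC.B_meas.comp (f := fun p : ((ℝ≥0 × H) × H) × H =>
      ((p.1.1.1, p.1.1.2 + (n : ℝ)⁻¹ • p.1.2), p.2)) (by fun_prop)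
    have h2 := hC.B_meas.comp (f := fun p : ((ℝ≥0 × H) × H) × H => (p.1.1, p.2)) (by fun_prop)
    exact (h1.sub h2).const_smul _
  · have h1 := ((hC.B_diff p.1.1.1 p.1.1.1.2 p.1.1.2).hasFDerivAt.lim_real p.1.2).comp
      tendsto_natCast_atTop_atTop
    have h2 := ((ContinuousLinearMap.apply ℝ H p.2).continuous.tendsto _).comp h1
    refine h2.congr fun n => ?_
    simp

theorem db_norm (hC : Coeffs S b B T K) {t : ℝ} (ht : t ∈ Icc 0 T) (x : H) :
    ‖fderiv ℝ (b t) x‖ ≤ K := by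
  have : LipschitzWith ⟨K, hC.K_nonneg⟩ (b t) := LipschitzWith.of_dist_le_mul fun x y => by
    rw [dist_eq_norm, dist_eq_norm]; exact hC.b_lip t ht x y
  exact norm_fderiv_le_of_lipschitz ℝ this

theorem B_lip (hC : Coeffs S b B T K) {t : ℝ} (ht : t ∈ Icc 0 T) (x y : H) :
    ‖B t x - B t y‖ ≤ K * ‖x - y‖ :=
  Convex.norm_image_sub_le_of_norm_fderiv_le (𝕜 := ℝ) (s := univ)
    (fun z _ => hC.B_diff t ht.1 z) (fun z _ => hC.dB_norm t ht z) convex_univ (mem_univ _)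
    (mem_univ _)

theorem intervalIntegrable_S (hC : Coeffs S b B T K) {g : ℝ → H} {a t : ℝ} (hat : a ≤ t)
    (hg : IntervalIntegrable g volume a t) :
    IntervalIntegrable (fun s => S (t - s) (g s)) volume a t := by
  refine hg.norm.mono_fun' ?_ ?_
  · have hg1 : AEMeasurable g (volume.restrict (uIoc a t)) :=
      hg.aestronglyMeasurable_restrict_uIoc.aemeasurable
    have h1 : AEMeasurable (fun s => S ((t - s).toNNReal : ℝ) (g s))
        (volume.restrict (uIoc a t)) :=
      hC.S_meas.comp_aemeasurable (f := fun s => ((t - s).toNNReal, g s))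
        (((measurable_const.sub measurable_id).real_toNNReal).aemeasurable.prodMk hg1)
    refine (h1.congr ?_).aestronglyMeasurable
    rw [EventuallyEq, ae_restrict_iff' measurableSet_uIoc]
    refine ae_of_all _ fun s hs => ?_
    rw [uIoc_of_le hat] at hs
    rw [Real.coe_toNNReal _ (by linarith [hs.2])]
  · rw [EventuallyLE, ae_restrict_iff' measurableSet_uIoc]
    refine ae_of_all _ fun s hs => ?_
    rw [uIoc_of_le hat] at hs
    exact hC.S_apply_le (by linarith [hs.2]) (g s)

/-- Stability of mild equations with respect to the inhomogeneity. -/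
theorem mild_norm_sub_le (hC : Coeffs S b B T K) {ψ : ℝ → H → H} {a c : ℝ} {f f' X X' : ℝ → H}
    (hψ : ∀ t ∈ Icc a c, ∀ x y, ‖ψ t x - ψ t y‖ ≤ K * ‖x - y‖)
    (hX : IsMildSol S ψ a c f X) (hX' : IsMildSol S ψ a c f' X')
    (hm : AEStronglyMeasurable (fun t => X t - X' t) (volume.restrict (Ioc a c)))
    {δ : ℝ} (hδ0 : 0 ≤ δ) (hδ : ∀ᵐ t, t ∈ Icc a c → ‖f t - f' t‖ ≤ δ) {t : ℝ} (ht : t ∈ Icc a c)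
    (hft : ‖f t - f' t‖ ≤ δ) : ‖X t - X' t‖ ≤ δ * Real.exp (2 * K * (c - a)) := by
  have hac := ht.1.trans ht.2
  have hsub : ∀ t ∈ Icc a c, uIcc a t ⊆ uIcc a c := fun t ht => by
    rw [uIcc_of_le ht.1, uIcc_of_le hac]; exact Icc_subset_Icc_right ht.2
  have hdiff := hX.1.sub hX'.1
  have hdn : ∀ t ∈ Icc a c, ‖X t - X' t‖ ≤ ‖f t - f' t‖ +
      ∫ s in a..t, ‖ψ s (X s) - ψ s (X' s)‖ := by
    intro t ht
    have i1 := hC.intervalIntegrable_S ht.1 (hX.1.mono_set (hsub t ht))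
    have i2 := hC.intervalIntegrable_S ht.1 (hX'.1.mono_set (hsub t ht))
    have : X t - X' t = (f t - f' t) +
        ∫ s in a..t, S (t - s) (ψ s (X s) - ψ s (X' s)) := by
      simp only [map_sub]
      rw [intervalIntegral.integral_sub i1 i2, hX.2 t ht, hX'.2 t ht]; abel
    rw [this]
    refine (norm_add_le _ _).trans (add_le_add_right ?_ _)
    refine intervalIntegral.norm_integral_le_of_norm_le ht.1 (ae_of_all _ fun s hs => ?_)
      (hdiff.norm.mono_set (hsub t ht))
    exact hC.S_apply_le (by linarith [hs.2]) _
  have hM : ∀ t ∈ Icc a c, ‖f t - f' t‖ ≤ δ →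
      ‖X t - X' t‖ ≤ δ + ∫ s in a..c, ‖ψ s (X s) - ψ s (X' s)‖ := by
    intro t ht hft
    refine (hdn t ht).trans (add_le_add hft ?_)
    exact intervalIntegral.integral_mono_interval le_rfl ht.1 ht.2
      (ae_of_all _ fun s => norm_nonneg _) hdiff.norm
  have hin : IntervalIntegrable (fun t => ‖X t - X' t‖) volume a c := by
    refine (intervalIntegrable_const
      (c := δ + ∫ s in a..c, ‖ψ s (X s) - ψ s (X' s)‖)).mono_fun' ?_ ?_
    · rw [uIoc_of_le hac]; exact hm.norm
    · rw [EventuallyLE, ae_restrict_iff' measurableSet_uIoc, uIoc_of_le hac]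
      filter_upwards [hδ] with s hs hs'
      rw [norm_norm]
      exact hM s ⟨hs'.1.le, hs'.2⟩ (hs ⟨hs'.1.le, hs'.2⟩)
  have hineq : ∀ t ∈ Icc a c, ‖f t - f' t‖ ≤ δ →
      ‖X t - X' t‖ ≤ δ + K * ∫ s in a..t, ‖X s - X' s‖ := by
    intro t ht hft
    refine (hdn t ht).trans (add_le_add hft ?_)
    rw [← intervalIntegral.integral_const_mul]
    refine intervalIntegral.integral_mono_on ht.1 (hdiff.norm.mono_set (hsub t ht))
      ((hin.mono_set (hsub t ht)).const_mul K) fun s hs => hψ s ⟨hs.1, hs.2.trans ht.2⟩ _ _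
  refine (hineq t ht hft).trans ((gronwall_integral hC.K_nonneg hδ0 hin
    (by filter_upwards [hδ] with s hs hs' using hM s hs' (hs hs'))
    (by filter_upwards [hδ] with s hs hs' using hineq s hs' (hs hs')) ht).trans ?_)
  refine mul_le_mul_of_nonneg_left (Real.exp_le_exp.2 ?_) hδ0
  have := hC.K_nonneg
  nlinarith [ht.2]

/-- Mild solutions whose inhomogeneities agree almost everywhere agree wherever these do. -/
theorem mild_unique (hC : Coeffs S b B T K) {ψ : ℝ → H → H} {a c : ℝ} {f f' X X' : ℝ → H}
    (hψ : ∀ t ∈ Icc a c, ∀ x y, ‖ψ t x - ψ t y‖ ≤ K * ‖x - y‖)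
    (hX : IsMildSol S ψ a c f X) (hX' : IsMildSol S ψ a c f' X')
    (hm : AEStronglyMeasurable (fun t => X t - X' t) (volume.restrict (Ioc a c)))
    (hf : ∀ᵐ t, t ∈ Icc a c → f t = f' t) {t : ℝ} (ht : t ∈ Icc a c)
    (hft : f t = f' t) : X t = X' t := by
  have := hC.mild_norm_sub_le hψ hX hX' hm (δ := 0) le_rfl
    (by filter_upwards [hf] with s hs hs'; rw [hs hs', sub_self, norm_zero]) ht
    (by rw [hft, sub_self, norm_zero])
  rw [zero_mul] at this
  exact sub_eq_zero.1 (norm_le_zero_iff.1 this)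

/-- Mild solutions that depend measurably on a parameter; for each parameter value, the equation is
only claimed if its coefficient is Lipschitz and integrable along the inhomogeneity. -/
theorem exists_mildSol [CompleteSpace H] (hC : Coeffs S b B T K) {Θ : Type*} [MeasurableSpace Θ]
    {ψ : ℝ → Θ → H → H} (hψm : Measurable fun p : (ℝ × Θ) × H => ψ p.1.1 p.1.2 p.2)
    {c : ℝ → Θ → H} (hc : Measurable fun p : ℝ × Θ => c p.1 p.2) :
    ∃ X : ℝ → Θ → H, Measurable (fun p : ℝ × Θ => X p.1 p.2) ∧ ∀ θ,
      (∀ t ∈ Icc 0 T, ∀ x y, ‖ψ t θ x - ψ t θ y‖ ≤ K * ‖x - y‖) →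
      IntervalIntegrable (fun s => ψ s θ (c s θ)) volume 0 T →
      IsMildSol S (fun s => ψ s θ) 0 T (fun t => c t θ) (fun t => X t θ) := by
  obtain ⟨X, hXm, hX⟩ := exists_volterra (T := T) hC.K_nonneg
    (fun t s θ x => S ((t - s).toNNReal : ℝ) (ψ s θ x))
    (by
      refine hC.measurable_S_sub (t := fun p : ℝ × ℝ × Θ × H => p.1 - p.2.1) (by fun_prop) ?_
      exact hψm.comp (f := fun p : ℝ × ℝ × Θ × H => ((p.2.1, p.2.2.1), p.2.2.2)) (by fun_prop))
    c hc
  refine ⟨X, hXm, fun θ hlip hint => ?_⟩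
  have hS : ∀ t s, s ≤ t → S ((t - s).toNNReal : ℝ) = S (t - s) := fun t s hst => by
    rw [Real.coe_toNNReal _ (by linarith)]
  have hSn : ∀ (t s : ℝ) (x : H), ‖S ((t - s).toNNReal : ℝ) x‖ ≤ ‖x‖ := fun t s x =>
    hC.S_apply_le NNReal.zero_le_coe x
  have h := hX θ (∫ s in (0 : ℝ)..T, ‖ψ s θ (c s θ)‖)
    (fun t ht s hs x y => by
      rw [← map_sub]
      exact (hSn _ _ _).trans (hlip s ⟨hs.1, hs.2.trans ht.2⟩ x y))
    (fun t ht => by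
      have hm : IntervalIntegrable (fun s => ψ s θ (c s θ)) volume 0 t :=
        hint.mono_set (by rw [uIcc_of_le ht.1, uIcc_of_le hC.T_nonneg]
                          exact Icc_subset_Icc_right ht.2)
      have h1 := hC.intervalIntegrable_S ht.1 hm
      refine ⟨h1.congr fun s hs => ?_, ?_⟩
      · rw [uIoc_of_le ht.1] at hs
        simp only [hS t s hs.2]
      · refine (intervalIntegral.norm_integral_le_of_norm_le ht.1
          (ae_of_all _ fun s _ => hSn t s _) hm.norm).trans ?_
        exact intervalIntegral.integral_mono_interval le_rfl ht.1 ht.2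
          (ae_of_all _ fun s => norm_nonneg _) hint.norm)
  constructor
  · have h1 : IntervalIntegrable (fun s => ψ s θ (X s θ) - ψ s θ (c s θ)) volume 0 T := by
      refine (intervalIntegrable_const (c := K * (2 * (∫ s in (0 : ℝ)..T, ‖ψ s θ (c s θ)‖) *
        Real.exp (2 * K * T)))).mono_fun' ?_ ?_
      · have hX1 : Measurable fun s : ℝ => X s θ :=
          hXm.comp (f := fun s : ℝ => (s, θ)) (by fun_prop)
        have h1 : Measurable fun s : ℝ => c s θ :=
          hc.comp (f := fun s : ℝ => (s, θ)) (by fun_prop)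
        exact ((hψm.comp (f := fun s : ℝ => ((s, θ), X s θ)) (by fun_prop)).sub
          (hψm.comp (f := fun s : ℝ => ((s, θ), c s θ)) (by fun_prop))).aestronglyMeasurable
      · rw [EventuallyLE, ae_restrict_iff' measurableSet_uIoc, uIoc_of_le hC.T_nonneg]
        refine ae_of_all _ fun s hs => ?_
        exact (hlip s ⟨hs.1.le, hs.2⟩ _ _).trans (mul_le_mul_of_nonneg_left
          (h s ⟨hs.1.le, hs.2⟩).1 hC.K_nonneg)
    simpa using h1.add hint
  · intro t ht
    refine (h t ht).2.2.trans ?_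
    congr 1
    refine intervalIntegral.integral_congr fun s hs => ?_
    rw [uIcc_of_le ht.1] at hs
    simp only [hS t s hs.2]

end Coeffs

end Coeffs

/-! ### Derivatives of the solution and of the linearized flow along a deterministic direction -/

section Variation

variable {H : Type*} [NormedAddCommGroup H] [InnerProductSpace ℝ H] [MeasurableSpace H]
  [BorelSpace H] [SecondCountableTopology H] [CompleteSpace H]
  {S : ℝ → H →L[ℝ] H} {b : ℝ → H → H} {B : ℝ → H → H →L[ℝ] H} {T K : ℝ}

namespace Coeffs

theorem measurable_comp_nnreal {F : ℝ → H} (hF : Measurable fun t : ℝ≥0 => F t) :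
    AEStronglyMeasurable F (volume.restrict (Icc 0 T)) := by
  have h1 : Measurable fun t : ℝ => F (t.toNNReal : ℝ) := hF.comp measurable_real_toNNReal
  refine h1.aestronglyMeasurable.congr ?_
  rw [EventuallyEq, ae_restrict_iff' measurableSet_Icc]
  exact ae_of_all _ fun t ht => by rw [Real.coe_toNNReal _ ht.1]

theorem aesm_b (hC : Coeffs S b B T K) {X : ℝ → H} (hX : Measurable X) :
    AEStronglyMeasurable (fun r => b r (X r)) (volume.restrict (Icc 0 T)) :=
  measurable_comp_nnreal (hC.b_meas.comp (f := fun t : ℝ≥0 => (t, X t))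
    (measurable_id.prodMk (hX.comp measurable_subtype_coe)))

theorem aesm_db (hC : Coeffs S b B T K) {X χ : ℝ → H} (hX : Measurable X) (hχ : Measurable χ) :
    AEStronglyMeasurable (fun r => fderiv ℝ (b r) (X r) (χ r)) (volume.restrict (Icc 0 T)) :=
  measurable_comp_nnreal (hC.db_meas.comp (f := fun t : ℝ≥0 => ((t, X t), χ t))
    ((measurable_id.prodMk (hX.comp measurable_subtype_coe)).prodMk
      (hχ.comp measurable_subtype_coe)))

theorem aesm_B (hC : Coeffs S b B T K) {X k : ℝ → H} (hX : Measurable X) (hk : Measurable k) :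
    AEStronglyMeasurable (fun r => B r (X r) (k r)) (volume.restrict (Icc 0 T)) :=
  measurable_comp_nnreal (hC.B_meas.comp (f := fun t : ℝ≥0 => ((t, X t), k t))
    ((measurable_id.prodMk (hX.comp measurable_subtype_coe)).prodMk
      (hk.comp measurable_subtype_coe)))

theorem aesm_dB (hC : Coeffs S b B T K) {X χ k : ℝ → H} (hX : Measurable X) (hχ : Measurable χ)
    (hk : Measurable k) :
    AEStronglyMeasurable (fun r => fderiv ℝ (B r) (X r) (χ r) (k r))
      (volume.restrict (Icc 0 T)) :=
  measurable_comp_nnreal (hC.dB_meas.comp (f := fun t : ℝ≥0 => (((t, X t), χ t), k t))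
    (((measurable_id.prodMk (hX.comp measurable_subtype_coe)).prodMk
      (hχ.comp measurable_subtype_coe)).prodMk (hk.comp measurable_subtype_coe)))

/-- A bound for the solution of the linearized mild equation. -/
theorem norm_linMild_le (hC : Coeffs S b B T K) {X y χ : ℝ → H} (hχm : Measurable χ)
    (hχ : IsMildSol S (fun s d => fderiv ℝ (b s) (X s) d) 0 T y χ) {δ : ℝ}
    (hy : ∀ t ∈ Icc 0 T, ‖y t‖ ≤ δ) {t : ℝ} (ht : t ∈ Icc 0 T) :
    ‖χ t‖ ≤ δ * Real.exp (2 * K * T) := by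
  have h0 : IsMildSol S (fun s d => fderiv ℝ (b s) (X s) d) 0 T (fun _ => 0) (fun _ => 0) :=
    ⟨by simp, fun t _ => by simp⟩
  have := hC.mild_norm_sub_le (fun t ht x y => by
      rw [← map_sub]; exact (fderiv ℝ (b t) (X t)).le_of_opNorm_le (hC.db_norm ht _) _)
    hχ h0 (by simpa using hχm.aestronglyMeasurable) (δ := δ)
    ((norm_nonneg _).trans (hy t ht)) (ae_of_all _ fun t ht => by simpa using hy t ht) ht
    (by simpa using hy t ht)
  simpa using this

variable {f y χ : ℝ → H} {X : ℝ → ℝ → H}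

theorem norm_mild_sub_le (hC : Coeffs S b B T K) (hXm : ∀ n, Measurable (X n))
    (hX : ∀ n, IsMildSol S b 0 T (fun t => f t + n • y t) (X n)) {δ : ℝ}
    (hy : ∀ t ∈ Icc 0 T, ‖y t‖ ≤ δ) (n m : ℝ) {t : ℝ} (ht : t ∈ Icc 0 T) :
    ‖X n t - X m t‖ ≤ |n - m| * δ * Real.exp (2 * K * T) := by
  have hb : ∀ t ∈ Icc 0 T, ‖(f t + n • y t) - (f t + m • y t)‖ ≤ |n - m| * δ := by
    intro t ht
    rw [add_sub_add_left_eq_sub, ← sub_smul, norm_smul, Real.norm_eq_abs]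
    exact mul_le_mul_of_nonneg_left (hy t ht) (abs_nonneg _)
  have := hC.mild_norm_sub_le hC.b_lip (hX n) (hX m)
    ((hXm n).sub (hXm m)).aestronglyMeasurable
    (mul_nonneg (abs_nonneg _) ((norm_nonneg _).trans (hy t ht))) (ae_of_all _ hb) ht (hb t ht)
  simpa using this

/-- The solution is differentiable with respect to the size `n` of the perturbation `n • y` of the
inhomogeneity; the derivative solves the linearized equation. -/
theorem hasDerivAt_mildSol (hC : Coeffs S b B T K) (hXm : ∀ n, Measurable (X n))
    (hX : ∀ n, IsMildSol S b 0 T (fun t => f t + n • y t) (X n)) {δ : ℝ}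
    (hy : ∀ t ∈ Icc 0 T, ‖y t‖ ≤ δ) {n : ℝ} (hχm : Measurable χ)
    (hχ : IsMildSol S (fun s d => fderiv ℝ (b s) (X n s) d) 0 T y χ) {t : ℝ} (ht : t ∈ Icc 0 T) :
    HasDerivAt (fun m => X m t) (χ t) n := by
  have hT := hC.T_nonneg
  have hK := hC.K_nonneg
  set Cχ := δ * Real.exp (2 * K * T) with hCχ
  have hχb : ∀ t ∈ Icc 0 T, ‖χ t‖ ≤ Cχ := fun t ht => hC.norm_linMild_le hχm hχ hy ht
  have hCχ0 : 0 ≤ Cχ := (norm_nonneg _).trans (hχb t ht)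
  rw [hasDerivAt_iff_tendsto_slope_zero]
  -- `ψ ε` is the difference quotient of the drift; the difference quotient of the solution solves
  -- the equation with `ψ ε`, and `χ` does so up to the error `∫ ‖r ε s‖ ds`.
  let ψ : ℝ → ℝ → H → H := fun ε s d => ε⁻¹ • (b s (X n s + ε • d) - b s (X n s))
  let r : ℝ → ℝ → H := fun ε s => fderiv ℝ (b s) (X n s) (χ s) - ψ ε s (χ s)
  have hψ : ∀ ε ≠ 0, ∀ t ∈ Icc 0 T, ∀ x y, ‖ψ ε t x - ψ ε t y‖ ≤ K * ‖x - y‖ := by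
    intro ε hε t ht x y
    simp only [ψ]
    rw [← smul_sub, sub_sub_sub_cancel_right, norm_smul, norm_inv]
    have h1 := hC.b_lip t ht (X n t + ε • x) (X n t + ε • y)
    rw [add_sub_add_left_eq_sub, ← smul_sub, norm_smul] at h1
    have h2 : 0 < ‖ε‖ := norm_pos_iff.2 hε
    rw [inv_mul_le_iff₀ h2]
    linarith
  have hψ0 : ∀ ε ≠ 0, ∀ t ∈ Icc 0 T, ∀ d, ‖ψ ε t d‖ ≤ K * ‖d‖ := by
    intro ε hε t ht d
    have := hψ ε hε t ht d 0
    simpa [ψ] using this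
  have hrb : ∀ ε ≠ 0, ∀ s ∈ Icc 0 T, ‖r ε s‖ ≤ 2 * K * Cχ := by
    intro ε hε s hs
    have h1 := (fderiv ℝ (b s) (X n s)).le_of_opNorm_le (hC.db_norm hs _) (χ s)
    have h2 := hψ0 ε hε s hs (χ s)
    have h3 := mul_le_mul_of_nonneg_left (hχb s hs) hK
    exact (norm_sub_le _ _).trans (by linarith)
  have hψm : ∀ ε (d : ℝ → H), Measurable d →
      AEStronglyMeasurable (fun s => ψ ε s (d s)) (volume.restrict (Icc 0 T)) := fun ε d hd =>
    ((hC.aesm_b ((hXm n).add (hd.const_smul ε))).sub (hC.aesm_b (hXm n))).const_smul _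
  have hrm : ∀ ε, AEStronglyMeasurable (r ε) (volume.restrict (Icc 0 T)) := fun ε =>
    (hC.aesm_db (hXm n) hχm).sub (hψm ε χ hχm)
  have hbint : ∀ (g : ℝ → H) (C : ℝ), AEStronglyMeasurable g (volume.restrict (Icc 0 T)) →
      (∀ s ∈ Icc 0 T, ‖g s‖ ≤ C) → IntervalIntegrable g volume 0 T := by
    intro g C hg hgC
    refine (intervalIntegrable_const (μ := volume) (c := C)).mono_fun' ?_ ?_
    · rw [uIoc_of_le hT]; exact hg.mono_set Ioc_subset_Icc_self
    · rw [EventuallyLE, ae_restrict_iff' measurableSet_uIoc, uIoc_of_le hT]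
      exact ae_of_all _ fun s hs => hgC s ⟨hs.1.le, hs.2⟩
  have hri : ∀ ε ≠ 0, IntervalIntegrable (r ε) volume 0 T := fun ε hε =>
    hbint _ _ (hrm ε) (hrb ε hε)
  have hsub : ∀ {t}, t ∈ Icc 0 T → uIcc 0 t ⊆ uIcc 0 T := fun ht => by
    rw [uIcc_of_le ht.1, uIcc_of_le hT]; exact Icc_subset_Icc_right ht.2
  have hmain : ∀ ε ≠ 0, ‖ε⁻¹ • (X (n + ε) t - X n t) - χ t‖ ≤
      (∫ s in (0 : ℝ)..T, ‖r ε s‖) * Real.exp (2 * K * T) := by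
    intro ε hε
    have hq : IsMildSol S (ψ ε) 0 T y (fun t => ε⁻¹ • (X (n + ε) t - X n t)) := by
      have e1 : ∀ s, ψ ε s (ε⁻¹ • (X (n + ε) s - X n s)) =
          ε⁻¹ • (b s (X (n + ε) s) - b s (X n s)) := by
        intro s
        simp only [ψ]
        rw [smul_inv_smul₀ hε, add_sub_cancel]
      refine ⟨?_, fun t ht => ?_⟩
      · simp only [e1]
        exact ((hX (n + ε)).1.sub (hX n).1).smul ε⁻¹
      · simp only [e1]
        have i1 := hC.intervalIntegrable_S ht.1 ((hX (n + ε)).1.mono_set (hsub ht))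
        have i2 := hC.intervalIntegrable_S ht.1 ((hX n).1.mono_set (hsub ht))
        simp only [map_smul, map_sub]
        rw [intervalIntegral.integral_smul, intervalIntegral.integral_sub i1 i2,
          (hX (n + ε)).2 t ht, (hX n).2 t ht]
        have : f t + (n + ε) • y t + (∫ s in (0 : ℝ)..t, S (t - s) (b s (X (n + ε) s))) -
            (f t + n • y t + ∫ s in (0 : ℝ)..t, S (t - s) (b s (X n s))) =
            ε • y t + ((∫ s in (0 : ℝ)..t, S (t - s) (b s (X (n + ε) s))) -
              ∫ s in (0 : ℝ)..t, S (t - s) (b s (X n s))) := by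
          rw [add_smul]; abel
        rw [this, smul_add, inv_smul_smul₀ hε]
    have hχ' : IsMildSol S (ψ ε) 0 T
        (fun t => y t + ∫ s in (0 : ℝ)..t, S (t - s) (r ε s)) χ := by
      have i0 : IntervalIntegrable (fun s => ψ ε s (χ s)) volume 0 T := by
        have := hχ.1.sub (hri ε hε)
        simpa [r] using this
      refine ⟨i0, fun t ht => ?_⟩
      have i1 := hC.intervalIntegrable_S ht.1 (i0.mono_set (hsub ht))
      have i2 := hC.intervalIntegrable_S ht.1 ((hri ε hε).mono_set (hsub ht))
      rw [add_assoc, ← intervalIntegral.integral_add i2 i1, hχ.2 t ht]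
      congr 2
      ext s
      simp only [r, map_sub, sub_add_cancel]
    have hcc : ∀ t ∈ Icc 0 T, ‖y t - (y t + ∫ s in (0 : ℝ)..t, S (t - s) (r ε s))‖ ≤
        ∫ s in (0 : ℝ)..T, ‖r ε s‖ := by
      intro t ht
      rw [sub_add_cancel_left, norm_neg]
      refine (intervalIntegral.norm_integral_le_of_norm_le ht.1 (ae_of_all _ fun s hs =>
        hC.S_apply_le (by linarith [hs.2]) _) ((hri ε hε).norm.mono_set (hsub ht))).trans ?_
      exact intervalIntegral.integral_mono_interval le_rfl ht.1 ht.2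
        (ae_of_all _ fun s => norm_nonneg _) (hri ε hε).norm
    have := hC.mild_norm_sub_le (hψ ε hε) hq hχ'
      ((((hXm (n + ε)).sub (hXm n)).const_smul ε⁻¹).sub hχm).aestronglyMeasurable
      (intervalIntegral.integral_nonneg hT fun s _ => norm_nonneg _) (ae_of_all _ hcc) ht
      (hcc t ht)
    simpa using this
  have hr0 : Tendsto (fun ε => ∫ s in (0 : ℝ)..T, ‖r ε s‖) (𝓝[≠] 0) (𝓝 0) := by
    suffices h : Tendsto (fun ε => ∫ s in (0 : ℝ)..T, ‖r ε s‖) (𝓝[≠] 0)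
        (𝓝 (∫ _ in (0 : ℝ)..T, (0 : ℝ))) by simpa using h
    refine intervalIntegral.tendsto_integral_filter_of_dominated_convergence
      (fun _ => 2 * K * Cχ) ?_ ?_ intervalIntegrable_const ?_
    · refine Eventually.of_forall fun ε => ?_
      rw [uIoc_of_le hT]
      exact ((hrm ε).mono_set Ioc_subset_Icc_self).norm
    · filter_upwards [self_mem_nhdsWithin] with ε hε
      refine ae_of_all _ fun s hs => ?_
      rw [uIoc_of_le hT] at hs
      rw [norm_norm]
      exact hrb ε hε s ⟨hs.1.le, hs.2⟩
    · refine ae_of_all _ fun s hs => ?_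
      rw [uIoc_of_le hT] at hs
      have h1 := (hC.b_diff s hs.1.le (X n s)).hasFDerivAt.hasLineDerivAt (χ s)
      have h2 := hasDerivAt_iff_tendsto_slope_zero.1 h1
      simp only [zero_add, zero_smul, add_zero] at h2
      have h3 := (h2.const_sub (fderiv ℝ (b s) (X n s) (χ s))).norm
      simpa only [sub_self, norm_zero] using h3
  rw [tendsto_iff_norm_sub_tendsto_zero]
  refine squeeze_zero' (Eventually.of_forall fun _ => norm_nonneg _)
    (by filter_upwards [self_mem_nhdsWithin] with ε hε using hmain ε hε) ?_
  simpa using hr0.mul_const (Real.exp (2 * K * T))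

/-- The derivative of the backward linearized flow: if `k n` solves `k' = B(X n) k` with terminal
value `v`, then `⟨p_0, k_0⟩` is differentiable in `n`, with the derivative given by Duhamel's
formula; `p` is the solution of the adjoint equation. -/
theorem hasDerivAt_backward (hC : Coeffs S b B T K) (hXm : ∀ n, Measurable (X n))
    (hX : ∀ n, IsMildSol S b 0 T (fun t => f t + n • y t) (X n)) {δ : ℝ}
    (hy : ∀ t ∈ Icc 0 T, ‖y t‖ ≤ δ) {n : ℝ} (hχm : Measurable χ)
    (hχ : IsMildSol S (fun s d => fderiv ℝ (b s) (X n s) d) 0 T y χ)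
    {k : ℝ → ℝ → H} {v : H} (hkm : ∀ n, Measurable (k n)) (hkT : ∀ n, k n T = v)
    (hk : ∀ n, IsLinSol (fun r => B r (X n r)) 0 T (k n)) {p : ℝ → H} (hpm : Measurable p)
    (hp : IsLinSol (fun r => -ContinuousLinearMap.adjoint (B r (X n r))) 0 T p) :
    HasDerivAt (fun m => ⟪p 0, k m 0⟫_ℝ)
      (-∫ r in (0 : ℝ)..T, ⟪p r, fderiv ℝ (B r) (X n r) (χ r) (k n r)⟫_ℝ) n := by
  have hT := hC.T_nonneg
  have hK := hC.K_nonneg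
  have h0T : (0 : ℝ) ∈ Icc 0 T := ⟨le_rfl, hT⟩
  have hδ0 : 0 ≤ δ := (norm_nonneg _).trans (hy 0 h0T)
  set E := Real.exp (2 * K * T) with hE
  have hE0 : 0 < E := Real.exp_pos _
  have hkb : ∀ m, ∀ t ∈ Icc 0 T, ‖k m t‖ ≤ ‖v‖ * E := by
    intro m t ht
    have := (hk m).norm_le_right hK (fun r hr => hC.B_norm r hr _) ht
    rw [hkT] at this
    refine this.trans (mul_le_mul_of_nonneg_left (Real.exp_le_exp.2 ?_) (norm_nonneg _))
    nlinarith [ht.1]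
  have hpb : ∀ t ∈ Icc 0 T, ‖p t‖ ≤ ‖p 0‖ * E := by
    intro t ht
    have := hp.norm_le_left hK (fun r hr => by
      rw [norm_neg, ContinuousLinearMap.adjoint.norm_map]; exact hC.B_norm r hr _) ht
    refine this.trans (mul_le_mul_of_nonneg_left (Real.exp_le_exp.2 ?_) (norm_nonneg _))
    nlinarith [ht.2]
  -- the difference of the generators, applied to `k m`
  let g : ℝ → ℝ → H := fun m r => (B r (X m r) - B r (X n r)) (k m r)
  have hgb : ∀ m, ∀ r ∈ Icc 0 T, ‖g m r‖ ≤ K * (|m - n| * δ * E) * (‖v‖ * E) := by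
    intro m r hr
    refine (ContinuousLinearMap.le_opNorm _ _).trans ?_
    refine mul_le_mul ((hC.B_lip hr _ _).trans ?_) (hkb m r hr) (norm_nonneg _) (by positivity)
    exact mul_le_mul_of_nonneg_left (hC.norm_mild_sub_le hXm hX hy m n hr) hK
  have hgm : ∀ m, AEStronglyMeasurable (g m) (volume.restrict (Icc 0 T)) := fun m => by
    simpa [g] using! (hC.aesm_B (hXm m) (hkm m)).sub (hC.aesm_B (hXm n) (hkm m))
  have hgi : ∀ m, IntervalIntegrable (g m) volume 0 T := by
    intro m
    refine (intervalIntegrable_const (c := K * (|m - n| * δ * E) * (‖v‖ * E))).mono_fun' ?_ ?_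
    · rw [uIoc_of_le hT]; exact (hgm m).mono_set Ioc_subset_Icc_self
    · rw [EventuallyLE, ae_restrict_iff' measurableSet_uIoc, uIoc_of_le hT]
      exact ae_of_all _ fun s hs => hgb m s ⟨hs.1.le, hs.2⟩
  have hsub : ∀ {t}, t ∈ Icc 0 T → uIcc 0 t ⊆ uIcc 0 T := fun ht => by
    rw [uIcc_of_le ht.1, uIcc_of_le hT]; exact Icc_subset_Icc_right ht.2
  have hdγ : ∀ m r, B r (X m r) (k m r) - B r (X n r) (k n r) =
      B r (X n r) (k m r - k n r) + g m r := by
    intro m r; simp [g]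
  have hdint : ∀ m, IntervalIntegrable (fun r => B r (X n r) (k m r - k n r) + g m r)
      volume 0 T := fun m => by
    simpa only [hdγ] using (hk m).1.sub (hk n).1
  have hdeq : ∀ m, ∀ t ∈ Icc 0 T, k m t - k n t = (k m 0 - k n 0) +
      ∫ r in (0 : ℝ)..t, (B r (X n r) (k m r - k n r) + g m r) := by
    intro m t ht
    simp only [← hdγ]
    rw [intervalIntegral.integral_sub ((hk m).intervalIntegrable h0T ht)
      ((hk n).intervalIntegrable h0T ht), ← (hk m).sub_eq h0T ht, ← (hk n).sub_eq h0T ht]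
    abel
  have hpair : ∀ m, ⟪p 0, k m 0⟫_ℝ - ⟪p 0, k n 0⟫_ℝ = -∫ r in (0 : ℝ)..T, ⟪p r, g m r⟫_ℝ := by
    intro m
    have := inner_eq_add_integral hT hp.1 (hdint m) hp.2 (d := fun t => k m t - k n t)
      (hdeq m)
    simp only [hkT, sub_self, inner_zero_right, neg_apply, inner_neg_left,
      ContinuousLinearMap.adjoint_inner_left, inner_add_right, neg_add_cancel_left] at this
    rw [inner_sub_right] at this
    linarith
  have hkc : ∀ r ∈ Icc 0 T, Tendsto (fun m => k m r) (𝓝 n) (𝓝 (k n r)) := by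
    intro r hr
    have hbd : ∀ m, ‖k m r - k n r‖ ≤ (K * (|m - n| * δ * E) * (‖v‖ * E) * T) * E := by
      intro m
      have hε0 : 0 ≤ K * (|m - n| * δ * E) * (‖v‖ * E) * T := by positivity
      have hc1 : ContinuousOn (fun t => k m t - k n t) (Icc 0 T) :=
        (hk m).continuousOn.sub (hk n).continuousOn
      have hin : IntervalIntegrable (fun t => ‖k m t - k n t‖) volume 0 T :=
        (hc1.norm.mono (by rw [uIcc_of_le hT])).intervalIntegrable
      obtain ⟨M, hM⟩ := isCompact_Icc.exists_bound_of_continuousOn hc1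
      have hineq : ∀ t ∈ Icc 0 T, ‖k m t - k n t‖ ≤
          K * (|m - n| * δ * E) * (‖v‖ * E) * T + K * ∫ s in t..T, ‖k m s - k n s‖ := by
        intro t ht
        have hTT : T ∈ Icc 0 T := ⟨hT, le_rfl⟩
        have e1 : k m t - k n t = -∫ r in t..T, (B r (X n r) (k m r - k n r) + g m r) := by
          have h1 := hdeq m T hTT
          have h2 := hdeq m t ht
          rw [hkT, hkT, sub_self] at h1
          rw [← intervalIntegral.integral_interval_sub_left (hdint m)
            ((hdint m).mono_set (hsub ht)), h2]
          rw [eq_comm, add_comm, add_eq_zero_iff_eq_neg] at h1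
          rw [h1]; abel
        rw [e1, norm_neg]
        have hcb : ∀ s ∈ Ioc t T, ‖B s (X n s) (k m s - k n s) + g m s‖ ≤
            K * ‖k m s - k n s‖ + K * (|m - n| * δ * E) * (‖v‖ * E) := by
          intro s hs
          have hs' : s ∈ Icc 0 T := ⟨ht.1.trans hs.1.le, hs.2⟩
          exact (norm_add_le _ _).trans (add_le_add
            ((B s (X n s)).le_of_opNorm_le (hC.B_norm s hs' _) _) (hgb m s hs'))
        have hi1 : IntervalIntegrable (fun s => K * ‖k m s - k n s‖) volume t T :=
          (hin.mono_set (by rw [uIcc_of_le ht.2, uIcc_of_le hT]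
                            exact Icc_subset_Icc_left ht.1)).const_mul K
        refine (intervalIntegral.norm_integral_le_of_norm_le ht.2 (ae_of_all _ hcb)
          (hi1.add intervalIntegrable_const)).trans ?_
        rw [intervalIntegral.integral_add hi1 intervalIntegrable_const,
          intervalIntegral.integral_const_mul, intervalIntegral.integral_const, smul_eq_mul,
          add_comm]
        refine add_le_add_left ?_ _
        rw [mul_comm]
        exact mul_le_mul_of_nonneg_left (by linarith [ht.1]) (by positivity)
      refine (hineq r hr).trans ((gronwall_integral_backward hK hε0 hin (ae_of_all _ hM)
        (ae_of_all _ hineq) hr).trans ?_)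
      refine mul_le_mul_of_nonneg_left (Real.exp_le_exp.2 ?_) hε0
      nlinarith [hr.1]
    rw [tendsto_iff_norm_sub_tendsto_zero]
    refine squeeze_zero (fun _ => norm_nonneg _) hbd ?_
    have : Tendsto (fun m => |m - n|) (𝓝 n) (𝓝 0) := by
      have : Continuous fun m : ℝ => |m - n| := by fun_prop
      simpa using this.tendsto n
    simpa using ((((((this.mul_const δ).mul_const E).const_mul K).mul_const
      (‖v‖ * E)).mul_const T).mul_const E)
  rw [hasDerivAt_iff_tendsto_slope]
  have hslope : ∀ m, slope (fun m => ⟪p 0, k m 0⟫_ℝ) n m =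
      -∫ r in (0 : ℝ)..T, ⟪p r, (m - n)⁻¹ • g m r⟫_ℝ := by
    intro m
    rw [slope_def_module, hpair, smul_eq_mul, mul_neg, ← intervalIntegral.integral_const_mul]
    simp only [inner_smul_right]
  refine Tendsto.congr (fun m => (hslope m).symm) (Tendsto.neg ?_)
  refine intervalIntegral.tendsto_integral_filter_of_dominated_convergence
    (fun _ => (‖p 0‖ * E) * (K * (δ * E) * (‖v‖ * E))) ?_ ?_ intervalIntegrable_const ?_
  · refine Eventually.of_forall fun m => ?_
    rw [uIoc_of_le hT]
    exact hpm.aestronglyMeasurable.inner (((hgm m).mono_set Ioc_subset_Icc_self).const_smul _)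
  · filter_upwards [self_mem_nhdsWithin] with m hm
    refine ae_of_all _ fun r hr => ?_
    rw [uIoc_of_le hT] at hr
    have hr' : r ∈ Icc 0 T := ⟨hr.1.le, hr.2⟩
    refine (norm_inner_le_norm _ _).trans ?_
    refine mul_le_mul (hpb r hr') ?_ (norm_nonneg _) (by positivity)
    have hmn : 0 < |m - n| := abs_pos.2 (sub_ne_zero.2 hm)
    rw [norm_smul, norm_inv, Real.norm_eq_abs, inv_mul_le_iff₀ hmn]
    exact (hgb m r hr').trans (le_of_eq (by ring))
  · refine ae_of_all _ fun r hr => ?_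
    rw [uIoc_of_le hT] at hr
    have hr' : r ∈ Icc 0 T := ⟨hr.1.le, hr.2⟩
    have h1 : HasDerivAt (fun m => B r (X m r)) (fderiv ℝ (B r) (X n r) (χ r)) n :=
      (hC.B_diff r hr'.1 (X n r)).hasFDerivAt.comp_hasDerivAt n
        (hC.hasDerivAt_mildSol hXm hX hy hχm hχ hr')
    have h2 := hasDerivAt_iff_tendsto_slope.1 h1
    have h3 : Tendsto (fun m => slope (fun m => B r (X m r)) n m (k m r)) (𝓝[≠] n)
        (𝓝 (fderiv ℝ (B r) (X n r) (χ r) (k n r))) :=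
      (isBoundedBilinearMap_apply.continuous.tendsto _).comp
        (h2.prodMk_nhds ((hkc r hr').mono_left nhdsWithin_le_nhds))
    refine (tendsto_const_nhds.inner h3).congr fun m => ?_
    rw [slope_def_module, smul_apply]

end Coeffs

end Variation

/-! ### Independence properties of the noise -/

section Noise

/-- If `m₁` and `m₂` are independent and `mV` is independent of a σ-algebra that contains both, then
`m₁` together with `mV` is independent of `m₂`. -/
theorem indep_sup_left_of_indep {Ω : Type*} {m₁ m₂ mV mW m₀ : MeasurableSpace Ω} {P : Measure[m₀] Ω}
    [IsProbabilityMeasure P] (h₁₂ : Indep m₁ m₂ P) (h : Indep mW mV P) (h₁ : m₁ ≤ mW)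
    (h₂ : m₂ ≤ mW) (hW : mW ≤ m₀) (hV : mV ≤ m₀) : Indep (m₁ ⊔ mV) m₂ P := by
  let p₁ : Set (Set Ω) := {C | ∃ A B, MeasurableSet[m₁] A ∧ MeasurableSet[mV] B ∧ C = A ∩ B}
  have hp₁ : IsPiSystem p₁ := by
    rintro _ ⟨A, B, hA, hB, rfl⟩ _ ⟨A', B', hA', hB', rfl⟩ -
    exact ⟨A ∩ A', B ∩ B', hA.inter hA', hB.inter hB', inter_inter_inter_comm _ _ _ _⟩
  have hgen : m₁ ⊔ mV = MeasurableSpace.generateFrom p₁ := by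
    apply le_antisymm
    · refine sup_le (fun A hA => ?_) fun B hB => ?_
      · exact MeasurableSpace.measurableSet_generateFrom
          ⟨A, univ, hA, MeasurableSet.univ, (inter_univ A).symm⟩
      · exact MeasurableSpace.measurableSet_generateFrom
          ⟨univ, B, MeasurableSet.univ, hB, (univ_inter B).symm⟩
    · refine MeasurableSpace.generateFrom_le ?_
      rintro _ ⟨A, B, hA, hB, rfl⟩
      exact MeasurableSet.inter ((le_sup_left : m₁ ≤ m₁ ⊔ mV) A hA)
        ((le_sup_right : mV ≤ m₁ ⊔ mV) B hB)
  refine IndepSets.indep (p1 := p₁) (p2 := {s | MeasurableSet[m₂] s})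
    (sup_le (h₁.trans hW) hV) (h₂.trans hW) hp₁ (@MeasurableSpace.isPiSystem_measurableSet Ω m₂)
    hgen (@MeasurableSpace.generateFrom_measurableSet Ω m₂).symm ?_
  rw [IndepSets_iff]
  rintro _ D ⟨A, B, hA, hB, rfl⟩ hD
  have e1 := (Indep_iff _ _ _).1 h (A ∩ D) B (MeasurableSet.inter (h₁ A hA) (h₂ D hD)) hB
  have e2 := (Indep_iff _ _ _).1 h A B (h₁ A hA) hB
  have e3 := (Indep_iff _ _ _).1 h₁₂ A D hA hD
  rw [inter_right_comm, e1, e3, e2]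
  ring

variable {Ω H : Type*} [NormedAddCommGroup H] [InnerProductSpace ℝ H] [MeasurableSpace H]
  [mΩ : MeasurableSpace Ω] {P : Measure Ω} {W : ℝ≥0 → H → Ω → ℝ} {V : ℝ → Ω → H}

theorem sigmaV_le (hV : ∀ t, 0 ≤ t → Measurable (V t)) : sigmaV V ≤ mΩ :=
  iSup₂_le fun t ht => (hV t ht).comap_le

theorem history_le (hW : ∀ t u, Measurable (W t u)) (hV : ∀ t, 0 ≤ t → Measurable (V t))
    (ℓ : StieltjesFunction ℝ) (t : ℝ) : history W V ℓ t ≤ mΩ :=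
  sup_le (iSup₂_le fun r _ => iSup_le fun u => (hW r u).comap_le) (sigmaV_le hV)

theorem history_mono (ℓ : StieltjesFunction ℝ) {s t : ℝ} (hst : s ≤ t) :
    history W V ℓ s ≤ history W V ℓ t :=
  sup_le_sup_right (iSup₂_le fun r hr => le_iSup₂_of_le (f := fun (r : ℝ≥0)
    (_ : r ≤ (ℓ t).toNNReal) => ⨆ u : H, MeasurableSpace.comap (W r u) inferInstance) r
    (hr.trans (Real.toNNReal_le_toNNReal (ℓ.mono hst))) le_rfl) _

theorem measurable_history_W (ℓ : StieltjesFunction ℝ) {s t : ℝ} (hst : s ≤ t) (u : H) :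
    Measurable[history W V ℓ t] (W (ℓ s).toNNReal u) := by
  rw [measurable_iff_comap_le]
  exact le_sup_of_le_left (le_iSup₂_of_le (f := fun (r : ℝ≥0)
    (_ : r ≤ (ℓ t).toNNReal) => ⨆ u : H, MeasurableSpace.comap (W r u) inferInstance) _
    (Real.toNNReal_le_toNNReal (ℓ.mono hst)) (le_iSup (fun u : H =>
      MeasurableSpace.comap (W (ℓ s).toNNReal u) inferInstance) u))

theorem measurable_sigmaV {t : ℝ} (ht : 0 ≤ t) : Measurable[sigmaV V] (V t) := by
  rw [measurable_iff_comap_le]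
  exact le_iSup₂_of_le (f := fun (t : ℝ) (_ : 0 ≤ t) =>
    MeasurableSpace.comap (V t) inferInstance) t ht le_rfl

theorem comap_pi_eq_iSup {γ : Type*} (φ : γ → Ω → ℝ) :
    MeasurableSpace.comap (fun ω c => φ c ω) MeasurableSpace.pi =
      ⨆ c, MeasurableSpace.comap (φ c) inferInstance := by
  rw [MeasurableSpace.pi, MeasurableSpace.comap_iSup]
  simp only [MeasurableSpace.comap_comp, Function.comp_def]

/-- The real linear span of the noise variables `W_t u`. -/
def noiseSpan (W : ℝ≥0 → H → Ω → ℝ) : Submodule ℝ (Ω → ℝ) :=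
  Submodule.span ℝ (range fun p : ℝ≥0 × H => W p.1 p.2)

theorem mem_noiseSpan (t : ℝ≥0) (u : H) : W t u ∈ noiseSpan W :=
  Submodule.subset_span ⟨(t, u), rfl⟩

theorem measurable_of_mem_noiseSpan {f : Ω → ℝ} (hf : f ∈ noiseSpan W) :
    Measurable[sigmaW W] f := by
  induction hf using Submodule.span_induction with
  | mem x hx =>
    obtain ⟨p, rfl⟩ := hx
    rw [measurable_iff_comap_le]
    exact le_iSup₂_of_le (f := fun (t : ℝ≥0) (u : H) =>
      MeasurableSpace.comap (W t u) inferInstance) p.1 p.2 le_rfl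
  | zero => exact measurable_const
  | add x y _ _ hx hy => exact hx.add hy
  | smul a x _ hx => exact hx.const_smul a

namespace IsCylindricalBrownian

theorem sigmaW_le (hW : IsCylindricalBrownian W P) : sigmaW W ≤ mΩ :=
  iSup₂_le fun t u => (hW.measurable t u).comap_le

theorem memLp (hW : IsCylindricalBrownian W P) (t : ℝ≥0) (u : H) : MemLp (W t u) 2 P :=
  (hW.isGaussian.hasGaussianLaw_eval (t, u)).memLp_two

theorem integrable_mul (hW : IsCylindricalBrownian W P) (s t : ℝ≥0) (u v : H) :
    Integrable (fun ω => W s u ω * W t v ω) P :=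
  (hW.memLp s u).integrable_mul (hW.memLp t v)

theorem memLp_span (hW : IsCylindricalBrownian W P) {f : Ω → ℝ} (hf : f ∈ noiseSpan W) :
    MemLp f 2 P := by
  induction hf using Submodule.span_induction with
  | mem x hx => obtain ⟨p, rfl⟩ := hx; exact hW.memLp _ _
  | zero => exact MemLp.zero
  | add x y _ _ hx hy => exact hx.add hy
  | smul a x _ hx => exact hx.const_smul a

theorem integral_span [IsProbabilityMeasure P] (hW : IsCylindricalBrownian W P) {f : Ω → ℝ}
    (hf : f ∈ noiseSpan W) : ∫ ω, f ω ∂P = 0 := by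
  induction hf using Submodule.span_induction with
  | mem x hx => obtain ⟨p, rfl⟩ := hx; exact hW.mean _ _
  | zero => simp
  | add x y hx' hy' hx hy =>
    simp only [Pi.add_apply]
    rw [integral_add ((hW.memLp_span hx').integrable (by norm_num))
      ((hW.memLp_span hy').integrable (by norm_num)), hx, hy, add_zero]
  | smul a x _ hx =>
    simp only [Pi.smul_apply, smul_eq_mul]
    rw [integral_const_mul, hx, mul_zero]

theorem isGaussianProcess_span (hW : IsCylindricalBrownian W P) {α : Type*} {f : α → Ω → ℝ}
    (hf : ∀ a, f a ∈ noiseSpan W) : IsGaussianProcess f P := by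
  refine hW.isGaussian.of_isGaussianProcess fun a => ?_
  obtain ⟨c, hc⟩ := Finsupp.mem_span_range_iff_exists_finsupp.1 (hf a)
  refine ⟨c.support, ∑ i : c.support, c i • ContinuousLinearMap.proj (R := ℝ) i, fun ω => ?_⟩
  rw [← hc, Finsupp.sum, Finset.sum_apply]
  simp only [sum_apply, Pi.smul_apply]
  rw [← Finset.sum_coe_sort]
  rfl

/-- Uncorrelated families of noise variables are independent, also jointly with an independent
process. -/
theorem indep_span [IsProbabilityMeasure P] (hW : IsCylindricalBrownian W P)
    (hV : ∀ t, 0 ≤ t → Measurable (V t)) (hWV : Indep (sigmaW W) (sigmaV V) P)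
    {α β : Type*} {f : α → Ω → ℝ} {g : β → Ω → ℝ}
    (hf : ∀ a, f a ∈ noiseSpan W) (hg : ∀ b, g b ∈ noiseSpan W)
    (h : ∀ a b, ∫ ω, f a ω * g b ω ∂P = 0) :
    Indep ((⨆ a, MeasurableSpace.comap (f a) inferInstance) ⊔ sigmaV V)
      (⨆ b, MeasurableSpace.comap (g b) inferInstance) P := by
  have hfg : IsGaussianProcess (Sum.elim f g) P :=
    hW.isGaussianProcess_span (by rintro (a | b); exacts [hf a, hg b])
  have hind := hfg.indepFun_of_covariance_eq_zero
    (fun a => (hW.memLp_span (hf a)).aestronglyMeasurable.aemeasurable)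
    (fun b => (hW.memLp_span (hg b)).aestronglyMeasurable.aemeasurable) (fun a b => by
      rw [covariance_eq_sub (hW.memLp_span (hf a)) (hW.memLp_span (hg b))]
      simp [h a b, hW.integral_span (hf a)])
  have hind' : Indep (⨆ a, MeasurableSpace.comap (f a) inferInstance)
      (⨆ b, MeasurableSpace.comap (g b) inferInstance) P := by
    have := (IndepFun_iff_Indep _ _ _).1 hind
    rwa [comap_pi_eq_iSup, comap_pi_eq_iSup] at this
  refine indep_sup_left_of_indep hind' hWV (iSup_le fun a => ?_) (iSup_le fun b => ?_)
    hW.sigmaW_le (sigmaV_le hV)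
  · exact (measurable_of_mem_noiseSpan (hf a)).comap_le
  · exact (measurable_of_mem_noiseSpan (hg b)).comap_le

theorem integral_incr_mul [IsProbabilityMeasure P] (hW : IsCylindricalBrownian W P)
    (s t s' t' : ℝ≥0) (u u' : H) :
    ∫ ω, (W t u ω - W s u ω) * (W t' u' ω - W s' u' ω) ∂P =
      ((min t t' : ℝ≥0) - (min t s' : ℝ≥0) - (min s t' : ℝ≥0) + (min s s' : ℝ≥0)) *
        ⟪u, u'⟫_ℝ := by
  have hi : ∀ s t t' u v, Integrable
      (fun ω => W s u ω * W t v ω - W s u ω * W t' v ω) P := fun s t t' u v =>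
    (hW.integrable_mul _ _ _ _).sub (hW.integrable_mul _ _ _ _)
  have : ∀ ω, (W t u ω - W s u ω) * (W t' u' ω - W s' u' ω) =
      (W t u ω * W t' u' ω - W t u ω * W s' u' ω) -
        (W s u ω * W t' u' ω - W s u ω * W s' u' ω) := fun ω => by ring
  simp_rw [this]
  rw [integral_sub (hi _ _ _ _ _) (hi _ _ _ _ _),
    integral_sub (hW.integrable_mul _ _ _ _) (hW.integrable_mul _ _ _ _),
    integral_sub (hW.integrable_mul _ _ _ _) (hW.integrable_mul _ _ _ _),
    hW.cov, hW.cov, hW.cov, hW.cov]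
  ring

/-- The increments of the time-changed noise after time `a` are independent of the history up to
time `a`. -/
theorem indep_history [IsProbabilityMeasure P] (hW : IsCylindricalBrownian W P)
    (hV : ∀ t, 0 ≤ t → Measurable (V t)) (hWV : Indep (sigmaW W) (sigmaV V) P)
    (ℓ : StieltjesFunction ℝ) (a : ℝ) :
    Indep (history W V ℓ a) (⨆ q : {r : ℝ≥0 // (ℓ a).toNNReal ≤ r} × H,
      MeasurableSpace.comap (fun ω => W q.1 q.2 ω - W (ℓ a).toNNReal q.2 ω) inferInstance) P := by
  have h := hW.indep_span hV hWV (α := {r : ℝ≥0 // r ≤ (ℓ a).toNNReal} × H)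
    (β := {r : ℝ≥0 // (ℓ a).toNNReal ≤ r} × H)
    (f := fun q => W q.1 q.2) (g := fun q ω => W q.1 q.2 ω - W (ℓ a).toNNReal q.2 ω)
    (fun q => mem_noiseSpan _ _)
    (fun q => (noiseSpan W).sub_mem (mem_noiseSpan _ _) (mem_noiseSpan _ _)) ?_
  · refine indep_of_indep_of_le_left h (sup_le_sup_right ?_ _)
    refine iSup₂_le fun r hr => iSup_le fun u => ?_
    exact le_iSup (fun q : {r : ℝ≥0 // r ≤ (ℓ a).toNNReal} × H =>
      MeasurableSpace.comap (W q.1 q.2) inferInstance) (⟨r, hr⟩, u)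
  · rintro ⟨⟨r, hr⟩, u⟩ ⟨⟨t, ht⟩, v⟩
    simp only [mul_sub]
    rw [integral_sub (hW.integrable_mul _ _ _ _) (hW.integrable_mul _ _ _ _), hW.cov, hW.cov,
      min_eq_left (hr.trans ht), min_eq_left hr, sub_self]

end IsCylindricalBrownian

end Noise

/-! ### Itô's isometry -/

section Isometry

variable {Ω H : Type*} [NormedAddCommGroup H] [InnerProductSpace ℝ H] [MeasurableSpace H]
  [mΩ : MeasurableSpace Ω] {P : Measure Ω} [IsProbabilityMeasure P] {W : ℝ≥0 → H → Ω → ℝ}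
  {V : ℝ → Ω → H} {ℓ : StieltjesFunction ℝ} {T : ℝ}

/-- The martingale property of the noise. -/
theorem integral_history_mul_incr (hW : IsCylindricalBrownian W P)
    (hV : ∀ t, 0 ≤ t → Measurable (V t)) (hWV : Indep (sigmaW W) (sigmaV V) P) {a c : ℝ}
    (hac : a ≤ c) {η : Ω → ℝ} (hη : Measurable[history W V ℓ a] η) (u : H) :
    ∫ ω, η ω * (W (ℓ c).toNNReal u ω - W (ℓ a).toNNReal u ω) ∂P = 0 := by
  have hind : IndepFun η (fun ω => W (ℓ c).toNNReal u ω - W (ℓ a).toNNReal u ω) P := by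
    rw [IndepFun_iff_Indep]
    refine indep_of_indep_of_le_left (indep_of_indep_of_le_right
      (hW.indep_history hV hWV ℓ a) ?_) hη.comap_le
    exact le_iSup (fun q : {r : ℝ≥0 // (ℓ a).toNNReal ≤ r} × H =>
      MeasurableSpace.comap (fun ω => W q.1 q.2 ω - W (ℓ a).toNNReal q.2 ω) inferInstance)
      (⟨_, Real.toNNReal_le_toNNReal (ℓ.mono hac)⟩, u)
  rw [hind.integral_fun_mul_eq_mul_integral
    (hη.mono (history_le hW.measurable hV ℓ a) le_rfl).aestronglyMeasurable
    ((hW.measurable _ _).sub (hW.measurable _ _)).aestronglyMeasurable,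
    hW.integral_span (f := fun ω => W (ℓ c).toNNReal u ω - W (ℓ a).toNNReal u ω)
      ((noiseSpan W).sub_mem (mem_noiseSpan _ _) (mem_noiseSpan _ _)), mul_zero]

/-- The martingale property of products of increments, compensated by their covariance. -/
theorem integral_history_mul_incr_mul_incr (hW : IsCylindricalBrownian W P)
    (hV : ∀ t, 0 ≤ t → Measurable (V t)) (hWV : Indep (sigmaW W) (sigmaV V) P) {a c c' : ℝ}
    (hac : a ≤ c) (hac' : a ≤ c') (ha : 0 ≤ ℓ a) {η : Ω → ℝ}
    (hη : Measurable[history W V ℓ a] η) (u u' : H) :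
    ∫ ω, η ω * ((W (ℓ c).toNNReal u ω - W (ℓ a).toNNReal u ω) *
      (W (ℓ c').toNNReal u' ω - W (ℓ a).toNNReal u' ω)) ∂P =
      (∫ ω, η ω ∂P) * ((ℓ (min c c') - ℓ a) * ⟪u, u'⟫_ℝ) := by
  have hle : ∀ {c : ℝ}, a ≤ c → (ℓ a).toNNReal ≤ (ℓ c).toNNReal := fun h =>
    Real.toNNReal_le_toNNReal (ℓ.mono h)
  have hsub : ∀ {c : ℝ}, a ≤ c → ∀ u : H, Measurable[⨆ q : {r : ℝ≥0 // (ℓ a).toNNReal ≤ r} × H,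
      MeasurableSpace.comap (fun ω => W q.1 q.2 ω - W (ℓ a).toNNReal q.2 ω) inferInstance]
      (fun ω => W (ℓ c).toNNReal u ω - W (ℓ a).toNNReal u ω) := by
    intro c hc u
    rw [measurable_iff_comap_le]
    exact le_iSup (fun q : {r : ℝ≥0 // (ℓ a).toNNReal ≤ r} × H =>
      MeasurableSpace.comap (fun ω => W q.1 q.2 ω - W (ℓ a).toNNReal q.2 ω) inferInstance)
      (⟨_, hle hc⟩, u)
  have hind : IndepFun η (fun ω => (W (ℓ c).toNNReal u ω - W (ℓ a).toNNReal u ω) *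
      (W (ℓ c').toNNReal u' ω - W (ℓ a).toNNReal u' ω)) P := by
    rw [IndepFun_iff_Indep]
    refine indep_of_indep_of_le_left (indep_of_indep_of_le_right
      (hW.indep_history hV hWV ℓ a) ?_) hη.comap_le
    exact ((hsub hac u).mul (hsub hac' u')).comap_le
  rw [hind.integral_fun_mul_eq_mul_integral
    (hη.mono (history_le hW.measurable hV ℓ a) le_rfl).aestronglyMeasurable
    (((hW.measurable _ _).sub (hW.measurable _ _)).mul
      ((hW.measurable _ _).sub (hW.measurable _ _))).aestronglyMeasurable,
    hW.integral_incr_mul]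
  congr 2
  have h1 : min (ℓ c).toNNReal (ℓ c').toNNReal = (ℓ (min c c')).toNNReal := by
    rw [ℓ.mono.map_min, Real.toNNReal_monotone.map_min]
  rw [h1, min_eq_right (hle hac), min_eq_left (hle hac'), min_self, Real.coe_toNNReal _ ha,
    Real.coe_toNNReal _ (ha.trans (ℓ.mono (le_min hac hac')))]
  ring

/-- Itô's isometry for two elementary integrands, each with a single interval. -/
theorem integral_elementary_mul (hW : IsCylindricalBrownian W P)
    (hV : ∀ t, 0 ≤ t → Measurable (V t)) (hWV : Indep (sigmaW W) (sigmaV V) P) {a c a' c' : ℝ}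
    (hac' : a' ≤ c') (haa' : a ≤ a') (ha' : 0 ≤ ℓ a') {ξ ξ' : Ω → ℝ}
    (hξ : Measurable[history W V ℓ a] ξ) (hξ' : Measurable[history W V ℓ a'] ξ') {C : ℝ}
    (hξC : ∀ ω, |ξ ω| ≤ C) (hξC' : ∀ ω, |ξ' ω| ≤ C) (u u' : H) :
    ∫ ω, (ξ ω * (W (ℓ c).toNNReal u ω - W (ℓ a).toNNReal u ω)) *
      (ξ' ω * (W (ℓ c').toNNReal u' ω - W (ℓ a').toNNReal u' ω)) ∂P =
      ℓ.measure.real (Ioc a c ∩ Ioc a' c') * ((∫ ω, ξ ω * ξ' ω ∂P) * ⟪u, u'⟫_ℝ) := by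
  have hξ1 : Measurable[history W V ℓ a'] ξ := hξ.mono (history_mono ℓ haa') le_rfl
  have hset : Ioc a c ∩ Ioc a' c' = Ioc a' (min c c') := by
    rw [Ioc_inter_Ioc, max_eq_right haa']
  rw [hset, measureReal_def, ℓ.measure_Ioc]
  rcases le_or_gt c a' with hca | hca
  · rw [ENNReal.toReal_ofReal', max_eq_right, zero_mul]
    swap
    · rw [sub_nonpos]; exact ℓ.mono ((min_le_left _ _).trans hca)
    have : ∀ ω, (ξ ω * (W (ℓ c).toNNReal u ω - W (ℓ a).toNNReal u ω)) *
        (ξ' ω * (W (ℓ c').toNNReal u' ω - W (ℓ a').toNNReal u' ω)) =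
        (ξ ω * (W (ℓ c).toNNReal u ω - W (ℓ a).toNNReal u ω) * ξ' ω) *
        (W (ℓ c').toNNReal u' ω - W (ℓ a').toNNReal u' ω) := fun ω => by ring
    simp_rw [this]
    refine integral_history_mul_incr hW hV hWV hac' ?_ u'
    exact (hξ1.mul ((measurable_history_W ℓ hca u).sub
      (measurable_history_W ℓ haa' u))).mul hξ'
  · rw [ENNReal.toReal_ofReal (sub_nonneg.2 (ℓ.mono (le_min hca.le hac')))]
    have hsplit : ∀ ω, (ξ ω * (W (ℓ c).toNNReal u ω - W (ℓ a).toNNReal u ω)) *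
        (ξ' ω * (W (ℓ c').toNNReal u' ω - W (ℓ a').toNNReal u' ω)) =
        (ξ ω * (W (ℓ a').toNNReal u ω - W (ℓ a).toNNReal u ω) * ξ' ω) *
          (W (ℓ c').toNNReal u' ω - W (ℓ a').toNNReal u' ω) +
        (ξ ω * ξ' ω) * ((W (ℓ c).toNNReal u ω - W (ℓ a').toNNReal u ω) *
          (W (ℓ c').toNNReal u' ω - W (ℓ a').toNNReal u' ω)) := fun ω => by ring
    simp_rw [hsplit]
    have hm : AEStronglyMeasurable (fun ω => ξ ω * ξ' ω) P :=
      ((hξ1.mul hξ').mono (history_le hW.measurable hV ℓ a') le_rfl).aestronglyMeasurable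
    have hb : ∀ ω, ‖ξ ω * ξ' ω‖ ≤ C * C := fun ω => by
      rw [norm_mul]
      exact mul_le_mul (hξC ω) (hξC' ω) (abs_nonneg _) ((abs_nonneg _).trans (hξC ω))
    have hincr : ∀ s t (v : H), MemLp (fun ω => W t v ω - W s v ω) 2 P := fun s t v =>
      (hW.memLp t v).sub (hW.memLp s v)
    have i1 : Integrable (fun ω => (ξ ω * (W (ℓ a').toNNReal u ω - W (ℓ a).toNNReal u ω) * ξ' ω) *
          (W (ℓ c').toNNReal u' ω - W (ℓ a').toNNReal u' ω)) P := by
      refine (((hincr (ℓ a).toNNReal (ℓ a').toNNReal u).integrable_mul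
        (hincr (ℓ a').toNNReal (ℓ c').toNNReal u')).bdd_mul hm (ae_of_all _ hb)).congr
        (ae_of_all _ fun ω => ?_)
      simp only [Pi.mul_apply]; ring
    have i2 : Integrable (fun ω => (ξ ω * ξ' ω) *
        ((W (ℓ c).toNNReal u ω - W (ℓ a').toNNReal u ω) *
          (W (ℓ c').toNNReal u' ω - W (ℓ a').toNNReal u' ω))) P :=
      ((hincr (ℓ a').toNNReal (ℓ c).toNNReal u).integrable_mul
        (hincr (ℓ a').toNNReal (ℓ c').toNNReal u')).bdd_mul hm (ae_of_all _ hb)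
    rw [integral_add i1 i2, integral_history_mul_incr hW hV hWV hac' ?_ u',
      integral_history_mul_incr_mul_incr hW hV hWV hca.le hac' ha'
        (η := fun ω => ξ ω * ξ' ω) (hξ1.mul hξ')]
    · ring
    · exact (hξ1.mul ((measurable_history_W ℓ le_rfl u).sub
        (measurable_history_W ℓ haa' u))).mul hξ'

namespace SimpleIntegrand

variable (Φ Ψ : SimpleIntegrand H (history W V ℓ) T)

theorem exists_bound : ∃ C : ℝ, 0 ≤ C ∧ ∀ j ω, |Φ.coef j ω| ≤ C := by
  obtain ⟨C, hC⟩ := Φ.bounded_coef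
  exact ⟨max C 0, le_max_right _ _, fun j ω => (hC j ω).trans (le_max_left _ _)⟩

theorem measurable_coef' (hW : IsCylindricalBrownian W P) (hV : ∀ t, 0 ≤ t → Measurable (V t))
    (j : Fin Φ.n) : Measurable (Φ.coef j) :=
  (Φ.measurable_coef j).mono (history_le hW.measurable hV ℓ _) le_rfl

theorem val_eq (t : ℝ) (ω : Ω) : Φ.val t ω =
    ∑ j, ((Ioc (Φ.left j) (Φ.right j)).indicator (fun _ => (1 : ℝ)) t * Φ.coef j ω) • Φ.dir j := by
  unfold val
  refine Finset.sum_congr rfl fun j _ => ?_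
  by_cases h : t ∈ Ioc (Φ.left j) (Φ.right j) <;> simp [h]

theorem memLp_stochInt (hW : IsCylindricalBrownian W P) (hV : ∀ t, 0 ≤ t → Measurable (V t)) :
    MemLp (Φ.stochInt W ℓ) 2 P := by
  obtain ⟨C, -, hC⟩ := Φ.exists_bound
  unfold stochInt
  refine memLp_finsetSum _ fun j _ => ?_
  refine MemLp.of_le_mul (c := C) ((hW.memLp (ℓ (Φ.right j)).toNNReal (Φ.dir j)).sub
    (hW.memLp (ℓ (Φ.left j)).toNNReal (Φ.dir j))) ?_ (ae_of_all _ fun ω => ?_)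
  · exact ((Φ.measurable_coef' hW hV j).mul
      ((hW.measurable _ _).sub (hW.measurable _ _))).aestronglyMeasurable
  · rw [norm_mul]
    exact mul_le_mul_of_nonneg_right (hC j ω) (norm_nonneg _)

variable [BorelSpace H] [SecondCountableTopology H]

theorem measurable_val (hW : IsCylindricalBrownian W P) (hV : ∀ t, 0 ≤ t → Measurable (V t)) :
    Measurable (fun p : ℝ × Ω => Φ.val p.1 p.2) := by
  simp_rw [val_eq]
  refine Finset.measurable_sum _ fun j _ => ?_
  exact (((measurable_const.indicator measurableSet_Ioc).comp measurable_fst).mul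
    ((Φ.measurable_coef' hW hV j).comp measurable_snd)).smul_const _

/-- Itô's isometry for simple integrands. -/
theorem lintegral_stochInt_sq (hW : IsCylindricalBrownian W P)
    (hV : ∀ t, 0 ≤ t → Measurable (V t)) (hWV : Indep (sigmaW W) (sigmaV V) P) (hℓ0 : ℓ 0 = 0) :
    ∫⁻ ω, ‖Φ.stochInt W ℓ ω‖ₑ ^ 2 ∂P =
      ∫⁻ p, ‖Φ.val p.1 p.2‖ₑ ^ 2 ∂((ℓ.measure.restrict (Ioc 0 T)).prod P) := by
  obtain ⟨C, hC0, hC⟩ := Φ.exists_bound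
  set ν := ℓ.measure.restrict (Ioc 0 T) with hν
  have : IsFiniteMeasure ν := ⟨by
    rw [hν, Measure.restrict_apply_univ, ℓ.measure_Ioc]; exact ENNReal.ofReal_lt_top⟩
  have hsq : ∀ x : ℝ, ‖x‖ₑ ^ 2 = ENNReal.ofReal (‖x‖ ^ 2) :=
    fun x => by rw [← ofReal_norm, ENNReal.ofReal_pow (norm_nonneg _)]
  have hsq' : ∀ (x : H), ‖x‖ₑ ^ 2 = ENNReal.ofReal (‖x‖ ^ 2) :=
    fun x => by rw [← ofReal_norm, ENNReal.ofReal_pow (norm_nonneg _)]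
  have hS := Φ.memLp_stochInt (P := P) hW hV
  -- the matrix of pairings of the summands
  let I : Fin Φ.n → Ω → ℝ := fun j ω => Φ.coef j ω *
    (W (ℓ (Φ.right j)).toNNReal (Φ.dir j) ω - W (ℓ (Φ.left j)).toNNReal (Φ.dir j) ω)
  let X : Fin Φ.n → ℝ × Ω → ℝ := fun j p =>
    (Ioc (Φ.left j) (Φ.right j)).indicator (fun _ => (1 : ℝ)) p.1 * Φ.coef j p.2
  have hI : ∀ j, MemLp (I j) 2 P := fun j => by
    refine MemLp.of_le_mul (c := C) ((hW.memLp (ℓ (Φ.right j)).toNNReal (Φ.dir j)).sub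
      (hW.memLp (ℓ (Φ.left j)).toNNReal (Φ.dir j))) ?_ (ae_of_all _ fun ω => ?_)
    · exact ((Φ.measurable_coef' hW hV j).mul
        ((hW.measurable _ _).sub (hW.measurable _ _))).aestronglyMeasurable
    · rw [norm_mul]
      exact mul_le_mul_of_nonneg_right (hC j ω) (norm_nonneg _)
  have hXm : ∀ j, Measurable (X j) := fun j =>
    ((measurable_const.indicator measurableSet_Ioc).comp measurable_fst).mul
      ((Φ.measurable_coef' hW hV j).comp measurable_snd)
  have hXb : ∀ j p, ‖X j p‖ ≤ C := fun j p => by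
    simp only [X, norm_mul]
    have h1 : ‖(Ioc (Φ.left j) (Φ.right j)).indicator (fun _ => (1 : ℝ)) p.1‖ ≤ 1 := by
      by_cases h : p.1 ∈ Ioc (Φ.left j) (Φ.right j) <;> simp [h]
    calc _ ≤ 1 * C := mul_le_mul h1 (hC j p.2) (abs_nonneg _) zero_le_one
      _ = C := one_mul C
  have hXX : ∀ j k, Integrable (fun p => X j p * X k p * ⟪Φ.dir j, Φ.dir k⟫_ℝ) (ν.prod P) :=
    fun j k => by
      refine (Integrable.of_bound ((hXm j).mul (hXm k)).aestronglyMeasurable (C * C)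
        (ae_of_all _ fun p => ?_)).mul_const _
      change ‖X j p * X k p‖ ≤ _
      rw [norm_mul]
      exact mul_le_mul (hXb j p) (hXb k p) (norm_nonneg _) hC0
  -- Products of integrals of summands have the right expectation when the summand that starts
  -- earlier comes first; the other case follows by symmetry.
  have hpair' : ∀ j k, Φ.left j ≤ Φ.left k → ∫ ω, I j ω * I k ω ∂P =
      ∫ p, X j p * X k p * ⟪Φ.dir j, Φ.dir k⟫_ℝ ∂(ν.prod P) := by
    intro j k hjk
    rw [integral_elementary_mul hW hV hWV (Φ.left_le_right k) hjk
      (hℓ0 ▸ ℓ.mono (Φ.left_nonneg k)) (Φ.measurable_coef j) (Φ.measurable_coef k) (hC j) (hC k)]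
    have : ∀ p : ℝ × Ω, X j p * X k p * ⟪Φ.dir j, Φ.dir k⟫_ℝ =
        (Ioc (Φ.left j) (Φ.right j) ∩ Ioc (Φ.left k) (Φ.right k)).indicator
          (fun _ => (1 : ℝ)) p.1 * (Φ.coef j p.2 * Φ.coef k p.2 * ⟪Φ.dir j, Φ.dir k⟫_ℝ) := by
      intro p
      simp only [X]
      by_cases h1 : p.1 ∈ Ioc (Φ.left j) (Φ.right j) <;>
        by_cases h2 : p.1 ∈ Ioc (Φ.left k) (Φ.right k)
      · rw [indicator_of_mem h1, indicator_of_mem h2, indicator_of_mem (mem_inter h1 h2)]; ring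
      · rw [indicator_of_notMem h2, indicator_of_notMem
          (show p.1 ∉ Ioc (Φ.left j) (Φ.right j) ∩ Ioc (Φ.left k) (Φ.right k) from
            fun h => h2 h.2)]; ring
      · rw [indicator_of_notMem h1, indicator_of_notMem
          (show p.1 ∉ Ioc (Φ.left j) (Φ.right j) ∩ Ioc (Φ.left k) (Φ.right k) from
            fun h => h1 h.1)]; ring
      · rw [indicator_of_notMem h1, indicator_of_notMem
          (show p.1 ∉ Ioc (Φ.left j) (Φ.right j) ∩ Ioc (Φ.left k) (Φ.right k) from
            fun h => h1 h.1)]; ring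
    simp_rw [this]
    rw [integral_prod_mul (fun t => (Ioc (Φ.left j) (Φ.right j) ∩
      Ioc (Φ.left k) (Φ.right k)).indicator (fun _ => (1 : ℝ)) t)
      (fun ω => Φ.coef j ω * Φ.coef k ω * ⟪Φ.dir j, Φ.dir k⟫_ℝ), integral_mul_const]
    congr 1
    rw [integral_indicator_const _ (measurableSet_Ioc.inter measurableSet_Ioc), smul_eq_mul,
      mul_one, hν, measureReal_restrict_apply (measurableSet_Ioc.inter measurableSet_Ioc)]
    congr 1
    refine (inter_eq_left.2 ?_).symm
    exact inter_subset_left.trans (Ioc_subset_Ioc (Φ.left_nonneg j) (Φ.right_le j))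
  have hpair : ∀ j k, ∫ ω, I j ω * I k ω ∂P =
      ∫ p, X j p * X k p * ⟪Φ.dir j, Φ.dir k⟫_ℝ ∂(ν.prod P) := by
    intro j k
    rcases le_total (Φ.left j) (Φ.left k) with h | h
    · exact hpair' j k h
    · have := hpair' k j h
      simpa only [mul_comm (I k _), mul_comm (X k _), real_inner_comm] using this
  have e1 : ∫ ω, ‖Φ.stochInt W ℓ ω‖ ^ 2 ∂P = ∑ j, ∑ k, ∫ ω, I j ω * I k ω ∂P := by
    have : ∀ ω, ‖Φ.stochInt W ℓ ω‖ ^ 2 = ∑ j, ∑ k, I j ω * I k ω := fun ω => by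
      rw [Real.norm_eq_abs, sq_abs, sq, ← Finset.sum_mul_sum]; rfl
    simp_rw [this]
    have hII : ∀ j k, Integrable (fun ω => I j ω * I k ω) P := fun j k =>
      (hI j).integrable_mul (hI k)
    rw [integral_finsetSum _ fun j _ => integrable_finsetSum _ fun k _ => hII j k]
    exact Finset.sum_congr rfl fun j _ => integral_finsetSum _ fun k _ => hII j k
  have hval : ∀ p : ℝ × Ω, ‖Φ.val p.1 p.2‖ ^ 2 =
      ∑ j, ∑ k, X j p * X k p * ⟪Φ.dir j, Φ.dir k⟫_ℝ := by
    intro p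
    rw [← real_inner_self_eq_norm_sq, val_eq, sum_inner]
    refine Finset.sum_congr rfl fun j _ => ?_
    rw [inner_sum]
    refine Finset.sum_congr rfl fun k _ => ?_
    rw [inner_smul_left, inner_smul_right]
    simp [X]; ring
  have e2 : ∫ p, ‖Φ.val p.1 p.2‖ ^ 2 ∂(ν.prod P) =
      ∑ j, ∑ k, ∫ p, X j p * X k p * ⟪Φ.dir j, Φ.dir k⟫_ℝ ∂(ν.prod P) := by
    simp_rw [hval]
    rw [integral_finsetSum _ fun j _ => integrable_finsetSum _ fun k _ => hXX j k]
    exact Finset.sum_congr rfl fun j _ => integral_finsetSum _ fun k _ => hXX j k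
  simp_rw [hsq, hsq']
  rw [← ofReal_integral_eq_lintegral_ofReal, ← ofReal_integral_eq_lintegral_ofReal, e1, e2]
  · exact congrArg _ (Finset.sum_congr rfl fun j _ => Finset.sum_congr rfl fun k _ => hpair j k)
  · simp_rw [hval]
    exact integrable_finsetSum _ fun j _ => integrable_finsetSum _ fun k _ => hXX j k
  · exact ae_of_all _ fun p => by positivity
  · exact hS.integrable_norm_pow (by norm_num)
  · exact ae_of_all _ fun p => by positivity

end SimpleIntegrand

end Isometry

/-! ### The Itô integral in `L²` -/

section LpTwo

variable {α E : Type*} [MeasurableSpace α] [NormedAddCommGroup E] {μ : Measure α}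

theorem eLpNorm_two_sq (f : α → E) : eLpNorm f 2 μ ^ 2 = ∫⁻ a, ‖f a‖ₑ ^ 2 ∂μ := by
  have := eLpNorm_nnreal_pow_eq_lintegral (f := f) (μ := μ) (p := 2) two_ne_zero
  simpa using this

theorem tendsto_eLpNorm_two_iff {γ : Type*} {l : Filter γ} {f : γ → α → E} :
    Tendsto (fun n => eLpNorm (f n) 2 μ) l (𝓝 0) ↔
      Tendsto (fun n => ∫⁻ a, ‖f n a‖ₑ ^ 2 ∂μ) l (𝓝 0) := by
  simp_rw [← eLpNorm_two_sq]
  refine ⟨fun h => ?_, fun h => ?_⟩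
  · simpa using ENNReal.Tendsto.pow (n := 2) h
  · have := h.ennrpow_const (1 / 2 : ℝ)
    have h2 : ∀ x : ℝ≥0∞, (x ^ 2) ^ (1 / 2 : ℝ) = x := fun x => by
      rw [← ENNReal.rpow_natCast, ← ENNReal.rpow_mul]; norm_num
    simp only [h2] at this
    simpa using this

end LpTwo

namespace SimpleIntegrand

variable {Ω H : Type*} [NormedAddCommGroup H] [InnerProductSpace ℝ H]
  {𝓕 𝓖 : ℝ → MeasurableSpace Ω} {T : ℝ}

/-- The integrand `0`. -/
def zero (H : Type*) (𝓕 : ℝ → MeasurableSpace Ω) (T : ℝ) : SimpleIntegrand H 𝓕 T where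
  n := 0
  left := Fin.elim0
  right := Fin.elim0
  left_nonneg j := j.elim0
  left_le_right j := j.elim0
  right_le j := j.elim0
  coef := Fin.elim0
  measurable_coef j := j.elim0
  bounded_coef := ⟨0, fun j => j.elim0⟩
  dir := Fin.elim0

/-- The sum of two simple integrands. -/
def add (Φ Ψ : SimpleIntegrand H 𝓕 T) : SimpleIntegrand H 𝓕 T where
  n := Φ.n + Ψ.n
  left := Fin.append Φ.left Ψ.left
  right := Fin.append Φ.right Ψ.right
  left_nonneg j := by
    refine Fin.addCases (fun i => ?_) (fun i => ?_) j
    · simpa using Φ.left_nonneg i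
    · simpa using Ψ.left_nonneg i
  left_le_right j := by
    refine Fin.addCases (fun i => ?_) (fun i => ?_) j
    · simpa using Φ.left_le_right i
    · simpa using Ψ.left_le_right i
  right_le j := by
    refine Fin.addCases (fun i => ?_) (fun i => ?_) j
    · simpa using Φ.right_le i
    · simpa using Ψ.right_le i
  coef := Fin.append Φ.coef Ψ.coef
  measurable_coef j := by
    refine Fin.addCases (fun i => ?_) (fun i => ?_) j
    · rw [Fin.append_left, Fin.append_left]; exact Φ.measurable_coef i
    · rw [Fin.append_right, Fin.append_right]; exact Ψ.measurable_coef i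
  bounded_coef := by
    obtain ⟨C, hC⟩ := Φ.bounded_coef
    obtain ⟨D, hD⟩ := Ψ.bounded_coef
    refine ⟨max C D, fun j => ?_⟩
    refine Fin.addCases (fun i ω => ?_) (fun i ω => ?_) j
    · simpa using Or.inl (hC i ω)
    · simpa using Or.inr (hD i ω)
  dir := Fin.append Φ.dir Ψ.dir

/-- A real multiple of a simple integrand. -/
def smul (c : ℝ) (Φ : SimpleIntegrand H 𝓕 T) : SimpleIntegrand H 𝓕 T where
  n := Φ.n
  left := Φ.left
  right := Φ.right
  left_nonneg := Φ.left_nonneg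
  left_le_right := Φ.left_le_right
  right_le := Φ.right_le
  coef j ω := c * Φ.coef j ω
  measurable_coef j := (Φ.measurable_coef j).const_mul c
  bounded_coef := by
    obtain ⟨C, hC⟩ := Φ.bounded_coef
    refine ⟨|c| * C, fun j ω => ?_⟩
    rw [abs_mul]
    exact mul_le_mul_of_nonneg_left (hC j ω) (abs_nonneg c)
  dir := Φ.dir

/-- A simple integrand is a simple integrand for every larger filtration. -/
def mono (h : ∀ t, 𝓕 t ≤ 𝓖 t) (Φ : SimpleIntegrand H 𝓕 T) : SimpleIntegrand H 𝓖 T where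
  n := Φ.n
  left := Φ.left
  right := Φ.right
  left_nonneg := Φ.left_nonneg
  left_le_right := Φ.left_le_right
  right_le := Φ.right_le
  coef := Φ.coef
  measurable_coef j := (Φ.measurable_coef j).mono (h _) le_rfl
  bounded_coef := Φ.bounded_coef
  dir := Φ.dir

theorem val_zero (t : ℝ) (ω : Ω) : (zero H 𝓕 T).val t ω = 0 := by
  simp [val, zero]

theorem val_add (Φ Ψ : SimpleIntegrand H 𝓕 T) (t : ℝ) (ω : Ω) :
    (Φ.add Ψ).val t ω = Φ.val t ω + Ψ.val t ω := by
  refine (Fin.sum_univ_add (a := Φ.n) (b := Ψ.n) _).trans ?_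
  simp [val, add]

theorem val_smul (c : ℝ) (Φ : SimpleIntegrand H 𝓕 T) (t : ℝ) (ω : Ω) :
    (Φ.smul c).val t ω = c • Φ.val t ω := by
  simp only [val, smul, Finset.smul_sum]
  refine Finset.sum_congr rfl fun j _ => ?_
  by_cases h : t ∈ Ioc (Φ.left j) (Φ.right j)
  · simp only [indicator_of_mem h, mul_smul]
  · simp only [indicator_of_notMem h, smul_zero]

variable {W : ℝ≥0 → H → Ω → ℝ} {ℓ : StieltjesFunction ℝ}

theorem stochInt_zero (ω : Ω) : (zero H 𝓕 T).stochInt W ℓ ω = 0 := by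
  simp [stochInt, zero]

theorem stochInt_add (Φ Ψ : SimpleIntegrand H 𝓕 T) (ω : Ω) :
    (Φ.add Ψ).stochInt W ℓ ω = Φ.stochInt W ℓ ω + Ψ.stochInt W ℓ ω := by
  refine (Fin.sum_univ_add (a := Φ.n) (b := Ψ.n) _).trans ?_
  simp [stochInt, add]

theorem stochInt_smul (c : ℝ) (Φ : SimpleIntegrand H 𝓕 T) (ω : Ω) :
    (Φ.smul c).stochInt W ℓ ω = c * Φ.stochInt W ℓ ω := by
  simp only [stochInt, smul, Finset.mul_sum, mul_assoc]
  rfl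

end SimpleIntegrand

section Ito

variable {Ω H : Type*} [NormedAddCommGroup H] [InnerProductSpace ℝ H] [MeasurableSpace H]
  [BorelSpace H] [SecondCountableTopology H]
  [mΩ : MeasurableSpace Ω] {P : Measure Ω} [IsProbabilityMeasure P] {W : ℝ≥0 → H → Ω → ℝ}
  {V : ℝ → Ω → H} {ℓ : StieltjesFunction ℝ} {T : ℝ}

instance isFiniteMeasure_restrict_Ioc (ℓ : StieltjesFunction ℝ) (a b : ℝ) :
    IsFiniteMeasure (ℓ.measure.restrict (Ioc a b)) :=
  ⟨by rw [Measure.restrict_apply_univ, ℓ.measure_Ioc]; exact ENNReal.ofReal_lt_top⟩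

theorem SimpleIntegrand.eLpNorm_stochInt_sub (hW : IsCylindricalBrownian W P)
    (hV : ∀ t, 0 ≤ t → Measurable (V t)) (hWV : Indep (sigmaW W) (sigmaV V) P) (hℓ0 : ℓ 0 = 0)
    (Φ Ψ : SimpleIntegrand H (history W V ℓ) T) :
    eLpNorm (fun ω => Φ.stochInt W ℓ ω - Ψ.stochInt W ℓ ω) 2 P =
      eLpNorm (fun p : ℝ × Ω => Φ.val p.1 p.2 - Ψ.val p.1 p.2) 2
        ((ℓ.measure.restrict (Ioc 0 T)).prod P) := by
  have h := (Φ.add (Ψ.smul (-1))).lintegral_stochInt_sq hW hV hWV hℓ0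
  simp_rw [val_add, stochInt_add, val_smul, stochInt_smul, neg_one_mul, neg_one_smul,
    ← sub_eq_add_neg] at h
  rw [← eLpNorm_two_sq, ← eLpNorm_two_sq] at h
  exact le_antisymm ((ENNReal.pow_le_pow_left_iff two_ne_zero).1 h.le)
    ((ENNReal.pow_le_pow_left_iff two_ne_zero).1 h.ge)

/-- An Itô integral can be approximated to any precision, together with its integrand, by
simple ones. -/
theorem isItoIntegral_iff {φ : ℝ → Ω → H} {I : Ω → ℝ} :
    IsItoIntegral W V ℓ P T φ I ↔
    AEStronglyMeasurable (fun p : ℝ × Ω => φ p.1 p.2) ((ℓ.measure.restrict (Ioc 0 T)).prod P) ∧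
    MemLp I 2 P ∧ ∀ ε : ℝ≥0∞, 0 < ε → ∃ Φ : SimpleIntegrand H (history W V ℓ) T,
      eLpNorm (fun p : ℝ × Ω => Φ.val p.1 p.2 - φ p.1 p.2) 2
        ((ℓ.measure.restrict (Ioc 0 T)).prod P) ≤ ε ∧
      eLpNorm (fun ω => Φ.stochInt W ℓ ω - I ω) 2 P ≤ ε := by
  unfold IsItoIntegral
  refine and_congr_right fun _ => and_congr_right fun _ => ⟨?_, fun h => ?_⟩
  · rintro ⟨Φ, h1, h2⟩ ε hε
    rw [← tendsto_eLpNorm_two_iff] at h1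
    obtain ⟨n, hn⟩ := ((ENNReal.tendsto_nhds_zero.1 h1 ε hε).and
      (ENNReal.tendsto_nhds_zero.1 h2 ε hε)).exists
    exact ⟨Φ n, hn⟩
  · obtain ⟨u, -, hu0, hu⟩ := exists_seq_strictAnti_tendsto' (x := (0 : ℝ≥0∞)) one_pos
    choose Φ hΦ using fun n => h (u n) (hu0 n).1
    refine ⟨Φ, ?_, ?_⟩
    · rw [← tendsto_eLpNorm_two_iff (μ := (ℓ.measure.restrict (Ioc 0 T)).prod P)
        (f := fun n (p : ℝ × Ω) => (Φ n).val p.1 p.2 - φ p.1 p.2)]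
      exact tendsto_of_tendsto_of_tendsto_of_le_of_le tendsto_const_nhds hu
        (fun _ => zero_le) fun n => (hΦ n).1
    · exact tendsto_of_tendsto_of_tendsto_of_le_of_le tendsto_const_nhds hu
        (fun _ => zero_le) fun n => (hΦ n).2

theorem eLpNorm_sub_le_add {α E : Type*} [MeasurableSpace α] [NormedAddCommGroup E]
    {μ : Measure α} {f g h : α → E} (hf : AEStronglyMeasurable f μ)
    (hg : AEStronglyMeasurable g μ) (hh : AEStronglyMeasurable h μ) :
    eLpNorm (fun a => f a - h a) 2 μ ≤
      eLpNorm (fun a => f a - g a) 2 μ + eLpNorm (fun a => g a - h a) 2 μ := by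
  have : (fun a => f a - h a) = (fun a => f a - g a) + fun a => g a - h a := by
    ext a; simp
  rw [this]
  exact eLpNorm_add_le (hf.sub hg) (hg.sub hh) one_le_two

/-- Itô's isometry, as an estimate of the distance to a simple integral. -/
theorem IsItoIntegral.eLpNorm_stochInt_sub_le (hW : IsCylindricalBrownian W P)
    (hV : ∀ t, 0 ≤ t → Measurable (V t)) (hWV : Indep (sigmaW W) (sigmaV V) P) (hℓ0 : ℓ 0 = 0)
    {φ : ℝ → Ω → H} {I : Ω → ℝ} (h : IsItoIntegral W V ℓ P T φ I)
    (Ψ : SimpleIntegrand H (history W V ℓ) T) :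
    eLpNorm (fun ω => Ψ.stochInt W ℓ ω - I ω) 2 P ≤
      eLpNorm (fun p : ℝ × Ω => Ψ.val p.1 p.2 - φ p.1 p.2) 2
        ((ℓ.measure.restrict (Ioc 0 T)).prod P) := by
  obtain ⟨hφ, hI, h⟩ := isItoIntegral_iff.1 h
  refine ENNReal.le_of_forall_pos_le_add fun ε hε _ => ?_
  obtain ⟨Φ, h1, h2⟩ := h (ε / 2) (by simpa using hε.ne')
  calc _ ≤ eLpNorm (fun ω => Ψ.stochInt W ℓ ω - Φ.stochInt W ℓ ω) 2 P +
        eLpNorm (fun ω => Φ.stochInt W ℓ ω - I ω) 2 P :=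
        eLpNorm_sub_le_add (Ψ.memLp_stochInt hW hV).1 (Φ.memLp_stochInt hW hV).1 hI.1
    _ ≤ (eLpNorm (fun p : ℝ × Ω => Ψ.val p.1 p.2 - φ p.1 p.2) 2
        ((ℓ.measure.restrict (Ioc 0 T)).prod P) + ε / 2) + ε / 2 := by
        refine add_le_add ?_ h2
        rw [Ψ.eLpNorm_stochInt_sub hW hV hWV hℓ0]
        refine (eLpNorm_sub_le_add (Ψ.measurable_val hW hV).aestronglyMeasurable hφ
          (Φ.measurable_val hW hV).aestronglyMeasurable).trans (add_le_add le_rfl ?_)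
        have := eLpNorm_sub_comm (fun p : ℝ × Ω => φ p.1 p.2) (fun p => Φ.val p.1 p.2) 2
          ((ℓ.measure.restrict (Ioc 0 T)).prod P)
        exact (le_of_eq this).trans h1
    _ = _ := by rw [add_assoc, ENNReal.add_halves]

theorem IsItoIntegral.eLpNorm_le (hW : IsCylindricalBrownian W P)
    (hV : ∀ t, 0 ≤ t → Measurable (V t)) (hWV : Indep (sigmaW W) (sigmaV V) P) (hℓ0 : ℓ 0 = 0)
    {φ : ℝ → Ω → H} {I : Ω → ℝ} (h : IsItoIntegral W V ℓ P T φ I) :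
    eLpNorm I 2 P ≤ eLpNorm (fun p : ℝ × Ω => φ p.1 p.2) 2
        ((ℓ.measure.restrict (Ioc 0 T)).prod P) := by
  have := h.eLpNorm_stochInt_sub_le hW hV hWV hℓ0 (SimpleIntegrand.zero H _ T)
  simp only [SimpleIntegrand.stochInt_zero, SimpleIntegrand.val_zero, zero_sub] at this
  change eLpNorm (-I) 2 P ≤ eLpNorm (-(fun p : ℝ × Ω => φ p.1 p.2)) 2 _ at this
  rwa [eLpNorm_neg, eLpNorm_neg] at this

theorem IsItoIntegral.zero : IsItoIntegral W V ℓ P T (fun _ _ => 0) (fun _ => 0) := by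
  rw [isItoIntegral_iff]
  refine ⟨aestronglyMeasurable_const, MemLp.zero, fun ε _ =>
    ⟨SimpleIntegrand.zero H _ T, ?_⟩⟩
  simp [SimpleIntegrand.val_zero, SimpleIntegrand.stochInt_zero]

theorem IsItoIntegral.add {φ ψ : ℝ → Ω → H} {I I' : Ω → ℝ} (hW : IsCylindricalBrownian W P)
    (hV : ∀ t, 0 ≤ t → Measurable (V t)) (h : IsItoIntegral W V ℓ P T φ I)
    (h' : IsItoIntegral W V ℓ P T ψ I') :
    IsItoIntegral W V ℓ P T (fun t ω => φ t ω + ψ t ω) (fun ω => I ω + I' ω) := by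
  rw [isItoIntegral_iff] at *
  obtain ⟨hφ, hI, h⟩ := h
  obtain ⟨hψ, hI', h'⟩ := h'
  refine ⟨hφ.add hψ, hI.add hI', fun ε hε => ?_⟩
  obtain ⟨Φ, h1, h2⟩ := h (ε / 2) (by simpa using hε.ne')
  obtain ⟨Ψ, h3, h4⟩ := h' (ε / 2) (by simpa using hε.ne')
  refine ⟨Φ.add Ψ, ?_, ?_⟩
  · simp_rw [SimpleIntegrand.val_add, add_sub_add_comm]
    exact (eLpNorm_add_le ((Φ.measurable_val hW hV).aestronglyMeasurable.sub hφ)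
      ((Ψ.measurable_val hW hV).aestronglyMeasurable.sub hψ) one_le_two).trans
      ((add_le_add h1 h3).trans (ENNReal.add_halves ε).le)
  · simp_rw [SimpleIntegrand.stochInt_add, add_sub_add_comm]
    exact (eLpNorm_add_le ((Φ.memLp_stochInt hW hV).1.sub hI.1)
      ((Ψ.memLp_stochInt hW hV).1.sub hI'.1) one_le_two).trans
      ((add_le_add h2 h4).trans (ENNReal.add_halves ε).le)

theorem IsItoIntegral.const_smul {φ : ℝ → Ω → H} {I : Ω → ℝ}
    (h : IsItoIntegral W V ℓ P T φ I) (c : ℝ) :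
    IsItoIntegral W V ℓ P T (fun t ω => c • φ t ω) (fun ω => c * I ω) := by
  obtain ⟨hφ, hI, Φ, h1, h2⟩ := h
  refine ⟨hφ.const_smul c, hI.const_mul c, fun n => (Φ n).smul c, ?_, ?_⟩
  · have : Tendsto (fun n => ‖c‖ₑ ^ 2 * ∫⁻ p, ‖(Φ n).val p.1 p.2 - φ p.1 p.2‖ₑ ^ 2
        ∂((ℓ.measure.restrict (Ioc 0 T)).prod P)) atTop (𝓝 (‖c‖ₑ ^ 2 * 0)) :=
      ENNReal.Tendsto.const_mul h1 (Or.inr (by simp))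
    rw [mul_zero] at this
    refine this.congr fun n => ?_
    rw [← lintegral_const_mul' _ _ (by simp)]
    refine lintegral_congr fun p => ?_
    rw [SimpleIntegrand.val_smul, ← smul_sub, enorm_smul, mul_pow]
  · have : Tendsto (fun n => ‖c‖ₑ * eLpNorm (fun ω => (Φ n).stochInt W ℓ ω - I ω) 2 P) atTop
        (𝓝 (‖c‖ₑ * 0)) := ENNReal.Tendsto.const_mul h2 (Or.inr (by simp))
    rw [mul_zero] at this
    refine this.congr fun n => ?_
    rw [← eLpNorm_const_smul]
    congr 1
    ext ω
    simp only [Pi.smul_apply, smul_eq_mul, SimpleIntegrand.stochInt_smul, mul_sub]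

theorem IsItoIntegral.sum {γ : Type*} (s : Finset γ) {φ : γ → ℝ → Ω → H} {I : γ → Ω → ℝ}
    (hW : IsCylindricalBrownian W P) (hV : ∀ t, 0 ≤ t → Measurable (V t))
    (h : ∀ i, IsItoIntegral W V ℓ P T (φ i) (I i)) :
    IsItoIntegral W V ℓ P T (fun t ω => ∑ i ∈ s, φ i t ω) (fun ω => ∑ i ∈ s, I i ω) := by
  classical
  induction s using Finset.induction_on with
  | empty => simpa using IsItoIntegral.zero
  | insert i s hi ih =>
    simp_rw [Finset.sum_insert hi]
    exact (h i).add hW hV ih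

/-- The Itô integral is a closed operator. -/
theorem IsItoIntegral.of_approx (hW : IsCylindricalBrownian W P)
    (hV : ∀ t, 0 ≤ t → Measurable (V t)) {φ : ℝ → Ω → H} {I : Ω → ℝ}
    (hφ : AEStronglyMeasurable (fun p : ℝ × Ω => φ p.1 p.2)
      ((ℓ.measure.restrict (Ioc 0 T)).prod P)) (hI : MemLp I 2 P)
    (h : ∀ ε : ℝ≥0∞, 0 < ε → ∃ ψ I', IsItoIntegral W V ℓ P T ψ I' ∧
      eLpNorm (fun p : ℝ × Ω => ψ p.1 p.2 - φ p.1 p.2) 2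
        ((ℓ.measure.restrict (Ioc 0 T)).prod P) ≤ ε ∧
      eLpNorm (fun ω => I' ω - I ω) 2 P ≤ ε) : IsItoIntegral W V ℓ P T φ I := by
  rw [isItoIntegral_iff]
  refine ⟨hφ, hI, fun ε hε => ?_⟩
  have hε2 : 0 < ε / 2 := by simpa using hε.ne'
  obtain ⟨ψ, I', hψ, h1, h2⟩ := h (ε / 2) hε2
  obtain ⟨hψm, hI', h'⟩ := isItoIntegral_iff.1 hψ
  obtain ⟨Φ, h3, h4⟩ := h' (ε / 2) hε2
  exact ⟨Φ, (eLpNorm_sub_le_add (Φ.measurable_val hW hV).aestronglyMeasurable hψm hφ).trans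
      ((add_le_add h3 h1).trans (ENNReal.add_halves ε).le),
    (eLpNorm_sub_le_add (Φ.memLp_stochInt hW hV).1 hI'.1 hI.1).trans
      ((add_le_add h4 h2).trans (ENNReal.add_halves ε).le)⟩

theorem IsItoIntegral.congr_ae {φ ψ : ℝ → Ω → H} {I I' : Ω → ℝ}
    (h : IsItoIntegral W V ℓ P T φ I)
    (hφ : ∀ᵐ p ∂((ℓ.measure.restrict (Ioc 0 T)).prod P), φ p.1 p.2 = ψ p.1 p.2)
    (hI : I =ᵐ[P] I') : IsItoIntegral W V ℓ P T ψ I' := by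
  obtain ⟨hm, hI2, Φ, h1, h2⟩ := h
  refine ⟨hm.congr hφ, hI2.ae_eq hI, Φ, h1.congr fun n => lintegral_congr_ae ?_,
    h2.congr fun n => eLpNorm_congr_ae ?_⟩
  · filter_upwards [hφ] with p hp using by rw [hp]
  · filter_upwards [hI] with ω hω using by rw [hω]

/-! ### Existence of the Itô integral -/

/-- `φ` is an `L²`-limit of simple integrands that are adapted to `𝓕`. -/
def IsApprox (𝓕 : ℝ → MeasurableSpace Ω) (ℓ : StieltjesFunction ℝ) (P : Measure Ω) (T : ℝ)
    (φ : ℝ → Ω → H) : Prop :=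
  ∀ ε : ℝ≥0∞, 0 < ε → ∃ Φ : SimpleIntegrand H 𝓕 T,
    eLpNorm (fun p : ℝ × Ω => Φ.val p.1 p.2 - φ p.1 p.2) 2
      ((ℓ.measure.restrict (Ioc 0 T)).prod P) ≤ ε

/-- By Itô's isometry, the integrals of approximating simple integrands form a Cauchy sequence. -/
theorem IsApprox.exists_isItoIntegral (hW : IsCylindricalBrownian W P)
    (hV : ∀ t, 0 ≤ t → Measurable (V t)) (hWV : Indep (sigmaW W) (sigmaV V) P) (hℓ0 : ℓ 0 = 0)
    {φ : ℝ → Ω → H} (hφ : AEStronglyMeasurable (fun p : ℝ × Ω => φ p.1 p.2)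
      ((ℓ.measure.restrict (Ioc 0 T)).prod P)) (h : IsApprox (history W V ℓ) ℓ P T φ) :
    ∃ I, IsItoIntegral W V ℓ P T φ I := by
  set μ := (ℓ.measure.restrict (Ioc 0 T)).prod P
  let u : ℕ → ℝ≥0∞ := fun n => (2⁻¹ : ℝ≥0∞) ^ n
  have hu0 : ∀ n, 0 < u n := fun n => ENNReal.pow_pos (by simp) n
  have hu : Tendsto u atTop (𝓝 0) :=
    ENNReal.tendsto_pow_atTop_nhds_zero_of_lt_one (by simp)
  have hut : ∀ n, u n ≠ ∞ := fun n => ENNReal.pow_ne_top (by simp)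
  have hanti : ∀ {m n}, m ≤ n → u n ≤ u m := fun hmn =>
    pow_le_pow_of_le_one (zero_le) (by simp) hmn
  choose Φ hΦ using fun n => h (u (n + 2)) (hu0 _)
  obtain ⟨I, hI, hlim⟩ := Lp.cauchy_complete_eLpNorm (μ := P) (p := 2) one_le_two
    (f := fun n => (Φ n).stochInt W ℓ) (fun n => (Φ n).memLp_stochInt hW hV) (B := u)
    (by simp [u, ENNReal.tsum_geometric]) (fun N n m hn hm => by
      change eLpNorm (fun ω => (Φ n).stochInt W ℓ ω - (Φ m).stochInt W ℓ ω) 2 P < u N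
      rw [SimpleIntegrand.eLpNorm_stochInt_sub hW hV hWV hℓ0]
      have h3 := eLpNorm_sub_comm (fun p : ℝ × Ω => φ p.1 p.2) (fun p => (Φ m).val p.1 p.2) 2 μ
      have h4 : u (N + 2) + u (N + 2) = u (N + 1) := by
        simp only [u, pow_succ _ (N + 1)]
        rw [← mul_add, ENNReal.inv_two_add_inv_two, mul_one]
      have h5 : u (N + 1) < u N := by
        rw [← h4]
        have h6 : u N = u (N + 1) + u (N + 1) := by
          simp only [u, pow_succ _ N]
          rw [← mul_add, ENNReal.inv_two_add_inv_two, mul_one]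
        rw [h4, h6]
        exact ENNReal.lt_add_right (hut _) (hu0 _).ne'
      refine lt_of_le_of_lt ?_ h5
      refine (eLpNorm_sub_le_add ((Φ n).measurable_val hW hV).aestronglyMeasurable hφ
        ((Φ m).measurable_val hW hV).aestronglyMeasurable).trans ?_
      rw [← h4]
      exact add_le_add ((hΦ n).trans (hanti (by omega)))
        ((le_of_eq h3).trans ((hΦ m).trans (hanti (by omega)))))
  refine ⟨I, hφ, hI, Φ, ?_, hlim⟩
  rw [← tendsto_eLpNorm_two_iff (μ := μ)
    (f := fun n (p : ℝ × Ω) => (Φ n).val p.1 p.2 - φ p.1 p.2)]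
  exact tendsto_of_tendsto_of_tendsto_of_le_of_le tendsto_const_nhds
    (hu.comp (tendsto_add_atTop_nat 2)) (fun _ => zero_le) hΦ

end Ito

section Approx

variable {Ω H : Type*} [NormedAddCommGroup H] [InnerProductSpace ℝ H] [MeasurableSpace H]
  [BorelSpace H] [SecondCountableTopology H]
  [mΩ : MeasurableSpace Ω] {P : Measure Ω} [IsProbabilityMeasure P]
  {ℓ : StieltjesFunction ℝ} {T : ℝ} {𝓕 : ℝ → MeasurableSpace Ω}

theorem SimpleIntegrand.measurable_val_of_le (h𝓕 : ∀ t, 𝓕 t ≤ mΩ) (Φ : SimpleIntegrand H 𝓕 T) :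
    Measurable (fun p : ℝ × Ω => Φ.val p.1 p.2) := by
  have : ∀ p : ℝ × Ω, Φ.val p.1 p.2 = ∑ j, ((Ioc (Φ.left j) (Φ.right j)).indicator
      (fun _ => (1 : ℝ)) p.1 * Φ.coef j p.2) • Φ.dir j := fun p => by
    unfold val
    refine Finset.sum_congr rfl fun j _ => ?_
    by_cases h : p.1 ∈ Ioc (Φ.left j) (Φ.right j) <;> simp [h]
  simp_rw [this]
  refine Finset.measurable_sum _ fun j _ => ?_
  exact (((measurable_const.indicator measurableSet_Ioc).comp measurable_fst).mul
    (((Φ.measurable_coef j).mono (h𝓕 _) le_rfl).comp measurable_snd)).smul_const _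

theorem IsApprox.add (h𝓕 : ∀ t, 𝓕 t ≤ mΩ) {φ ψ : ℝ → Ω → H}
    (hφm : AEStronglyMeasurable (fun p : ℝ × Ω => φ p.1 p.2)
      ((ℓ.measure.restrict (Ioc 0 T)).prod P))
    (hψm : AEStronglyMeasurable (fun p : ℝ × Ω => ψ p.1 p.2)
      ((ℓ.measure.restrict (Ioc 0 T)).prod P))
    (hφ : IsApprox 𝓕 ℓ P T φ) (hψ : IsApprox 𝓕 ℓ P T ψ) :
    IsApprox 𝓕 ℓ P T (fun t ω => φ t ω + ψ t ω) := fun ε hε => by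
  obtain ⟨Φ, h1⟩ := hφ (ε / 2) (by simpa using hε.ne')
  obtain ⟨Ψ, h2⟩ := hψ (ε / 2) (by simpa using hε.ne')
  refine ⟨Φ.add Ψ, ?_⟩
  simp_rw [SimpleIntegrand.val_add, add_sub_add_comm]
  exact (eLpNorm_add_le ((Φ.measurable_val_of_le h𝓕).aestronglyMeasurable.sub hφm)
    ((Ψ.measurable_val_of_le h𝓕).aestronglyMeasurable.sub hψm) one_le_two).trans
    ((add_le_add h1 h2).trans (ENNReal.add_halves ε).le)

theorem IsApprox.sum (h𝓕 : ∀ t, 𝓕 t ≤ mΩ) {γ : Type*} (s : Finset γ) {φ : γ → ℝ → Ω → H}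
    (hφm : ∀ i, AEStronglyMeasurable (fun p : ℝ × Ω => φ i p.1 p.2)
      ((ℓ.measure.restrict (Ioc 0 T)).prod P))
    (hφ : ∀ i, IsApprox 𝓕 ℓ P T (φ i)) : IsApprox 𝓕 ℓ P T (fun t ω => ∑ i ∈ s, φ i t ω) := by
  classical
  induction s using Finset.induction_on with
  | empty =>
    intro ε _
    exact ⟨SimpleIntegrand.zero H _ T, by simp [SimpleIntegrand.val_zero]⟩
  | insert i s hi ih =>
    simp_rw [Finset.sum_insert hi]
    exact (hφ i).add h𝓕 (hφm i) (Finset.aestronglyMeasurable_fun_sum s fun i _ => hφm i) ih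

theorem IsApprox.of_approx (h𝓕 : ∀ t, 𝓕 t ≤ mΩ) {φ : ℝ → Ω → H}
    (hφm : AEStronglyMeasurable (fun p : ℝ × Ω => φ p.1 p.2)
      ((ℓ.measure.restrict (Ioc 0 T)).prod P))
    (h : ∀ ε : ℝ≥0∞, 0 < ε → ∃ ψ : ℝ → Ω → H, IsApprox 𝓕 ℓ P T ψ ∧
      AEStronglyMeasurable (fun p : ℝ × Ω => ψ p.1 p.2)
        ((ℓ.measure.restrict (Ioc 0 T)).prod P) ∧
      eLpNorm (fun p : ℝ × Ω => ψ p.1 p.2 - φ p.1 p.2) 2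
        ((ℓ.measure.restrict (Ioc 0 T)).prod P) ≤ ε) : IsApprox 𝓕 ℓ P T φ := fun ε hε => by
  have hε2 : 0 < ε / 2 := by simpa using hε.ne'
  obtain ⟨ψ, h1, h2, h3⟩ := h _ hε2
  obtain ⟨Φ, h4⟩ := h1 _ hε2
  exact ⟨Φ, (eLpNorm_sub_le_add (Φ.measurable_val_of_le h𝓕).aestronglyMeasurable h2 hφm).trans
    ((add_le_add h4 h3).trans (ENNReal.add_halves ε).le)⟩

/-- A real process which is bounded, adapted up to null sets and has continuous paths, times a
bounded continuous function with values in `H`, is the limit of its left Riemann step processes. -/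
theorem isApprox_of_continuous (h𝓕 : ∀ t, 𝓕 t ≤ mΩ) (hT : 0 ≤ T) {α : ℝ → Ω → ℝ} {g : ℝ → H}
    {C D : ℝ} (hα : ∀ t ∈ Icc 0 T, ∃ α' : Ω → ℝ, Measurable[𝓕 t] α' ∧ α t =ᵐ[P] α')
    (hαm : AEStronglyMeasurable (fun p : ℝ × Ω => α p.1 p.2)
      ((ℓ.measure.restrict (Ioc 0 T)).prod P))
    (hαC : ∀ t ω, |α t ω| ≤ C) (hcont : ∀ᵐ ω ∂P, ContinuousOn (fun t => α t ω) (Icc 0 T))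
    (hg : Continuous g) (hgD : ∀ t, ‖g t‖ ≤ D) :
    IsApprox 𝓕 ℓ P T (fun t ω => α t ω • g t) := by
  classical
  set ν := ℓ.measure.restrict (Ioc 0 T) with hν
  rcases isEmpty_or_nonempty Ω with hΩ | ⟨⟨ω₀⟩⟩
  · intro ε _
    refine ⟨SimpleIntegrand.zero H _ T, ?_⟩
    rw [eLpNorm_congr_ae (g := fun _ => 0) (ae_of_all _ fun p => isEmptyElim p.2)]
    simp
  have hC0 : 0 ≤ C := (abs_nonneg _).trans (hαC 0 ω₀)
  have hD0 : 0 ≤ D := (norm_nonneg _).trans (hgD 0)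
  choose! α' hα'm hα' using hα
  let τ : ℕ → ℕ → ℝ := fun n j => T * (j / (n + 1))
  have hτ0 : ∀ n j, 0 ≤ τ n j := fun n j => by positivity
  have hτT : ∀ n j, j ≤ n + 1 → τ n j ≤ T := fun n j hj => by
    refine mul_le_of_le_one_right hT ?_
    rw [div_le_one (by positivity)]
    exact_mod_cast hj
  have hτmono : ∀ n, Monotone (τ n) := fun n i j hij => by
    refine mul_le_mul_of_nonneg_left ?_ hT
    gcongr
  let Φ : ℕ → SimpleIntegrand H 𝓕 T := fun n =>
    { n := n + 1
      left := fun j => τ n j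
      right := fun j => τ n (j + 1)
      left_nonneg := fun j => hτ0 n j
      left_le_right := fun j => hτmono n (Nat.le_succ _)
      right_le := fun j => hτT n _ (Nat.succ_le_of_lt j.2)
      -- `α'` obeys the bound `C` only almost surely, but coefficients have to be bounded everywhere
      coef := fun j ω => max (-C) (min C (α' (τ n j) ω))
      measurable_coef := fun j => measurable_const.max (measurable_const.min
        (hα'm _ ⟨hτ0 n j, hτT n j j.2.le⟩))
      bounded_coef := ⟨C, fun j ω => abs_le.2 ⟨le_max_left _ _,
        max_le (by linarith) (min_le_left _ _)⟩⟩
      dir := fun j => g (τ n j) }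
  -- the value of the step process at time `t` is that of `α • g` at a nearby earlier time
  have hval : ∀ n : ℕ, ∀ t ∈ Ioc 0 T, ∃ s ∈ Icc 0 T, |s - t| ≤ T / (n + 1) ∧ ∃ j : Fin (n + 1),
      s = τ n j ∧ ∀ ω, (Φ n).val t ω = max (-C) (min C (α' s ω)) • g s := by
    intro n t ht
    have hT0 : 0 < T := ht.1.trans_le ht.2
    have hex : ∃ j, t ≤ τ n (j + 1) := ⟨n, by
      have : τ n (n + 1) = T := by simp only [τ]; push_cast; field_simp
      rw [this]; exact ht.2⟩
    let j := Nat.find hex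
    have hj : t ≤ τ n (j + 1) := Nat.find_spec hex
    have hjn : j < n + 1 := Nat.lt_succ_of_le (Nat.find_min' hex (by
      have : τ n (n + 1) = T := by simp only [τ]; push_cast; field_simp
      rw [this]; exact ht.2))
    have hj' : τ n j < t := by
      rcases Nat.eq_zero_or_pos j with h0 | h0
      · rw [h0]; simpa [τ] using ht.1
      · have := Nat.find_min hex (m := j - 1) (by omega)
        rw [not_le, Nat.sub_add_cancel h0] at this
        exact this
    refine ⟨τ n j, ⟨hτ0 n j, hτT n j hjn.le⟩, ?_, ⟨j, hjn⟩, rfl, fun ω => ?_⟩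
    · rw [abs_le]
      have : τ n (j + 1) = τ n j + T / (n + 1) := by simp only [τ]; push_cast; ring
      constructor <;> linarith [div_nonneg hT (by positivity : (0 : ℝ) ≤ n + 1)]
    · unfold SimpleIntegrand.val
      rw [Finset.sum_eq_single (⟨j, hjn⟩ : Fin (n + 1))]
      · exact indicator_of_mem (show t ∈ Ioc (τ n j) (τ n (j + 1)) from ⟨hj', hj⟩) _
      · intro i _ hij
        refine indicator_of_notMem (show t ∉ Ioc (τ n i) (τ n (i + 1)) from fun h => ?_) _
        rcases lt_or_gt_of_ne (fun h => hij (Fin.ext h) : (i : ℕ) ≠ j) with h1 | h1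
        · exact absurd (h.2.trans (hτmono n (Nat.succ_le_of_lt h1))) (not_le.2 hj')
        · exact absurd (hj.trans (hτmono n (Nat.succ_le_of_lt h1))) (not_le.2 h.1)
      · intro h; exact absurd (Finset.mem_univ _) h
  have hφm : AEStronglyMeasurable (fun p : ℝ × Ω => α p.1 p.2 • g p.1) (ν.prod P) :=
    hαm.smul (hg.measurable.comp measurable_fst).aestronglyMeasurable
  have hgood : ∀ᵐ p ∂ν.prod P, p.1 ∈ Ioc 0 T ∧ ContinuousOn (fun t => α t p.2) (Icc 0 T) ∧
      ∀ n : ℕ, ∀ j : Fin (n + 1), α (τ n j) p.2 = α' (τ n j) p.2 := by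
    have h1 : ∀ᵐ t ∂ν, t ∈ Ioc 0 T := ae_restrict_mem measurableSet_Ioc
    have h2 : ∀ᵐ ω ∂P, ∀ n : ℕ, ∀ j : Fin (n + 1), α (τ n j) ω = α' (τ n j) ω :=
      ae_all_iff.2 fun n => ae_all_iff.2 fun j => hα' _ ⟨hτ0 n j, hτT n j j.2.le⟩
    filter_upwards [Measure.quasiMeasurePreserving_fst.ae h1,
      Measure.quasiMeasurePreserving_snd.ae hcont, Measure.quasiMeasurePreserving_snd.ae h2]
      with p h1 h2 h3 using ⟨h1, h2, h3⟩
  have hlim : Tendsto (fun n => ∫⁻ p, ‖(Φ n).val p.1 p.2 - α p.1 p.2 • g p.1‖ₑ ^ 2 ∂ν.prod P)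
      atTop (𝓝 (∫⁻ _, 0 ∂ν.prod P)) := by
    refine tendsto_lintegral_filter_of_dominated_convergence'
      (fun _ => ENNReal.ofReal (2 * (C * D)) ^ 2) (Eventually.of_forall fun n =>
      ((((Φ n).measurable_val_of_le h𝓕).aestronglyMeasurable.sub hφm).enorm).pow_const 2)
      (Eventually.of_forall fun n => ?_) ?_ ?_
    · filter_upwards [hgood] with p ⟨hp, _, hp2⟩
      obtain ⟨s, -, -, j, -, h⟩ := hval n p.1 hp
      have hb : ∀ c : ℝ, |max (-C) (min C c)| ≤ C := fun c =>
        abs_le.2 ⟨le_max_left _ _, max_le (by linarith) (min_le_left _ _)⟩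
      gcongr
      rw [← ofReal_norm]
      refine ENNReal.ofReal_le_ofReal ((norm_sub_le _ _).trans ?_)
      rw [h, norm_smul, norm_smul, two_mul]
      exact add_le_add (mul_le_mul (hb _) (hgD _) (norm_nonneg _) hC0)
        (mul_le_mul (hαC _ _) (hgD _) (norm_nonneg _) hC0)
    · rw [lintegral_const]
      exact ENNReal.mul_ne_top (ENNReal.pow_ne_top ENNReal.ofReal_ne_top) (measure_ne_top _ _)
    · filter_upwards [hgood] with p ⟨hp, hc, hp2⟩
      choose s hs hst j hsj h using fun n => hval n p.1 hp
      have hlim : Tendsto s atTop (𝓝[Icc 0 T] p.1) := by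
        refine tendsto_nhdsWithin_iff.2 ⟨?_, Eventually.of_forall hs⟩
        rw [tendsto_iff_dist_tendsto_zero]
        refine squeeze_zero (fun _ => dist_nonneg) hst ?_
        simpa using (tendsto_one_div_add_atTop_nhds_zero_nat (𝕜 := ℝ)).const_mul T |>.congr
          fun n => by rw [mul_one_div]
      have h1 : Tendsto (fun n => α (s n) p.2 • g (s n)) atTop (𝓝 (α p.1 p.2 • g p.1)) :=
        ((hc p.1 ⟨hp.1.le, hp.2⟩).tendsto.comp hlim).smul
          ((hg.tendsto _).comp (hlim.mono_right nhdsWithin_le_nhds))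
      have h2 : ∀ n, (Φ n).val p.1 p.2 = α (s n) p.2 • g (s n) := fun n => by
        rw [h, hsj, ← hp2 n (j n)]
        obtain ⟨h3, h4⟩ := abs_le.1 (hαC (τ n (j n)) p.2)
        rw [min_eq_right h4, max_eq_right h3]
      simp_rw [h2]
      have h3 := ENNReal.Tendsto.pow (n := 2) (h1.sub_const (α p.1 p.2 • g p.1)).enorm
      simpa using h3
  intro ε hε
  rw [lintegral_zero, ← tendsto_eLpNorm_two_iff] at hlim
  obtain ⟨n, hn⟩ := (ENNReal.tendsto_nhds_zero.1 hlim ε hε).exists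
  exact ⟨Φ n, hn⟩

/-- The continuous function in `isApprox_of_continuous` may be replaced by a square integrable one,
since bounded continuous functions are dense in `L²(dℓ)`. -/
theorem isApprox_smul_of_memLp (h𝓕 : ∀ t, 𝓕 t ≤ mΩ) (hT : 0 ≤ T) {α : ℝ → Ω → ℝ} {g : ℝ → H}
    {C : ℝ} (hα : ∀ t ∈ Icc 0 T, ∃ α' : Ω → ℝ, Measurable[𝓕 t] α' ∧ α t =ᵐ[P] α')
    (hαm : AEStronglyMeasurable (fun p : ℝ × Ω => α p.1 p.2)
      ((ℓ.measure.restrict (Ioc 0 T)).prod P))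
    (hαC : ∀ t ω, |α t ω| ≤ C) (hcont : ∀ᵐ ω ∂P, ContinuousOn (fun t => α t ω) (Icc 0 T))
    (hg : MemLp g 2 (ℓ.measure.restrict (Ioc 0 T))) :
    IsApprox 𝓕 ℓ P T (fun t ω => α t ω • g t) := by
  set ν := ℓ.measure.restrict (Ioc 0 T) with hν
  refine IsApprox.of_approx h𝓕 (hαm.smul hg.1.comp_fst) fun ε hε => ?_
  obtain ⟨δ, hδ0, hδ⟩ : ∃ δ : ℝ≥0∞, δ ≠ 0 ∧ ENNReal.ofReal C * δ ≤ ε := by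
    rcases eq_or_ne (ENNReal.ofReal C) 0 with h0 | h0
    · exact ⟨1, one_ne_zero, by simp [h0]⟩
    · rcases eq_or_ne ε ∞ with h1 | h1
      · exact ⟨1, one_ne_zero, by simp [h1]⟩
      · exact ⟨ε / ENNReal.ofReal C, (ENNReal.div_pos hε.ne' (by simp)).ne',
          (ENNReal.mul_div_cancel h0 (by simp)).le⟩
  obtain ⟨g', hg', -⟩ := hg.exists_boundedContinuous_eLpNorm_sub_le (by simp) hδ0
  refine ⟨fun t ω => α t ω • g' t, isApprox_of_continuous h𝓕 hT hα hαm hαC hcont g'.continuous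
    g'.norm_coe_le_norm, hαm.smul
    (g'.continuous.measurable.comp measurable_fst).aestronglyMeasurable, ?_⟩
  have h1 : eLpNorm (fun p : ℝ × Ω => g' p.1 - g p.1) 2 (ν.prod P) = eLpNorm (g - ⇑g') 2 ν := by
    rw [eLpNorm_sub_comm g, ← eLpNorm_comp_measurePreserving (p := 2)
      ((g'.continuous.aestronglyMeasurable).sub hg.1) (measurePreserving_fst (μ := ν) (ν := P))]
    rfl
  refine (eLpNorm_le_mul_eLpNorm_of_ae_le_mul (c := C) (g := fun p : ℝ × Ω => g' p.1 - g p.1)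
    (ae_of_all _ fun p => ?_) 2).trans ?_
  · rw [← smul_sub, norm_smul]
    exact mul_le_mul_of_nonneg_right (hαC _ _) (norm_nonneg _)
  · rw [h1]
    exact (mul_le_mul_right hg' _).trans hδ

/-- Deterministic square integrable functions are limits of deterministic step functions. -/
theorem isApprox_deterministic (hT : 0 ≤ T) {g : ℝ → H}
    (hg : MemLp g 2 (ℓ.measure.restrict (Ioc 0 T))) :
    IsApprox (fun _ => (⊥ : MeasurableSpace Ω)) ℓ P T (fun t _ => g t) := by
  simpa using isApprox_smul_of_memLp (𝓕 := fun _ => (⊥ : MeasurableSpace Ω)) (P := P)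
    (fun _ => bot_le) hT (α := fun _ _ => 1) (C := 1) (fun t _ => ⟨fun _ => 1, measurable_const,
      ae_eq_refl _⟩) aestronglyMeasurable_const (by simp) (ae_of_all _ fun _ => continuousOn_const)
    hg

/-- A bounded deterministic operator-valued function applied to a bounded continuous adapted
process is a limit of simple integrands. -/
theorem isApprox_clm_apply {ι : Type*} (e : HilbertBasis ι ℝ H) (h𝓕 : ∀ t, 𝓕 t ≤ mΩ)
    (hT : 0 ≤ T) {R : ℝ → H →L[ℝ] H} {j : ℝ → Ω → H} {C M : ℝ}
    (hR : ∀ u, AEStronglyMeasurable (fun t => R t u) (ℓ.measure.restrict (Ioc 0 T)))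
    (hRM : ∀ t ∈ Ioc 0 T, ‖R t‖ ≤ M)
    (hj : ∀ t ∈ Icc 0 T, ∃ j' : Ω → H, Measurable[𝓕 t] j' ∧ j t =ᵐ[P] j')
    (hjm : AEStronglyMeasurable (fun p : ℝ × Ω => j p.1 p.2)
      ((ℓ.measure.restrict (Ioc 0 T)).prod P))
    (hjC : ∀ t ω, ‖j t ω‖ ≤ C) (hcont : ∀ᵐ ω ∂P, ContinuousOn (fun t => j t ω) (Icc 0 T))
    (hφm : AEStronglyMeasurable (fun p : ℝ × Ω => R p.1 (j p.1 p.2))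
      ((ℓ.measure.restrict (Ioc 0 T)).prod P)) :
    IsApprox 𝓕 ℓ P T (fun t ω => R t (j t ω)) := by
  set ν := ℓ.measure.restrict (Ioc 0 T) with hν
  have hcount := countable_hilbertBasis e
  have hn : ∀ i, ‖e i‖ = 1 := fun i => e.orthonormal.1 i
  have hin : ∀ i x, |⟪e i, x⟫_ℝ| ≤ ‖x‖ := fun i x => by
    simpa [hn i] using abs_real_inner_le_norm (e i) x
  have hsm : ∀ i, AEStronglyMeasurable (fun p : ℝ × Ω => ⟪e i, j p.1 p.2⟫_ℝ) (ν.prod P) :=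
    fun i => aestronglyMeasurable_const.inner hjm
  have hterm : ∀ i, IsApprox 𝓕 ℓ P T (fun t ω => ⟪e i, j t ω⟫_ℝ • R t (e i)) := fun i => by
    refine isApprox_smul_of_memLp h𝓕 hT (fun t ht => ?_) (hsm i)
      (fun t ω => (hin i _).trans (hjC t ω)) ?_ ?_
    · obtain ⟨j', hj', h⟩ := hj t ht
      refine ⟨fun ω => ⟪e i, j' ω⟫_ℝ, ?_, ?_⟩
      · exact (measurable_const.inner measurable_id).comp hj'
      · filter_upwards [h] with ω hω using by rw [hω]
    · filter_upwards [hcont] with ω hω using continuousOn_const.inner hω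
    · refine MemLp.of_bound (hR _) M ?_
      filter_upwards [ae_restrict_mem measurableSet_Ioc] with t ht
      simpa [hn i] using (R t).le_of_opNorm_le (hRM t ht) (e i)
  have hsum : ∀ s : Finset ι, AEStronglyMeasurable
      (fun p : ℝ × Ω => ∑ i ∈ s, ⟪e i, j p.1 p.2⟫_ℝ • R p.1 (e i)) (ν.prod P) := fun s =>
    Finset.aestronglyMeasurable_fun_sum s fun i _ => (hsm i).smul (hR _).comp_fst
  have hgood : ∀ᵐ p ∂ν.prod P, p.1 ∈ Ioc 0 T :=
    Measure.quasiMeasurePreserving_fst.ae (ae_restrict_mem measurableSet_Ioc)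
  -- expansion of `j` in the basis `e` reduces the claim to real processes
  have hlim : Tendsto (fun s : Finset ι => ∫⁻ p, ‖∑ i ∈ s, ⟪e i, j p.1 p.2⟫_ℝ • R p.1 (e i) -
      R p.1 (j p.1 p.2)‖ₑ ^ 2 ∂ν.prod P) atTop (𝓝 (∫⁻ _, 0 ∂ν.prod P)) := by
    refine tendsto_lintegral_filter_of_dominated_convergence'
      (fun _ => ENNReal.ofReal (M * (2 * C)) ^ 2) (Eventually.of_forall fun s =>
      (((hsum s).sub hφm).enorm).pow_const 2) (Eventually.of_forall fun s => ?_) ?_ ?_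
    · filter_upwards [hgood] with p hp
      gcongr
      rw [← ofReal_norm]
      refine ENNReal.ofReal_le_ofReal ?_
      have h1 : ∑ i ∈ s, ⟪e i, j p.1 p.2⟫_ℝ • R p.1 (e i) - R p.1 (j p.1 p.2) =
          R p.1 (∑ i ∈ s, ⟪e i, j p.1 p.2⟫_ℝ • e i - j p.1 p.2) := by
        rw [map_sub, map_sum]; simp_rw [map_smul]
      have h2 : ‖∑ i ∈ s, ⟪e i, j p.1 p.2⟫_ℝ • e i‖ ≤ ‖j p.1 p.2‖ := by
        rw [← sq_le_sq₀ (norm_nonneg _) (norm_nonneg _), ← real_inner_self_eq_norm_sq,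
          e.orthonormal.inner_sum]
        refine le_trans (le_of_eq ?_) (e.orthonormal.sum_inner_products_le (j p.1 p.2) (s := s))
        refine Finset.sum_congr rfl fun i _ => ?_
        simp [sq]
      rw [h1]
      refine ((R p.1).le_of_opNorm_le (hRM _ hp) _).trans (mul_le_mul_of_nonneg_left ?_
        ((norm_nonneg _).trans (hRM _ hp)))
      linarith [norm_sub_le (∑ i ∈ s, ⟪e i, j p.1 p.2⟫_ℝ • e i) (j p.1 p.2), hjC p.1 p.2]
    · rw [lintegral_const]
      exact ENNReal.mul_ne_top (ENNReal.pow_ne_top ENNReal.ofReal_ne_top) (measure_ne_top _ _)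
    · refine ae_of_all _ fun p => ?_
      have h1 : HasSum (fun i => ⟪e i, j p.1 p.2⟫_ℝ • R p.1 (e i)) (R p.1 (j p.1 p.2)) := by
        have := (e.hasSum_repr (j p.1 p.2)).mapL (R p.1)
        simpa [HilbertBasis.repr_apply_apply] using this
      have h2 : Tendsto (fun s : Finset ι => ∑ i ∈ s, ⟪e i, j p.1 p.2⟫_ℝ • R p.1 (e i)) atTop
        (𝓝 (R p.1 (j p.1 p.2))) := h1
      have h3 := ENNReal.Tendsto.pow (n := 2) (h2.sub_const (R p.1 (j p.1 p.2))).enorm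
      simpa using h3
  refine IsApprox.of_approx h𝓕 hφm fun ε hε => ?_
  rw [lintegral_zero, ← tendsto_eLpNorm_two_iff] at hlim
  obtain ⟨s, hs⟩ := (ENNReal.tendsto_nhds_zero.1 hlim ε hε).exists
  exact ⟨fun t ω => ∑ i ∈ s, ⟪e i, j t ω⟫_ℝ • R t (e i),
    IsApprox.sum h𝓕 s (fun i => (hsm i).smul (hR _).comp_fst) hterm, hsum s, hs⟩

end Approx

/-! ### Jointly measurable versions -/

section Version

variable {Q Ω : Type*} [mQ : MeasurableSpace Q] {μ : Measure Q} [IsFiniteMeasure μ]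
  {m mΩ : MeasurableSpace Ω} {P : Measure[mΩ] Ω} [IsProbabilityMeasure P]

theorem integral_mul_condExp {α : Type*} {m m₀ : MeasurableSpace α} (hm : m ≤ m₀)
    {μ : Measure[m₀] α} [IsFiniteMeasure μ] {f g : α → ℝ} (hg : AEStronglyMeasurable[m] g μ)
    (hfg : Integrable (fun a => g a * f a) μ) (hf : Integrable f μ) :
    ∫ a, g a * (μ[f | m]) a ∂μ = ∫ a, g a * f a ∂μ := by
  rw [← integral_condExp hm (f := fun a => g a * f a)]
  exact integral_congr_ae (condExp_mul_of_aestronglyMeasurable_left hg hfg hf).symm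

/-- An integrable function whose integral over every measurable rectangle vanishes is zero. -/
theorem ae_eq_zero_of_forall_rectangle {f : Q × Ω → ℝ} (hf : Integrable f (μ.prod P))
    (h : ∀ A C, MeasurableSet A → MeasurableSet C → ∫ p in A ×ˢ C, f p ∂(μ.prod P) = 0) :
    f =ᵐ[μ.prod P] 0 := by
  refine hf.ae_eq_zero_of_forall_setIntegral_eq_zero fun s hs _ => ?_
  induction s, hs using MeasurableSpace.induction_on_inter generateFrom_prod.symm
    isPiSystem_prod with
  | empty => simp
  | basic t ht =>
    obtain ⟨A, hA, C, hC, rfl⟩ := ht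
    exact h A C hA hC
  | compl t ht ih =>
    have h1 := integral_add_compl ht hf
    have h2 := h univ univ MeasurableSet.univ MeasurableSet.univ
    rw [univ_prod_univ, setIntegral_univ] at h2
    have h3 := ih (measure_lt_top _ _)
    linarith
  | iUnion t hd ht ih =>
    rw [integral_iUnion ht hd hf.integrableOn]
    simp [fun i => ih i (measure_lt_top _ _)]

/-- The version is the conditional expectation of `φ` given the product σ-algebra. It agrees with
`φ` because both have the same integral over every rectangle `A ×ˢ C`, with `C` arbitrary in `mΩ`.
-/
theorem exists_measurable_version_real (hm : m ≤ mΩ) {φ : Q × Ω → ℝ} (hφ : Measurable φ)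
    {c : ℝ} (hc : ∀ p, |φ p| ≤ c)
    (h : ∀ᵐ q ∂μ, ∃ ψ : Ω → ℝ, Measurable[m] ψ ∧ (fun ω => φ (q, ω)) =ᵐ[P] ψ) :
    ∃ ψ : Q × Ω → ℝ, Measurable[mQ.prod m] ψ ∧ φ =ᵐ[μ.prod P] ψ := by
  have hM : mQ.prod m ≤ mQ.prod mΩ := sup_le_sup le_rfl (MeasurableSpace.comap_mono hm)
  have hφi : Integrable φ (μ.prod P) :=
    Integrable.of_bound hφ.aestronglyMeasurable c (ae_of_all _ hc)
  set ψ : Q × Ω → ℝ := (μ.prod P)[φ | mQ.prod m] with hψ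
  have hψm : Measurable[mQ.prod m] ψ := stronglyMeasurable_condExp.measurable
  have hψi : Integrable ψ (μ.prod P) := integrable_condExp
  refine ⟨ψ, hψm, ?_⟩
  suffices h0 : (fun p => φ p - ψ p) =ᵐ[μ.prod P] 0 by
    filter_upwards [h0] with p hp using sub_eq_zero.1 hp
  refine ae_eq_zero_of_forall_rectangle (hφi.sub hψi) fun A C hA hC => ?_
  -- Replace the indicator of `C` by its conditional expectation `k` given `m`.
  set k : Ω → ℝ := P[C.indicator (fun _ => (1 : ℝ)) | m] with hk
  have hkm : Measurable[m] k := stronglyMeasurable_condExp.measurable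
  have hk1 : ∀ᵐ ω ∂P, ‖k ω‖ ≤ 1 := by
    refine ae_bdd_abs_condExp_of_ae_bdd_abs (R := 1) (ae_of_all _ fun ω => ?_)
    by_cases hω : ω ∈ C <;> simp [hω]
  have hCi : Integrable (C.indicator (fun _ => (1 : ℝ))) P :=
    (integrable_const 1).indicator hC
  let a : Q → ℝ := A.indicator (fun _ => 1)
  have ham : Measurable a := measurable_const.indicator hA
  have ha1 : ∀ q, ‖a q‖ ≤ 1 := fun q => by by_cases hq : q ∈ A <;> simp [a, hq]
  have hset : ∀ f : Q × Ω → ℝ, Integrable f (μ.prod P) →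
      (∀ᵐ q ∂μ, ∃ g : Ω → ℝ, Measurable[m] g ∧ (fun ω => f (q, ω)) =ᵐ[P] g) →
      ∫ p in A ×ˢ C, f p ∂(μ.prod P) = ∫ p, (a p.1 * k p.2) * f p ∂(μ.prod P) := by
    intro f hf hfm
    have e1 : ∫ p in A ×ˢ C, f p ∂(μ.prod P) =
        ∫ p, (a p.1 * C.indicator (fun _ => (1 : ℝ)) p.2) * f p ∂(μ.prod P) := by
      rw [← integral_indicator (hA.prod hC)]
      congr 1
      ext p
      by_cases h1 : p.1 ∈ A <;> by_cases h2 : p.2 ∈ C <;> simp [indicator, a, h1, h2]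
    have i1 : Integrable (fun p : Q × Ω => (a p.1 * C.indicator (fun _ => (1 : ℝ)) p.2) * f p)
        (μ.prod P) := by
      refine hf.bdd_mul (c := 1 * 1) ((ham.comp measurable_fst).mul
        ((measurable_const.indicator hC).comp measurable_snd)).aestronglyMeasurable
        (ae_of_all _ fun p => ?_)
      rw [norm_mul]
      refine mul_le_mul (ha1 _) ?_ (norm_nonneg _) zero_le_one
      by_cases h2 : p.2 ∈ C <;> simp [h2]
    have i2 : Integrable (fun p : Q × Ω => (a p.1 * k p.2) * f p) (μ.prod P) := by
      refine hf.bdd_mul (c := 1 * 1) ((ham.comp measurable_fst).mul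
        ((hkm.mono hm le_rfl).comp measurable_snd)).aestronglyMeasurable ?_
      filter_upwards [Measure.quasiMeasurePreserving_snd.ae hk1] with p hp
      rw [norm_mul]
      exact mul_le_mul (ha1 _) hp (norm_nonneg _) zero_le_one
    rw [e1, integral_prod _ i1, integral_prod _ i2]
    refine integral_congr_ae ?_
    filter_upwards [hfm, hf.prod_right_ae] with q ⟨g, hg, hfg⟩ hfq
    have hgm : AEStronglyMeasurable[m] (fun ω => f (q, ω)) P :=
      ⟨g, hg.stronglyMeasurable, hfg⟩
    have := integral_mul_condExp hm (f := C.indicator (fun _ => (1 : ℝ))) hgm (by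
      refine (hfq.indicator hC).congr (ae_of_all _ fun ω => ?_)
      by_cases h2 : ω ∈ C <;> simp [h2]) hCi
    have e2 : ∀ κ : Ω → ℝ, ∫ ω, (a q * κ ω) * f (q, ω) ∂P = a q * ∫ ω, f (q, ω) * κ ω ∂P :=
      fun κ => by rw [← integral_const_mul]; congr 1; ext ω; ring
    simp only [e2]
    rw [← this]
  rw [integral_sub hφi.integrableOn hψi.integrableOn, hset φ hφi h, hset ψ hψi
    (ae_of_all _ fun q => ⟨fun ω => ψ (q, ω), hψm.comp measurable_prodMk_left, ae_eq_refl _⟩),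
    sub_eq_zero]
  refine (integral_mul_condExp hM ?_ ?_ hφi).symm
  · have : Measurable[mQ.prod m] (fun p : Q × Ω => a p.1 * k p.2) :=
      (ham.comp measurable_fst).mul (hkm.comp measurable_snd)
    exact this.stronglyMeasurable.aestronglyMeasurable
  · refine hφi.bdd_mul (c := 1 * 1) ((ham.comp measurable_fst).mul
        ((hkm.mono hm le_rfl).comp measurable_snd)).aestronglyMeasurable ?_
    filter_upwards [Measure.quasiMeasurePreserving_snd.ae hk1] with p hp
    rw [norm_mul]
    exact mul_le_mul (ha1 _) hp (norm_nonneg _) zero_le_one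

/-- A jointly measurable process, almost all of whose values are almost surely `m`-measurable, has
a version which is jointly measurable with respect to `m`. -/
theorem exists_measurable_version {E : Type*} [MeasurableSpace E] [StandardBorelSpace E]
    [Nonempty E] (hm : m ≤ mΩ) {φ : Q × Ω → E} (hφ : Measurable φ)
    (h : ∀ᵐ q ∂μ, ∃ ψ : Ω → E, Measurable[m] ψ ∧ (fun ω => φ (q, ω)) =ᵐ[P] ψ) :
    ∃ ψ : Q × Ω → E, Measurable[mQ.prod m] ψ ∧ φ =ᵐ[μ.prod P] ψ := by
  obtain ⟨g₀, hg₀⟩ := exists_measurableEmbedding_real E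
  have hat : MeasurableEmbedding Real.arctan :=
    Real.continuous_arctan.measurableEmbedding Real.arctan_injective
  have hg := hat.comp hg₀
  obtain ⟨d, hd, hdg⟩ := hg.exists_measurable_extend measurable_id fun _ => inferInstance
  obtain ⟨ψ, hψ, hφψ⟩ := exists_measurable_version_real hm (μ := μ) (P := P)
    (φ := fun p => (Real.arctan ∘ g₀) (φ p)) (c := Real.pi / 2) (hg.measurable.comp hφ)
    (fun p => abs_le.2 ⟨(Real.neg_pi_div_two_lt_arctan _).le, (Real.arctan_lt_pi_div_two _).le⟩) (by
      filter_upwards [h] with q ⟨ψ, h1, h2⟩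
      refine ⟨fun ω => (Real.arctan ∘ g₀) (ψ ω), hg.measurable.comp h1, ?_⟩
      filter_upwards [h2] with ω hω using by rw [hω])
  refine ⟨fun p => d (ψ p), hd.comp hψ, ?_⟩
  filter_upwards [hφψ] with p hp
  rw [← hp]
  exact (congrFun hdg (φ p)).symm

end Version

/-! ### The solution as a pathwise function of the noise -/

section Model

variable {Ω H ι : Type*} [mΩ : MeasurableSpace Ω] [NormedAddCommGroup H] [InnerProductSpace ℝ H]
  [CompleteSpace H] [SecondCountableTopology H] [MeasurableSpace H] [BorelSpace H]

/-- `Y_t` is a version of `e^{At} x + ∫_0^t e^{A(t-s)} σ_s dW_{ℓ(s)} + V_t`. -/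
def IsForcing (W : ℝ≥0 → H → Ω → ℝ) (V : ℝ → Ω → H) (ℓ : StieltjesFunction ℝ) (P : Measure Ω)
    (S : ℝ → H →L[ℝ] H) (σ : ℝ → H →L[ℝ] H) (x : H) (Y : ℝ → Ω → H) (t : ℝ) : Prop :=
  ∃ Z : Ω → H, IsItoIntegralH W V ℓ P t (fun s _ => (S (t - s)).comp (σ s)) Z ∧
    Y t =ᵐ[P] fun ω => S t x + Z ω + V t ω

/-- The setting of the theorem after all null sets and versions have been chosen: `X` is a jointly
measurable process which, path by path, solves the mild equation with the jointly measurable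
forcing `Y`; and `Y` is the stochastic convolution plus `e^{At} x + V_t` at almost every time and
at time `T`. The constant `K` bounds all the coefficients on `[0, T]`. -/
structure Model (W : ℝ≥0 → H → Ω → ℝ) (V : ℝ → Ω → H) (ℓ : StieltjesFunction ℝ) (P : Measure Ω)
    (S : ℝ → H →L[ℝ] H) (b : ℝ → H → H) (σ : ℝ → H →L[ℝ] H) (B : ℝ → H → H →L[ℝ] H) (T K : ℝ)
    (x : H) (X Y : ℝ → Ω → H) : Prop where
  coeffs : Coeffs S b B T K
  T_pos : 0 < T
  brownian : IsCylindricalBrownian W P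
  V_meas : ∀ t, 0 ≤ t → Measurable (V t)
  indep : Indep (sigmaW W) (sigmaV V) P
  ℓ_zero : ℓ 0 = 0
  σ_meas : ∀ u : H, Measurable (fun t : ℝ≥0 => σ t u)
  σ_norm : ∀ t ∈ Icc 0 T, ‖σ t‖ ≤ K
  σ_unit : ∀ t, 0 ≤ t → IsUnit (σ t)
  σinv_meas : ∀ u : H, Measurable (fun t : ℝ≥0 => Ring.inverse (σ t) u)
  σinv_norm : ∀ t ∈ Icc 0 T, ‖Ring.inverse (σ t)‖ ≤ K
  X_meas : Measurable (fun p : ℝ × Ω => X p.1 p.2)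
  Y_meas : Measurable (fun p : ℝ × Ω => Y p.1 p.2)
  mild : ∀ᵐ ω ∂P, IsMildSol S b 0 T (fun t => Y t ω) (fun t => X t ω)
  forcing : ∀ᵐ t, t ∈ Icc 0 T → IsForcing W V ℓ P S σ x Y t
  forcing_end : IsForcing W V ℓ P S σ x Y T

theorem measurable_hsNormSq (e : HilbertBasis ι ℝ H) {S : ℝ → H →L[ℝ] H}
    (hS : ∀ x, ContinuousOn (fun t => S t x) (Ici 0)) :
    Measurable fun t : ℝ≥0 => hsNormSq e (S t) := by
  have := countable_hilbertBasis e
  refine Measurable.tsum fun i => ?_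
  exact (((hS (e i)).comp_continuous NNReal.continuous_coe fun t => t.2).measurable.enorm).pow_const
    2

/-- For almost every `t` the stochastic convolution exists at time `t`. -/
theorem ae_lintegral_hsNormSq_ne_top (e : HilbertBasis ι ℝ H) {S : ℝ → H →L[ℝ] H}
    (hS : ∀ x, ContinuousOn (fun t => S t x) (Ici 0)) {T : ℝ}
    (hHS : ∫⁻ t in Ioc 0 T, hsNormSq e (S t) ≠ ∞) (ℓ : StieltjesFunction ℝ) :
    ∀ᵐ t, t ∈ Icc 0 T → ∫⁻ s in Ioc 0 t, hsNormSq e (S (t - s)) ∂ℓ.measure ≠ ∞ := by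
  set ν := ℓ.measure.restrict (Ioc 0 T) with hν
  let h : ℝ → ℝ≥0∞ := fun r => hsNormSq e (S (r.toNNReal : ℝ))
  have hh : Measurable h := (measurable_hsNormSq e hS).comp measurable_real_toNNReal
  let G : ℝ → ℝ → ℝ≥0∞ := fun t s => (Icc 0 T).indicator h (t - s)
  have hG : Measurable (Function.uncurry G) :=
    (hh.indicator measurableSet_Icc).comp (measurable_fst.sub measurable_snd)
  have hC : ∫⁻ t, (Icc 0 T).indicator h t ≠ ∞ := by
    rw [lintegral_indicator measurableSet_Icc, ← setLIntegral_congr Ioc_ae_eq_Icc,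
      setLIntegral_congr_fun measurableSet_Ioc (g := fun t => hsNormSq e (S t)) fun t ht => ?_]
    · exact hHS
    · simp only [h, Real.coe_toNNReal _ ht.1.le]
  have hfin : ∫⁻ t, ∫⁻ s, G t s ∂ν ≠ ∞ := by
    rw [lintegral_lintegral_swap hG.aemeasurable]
    have : ∀ s, ∫⁻ t, G t s = ∫⁻ t, (Icc 0 T).indicator h t := fun s =>
      lintegral_sub_right_eq_self (μ := volume) ((Icc 0 T).indicator h) s
    simp_rw [this]
    rw [lintegral_const]
    exact ENNReal.mul_ne_top hC (measure_ne_top _ _)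
  filter_upwards [ae_lt_top (hG.lintegral_prod_right') hfin] with t ht htT
  refine ne_top_of_le_ne_top ht.ne ?_
  have hsub : Ioc 0 t ⊆ Ioc 0 T := Ioc_subset_Ioc_right htT.2
  have e1 : ∫⁻ s in Ioc 0 t, hsNormSq e (S (t - s)) ∂ℓ.measure =
      ∫⁻ s in Ioc 0 t, G t s ∂ℓ.measure := by
    refine setLIntegral_congr_fun measurableSet_Ioc fun s hs => ?_
    have h0 : 0 ≤ t - s := by linarith [hs.2]
    simp only [G]
    rw [indicator_of_mem (show t - s ∈ Icc 0 T from ⟨h0, by linarith [hs.1, htT.2]⟩)]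
    simp only [h, Real.coe_toNNReal _ h0]
  rw [e1]
  exact lintegral_mono' (Measure.restrict_mono hsub le_rfl) le_rfl

/-- On a bounded time interval the bounds of the assumptions reduce to a single constant. The joint
measurability of `B` follows from that of `∇b`, as every `S t` is injective. -/
theorem exists_coeffs {A : H →ₗ.[ℝ] H} {S : ℝ → H →L[ℝ] H} (hS : IsContractionSemigroup A S)
    (hS_inj : ∀ t, 0 ≤ t → Function.Injective (S t)) {b : ℝ → H → H} {σ : ℝ → H →L[ℝ] H}
    {B : ℝ → H → H →L[ℝ] H} (hbσ : StandingAssumptions b σ) (hH1 : AssumptionH1 S b B)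
    (hH2 : AssumptionH2 σ) {T : ℝ} (hT : 0 ≤ T) :
    ∃ K, Coeffs S b B T K ∧ (∀ t ∈ Icc 0 T, ‖σ t‖ ≤ K) ∧
      ∀ t ∈ Icc 0 T, ‖Ring.inverse (σ t)‖ ≤ K := by
  obtain ⟨K₁, K₂, hK₁, -, hK₂, -, hK⟩ := hH1.bounds
  obtain ⟨L₁, L₂, hL₁, -, hL₂, -, hL⟩ := hH2.bounds
  obtain ⟨k, hk⟩ := hbσ.lipschitz_b T
  have hmono : ∀ {f : ℝ → ℝ}, MonotoneOn f (Ici 0) → ∀ t ∈ Icc 0 T, f t ≤ f T :=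
    fun hf t ht => hf ht.1 hT ht.2
  have hd : ∀ t, 0 ≤ t → Differentiable ℝ (b t) := fun t ht =>
    (hH1.contDiff_b t ht).differentiable (by norm_num)
  refine ⟨max (max (K₁ T) (K₂ T)) (max (max (L₁ T) (L₂ T)) k), ⟨hT, ?_, hS.zero, hS.add,
    hS.norm_le_one, hS.continuousOn, hbσ.measurable_b, fun t ht x y => ?_, hd, ?_,
    hH1.differentiable_B, fun t ht x => ?_, fun t ht x => ?_, hH1.conj⟩, fun t ht => ?_,
    fun t ht => ?_⟩
  · exact le_max_of_le_right (le_max_of_le_right k.2)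
  · have := (hk t ht).dist_le_mul x y
    rw [dist_eq_norm, dist_eq_norm] at this
    exact this.trans (mul_le_mul_of_nonneg_right
      (le_max_of_le_right (le_max_right _ _)) (norm_nonneg _))
  · have hSm : Measurable fun p : ℝ≥0 × H => S p.1 p.2 :=
      measurable_clm_uncurry (A := fun t : ℝ≥0 => S t) fun u =>
        ((hS.continuousOn u).comp_continuous NNReal.continuous_coe fun t => t.2).measurable
    refine measurable_of_injective_apply (O := fun t x => S t x) hSm (fun t => hS_inj t t.2)
      (τ := fun p : (ℝ≥0 × H) × H => p.1.1) measurable_fst.fst ?_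
    have : (fun p : (ℝ≥0 × H) × H => S p.1.1 (B p.1.1 p.1.2 p.2)) =
        fun p => fderiv ℝ (b p.1.1) p.1.2 (S p.1.1 p.2) := by
      ext p
      exact DFunLike.congr_fun (hH1.conj p.1.1 p.1.1.2 p.1.2) p.2
    rw [this]
    exact (Coeffs.measurable_fderiv_apply hbσ.measurable_b hd).comp
      (f := fun p : (ℝ≥0 × H) × H => (p.1, S p.1.1 p.2)) (measurable_fst.prodMk
      (hSm.comp (f := fun p : (ℝ≥0 × H) × H => (p.1.1, p.2)) (by fun_prop)))
  · exact ((hK t ht.1 x).1.trans (hmono hK₁ t ht)).trans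
      (le_max_of_le_left (le_max_left _ _))
  · exact ((hK t ht.1 x).2.trans (hmono hK₂ t ht)).trans
      (le_max_of_le_left (le_max_right _ _))
  · exact ((hL t ht.1).1.trans (hmono hL₁ t ht)).trans
      (le_max_of_le_right (le_max_of_le_left (le_max_left _ _)))
  · exact ((hL t ht.1).2.trans (hmono hL₂ t ht)).trans
      (le_max_of_le_right (le_max_of_le_left (le_max_right _ _)))

theorem ae_ae_swap {α β : Type*} [MeasurableSpace α] [MeasurableSpace β] {μ : Measure α}
    {ν : Measure β} [SFinite μ] [SFinite ν] {p : α × β → Prop} (h : ∀ᵐ z ∂μ.prod ν, p z) :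
    ∀ᵐ y ∂ν, ∀ᵐ x ∂μ, p (x, y) :=
  Measure.ae_ae_of_ae_prod
    ((Measure.measurePreserving_swap (μ := ν) (ν := μ)).quasiMeasurePreserving.ae h)

/-- A solution of the equation agrees, for almost every time and at the terminal time, with the
first component of a `Model`. -/
theorem exists_model (e : HilbertBasis ι ℝ H) {P : Measure Ω} [IsProbabilityMeasure P]
    {A : H →ₗ.[ℝ] H} {S : ℝ → H →L[ℝ] H} (hS : IsContractionSemigroup A S)
    (hS_HS : ∀ t₀ : ℝ, 0 < t₀ → ∫⁻ t in Ioc 0 t₀, hsNormSq e (S t) ≠ ∞)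
    (hS_inj : ∀ t, 0 ≤ t → Function.Injective (S t))
    {b : ℝ → H → H} {σ : ℝ → H →L[ℝ] H} {B : ℝ → H → H →L[ℝ] H}
    (hbσ : StandingAssumptions b σ) (hH1 : AssumptionH1 S b B) (hH2 : AssumptionH2 σ)
    {W : ℝ≥0 → H → Ω → ℝ} (hW : IsCylindricalBrownian W P)
    {V : ℝ → Ω → H} (hV : IsCadlagProcess V P) (hWV : Indep (sigmaW W) (sigmaV V) P)
    {T : ℝ} (hT : 0 < T) {ℓ : StieltjesFunction ℝ} (hℓ0 : ℓ 0 = 0)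
    (hℓ_end : ∫⁻ t in Ioc 0 T, hsNormSq e (S (T - t)) ∂ℓ.measure ≠ ∞)
    {x : H} {X : ℝ → Ω → H} (hX : IsMildSolution e W V ℓ P S b σ T x X) :
    ∃ K X' Y, Model W V ℓ P S b σ B T K x X' Y ∧
      (∀ᵐ ω ∂P, ∀ᵐ t, t ∈ Icc 0 T → X t ω = X' t ω) ∧ X T =ᵐ[P] X' T := by
  obtain ⟨K, hC, hσ1, hσ2⟩ := exists_coeffs hS hS_inj hbσ hH1 hH2 hT.le
  have hTT : T ∈ Icc 0 T := ⟨hT.le, le_rfl⟩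
  let X₀ : ℝ × Ω → H := hX.aestronglyMeasurable.mk _
  have hX₀ : Measurable X₀ := hX.aestronglyMeasurable.stronglyMeasurable_mk.measurable
  have hXX₀ := hX.aestronglyMeasurable.ae_eq_mk
  have h1 : ∀ᵐ ω ∂P, ∀ᵐ t, t ∈ Icc 0 T → X t ω = X₀ (t, ω) := by
    filter_upwards [ae_ae_swap hXX₀] with ω hω
    exact (ae_restrict_iff' measurableSet_Icc).1 hω
  have h2 : ∀ᵐ t, t ∈ Icc 0 T → X t =ᵐ[P] fun ω => X₀ (t, ω) :=
    (ae_restrict_iff' measurableSet_Icc).1 (Measure.ae_ae_of_ae_prod hXX₀)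
  -- the drift, written so as to be measurable for all arguments
  let D : (ℝ × Ω → H) → ℝ → Ω → H := fun ξ t ω =>
    ∫ s in (0 : ℝ)..t, S ((t - s).toNNReal : ℝ) (b (s.toNNReal : ℝ) (ξ (s, ω)))
  have hD : ∀ ξ : ℝ × Ω → H, Measurable ξ → Measurable fun p : ℝ × Ω => D ξ p.1 p.2 := by
    intro ξ hξ
    refine measurable_intervalIntegral (a := fun _ => 0) (b := Prod.fst) measurable_const
      measurable_fst (f := fun (p : ℝ × Ω) s =>
        S ((p.1 - s).toNNReal : ℝ) (b (s.toNNReal : ℝ) (ξ (s, p.2)))) ?_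
    refine hC.measurable_S_sub (t := fun q : (ℝ × Ω) × ℝ => q.1.1 - q.2) (by fun_prop) ?_
    exact hC.b_meas.comp (f := fun q : (ℝ × Ω) × ℝ => (q.2.toNNReal, ξ (q.2, q.1.2)))
      ((measurable_snd.real_toNNReal).prodMk (hξ.comp (by fun_prop)))
  have hDeq : ∀ ξ : ℝ × Ω → H, ∀ ω, (∀ᵐ t, t ∈ Icc 0 T → X t ω = ξ (t, ω)) → ∀ t ∈ Icc 0 T,
      ∫ s in (0 : ℝ)..t, S (t - s) (b s (X s ω)) = D ξ t ω := by
    intro ξ ω hω t ht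
    refine intervalIntegral.integral_congr_ae ?_
    filter_upwards [hω] with s hs hst
    rw [uIoc_of_le ht.1] at hst
    rw [hs ⟨hst.1.le, hst.2.trans ht.2⟩, Real.coe_toNNReal _ hst.1.le,
      Real.coe_toNNReal _ (by linarith [hst.2])]
  obtain ⟨Z, hZ, hXT⟩ := hX.equation T hTT hℓ_end
  have hXTm : AEStronglyMeasurable (X T) P := by
    have : AEStronglyMeasurable (fun ω => S T x + D X₀ T ω + Z ω + V T ω) P :=
      ((aestronglyMeasurable_const.add ((hD X₀ hX₀).comp
        (f := fun ω => (T, ω)) (by fun_prop)).aestronglyMeasurable).add hZ.1).add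
        (hV.measurable T hT.le).aestronglyMeasurable
    refine this.congr ?_
    filter_upwards [hXT, h1] with ω hω hω1
    rw [hω, hDeq X₀ ω hω1 T hTT]
  -- The jointly measurable modification `X₀` agrees with `X` for almost every time only, so the
  -- value at `T` is restored by hand.
  let X' : ℝ → Ω → H := fun t ω => if t = T then hXTm.mk _ ω else X₀ (t, ω)
  have hX' : Measurable fun p : ℝ × Ω => X' p.1 p.2 :=
    Measurable.ite (measurableSet_eq_fun measurable_fst measurable_const)
      (hXTm.stronglyMeasurable_mk.measurable.comp measurable_snd) hX₀
  have hne : ∀ᵐ t : ℝ, t ≠ T := by simp [ae_iff, measure_singleton]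
  have h1' : ∀ᵐ ω ∂P, ∀ᵐ t, t ∈ Icc 0 T → X t ω = X' t ω := by
    filter_upwards [h1] with ω hω
    filter_upwards [hω, hne] with t ht htT htI
    simp only [X', if_neg htT]
    exact ht htI
  have hT' : X T =ᵐ[P] X' T := by
    simp only [X', if_true]
    exact hXTm.ae_eq_mk
  let ξ : ℝ × Ω → H := fun p => X' p.1 p.2
  -- With the forcing defined as solution minus drift, the mild equation holds for every `t`.
  let Y : ℝ → Ω → H := fun t ω => X' t ω - D ξ t ω
  have hforce : ∀ t ∈ Icc 0 T, X t =ᵐ[P] X' t →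
      ∫⁻ s in Ioc 0 t, hsNormSq e (S (t - s)) ∂ℓ.measure ≠ ∞ → IsForcing W V ℓ P S σ x Y t := by
    intro t ht hXt hfin
    obtain ⟨Z, hZ, hXt'⟩ := hX.equation t ht hfin
    refine ⟨Z, hZ, ?_⟩
    filter_upwards [hXt, hXt', h1'] with ω hω hω' hω1
    simp only [Y]
    rw [← hω, hω', hDeq ξ ω hω1 t ht]
    abel
  refine ⟨K, X', Y, ⟨hC, hT, hW, hV.measurable, hWV, hℓ0, hbσ.measurable_σ, hσ1, hH2.isUnit,
    fun u => ?_, hσ2, hX', hX'.sub (hD ξ hX'), ?_, ?_, ?_⟩, h1', hT'⟩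
  · refine measurable_of_injective_apply (O := fun t x => σ t x)
      (measurable_clm_uncurry hbσ.measurable_σ) (fun t => ?_) (τ := fun t : ℝ≥0 => t)
      measurable_id ?_
    · exact Function.LeftInverse.injective fun u => ringInverse_apply_apply (hH2.isUnit t t.2) u
    · simp_rw [fun t : ℝ≥0 => apply_ringInverse_apply (hH2.isUnit t t.2) u]
      exact measurable_const
  · filter_upwards [h1', hX.integrable_drift] with ω hω hint
    have e1 : ∀ t ∈ Icc 0 T, D ξ t ω = ∫ s in (0 : ℝ)..t, S (t - s) (b s (X' s ω)) := by
      intro t ht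
      refine intervalIntegral.integral_congr fun s hs => ?_
      rw [uIcc_of_le ht.1] at hs
      simp only [ξ, Real.coe_toNNReal _ hs.1,
        Real.coe_toNNReal _ (by linarith [hs.2] : 0 ≤ t - s)]
    refine ⟨?_, fun t ht => ?_⟩
    · rw [intervalIntegrable_iff_integrableOn_Icc_of_le hT.le]
      refine hint.congr_fun_ae ?_
      rw [EventuallyEq, ae_restrict_iff' measurableSet_Icc]
      filter_upwards [hω] with t ht htI
      rw [ht htI]
    · simp only [Y]
      rw [e1 t ht]
      abel
  · filter_upwards [h2, hne, ae_lintegral_hsNormSq_ne_top e hS.continuousOn (hS_HS T hT) ℓ]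
      with t ht htT hfin htI
    refine hforce t htI ?_ (hfin htI)
    simp only [X', if_neg htT]
    exact ht htI
  · exact hforce T hTT hT' hℓ_end

end Model

/-! ### Measurability with respect to a sub-σ-algebra -/

section SubAlgebra

variable {Ω H ι : Type*} {m mΩ : MeasurableSpace Ω} {P : Measure[mΩ] Ω} [NormedAddCommGroup H]
  [InnerProductSpace ℝ H] [CompleteSpace H]

theorem aestronglyMeasurable_sub_of_tendsto_ae {f : ℕ → Ω → H} {g : Ω → H}
    (hf : ∀ n, AEStronglyMeasurable[m] (f n) P)
    (h : ∀ᵐ ω ∂P, Tendsto (fun n => f n ω) atTop (𝓝 (g ω))) : AEStronglyMeasurable[m] g P := by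
  choose f' hf' hff' using hf
  refine ⟨fun ω => limUnder atTop fun n => f' n ω,
    @StronglyMeasurable.limUnder _ _ _ m _ _ _ _ _ _ _ hf', ?_⟩
  filter_upwards [h, ae_all_iff.2 hff'] with ω hω hω'
  refine (Tendsto.limUnder_eq ?_).symm
  simpa only [hω'] using hω

theorem aestronglyMeasurable_sub_of_tendsto_eLpNorm (hm : m ≤ mΩ) {f : ℕ → Ω → ℝ} {g : Ω → ℝ}
    (hf : ∀ n, AEStronglyMeasurable[m] (f n) P) (hg : AEStronglyMeasurable[mΩ] g P)
    (h : Tendsto (fun n => eLpNorm (fun ω => f n ω - g ω) 2 P) atTop (𝓝 0)) :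
    AEStronglyMeasurable[m] g P := by
  have h1 := tendstoInMeasure_of_tendsto_eLpNorm (μ := P) (p := 2) (f := f) (g := g) two_ne_zero
    (fun n => (hf n).mono hm) hg h
  obtain ⟨ns, -, hns⟩ := h1.exists_seq_tendsto_ae
  exact aestronglyMeasurable_sub_of_tendsto_ae (fun n => hf (ns n)) hns

theorem aestronglyMeasurable_sub_of_inner (e : HilbertBasis ι ℝ H) [Countable ι] {g : Ω → H}
    (h : ∀ i, AEStronglyMeasurable[m] (fun ω => ⟪g ω, e i⟫_ℝ) P) :
    AEStronglyMeasurable[m] g P := by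
  obtain ⟨s, hs⟩ := exists_seq_tendsto (atTop : Filter (Finset ι))
  refine aestronglyMeasurable_sub_of_tendsto_ae
    (f := fun n ω => ∑ i ∈ s n, ⟪g ω, e i⟫_ℝ • e i) (fun n => ?_) (ae_of_all _ fun ω => ?_)
  · choose k hk hk' using h
    refine ⟨fun ω => ∑ i ∈ s n, k i ω • e i,
      Finset.stronglyMeasurable_fun_sum _ fun i _ => (hk i).smul_const _, ?_⟩
    filter_upwards [ae_all_iff.2 hk'] with ω hω using Finset.sum_congr rfl fun i _ => by rw [hω i]
  · have h1 : HasSum (fun i => ⟪g ω, e i⟫_ℝ • e i) (g ω) := by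
      have := e.hasSum_repr (g ω)
      simpa [HilbertBasis.repr_apply_apply, real_inner_comm] using this
    have h2 : Tendsto (fun s : Finset ι => ∑ i ∈ s, ⟪g ω, e i⟫_ℝ • e i) atTop (𝓝 (g ω)) := h1
    exact h2.comp hs

end SubAlgebra

section LpTwo

theorem tendsto_integral_inner {α E : Type*} [MeasurableSpace α] {μ : Measure α}
    [NormedAddCommGroup E] [InnerProductSpace ℝ E] {f : ℕ → α → E} {f' g : α → E}
    (hf : ∀ n, MemLp (f n) 2 μ) (hf' : MemLp f' 2 μ) (hg : MemLp g 2 μ)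
    (h : Tendsto (fun n => eLpNorm (fun a => f n a - f' a) 2 μ) atTop (𝓝 0)) :
    Tendsto (fun n => ∫ a, ⟪f n a, g a⟫_ℝ ∂μ) atTop (𝓝 (∫ a, ⟪f' a, g a⟫_ℝ ∂μ)) := by
  have h1 : Tendsto (fun n => (hf n).toLp) atTop (𝓝 hf'.toLp) :=
    (Lp.tendsto_Lp_iff_tendsto_eLpNorm'' _ hf _ hf').2 h
  have h2 : ∀ {k : α → E} (hk : MemLp k 2 μ),
      ⟪hk.toLp, hg.toLp⟫_ℝ = ∫ a, ⟪k a, g a⟫_ℝ ∂μ := fun hk => by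
    rw [L2.inner_def]
    refine integral_congr_ae ?_
    filter_upwards [hk.coeFn_toLp, hg.coeFn_toLp] with a h3 h4 using by rw [h3, h4]
  have h3 := Tendsto.inner (𝕜 := ℝ) h1 (tendsto_const_nhds (x := hg.toLp))
  simpa only [h2] using h3

end LpTwo

section Ito

variable {Ω H ι : Type*} [mΩ : MeasurableSpace Ω] [NormedAddCommGroup H] [InnerProductSpace ℝ H]
  [CompleteSpace H] [SecondCountableTopology H] [MeasurableSpace H] [BorelSpace H]
  {P : Measure Ω} [IsProbabilityMeasure P] {W : ℝ≥0 → H → Ω → ℝ}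
  {V : ℝ → Ω → H} {ℓ : StieltjesFunction ℝ} {T : ℝ}

theorem SimpleIntegrand.measurable_stochInt (Φ : SimpleIntegrand H (history W V ℓ) T) :
    Measurable[history W V ℓ T] (Φ.stochInt W ℓ) := by
  unfold stochInt
  refine Finset.measurable_sum _ fun j _ => ?_
  have h1 := (Φ.left_le_right j).trans (Φ.right_le j)
  exact ((Φ.measurable_coef j).mono (history_mono ℓ h1) le_rfl).mul
    ((measurable_history_W ℓ (Φ.right_le j) _).sub (measurable_history_W ℓ h1 _))

theorem IsItoIntegral.aestronglyMeasurable_history (hW : IsCylindricalBrownian W P)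
    (hV : ∀ t, 0 ≤ t → Measurable (V t)) {φ : ℝ → Ω → H} {I : Ω → ℝ}
    (h : IsItoIntegral W V ℓ P T φ I) : AEStronglyMeasurable[history W V ℓ T] I P := by
  obtain ⟨-, hI, Φ, -, hΦ⟩ := h
  exact aestronglyMeasurable_sub_of_tendsto_eLpNorm (history_le hW.measurable hV ℓ T)
    (fun n => (Φ n).measurable_stochInt.stronglyMeasurable.aestronglyMeasurable) hI.1 hΦ

/-- The covariance of a simple stochastic integral with an increment of the noise. -/
theorem SimpleIntegrand.integral_stochInt_mul_incr (hW : IsCylindricalBrownian W P)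
    (hV : ∀ t, 0 ≤ t → Measurable (V t)) (hWV : Indep (sigmaW W) (sigmaV V) P) (hℓ0 : ℓ 0 = 0)
    (Φ : SimpleIntegrand H (history W V ℓ) T) {a c : ℝ} (ha : 0 ≤ a) (hac : a ≤ c) (u : H) :
    ∫ ω, Φ.stochInt W ℓ ω * (W (ℓ c).toNNReal u ω - W (ℓ a).toNNReal u ω) ∂P =
      ∫ p, ⟪Φ.val p.1 p.2, (Ioc a c).indicator (fun _ => u) p.1⟫_ℝ
        ∂((ℓ.measure.restrict (Ioc 0 T)).prod P) := by
  obtain ⟨C, hC0, hC⟩ := Φ.exists_bound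
  set ν := ℓ.measure.restrict (Ioc 0 T) with hν
  set N : Ω → ℝ := fun ω => W (ℓ c).toNNReal u ω - W (ℓ a).toNNReal u ω with hN
  let I : Fin Φ.n → Ω → ℝ := fun j ω => Φ.coef j ω *
    (W (ℓ (Φ.right j)).toNNReal (Φ.dir j) ω - W (ℓ (Φ.left j)).toNNReal (Φ.dir j) ω)
  have hNm : MemLp N 2 P := (hW.memLp _ _).sub (hW.memLp _ _)
  have hI : ∀ j, MemLp (I j) 2 P := fun j => by
    refine MemLp.of_le_mul (c := C) ((hW.memLp (ℓ (Φ.right j)).toNNReal (Φ.dir j)).sub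
      (hW.memLp (ℓ (Φ.left j)).toNNReal (Φ.dir j))) ?_ (ae_of_all _ fun ω => ?_)
    · exact ((Φ.measurable_coef' hW hV j).mul
        ((hW.measurable _ _).sub (hW.measurable _ _))).aestronglyMeasurable
    · rw [norm_mul]
      exact mul_le_mul_of_nonneg_right (hC j ω) (norm_nonneg _)
  let X : Fin Φ.n → ℝ × Ω → ℝ := fun j p =>
    (Ioc (Φ.left j) (Φ.right j) ∩ Ioc a c).indicator (fun _ => (1 : ℝ)) p.1 *
      (Φ.coef j p.2 * ⟪Φ.dir j, u⟫_ℝ)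
  have hXi : ∀ j, Integrable (X j) (ν.prod P) := fun j => by
    refine Integrable.of_bound (C := 1 * (C * |⟪Φ.dir j, u⟫_ℝ|)) ?_ (ae_of_all _ fun p => ?_)
    · exact (((measurable_const.indicator (measurableSet_Ioc.inter measurableSet_Ioc)).comp
        measurable_fst).mul (((Φ.measurable_coef' hW hV j).comp measurable_snd).mul_const
        _)).aestronglyMeasurable
    · simp only [X, norm_mul, Real.norm_eq_abs]
      refine mul_le_mul ?_ (mul_le_mul_of_nonneg_right (hC j _) (abs_nonneg _))
        (mul_nonneg (abs_nonneg _) (abs_nonneg _)) zero_le_one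
      by_cases h : p.1 ∈ Ioc (Φ.left j) (Φ.right j) ∩ Ioc a c
      · simp only [indicator_of_mem h, abs_one, le_refl]
      · simp only [indicator_of_notMem h, abs_zero, zero_le_one]
  have hval : ∀ p : ℝ × Ω, ⟪Φ.val p.1 p.2, (Ioc a c).indicator (fun _ => u) p.1⟫_ℝ =
      ∑ j, X j p := fun p => by
    unfold SimpleIntegrand.val
    rw [sum_inner]
    refine Finset.sum_congr rfl fun j _ => ?_
    by_cases h1 : p.1 ∈ Ioc (Φ.left j) (Φ.right j) <;> by_cases h2 : p.1 ∈ Ioc a c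
    · simp only [X]
      rw [indicator_of_mem h1, indicator_of_mem h2, indicator_of_mem (mem_inter h1 h2),
        inner_smul_left]
      simp
    · simp only [X]
      rw [indicator_of_notMem h2, indicator_of_notMem (show p.1 ∉ _ ∩ Ioc a c from
        fun h => h2 h.2), inner_zero_right, zero_mul]
    · simp only [X]
      rw [indicator_of_notMem h1, indicator_of_notMem (show p.1 ∉
        Ioc (Φ.left j) (Φ.right j) ∩ _ from fun h => h1 h.1), inner_zero_left, zero_mul]
    · simp only [X]
      rw [indicator_of_notMem h1, indicator_of_notMem (show p.1 ∉
        Ioc (Φ.left j) (Φ.right j) ∩ _ from fun h => h1 h.1), inner_zero_left, zero_mul]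
  have hpair : ∀ j, ∫ ω, I j ω * N ω ∂P = ∫ p, X j p ∂(ν.prod P) := by
    intro j
    have e1 : ∫ ω, I j ω * N ω ∂P = ℓ.measure.real (Ioc (Φ.left j) (Φ.right j) ∩ Ioc a c) *
        ((∫ ω, Φ.coef j ω ∂P) * ⟪Φ.dir j, u⟫_ℝ) := by
      have hC1 : ∀ ω, |Φ.coef j ω| ≤ max C 1 := fun ω => (hC j ω).trans (le_max_left _ _)
      have h1 : ∀ _ : Ω, |(1 : ℝ)| ≤ max C 1 := fun _ => by simp
      rcases le_total (Φ.left j) a with h | h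
      · have := integral_elementary_mul hW hV hWV (c := Φ.right j) hac h (hℓ0 ▸ ℓ.mono ha)
          (Φ.measurable_coef j) (ξ' := fun _ => 1) measurable_const hC1 h1 (Φ.dir j) u
        simpa only [one_mul, mul_one] using this
      · have := integral_elementary_mul hW hV hWV (c := c) (Φ.left_le_right j) h
          (hℓ0 ▸ ℓ.mono (Φ.left_nonneg j)) (ξ := fun _ => 1) measurable_const
          (Φ.measurable_coef j) h1 hC1 u (Φ.dir j)
        simp only [one_mul] at this
        rw [inter_comm, real_inner_comm, ← this]
        exact integral_congr_ae (ae_of_all _ fun ω => mul_comm _ _)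
    rw [e1]
    simp only [X]
    rw [integral_prod_mul (fun t => (Ioc (Φ.left j) (Φ.right j) ∩
      Ioc a c).indicator (fun _ => (1 : ℝ)) t) (fun ω => Φ.coef j ω * ⟪Φ.dir j, u⟫_ℝ),
      integral_mul_const, integral_indicator_const _ (measurableSet_Ioc.inter measurableSet_Ioc),
      smul_eq_mul, mul_one, hν,
      measureReal_restrict_apply (measurableSet_Ioc.inter measurableSet_Ioc)]
    congr 2
    refine (inter_eq_left.2 ?_).symm
    exact inter_subset_left.trans (Ioc_subset_Ioc (Φ.left_nonneg j) (Φ.right_le j))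
  have hIN : ∀ j, Integrable (fun ω => I j ω * N ω) P := fun j => (hI j).integrable_mul hNm
  have e2 : ∀ ω, Φ.stochInt W ℓ ω * N ω = ∑ j, I j ω * N ω := fun ω => by
    rw [← Finset.sum_mul]; rfl
  change ∫ ω, Φ.stochInt W ℓ ω * N ω ∂P = _
  simp_rw [hval, e2]
  rw [integral_finsetSum _ fun j _ => hIN j, integral_finsetSum _ fun j _ => hXi j]
  exact Finset.sum_congr rfl fun j _ => hpair j

theorem memLp_indicator_prod {ν : Measure ℝ} [IsFiniteMeasure ν] (a c : ℝ) (u : H) :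
    MemLp (fun p : ℝ × Ω => (Ioc a c).indicator (fun _ => u) p.1) 2 (ν.prod P) := by
  refine MemLp.of_bound ((measurable_const.indicator measurableSet_Ioc).comp
    measurable_fst).aestronglyMeasurable ‖u‖ (ae_of_all _ fun p => ?_)
  by_cases h : p.1 ∈ Ioc a c
  · rw [indicator_of_mem h]
  · rw [indicator_of_notMem h, norm_zero]; exact norm_nonneg u

theorem SimpleIntegrand.memLp_val (hW : IsCylindricalBrownian W P)
    (hV : ∀ t, 0 ≤ t → Measurable (V t)) (Φ : SimpleIntegrand H (history W V ℓ) T) :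
    MemLp (fun p : ℝ × Ω => Φ.val p.1 p.2) 2 ((ℓ.measure.restrict (Ioc 0 T)).prod P) := by
  obtain ⟨C, hC0, hC⟩ := Φ.exists_bound
  refine MemLp.of_bound (Φ.measurable_val hW hV).aestronglyMeasurable (∑ j, C * ‖Φ.dir j‖)
    (ae_of_all _ fun p => ?_)
  unfold SimpleIntegrand.val
  refine norm_sum_le_of_le _ fun j _ => ?_
  by_cases h : p.1 ∈ Ioc (Φ.left j) (Φ.right j)
  · rw [indicator_of_mem h, norm_smul]
    exact mul_le_mul_of_nonneg_right (hC j _) (norm_nonneg _)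
  · rw [indicator_of_notMem h, norm_zero]; positivity

/-- The covariance of a stochastic integral with an increment of the noise. -/
theorem IsItoIntegral.integral_mul_incr (hW : IsCylindricalBrownian W P)
    (hV : ∀ t, 0 ≤ t → Measurable (V t)) (hWV : Indep (sigmaW W) (sigmaV V) P) (hℓ0 : ℓ 0 = 0)
    {φ : ℝ → Ω → H} {I : Ω → ℝ} (h : IsItoIntegral W V ℓ P T φ I) {a c : ℝ} (ha : 0 ≤ a)
    (hac : a ≤ c) (u : H) :
    ∫ ω, I ω * (W (ℓ c).toNNReal u ω - W (ℓ a).toNNReal u ω) ∂P =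
      ∫ p, ⟪φ p.1 p.2, (Ioc a c).indicator (fun _ => u) p.1⟫_ℝ
        ∂((ℓ.measure.restrict (Ioc 0 T)).prod P) := by
  obtain ⟨hφ, hI, Φ, h1, h2⟩ := h
  rw [← tendsto_eLpNorm_two_iff (μ := (ℓ.measure.restrict (Ioc 0 T)).prod P)
    (f := fun n (p : ℝ × Ω) => (Φ n).val p.1 p.2 - φ p.1 p.2)] at h1
  have hφ2 : MemLp (fun p : ℝ × Ω => φ p.1 p.2) 2 ((ℓ.measure.restrict (Ioc 0 T)).prod P) := by
    obtain ⟨n, hn⟩ := (ENNReal.tendsto_nhds_zero.1 h1 1 one_pos).exists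
    have h3 : MemLp (fun p : ℝ × Ω => (Φ n).val p.1 p.2 - φ p.1 p.2) 2
        ((ℓ.measure.restrict (Ioc 0 T)).prod P) :=
      ⟨((Φ n).measurable_val hW hV).aestronglyMeasurable.sub hφ,
        hn.trans_lt ENNReal.one_lt_top⟩
    have := ((Φ n).memLp_val hW hV).sub h3
    refine this.congr_norm hφ (ae_of_all _ fun p => ?_)
    simp
  have hN : MemLp (fun ω => W (ℓ c).toNNReal u ω - W (ℓ a).toNNReal u ω) 2 P :=
    (hW.memLp _ _).sub (hW.memLp _ _)
  have t1 := tendsto_integral_inner (fun n => (Φ n).memLp_stochInt hW hV) hI hN h2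
  have t2 := tendsto_integral_inner (fun n => (Φ n).memLp_val hW hV) hφ2
    (memLp_indicator_prod (P := P) (ν := ℓ.measure.restrict (Ioc 0 T)) a c u) h1
  simp only [RCLike.inner_apply, RCLike.conj_to_real] at t1
  have e1 : ∀ {f : Ω → ℝ}, ∫ ω, (W (ℓ c).toNNReal u ω - W (ℓ a).toNNReal u ω) * f ω ∂P =
      ∫ ω, f ω * (W (ℓ c).toNNReal u ω - W (ℓ a).toNNReal u ω) ∂P := fun {f} =>
    integral_congr_ae (ae_of_all _ fun ω => mul_comm _ _)
  simp_rw [e1] at t1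
  refine tendsto_nhds_unique t1 (t2.congr fun n => ?_)
  exact ((Φ n).integral_stochInt_mul_incr hW hV hWV hℓ0 ha hac u).symm

end Ito

/-! ### Existence of solutions depending measurably on a parameter -/

namespace Coeffs

variable {H : Type*} [NormedAddCommGroup H] [InnerProductSpace ℝ H] [MeasurableSpace H]
  [BorelSpace H] [SecondCountableTopology H] [CompleteSpace H]
  {S : ℝ → H →L[ℝ] H} {b : ℝ → H → H} {B : ℝ → H → H →L[ℝ] H} {T K : ℝ}
  {Θ : Type*} {mΘ : MeasurableSpace Θ}

theorem exists_solution (hC : Coeffs S b B T K) {Y : ℝ × Θ → H} (hY : Measurable Y) {y : ℝ → H}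
    (hy : Measurable y) : ∃ X : ℝ → Θ × ℝ → H, Measurable (fun p : ℝ × Θ × ℝ => X p.1 p.2) ∧
      ∀ θ n, IntervalIntegrable (fun s => b s (Y (s, θ) + n • y s)) volume 0 T →
        IsMildSol S b 0 T (fun t => Y (t, θ) + n • y t) (fun t => X t (θ, n)) := by
  have hψ : Measurable fun p : (ℝ × Θ × ℝ) × H => b (p.1.1.toNNReal : ℝ) p.2 :=
    hC.b_meas.comp (f := fun p : (ℝ × Θ × ℝ) × H => (p.1.1.toNNReal, p.2)) (by fun_prop)
  obtain ⟨X, hXm, hX⟩ := hC.exists_mildSol (ψ := fun t (_ : Θ × ℝ) x => b (t.toNNReal : ℝ) x) hψ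
    (c := fun t q => Y (t, q.1) + q.2 • y t)
    ((hY.comp (f := fun p : ℝ × Θ × ℝ => (p.1, p.2.1)) (by fun_prop)).add
      (measurable_snd.snd.smul (hy.comp measurable_fst)))
  refine ⟨X, hXm, fun θ n hint => ?_⟩
  have hnn : ∀ t ∈ Icc 0 T, ((t.toNNReal : ℝ≥0) : ℝ) = t := fun t ht => Real.coe_toNNReal _ ht.1
  obtain ⟨h1, h2⟩ := hX (θ, n) (fun t ht x y => by rw [hnn t ht]; exact hC.b_lip t ht x y)
    (hint.congr fun s hs => by
      rw [uIoc_of_le hC.T_nonneg] at hs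
      simp only [hnn s ⟨hs.1.le, hs.2⟩])
  refine ⟨h1.congr fun s hs => ?_, fun t ht => (h2 t ht).trans ?_⟩
  · rw [uIoc_of_le hC.T_nonneg] at hs
    simp only [hnn s ⟨hs.1.le, hs.2⟩]
  · congr 1
    refine intervalIntegral.integral_congr fun s hs => ?_
    rw [uIcc_of_le ht.1] at hs
    simp only [hnn s ⟨hs.1, hs.2.trans ht.2⟩]

theorem measurable_B_comp (hC : Coeffs S b B T K) {X : ℝ → Θ → H}
    (hX : Measurable fun p : ℝ × Θ => X p.1 p.2) :
    Measurable fun p : (ℝ × Θ) × H => B (p.1.1.toNNReal : ℝ) (X p.1.1 p.1.2) p.2 :=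
  hC.B_meas.comp (f := fun p : (ℝ × Θ) × H => ((p.1.1.toNNReal, X p.1.1 p.1.2), p.2))
    (((measurable_fst.fst.real_toNNReal).prodMk (hX.comp measurable_fst)).prodMk measurable_snd)

theorem ae_toNNReal_eq {E : Type*} (T : ℝ) (A : ℝ → ℝ → E) :
    ∀ᵐ t : ℝ, t ∈ Icc 0 T → A (t.toNNReal : ℝ) t = A t t :=
  ae_of_all _ fun t ht => by rw [Real.coe_toNNReal _ ht.1]

theorem exists_forward (hC : Coeffs S b B T K) {X : ℝ → Θ → H}
    (hX : Measurable fun p : ℝ × Θ => X p.1 p.2) (w : H) :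
    ∃ d : ℝ → Θ → H, Measurable (fun p : ℝ × Θ => d p.1 p.2) ∧
      ∀ θ, d 0 θ = w ∧ IsLinSol (fun r => B r (X r θ)) 0 T (fun t => d t θ) := by
  obtain ⟨d, hdm, hd⟩ := exists_isLinSol_left hC.T_nonneg hC.K_nonneg
    (A := fun t θ => B (t.toNNReal : ℝ) (X t θ)) (hC.measurable_B_comp hX)
    (fun t ht θ => by rw [Real.coe_toNNReal _ ht.1]; exact hC.B_norm t ht _)
    (w := fun _ => w) measurable_const
  exact ⟨d, hdm, fun θ => ⟨(hd θ).1, (hd θ).2.congr_ae hC.T_nonneg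
    (ae_toNNReal_eq T fun s t => B s (X t θ))⟩⟩

theorem exists_backward (hC : Coeffs S b B T K) {X : ℝ → Θ → H}
    (hX : Measurable fun p : ℝ × Θ => X p.1 p.2) (v : H) :
    ∃ d : ℝ → Θ → H, Measurable (fun p : ℝ × Θ => d p.1 p.2) ∧
      ∀ θ, d T θ = v ∧ IsLinSol (fun r => B r (X r θ)) 0 T (fun t => d t θ) := by
  obtain ⟨d, hdm, hd⟩ := exists_isLinSol_right hC.T_nonneg hC.K_nonneg
    (A := fun t θ => B (t.toNNReal : ℝ) (X t θ)) (hC.measurable_B_comp hX)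
    (fun t ht θ => by rw [Real.coe_toNNReal _ ht.1]; exact hC.B_norm t ht _)
    (w := fun _ => v) measurable_const
  exact ⟨d, hdm, fun θ => ⟨(hd θ).1, (hd θ).2.congr_ae hC.T_nonneg
    (ae_toNNReal_eq T fun s t => B s (X t θ))⟩⟩

theorem exists_adjoint {ι : Type*} (e : HilbertBasis ι ℝ H) (hC : Coeffs S b B T K)
    {X : ℝ → Θ → H} (hX : Measurable fun p : ℝ × Θ => X p.1 p.2) (w : H) :
    ∃ d : ℝ → Θ → H, Measurable (fun p : ℝ × Θ => d p.1 p.2) ∧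
      ∀ θ, d 0 θ = w ∧
        IsLinSol (fun r => -ContinuousLinearMap.adjoint (B r (X r θ))) 0 T (fun t => d t θ) := by
  have hBm := hC.measurable_B_comp hX
  obtain ⟨d, hdm, hd⟩ := exists_isLinSol_left hC.T_nonneg hC.K_nonneg
    (A := fun t θ => -ContinuousLinearMap.adjoint (B (t.toNNReal : ℝ) (X t θ)))
    (by
      have := measurable_adjoint_apply e
        (A := fun p : (ℝ × Θ) × H => B (p.1.1.toNNReal : ℝ) (X p.1.1 p.1.2))
        (fun u => hBm.comp (f := fun p : (ℝ × Θ) × H => (p.1, u)) (by fun_prop)) measurable_snd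
      exact this.neg)
    (fun t ht θ => by
      rw [Real.coe_toNNReal _ ht.1, norm_neg, LinearIsometryEquiv.norm_map]
      exact hC.B_norm t ht _)
    (w := fun _ => w) measurable_const
  exact ⟨d, hdm, fun θ => ⟨(hd θ).1, (hd θ).2.congr_ae hC.T_nonneg
    (ae_toNNReal_eq T fun s t => -ContinuousLinearMap.adjoint (B s (X t θ)))⟩⟩

/-- The linearized mild equation along a path has a solution. -/
theorem exists_linMild (hC : Coeffs S b B T K) {X : ℝ → Θ → H}
    (hX : Measurable fun p : ℝ × Θ => X p.1 p.2) {y : ℝ → H} (hy : Measurable y) {δ : ℝ}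
    (hyδ : ∀ t ∈ Icc 0 T, ‖y t‖ ≤ δ) :
    ∃ χ : ℝ → Θ → H, Measurable (fun p : ℝ × Θ => χ p.1 p.2) ∧
      ∀ θ, IsMildSol S (fun s d => fderiv ℝ (b s) (X s θ) d) 0 T y (fun t => χ t θ) := by
  have hψ : Measurable fun p : (ℝ × Θ) × H =>
      fderiv ℝ (b (p.1.1.toNNReal : ℝ)) (X p.1.1 p.1.2) p.2 :=
    hC.db_meas.comp (f := fun p : (ℝ × Θ) × H => ((p.1.1.toNNReal, X p.1.1 p.1.2), p.2))
      (((measurable_fst.fst.real_toNNReal).prodMk (hX.comp measurable_fst)).prodMk measurable_snd)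
  obtain ⟨χ, hχm, hχ⟩ := hC.exists_mildSol
    (ψ := fun t θ x => fderiv ℝ (b (t.toNNReal : ℝ)) (X t θ) x) hψ (c := fun t _ => y t)
    (hy.comp measurable_fst)
  refine ⟨χ, hχm, fun θ => ?_⟩
  have hnn : ∀ t ∈ Icc 0 T, ((t.toNNReal : ℝ≥0) : ℝ) = t := fun t ht => Real.coe_toNNReal _ ht.1
  obtain ⟨h1, h2⟩ := hχ θ (fun t ht x y => by
      rw [hnn t ht, ← map_sub]; exact (fderiv ℝ (b t) _).le_of_opNorm_le (hC.db_norm ht _) _)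
    (by
      refine (intervalIntegrable_const (c := K * δ)).mono_fun' ?_ ?_
      · exact (hψ.comp (f := fun s : ℝ => ((s, θ), y s))
          (by fun_prop)).aestronglyMeasurable
      · rw [EventuallyLE, ae_restrict_iff' measurableSet_uIoc, uIoc_of_le hC.T_nonneg]
        refine ae_of_all _ fun s hs => ?_
        have hs' : s ∈ Icc 0 T := ⟨hs.1.le, hs.2⟩
        rw [hnn s hs']
        exact ((fderiv ℝ (b s) _).le_of_opNorm_le (hC.db_norm hs' _) _).trans
          (mul_le_mul_of_nonneg_left (hyδ s hs') hC.K_nonneg))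
  refine ⟨h1.congr fun s hs => ?_, fun t ht => (h2 t ht).trans ?_⟩
  · rw [uIoc_of_le hC.T_nonneg] at hs
    simp only [hnn s ⟨hs.1.le, hs.2⟩]
  · congr 1
    refine intervalIntegral.integral_congr fun s hs => ?_
    rw [uIcc_of_le ht.1] at hs
    simp only [hnn s ⟨hs.1, hs.2.trans ht.2⟩]

end Coeffs

/-! ### Adaptedness of the solution -/

theorem IsMildSol.mono {H : Type*} [NormedAddCommGroup H] [InnerProductSpace ℝ H]
    {S : ℝ → H →L[ℝ] H} {ψ : ℝ → H → H} {T t : ℝ} {c X : ℝ → H} (h : IsMildSol S ψ 0 T c X)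
    (ht : t ∈ Icc 0 T) : IsMildSol S ψ 0 t c X :=
  ⟨h.1.mono_set (by
    rw [uIcc_of_le ht.1, uIcc_of_le (ht.1.trans ht.2)]; exact Icc_subset_Icc_right ht.2),
    fun s hs => h.2 s ⟨hs.1, hs.2.trans ht.2⟩⟩

theorem measurable_slice {Ω β : Type*} {m : MeasurableSpace Ω} [MeasurableSpace β]
    {f : ℝ → Ω × ℝ → β} (hf : Measurable fun p : ℝ × Ω × ℝ => f p.1 p.2) (c : ℝ) :
    Measurable fun p : ℝ × Ω => f p.1 (p.2, c) :=
  hf.comp (f := fun p : ℝ × Ω => (p.1, p.2, c)) (by fun_prop)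

namespace Model

variable {Ω H ι : Type*} {m : MeasurableSpace Ω} [mΩ : MeasurableSpace Ω] [NormedAddCommGroup H]
  [InnerProductSpace ℝ H]
  [CompleteSpace H] [SecondCountableTopology H] [MeasurableSpace H] [BorelSpace H]
  {W : ℝ≥0 → H → Ω → ℝ} {V : ℝ → Ω → H} {ℓ : StieltjesFunction ℝ} {P : Measure Ω}
  [IsProbabilityMeasure P]
  {S : ℝ → H →L[ℝ] H} {b : ℝ → H → H} {σ : ℝ → H →L[ℝ] H} {B : ℝ → H → H →L[ℝ] H} {T K : ℝ}
  {x : H} {X Y : ℝ → Ω → H}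

/-- If the forcing, reduced by `N • y`, is known to the σ-algebra `m`, then for all real `n` there
is a solution `X' (ω, n)` for the reduced forcing plus `n • y` which depends on `ω` in an
`m`-measurable way; the value `n = N ω` returns the solution `X`. -/
theorem exists_solution_version (hM : Model W V ℓ P S b σ B T K x X Y)
    (hm : m ≤ mΩ) {t : ℝ} (ht : t ∈ Icc 0 T) {μ : Measure ℝ} [IsFiniteMeasure μ]
    (hμ : volume.restrict (Icc 0 t) ≪ μ) {y : ℝ → H} (hy : Measurable y) {δ : ℝ}
    (hyδ : ∀ s ∈ Icc 0 T, ‖y s‖ ≤ δ) {N : Ω → ℝ} (hN : Measurable N)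
    (h : ∀ᵐ q ∂μ, AEStronglyMeasurable[m] (fun ω => Y q ω - N ω • y q) P) :
    ∃ (Y' : ℝ × Ω → H) (X' : ℝ → Ω × ℝ → H),
      Measurable[(borel ℝ).prod (m.prod (borel ℝ))] (fun p : ℝ × Ω × ℝ => X' p.1 p.2) ∧
      ∀ᵐ ω ∂P, (∀ n, IsMildSol S b 0 t (fun q => Y' (q, ω) + n • y q)
        (fun q => X' q (ω, n))) ∧ ∀ᵐ q ∂μ, q ∈ Icc 0 t → X' q (ω, N ω) = X q ω := by
  have hC := hM.coeffs.mono ht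
  obtain ⟨Y', hY'm, hYY'⟩ := exists_measurable_version (μ := μ) (P := P) hm
    (φ := fun p : ℝ × Ω => Y p.1 p.2 - N p.2 • y p.1)
    (hM.Y_meas.sub ((hN.comp measurable_snd).smul (hy.comp measurable_fst))) (by
      filter_upwards [h] with q ⟨ψ, h1, h2⟩ using ⟨ψ, h1.measurable, h2⟩)
  obtain ⟨X', hX'm, hX'⟩ := hC.exists_solution (mΘ := m) hY'm hy
  have hreal : (Real.measurableSpace : MeasurableSpace ℝ) = borel ℝ := BorelSpace.measurable_eq
  refine ⟨Y', X', by rw [← hreal]; exact hX'm, ?_⟩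
  have hsec : ∀ ω, Measurable fun s => Y' (s, ω) := fun ω =>
    hY'm.comp (@measurable_prodMk_right _ _ _ m ω)
  have hX'sec : ∀ ω n, Measurable fun s => X' s (ω, n) := fun ω n =>
    hX'm.comp (@measurable_prodMk_right _ _ _ (m.prod _) (ω, n))
  filter_upwards [hM.mild, ae_ae_swap hYY'] with ω hmild hω
  have hmild' := hmild.mono ht
  have hXsec : Measurable fun s => X s ω := hM.X_meas.comp measurable_prodMk_right
  have hae : ∀ᵐ q, q ∈ Icc 0 t → Y q ω - N ω • y q = Y' (q, ω) :=
    (ae_restrict_iff' measurableSet_Icc).1 (hμ.ae_le hω)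
  set M := ∫ s in (0 : ℝ)..t, ‖b s (X s ω)‖ with hMdef
  have hYX : ∀ q ∈ Icc 0 t, ‖Y q ω - X q ω‖ ≤ M := by
    intro q hq
    have hq' : X q ω = Y q ω + ∫ s in (0 : ℝ)..q, S (q - s) (b s (X s ω)) := hmild'.2 q hq
    rw [hq', sub_add_cancel_left, norm_neg]
    refine (intervalIntegral.norm_integral_le_of_norm_le hq.1 (g := fun s => ‖b s (X s ω)‖)
      (ae_of_all _ fun s hs => hC.S_apply_le (sub_nonneg.2 hs.2) _) ?_).trans ?_
    · exact (hmild'.mono hq).1.norm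
    · exact intervalIntegral.integral_mono_interval le_rfl hq.1 hq.2
        (ae_of_all _ fun s => norm_nonneg _) hmild'.1.norm
  have hsol : ∀ n, IsMildSol S b 0 t (fun q => Y' (q, ω) + n • y q)
      (fun q => X' q (ω, n)) := by
    intro n
    refine hX' ω n ?_
    have h1 : IntervalIntegrable
        (fun s => b s (Y' (s, ω) + n • y s) - b s (X s ω)) volume 0 t := by
      refine (intervalIntegrable_const (c := K * (M + |n - N ω| * δ))).mono_fun' ?_ ?_
      · rw [uIoc_of_le ht.1]
        exact ((hC.aesm_b ((hsec ω).add (hy.const_smul n))).sub (hC.aesm_b hXsec)).mono_measure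
          (Measure.restrict_mono Ioc_subset_Icc_self le_rfl)
      · rw [EventuallyLE, ae_restrict_iff' measurableSet_uIoc, uIoc_of_le ht.1]
        filter_upwards [hae] with s hs hst
        have hst' : s ∈ Icc 0 t := ⟨hst.1.le, hst.2⟩
        refine (hC.b_lip s hst' _ _).trans (mul_le_mul_of_nonneg_left ?_ hC.K_nonneg)
        have e1 : Y' (s, ω) + n • y s - X s ω = (Y s ω - X s ω) + (n - N ω) • y s := by
          rw [← hs hst', sub_smul]; abel
        rw [e1]
        refine (norm_add_le _ _).trans (add_le_add (hYX s hst') ?_)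
        rw [norm_smul, Real.norm_eq_abs]
        exact mul_le_mul_of_nonneg_left (hyδ s ⟨hst.1.le, hst.2.trans ht.2⟩) (abs_nonneg _)
    simpa using h1.add hmild'.1
  refine ⟨hsol, ?_⟩
  filter_upwards [hω] with q hq hqt
  refine hC.mild_unique hC.b_lip (hsol (N ω)) hmild' ((hX'sec ω _).sub hXsec).aestronglyMeasurable
    ?_ hqt ?_
  · filter_upwards [hae] with s hs hst
    rw [← hs hst]; abel
  · rw [← hq]; abel

theorem _root_.SubordinateIBP.IsForcing.aestronglyMeasurable_history (e : HilbertBasis ι ℝ H)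
    (hW : IsCylindricalBrownian W P) (hV : ∀ t, 0 ≤ t → Measurable (V t)) {t : ℝ} (ht : 0 ≤ t)
    (h : IsForcing W V ℓ P S σ x Y t) : AEStronglyMeasurable[history W V ℓ t] (Y t) P := by
  have := countable_hilbertBasis e
  obtain ⟨Z, ⟨-, hZ⟩, hY⟩ := h
  obtain ⟨Z', hZ', hZZ'⟩ := aestronglyMeasurable_sub_of_inner e fun i =>
    (hZ (e i)).aestronglyMeasurable_history hW hV
  have hVm : Measurable[history W V ℓ t] (V t) :=
    (measurable_sigmaV ht).mono le_sup_right le_rfl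
  refine ⟨fun ω => S t x + Z' ω + V t ω,
    (stronglyMeasurable_const.add hZ').add hVm.stronglyMeasurable, ?_⟩
  filter_upwards [hY, hZZ'] with ω h1 h2
  rw [h1, h2]

/-- Solutions of the linearized equation are adapted: up to time `t` they can be rebuilt, by
uniqueness, from a version of the solution `X` which is measurable with respect to the history. -/
theorem aestronglyMeasurable_history_linSol (e : HilbertBasis ι ℝ H)
    (hM : Model W V ℓ P S b σ B T K x X Y) {w : H} {j : ℝ → Ω → H}
    (hj : ∀ ω, j 0 ω = w ∧ IsLinSol (fun r => B r (X r ω)) 0 T (fun t => j t ω)) {t : ℝ}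
    (ht : t ∈ Icc 0 T) : AEStronglyMeasurable[history W V ℓ t] (j t) P := by
  have hm := history_le hM.brownian.measurable hM.V_meas ℓ t
  have hC := hM.coeffs.mono ht
  obtain ⟨Y', X', hX'm, hX'⟩ := hM.exists_solution_version hm ht
    (μ := volume.restrict (Icc 0 t)) (Measure.AbsolutelyContinuous.refl _) (y := fun _ => 0)
    measurable_const (δ := 0) (by simp) (N := fun _ => 0) measurable_const (by
      rw [ae_restrict_iff' measurableSet_Icc]
      filter_upwards [hM.forcing] with q hq hqt
      simpa using ((hq ⟨hqt.1, hqt.2.trans ht.2⟩).aestronglyMeasurable_history e hM.brownian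
        hM.V_meas hqt.1).mono (history_mono ℓ hqt.2))
  rw [← (BorelSpace.measurable_eq : (Real.measurableSpace : MeasurableSpace ℝ) = borel ℝ)] at hX'm
  have hmm : Measurable[(Real.measurableSpace).prod (history W V ℓ t)]
      (fun p : ℝ × Ω => X' p.1 (p.2, 0)) :=
    measurable_slice hX'm 0
  obtain ⟨d, hdm, hd⟩ := hC.exists_forward (mΘ := history W V ℓ t)
    (X := fun r ω => X' r (ω, 0)) hmm w
  have hdt : Measurable[history W V ℓ t] (d t) := hdm.comp measurable_prodMk_left
  refine ⟨d t, hdt.stronglyMeasurable, ?_⟩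
  filter_upwards [hX'] with ω ⟨_, hω⟩
  obtain ⟨hj0, hjs⟩ := hj ω
  obtain ⟨hd0, hds⟩ := hd ω
  refine (hjs.mono ⟨le_rfl, hM.T_pos.le⟩ ht).eq_of_left (K := K) (d' := fun t => d t ω)
    (hds.congr_ae ht.1 ?_) (fun s hs => hC.B_norm s hs _) (hj0.trans hd0.symm) ⟨ht.1, le_rfl⟩
  filter_upwards [(ae_restrict_iff' measurableSet_Icc).1 hω] with s hs hst
  simp only [hs hst hst]

end Model

/-! ### The part of the noise that is independent of a given increment -/

section Complement

variable {Ω H ι : Type*} [mΩ : MeasurableSpace Ω] [NormedAddCommGroup H] [InnerProductSpace ℝ H]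
  [CompleteSpace H] [SecondCountableTopology H] [MeasurableSpace H] [BorelSpace H]
  {W : ℝ≥0 → H → Ω → ℝ} {V : ℝ → Ω → H} {ℓ : StieltjesFunction ℝ} {P : Measure Ω}
  [IsProbabilityMeasure P]

/-- The residual of `g` after subtracting its orthogonal projection on `N` in `L²(P)`. -/
def residual (P : Measure Ω) (N g : Ω → ℝ) (ω : Ω) : ℝ :=
  g ω - (∫ ω, g ω * N ω ∂P) / (∫ ω, N ω * N ω ∂P) * N ω

/-- The σ-algebra generated by `V` and by the part of the noise that is orthogonal to `N`. -/
@[reducible] def complement (W : ℝ≥0 → H → Ω → ℝ) (V : ℝ → Ω → H) (P : Measure Ω) (N : Ω → ℝ) :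
    MeasurableSpace Ω :=
  (⨆ q : ℝ≥0 × H, MeasurableSpace.comap (residual P N (W q.1 q.2)) inferInstance) ⊔ sigmaV V

variable {N : Ω → ℝ}

theorem residual_mem (hN : N ∈ noiseSpan W) {g : Ω → ℝ} (hg : g ∈ noiseSpan W) :
    residual P N g ∈ noiseSpan W :=
  (noiseSpan W).sub_mem hg ((noiseSpan W).smul_mem _ hN)

theorem complement_le (hW : IsCylindricalBrownian W P) (hV : ∀ t, 0 ≤ t → Measurable (V t))
    (hN : N ∈ noiseSpan W) : complement W V P N ≤ mΩ :=
  sup_le (iSup_le fun _ => ((measurable_of_mem_noiseSpan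
    (residual_mem hN (mem_noiseSpan _ _))).mono hW.sigmaW_le le_rfl).comap_le) (sigmaV_le hV)

/-- Elements of the Gaussian space spanned by the noise that are orthogonal to `N` are independent
of `N`. -/
theorem indep_complement (hW : IsCylindricalBrownian W P) (hV : ∀ t, 0 ≤ t → Measurable (V t))
    (hWV : Indep (sigmaW W) (sigmaV V) P) (hN : N ∈ noiseSpan W)
    (hN0 : ∫ ω, N ω * N ω ∂P ≠ 0) :
    Indep (complement W V P N) (MeasurableSpace.comap N inferInstance) P := by
  have h := hW.indep_span hV hWV (f := fun q : ℝ≥0 × H => residual P N (W q.1 q.2))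
    (g := fun _ : Unit => N) (fun q => residual_mem hN (mem_noiseSpan _ _)) (fun _ => hN)
    (fun q _ => by
      have hNN : Integrable (fun ω => N ω * N ω) P :=
        (hW.memLp_span hN).integrable_mul (hW.memLp_span hN)
      have hgN : Integrable (fun ω => W q.1 q.2 ω * N ω) P :=
        (hW.memLp _ _).integrable_mul (hW.memLp_span hN)
      simp only [residual, sub_mul, mul_assoc]
      rw [integral_sub hgN (hNN.const_mul _), integral_const_mul, div_mul_cancel₀ _ hN0, sub_self])
  have e := iSup_const (ι := Unit)
    (a := MeasurableSpace.comap N (inferInstance : MeasurableSpace ℝ))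
  rwa [e] at h

theorem measurable_complement_residual {g : Ω → ℝ} (hW : IsCylindricalBrownian W P)
    (hN : N ∈ noiseSpan W) (hg : g ∈ noiseSpan W) :
    Measurable[complement W V P N] (residual P N g) := by
  induction hg using Submodule.span_induction with
  | mem g hg =>
    obtain ⟨q, rfl⟩ := hg
    rw [measurable_iff_comap_le]
    exact le_sup_of_le_left (le_iSup (fun q : ℝ≥0 × H =>
      MeasurableSpace.comap (residual P N (W q.1 q.2)) inferInstance) q)
  | zero =>
    have : residual P N 0 = fun _ => 0 := by ext ω; simp [residual]
    rw [this]
    exact measurable_const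
  | add g g' hg hg' h h' =>
    have : residual P N (g + g') = fun ω => residual P N g ω + residual P N g' ω := by
      ext ω
      simp only [residual, Pi.add_apply, add_mul]
      rw [integral_add (f := fun ω => g ω * N ω) (g := fun ω => g' ω * N ω)
        ((hW.memLp_span hg).integrable_mul (hW.memLp_span hN))
        ((hW.memLp_span hg').integrable_mul (hW.memLp_span hN))]
      ring
    rw [this]
    exact h.add h'
  | smul c g _ h =>
    have : residual P N (c • g) = fun ω => c * residual P N g ω := by
      ext ω
      simp only [residual, Pi.smul_apply, smul_eq_mul, mul_assoc]
      rw [integral_const_mul]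
      ring
    rw [this]
    exact h.const_mul c

theorem exists_eq_const_of_measurable_bot {f : Ω → ℝ} (hf : Measurable[⊥] f) :
    ∃ c : ℝ, f = fun _ => c := by
  rcases isEmpty_or_nonempty Ω with h | ⟨⟨ω₀⟩⟩
  · exact ⟨0, funext fun ω => isEmptyElim ω⟩
  · refine ⟨f ω₀, funext fun ω => ?_⟩
    rcases MeasurableSpace.measurableSet_bot_iff.1 (hf (measurableSet_singleton (f ω₀))) with h | h
    · exact absurd (show ω₀ ∈ f ⁻¹' {f ω₀} from rfl) (by rw [h]; exact fun h => h)
    · have : ω ∈ f ⁻¹' {f ω₀} := by rw [h]; exact mem_univ _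
      exact this

/-- The stochastic integral of a deterministic integrand, reduced by its projection on `N`, is
independent of `N`. -/
theorem IsItoIntegral.aestronglyMeasurable_complement (hW : IsCylindricalBrownian W P)
    (hV : ∀ t, 0 ≤ t → Measurable (V t)) (hWV : Indep (sigmaW W) (sigmaV V) P) (hℓ0 : ℓ 0 = 0)
    (hN : N ∈ noiseSpan W) {t : ℝ} (ht : 0 ≤ t) {g : ℝ → H}
    (hg : MemLp g 2 (ℓ.measure.restrict (Ioc 0 t))) {I : Ω → ℝ}
    (h : IsItoIntegral W V ℓ P t (fun s _ => g s) I) :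
    AEStronglyMeasurable[complement W V P N] (residual P N I) P := by
  obtain ⟨u, -, hu0, hu⟩ := exists_seq_strictAnti_tendsto' (x := (0 : ℝ≥0∞)) one_pos
  choose Ψ hΨ using fun n => isApprox_deterministic (P := P) (Ω := Ω) ht hg (u n) (hu0 n).1
  let Φ : ℕ → SimpleIntegrand H (history W V ℓ) t := fun n => (Ψ n).mono fun _ => bot_le
  have hlim : Tendsto (fun n => eLpNorm (fun ω => (Φ n).stochInt W ℓ ω - I ω) 2 P) atTop (𝓝 0) :=
    tendsto_of_tendsto_of_tendsto_of_le_of_le tendsto_const_nhds hu (fun _ => zero_le)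
      fun n => (h.eLpNorm_stochInt_sub_le hW hV hWV hℓ0 (Φ n)).trans (hΨ n)
  have hspan : ∀ n, (Φ n).stochInt W ℓ ∈ noiseSpan W := by
    intro n
    choose c hc using fun j => exists_eq_const_of_measurable_bot ((Ψ n).measurable_coef j)
    have : (Φ n).stochInt W ℓ = ∑ j, c j • (W (ℓ ((Ψ n).right j)).toNNReal ((Ψ n).dir j) -
        W (ℓ ((Ψ n).left j)).toNNReal ((Ψ n).dir j)) := by
      ext ω
      rw [Finset.sum_apply]
      refine Finset.sum_congr rfl fun j _ => ?_
      have : (Ψ n).coef j ω = c j := congrFun (hc j) ω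
      simp only [Pi.smul_apply, Pi.sub_apply, smul_eq_mul, ← this]
      rfl
    rw [this]
    exact (noiseSpan W).sum_mem fun j _ => (noiseSpan W).smul_mem _
      ((noiseSpan W).sub_mem (mem_noiseSpan _ _) (mem_noiseSpan _ _))
  -- Residuals of the approximating integrals converge to the residual of the limit, almost surely
  -- along a subsequence.
  have hcov := tendsto_integral_inner (fun n => (Φ n).memLp_stochInt hW hV) h.2.1
    (hW.memLp_span hN) hlim
  simp only [RCLike.inner_apply, RCLike.conj_to_real] at hcov
  simp only [mul_comm (N _)] at hcov
  have hmeas := tendstoInMeasure_of_tendsto_eLpNorm (μ := P) (p := 2)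
    (f := fun n => (Φ n).stochInt W ℓ) (g := I) two_ne_zero
    (fun n => ((Φ n).memLp_stochInt hW hV).1) h.2.1.1 hlim
  obtain ⟨ns, hns, hae⟩ := hmeas.exists_seq_tendsto_ae
  refine aestronglyMeasurable_sub_of_tendsto_ae
    (f := fun n => residual P N ((Φ (ns n)).stochInt W ℓ))
    (fun n => (measurable_complement_residual hW hN
      (hspan _)).stronglyMeasurable.aestronglyMeasurable) ?_
  filter_upwards [hae] with ω hω
  exact hω.sub (((hcov.comp hns.tendsto_atTop).div_const _).mul_const _)

/-- The history up to time `a` is orthogonal to later increments, so that its noise is its own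
residual. -/
theorem history_le_complement (hW : IsCylindricalBrownian W P) {a c : ℝ} (hac : a ≤ c) (u : H) :
    history W V ℓ a ≤ complement W V P
      (fun ω => W (ℓ c).toNNReal u ω - W (ℓ a).toNNReal u ω) := by
  refine sup_le_sup (iSup₂_le fun r hr => iSup_le fun z => ?_) le_rfl
  have hrc : r ≤ (ℓ c).toNNReal := hr.trans (Real.toNNReal_le_toNNReal (ℓ.mono hac))
  have h0 : ∫ ω, W r z ω * (W (ℓ c).toNNReal u ω - W (ℓ a).toNNReal u ω) ∂P = 0 := by
    simp_rw [mul_sub]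
    rw [integral_sub (hW.integrable_mul _ _ _ _) (hW.integrable_mul _ _ _ _), hW.cov, hW.cov,
      min_eq_left hr, min_eq_left hrc, sub_self]
  have : residual P (fun ω => W (ℓ c).toNNReal u ω - W (ℓ a).toNNReal u ω) (W r z) = W r z := by
    ext ω
    simp [residual, h0]
  refine le_trans (le_of_eq ?_) (le_iSup (fun q : ℝ≥0 × H => MeasurableSpace.comap (residual P
    (fun ω => W (ℓ c).toNNReal u ω - W (ℓ a).toNNReal u ω) (W q.1 q.2)) inferInstance) (r, z))
  rw [this]

end Complement

/-! ### The response of the forcing to a shift of the noise -/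

section Conv

variable {Ω H ι : Type*} [mΩ : MeasurableSpace Ω] [NormedAddCommGroup H] [InnerProductSpace ℝ H]
  [CompleteSpace H] [SecondCountableTopology H] [MeasurableSpace H] [BorelSpace H]
  {S : ℝ → H →L[ℝ] H} {b : ℝ → H → H} {B : ℝ → H → H →L[ℝ] H} {T K : ℝ}
  {σ : ℝ → H →L[ℝ] H} {ℓ : StieltjesFunction ℝ}

/-- The convolution `∫_{(0,t]} e^{A(t-s)} σ_s g_s dℓ(s)`: the change of the forcing at time `t`
when the noise `dW_{ℓ(s)}` is shifted in the direction `g_s dℓ(s)`. -/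
def noiseConv (S : ℝ → H →L[ℝ] H) (σ : ℝ → H →L[ℝ] H) (ℓ : StieltjesFunction ℝ) (g : ℝ → H)
    (t : ℝ) : H :=
  ∫ s in Ioc 0 t, S (t - s) (σ s (g s)) ∂ℓ.measure

theorem measurable_noiseConv_integrand (hC : Coeffs S b B T K)
    (hσ : ∀ u : H, Measurable (fun t : ℝ≥0 => σ t u)) {α : Type*} [MeasurableSpace α]
    {τ ρ : α → ℝ} {g : α → H} (hτ : Measurable τ) (hρ : Measurable ρ) (hg : Measurable g) :
    Measurable fun a => S ((τ a).toNNReal : ℝ) (σ ((ρ a).toNNReal : ℝ) (g a)) :=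
  hC.S_meas.comp (f := fun a => ((τ a).toNNReal, σ ((ρ a).toNNReal : ℝ) (g a)))
    (hτ.real_toNNReal.prodMk ((measurable_clm_uncurry (A := fun t : ℝ≥0 => σ t) hσ).comp
      (f := fun a => ((ρ a).toNNReal, g a)) (hρ.real_toNNReal.prodMk hg)))

theorem measurable_noiseConv (hC : Coeffs S b B T K)
    (hσ : ∀ u : H, Measurable (fun t : ℝ≥0 => σ t u)) {Θ : Type*} [MeasurableSpace Θ]
    {g : ℝ → Θ → H} (hg : Measurable fun p : ℝ × Θ => g p.1 p.2) :
    Measurable fun p : ℝ × Θ => noiseConv S σ ℓ (fun s => g s p.2) p.1 := by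
  have key : ∀ p : ℝ × Θ, noiseConv S σ ℓ (fun s => g s p.2) p.1 =
      ∫ s, {q : (ℝ × Θ) × ℝ | q.2 ∈ Ioc 0 q.1.1}.indicator (fun q => S ((q.1.1 - q.2).toNNReal : ℝ)
        (σ (q.2.toNNReal : ℝ) (g q.2 q.1.2))) (p, s) ∂ℓ.measure := by
    intro p
    rw [noiseConv, ← integral_indicator measurableSet_Ioc]
    refine integral_congr_ae (ae_of_all _ fun s => ?_)
    by_cases hs : s ∈ Ioc 0 p.1
    · simp only [indicator_of_mem hs]
      rw [indicator_of_mem (show (p, s) ∈ {q : (ℝ × Θ) × ℝ | q.2 ∈ Ioc 0 q.1.1} from hs)]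
      simp only [Real.coe_toNNReal _ hs.1.le, Real.coe_toNNReal _ (sub_nonneg.2 hs.2)]
    · simp only [indicator_of_notMem hs]
      rw [indicator_of_notMem (show (p, s) ∉ {q : (ℝ × Θ) × ℝ | q.2 ∈ Ioc 0 q.1.1} from hs)]
  simp_rw [key]
  have hmeas : Measurable ({q : (ℝ × Θ) × ℝ | q.2 ∈ Ioc 0 q.1.1}.indicator
      (fun q => S ((q.1.1 - q.2).toNNReal : ℝ) (σ (q.2.toNNReal : ℝ) (g q.2 q.1.2)))) := by
    refine (measurable_noiseConv_integrand hC hσ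
      (measurable_fst.fst.sub measurable_snd) measurable_snd
      (hg.comp (f := fun q : (ℝ × Θ) × ℝ => (q.2, q.1.2)) (by fun_prop))).indicator ?_
    exact (measurableSet_lt measurable_const measurable_snd).inter
      (measurableSet_le measurable_snd measurable_fst.fst)
  exact hmeas.stronglyMeasurable.integral_prod_right'.measurable

theorem integrableOn_noiseConv (hC : Coeffs S b B T K)
    (hσ : ∀ u : H, Measurable (fun t : ℝ≥0 => σ t u)) (hσK : ∀ t ∈ Icc 0 T, ‖σ t‖ ≤ K)
    {g : ℝ → H} (hgm : Measurable g) (hg : IntegrableOn g (Ioc 0 T) ℓ.measure) {t : ℝ}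
    (ht : t ∈ Icc 0 T) :
    IntegrableOn (fun s => S (t - s) (σ s (g s))) (Ioc 0 t) ℓ.measure ∧
      ∀ s ∈ Ioc 0 t, ‖S (t - s) (σ s (g s))‖ ≤ K * ‖g s‖ := by
  have hb : ∀ s ∈ Ioc 0 t, ‖S (t - s) (σ s (g s))‖ ≤ K * ‖g s‖ := fun s hs =>
    (hC.S_apply_le (sub_nonneg.2 hs.2) _).trans
      ((σ s).le_of_opNorm_le (hσK s ⟨hs.1.le, hs.2.trans ht.2⟩) _)
  refine ⟨?_, hb⟩
  refine ((hg.mono_set (Ioc_subset_Ioc_right ht.2)).norm.const_mul K).mono' ?_ ?_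
  · refine ((measurable_noiseConv_integrand hC hσ (measurable_const.sub measurable_id)
      measurable_id hgm).aestronglyMeasurable (f := fun s : ℝ => S ((t - s).toNNReal : ℝ)
      (σ (s.toNNReal : ℝ) (g s)))).congr ?_
    rw [EventuallyEq, ae_restrict_iff' measurableSet_Ioc]
    refine ae_of_all _ fun s hs => ?_
    simp only [Real.coe_toNNReal _ hs.1.le, Real.coe_toNNReal _ (sub_nonneg.2 hs.2)]
  · rw [ae_restrict_iff' measurableSet_Ioc]
    exact ae_of_all _ hb

theorem norm_noiseConv_le (hC : Coeffs S b B T K)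
    (hσ : ∀ u : H, Measurable (fun t : ℝ≥0 => σ t u)) (hσK : ∀ t ∈ Icc 0 T, ‖σ t‖ ≤ K)
    {g : ℝ → H} (hgm : Measurable g) (hg : IntegrableOn g (Ioc 0 T) ℓ.measure) {t : ℝ}
    (ht : t ∈ Icc 0 T) :
    ‖noiseConv S σ ℓ g t‖ ≤ K * ∫ s in Ioc 0 T, ‖g s‖ ∂ℓ.measure := by
  obtain ⟨-, hb⟩ := integrableOn_noiseConv hC hσ hσK hgm hg ht
  have hsub : Ioc 0 t ⊆ Ioc 0 T := Ioc_subset_Ioc_right ht.2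
  refine (norm_integral_le_of_norm_le ((hg.mono_set hsub).norm.const_mul K)
    ((ae_restrict_iff' measurableSet_Ioc).2 (ae_of_all _ hb))).trans ?_
  rw [integral_const_mul]
  exact mul_le_mul_of_nonneg_left (setIntegral_mono_set hg.norm
    (ae_of_all _ fun s => norm_nonneg _) hsub.eventuallyLE) hC.K_nonneg

theorem noiseConv_sub (hC : Coeffs S b B T K)
    (hσ : ∀ u : H, Measurable (fun t : ℝ≥0 => σ t u)) (hσK : ∀ t ∈ Icc 0 T, ‖σ t‖ ≤ K)
    {g h : ℝ → H} (hgm : Measurable g) (hg : IntegrableOn g (Ioc 0 T) ℓ.measure)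
    (hhm : Measurable h) (hh : IntegrableOn h (Ioc 0 T) ℓ.measure) {t : ℝ} (ht : t ∈ Icc 0 T) :
    noiseConv S σ ℓ (fun s => g s - h s) t = noiseConv S σ ℓ g t - noiseConv S σ ℓ h t := by
  unfold noiseConv
  simp only [map_sub]
  exact integral_sub (integrableOn_noiseConv hC hσ hσK hgm hg ht).1
    (integrableOn_noiseConv hC hσ hσK hhm hh ht).1

theorem noiseConv_sum_smul (hC : Coeffs S b B T K)
    (hσ : ∀ u : H, Measurable (fun t : ℝ≥0 => σ t u)) (hσK : ∀ t ∈ Icc 0 T, ‖σ t‖ ≤ K)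
    {κ : Type*} (s : Finset κ) (ξ : κ → ℝ) {g : κ → ℝ → H} (hgm : ∀ j, Measurable (g j))
    (hg : ∀ j, IntegrableOn (g j) (Ioc 0 T) ℓ.measure) {t : ℝ} (ht : t ∈ Icc 0 T) :
    noiseConv S σ ℓ (fun r => ∑ j ∈ s, ξ j • g j r) t = ∑ j ∈ s, ξ j • noiseConv S σ ℓ (g j) t := by
  unfold noiseConv
  simp only [map_sum, map_smul]
  rw [integral_finsetSum (f := fun j r => ξ j • S (t - r) (σ r (g j r))) _ fun j _ =>
    (integrableOn_noiseConv hC hσ hσK (hgm j) (hg j) ht).1.smul (ξ j)]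
  simp only [integral_smul]

theorem integrableOn_indicator_const (ℓ : StieltjesFunction ℝ) (a c T : ℝ) (u : H) :
    IntegrableOn ((Ioc a c).indicator fun _ => u) (Ioc 0 T) ℓ.measure :=
  (integrable_const u).indicator measurableSet_Ioc

end Conv

section Forcing

variable {Ω H ι : Type*} [mΩ : MeasurableSpace Ω] [NormedAddCommGroup H] [InnerProductSpace ℝ H]
  [CompleteSpace H] [SecondCountableTopology H] [MeasurableSpace H] [BorelSpace H]
  {W : ℝ≥0 → H → Ω → ℝ} {V : ℝ → Ω → H} {ℓ : StieltjesFunction ℝ} {P : Measure Ω}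
  [IsProbabilityMeasure P]
  {S : ℝ → H →L[ℝ] H} {b : ℝ → H → H} {σ : ℝ → H →L[ℝ] H} {B : ℝ → H → H →L[ℝ] H} {T K : ℝ}
  {x : H} {X Y : ℝ → Ω → H}

/-- The projection of the forcing on an increment `N` of the noise is explicit: the covariance of
the stochastic convolution with `N` is `noiseConv` of the indicator function of the increment. -/
theorem IsForcing.aestronglyMeasurable_complement (e : HilbertBasis ι ℝ H)
    (hM : Model W V ℓ P S b σ B T K x X Y) {t : ℝ} (ht : t ∈ Icc 0 T)
    (h : IsForcing W V ℓ P S σ x Y t) {a c : ℝ} (ha : 0 ≤ a) (hac : a ≤ c) (u : H) {N : Ω → ℝ}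
    (hNdef : N = fun ω => W (ℓ c).toNNReal u ω - W (ℓ a).toNNReal u ω) :
    AEStronglyMeasurable[complement W V P N] (fun ω => Y t ω - (N ω / ∫ ω, N ω * N ω ∂P) •
      noiseConv S σ ℓ ((Ioc a c).indicator fun _ => u) t) P := by
  have := countable_hilbertBasis e
  have hW := hM.brownian
  have hC := hM.coeffs
  have hN : N ∈ noiseSpan W := hNdef ▸ (noiseSpan W).sub_mem (mem_noiseSpan _ _)
    (mem_noiseSpan _ _)
  set y := noiseConv S σ ℓ ((Ioc a c).indicator fun _ => u) t with hy
  have hum : Measurable ((Ioc a c).indicator fun _ => u) := measurable_const.indicator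
    measurableSet_Ioc
  have hG : ∀ z : H, Measurable fun s : ℝ => ContinuousLinearMap.adjoint
      ((S ((t - s).toNNReal : ℝ)).comp (σ (s.toNNReal : ℝ))) z := fun z =>
    measurable_adjoint_apply e (fun v => measurable_noiseConv_integrand hC hM.σ_meas
      (measurable_const.sub measurable_id) measurable_id measurable_const) measurable_const
  have hGeq : ∀ s ∈ Ioc 0 t, (S ((t - s).toNNReal : ℝ)).comp (σ (s.toNNReal : ℝ)) =
      (S (t - s)).comp (σ s) := fun s hs => by
    rw [Real.coe_toNNReal _ hs.1.le, Real.coe_toNNReal _ (sub_nonneg.2 hs.2)]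
  have hmem : ∀ z : H, MemLp (fun s : ℝ => ContinuousLinearMap.adjoint ((S (t - s)).comp (σ s)) z)
      2 (ℓ.measure.restrict (Ioc 0 t)) := by
    intro z
    refine MemLp.of_bound ((hG z).aestronglyMeasurable.congr ?_) (K * ‖z‖) ?_
    · rw [EventuallyEq, ae_restrict_iff' measurableSet_Ioc]
      exact ae_of_all _ fun s hs => by simp only [hGeq s hs]
    · rw [ae_restrict_iff' measurableSet_Ioc]
      refine ae_of_all _ fun s hs => ContinuousLinearMap.le_of_opNorm_le _ ?_ _
      rw [LinearIsometryEquiv.norm_map]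
      refine ((S (t - s)).opNorm_comp_le (σ s)).trans ?_
      have h1 := hC.S_norm (t - s) (sub_nonneg.2 hs.2)
      have h2 := hM.σ_norm s ⟨hs.1.le, hs.2.trans ht.2⟩
      nlinarith [norm_nonneg (S (t - s)), norm_nonneg (σ s)]
  obtain ⟨Z, ⟨-, hZ⟩, hY⟩ := h
  have hcov : ∀ z : H, ∫ ω, ⟪Z ω, z⟫_ℝ * N ω ∂P = ⟪y, z⟫_ℝ := by
    intro z
    rw [hNdef, (hZ z).integral_mul_incr hW hM.V_meas hM.indep hM.ℓ_zero ha hac u,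
      integral_fun_fst (fun s => ⟪ContinuousLinearMap.adjoint ((S (t - s)).comp (σ s)) z,
        (Ioc a c).indicator (fun _ => u) s⟫_ℝ), hy, noiseConv, real_inner_comm,
      ← integral_inner (integrableOn_noiseConv hC hM.σ_meas hM.σ_norm hum
        (integrableOn_indicator_const ℓ a c T u) ht).1]
    simp [ContinuousLinearMap.adjoint_inner_left]
  obtain ⟨Z', hZ', hZZ'⟩ := aestronglyMeasurable_sub_of_inner e
    (g := fun ω => Z ω - (N ω / ∫ ω, N ω * N ω ∂P) • y)
    (m := complement W V P N) (P := P) fun i => by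
      have := (hZ (e i)).aestronglyMeasurable_complement hW hM.V_meas hM.indep hM.ℓ_zero hN ht.1
        (hmem (e i))
      refine this.congr (ae_of_all _ fun ω => ?_)
      simp only [residual, hcov, inner_sub_left, real_inner_smul_left]
      ring
  have hVm : Measurable[complement W V P N] (V t) :=
    (measurable_sigmaV ht.1).mono le_sup_right le_rfl
  refine ⟨fun ω => S t x + Z' ω + V t ω,
    (stronglyMeasurable_const.add hZ').add hVm.stronglyMeasurable, ?_⟩
  filter_upwards [hY, hZZ'] with ω h1 h2
  rw [h1, ← h2]
  abel

end Forcing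

/-! ### Integrating out an independent Gaussian variable -/

section Gaussian

theorem IsCylindricalBrownian.map_span {Ω H : Type*} [mΩ : MeasurableSpace Ω]
    [NormedAddCommGroup H] [InnerProductSpace ℝ H] [CompleteSpace H] [SecondCountableTopology H]
    [MeasurableSpace H] [BorelSpace H] {W : ℝ≥0 → H → Ω → ℝ} {P : Measure Ω}
    [IsProbabilityMeasure P] (hW : IsCylindricalBrownian W P)
    {N : Ω → ℝ} (hN : N ∈ noiseSpan W) :
    P.map N = gaussianReal 0 (∫ ω, N ω * N ω ∂P).toNNReal := by
  have h := ((hW.isGaussianProcess_span (f := fun _ : Unit => N) fun _ => hN).hasGaussianLaw_eval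
    ()).map_eq_gaussianReal
  rw [h, hW.integral_span hN, variance_of_integral_eq_zero
    (hW.memLp_span hN).aestronglyMeasurable.aemeasurable (hW.integral_span hN)]
  simp only [sq]

/-- An independent variable may be integrated out first. -/
theorem integral_comp_of_indepFun {Ω Ω' : Type*} [MeasurableSpace Ω] [MeasurableSpace Ω']
    {P : Measure Ω} [IsProbabilityMeasure P] {φ : Ω → Ω'} (hφ : Measurable φ) {N : Ω → ℝ}
    (hN : Measurable N) (hind : IndepFun φ N P) {γ : Measure ℝ} [SFinite γ] (hγ : P.map N = γ)
    {G : Ω' × ℝ → ℝ} (hG : Measurable G) {g : ℝ → ℝ} (hg : Integrable g γ)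
    (hGg : ∀ ω n, |G (ω, n)| ≤ g n) :
    ∫ ω, G (φ ω, N ω) ∂P = ∫ ω, ∫ n, G (φ ω, n) ∂γ ∂P := by
  have hlaw := (indepFun_iff_map_prod_eq_prod_map_map hφ.aemeasurable hN.aemeasurable).1 hind
  rw [hγ] at hlaw
  have : IsProbabilityMeasure (P.map φ) := Measure.isProbabilityMeasure_map hφ.aemeasurable
  have hint : Integrable G ((P.map φ).prod γ) :=
    Integrable.mono' (hg.comp_snd (P.map φ)) hG.aestronglyMeasurable
      (ae_of_all _ fun p => hGg p.1 p.2)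
  rw [← integral_map (f := G) (hφ.prodMk hN).aemeasurable hG.aestronglyMeasurable, hlaw,
    integral_prod _ hint, integral_map hφ.aemeasurable
      hG.stronglyMeasurable.integral_prod_right'.aestronglyMeasurable]

end Gaussian

/-! ### Integration by parts in the direction of one increment of the noise -/

section Pathwise

variable {H : Type*} [NormedAddCommGroup H] [InnerProductSpace ℝ H]
  [CompleteSpace H] [SecondCountableTopology H] [MeasurableSpace H] [BorelSpace H]
  {S : ℝ → H →L[ℝ] H} {b : ℝ → H → H} {B : ℝ → H → H →L[ℝ] H} {T K : ℝ}

/-- The functional `f(X_T) ⟨w', k_0⟩` of the path `X`, where `k` is a solution of the linearized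
equation along `X`. -/
def ibpValue (f : H → ℝ) (w' : H) (T : ℝ) (X k : ℝ → H) : ℝ := f (X T) * ⟪w', k 0⟫_ℝ

/-- The derivative of `ibpValue` when `X` moves in the direction `χ` and the terminal value of `k`
is kept; `p` solves the adjoint linearized equation with `p_0 = w'`. -/
def ibpDeriv (f : H → ℝ) (B : ℝ → H → H →L[ℝ] H) (w' : H) (T : ℝ) (X χ k p : ℝ → H) : ℝ :=
  fderiv ℝ f (X T) (χ T) * ⟪w', k 0⟫_ℝ -
    f (X T) * ∫ r in (0 : ℝ)..T, ⟪p r, fderiv ℝ (B r) (X r) (χ r) (k r)⟫_ℝ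

theorem IsMildSol.congr_ae {ψ ψ' : ℝ → H → H} {a t : ℝ} {c X : ℝ → H} (h : IsMildSol S ψ a t c X)
    (hat : a ≤ t) (hψ : ∀ᵐ s, s ∈ Icc a t → ∀ d, ψ s d = ψ' s d) : IsMildSol S ψ' a t c X := by
  have hE : ∀ q ∈ Icc a t, ∀ᵐ s, s ∈ uIoc a q → ψ s (X s) = ψ' s (X s) := by
    intro q hq
    filter_upwards [hψ] with s hs hsq
    rw [uIoc_of_le hq.1] at hsq
    exact hs ⟨hsq.1.le, hsq.2.trans hq.2⟩ _
  refine ⟨h.1.congr_ae ((ae_restrict_iff' measurableSet_uIoc).2 (hE t ⟨hat, le_rfl⟩)),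
    fun q hq => ?_⟩
  rw [h.2 q hq]
  congr 1
  refine intervalIntegral.integral_congr_ae ?_
  filter_upwards [hE q hq] with s hs hsq
  rw [hs hsq]

theorem norm_backward_le (hC : Coeffs S b B T K) {X k : ℝ → H}
    (hk : IsLinSol (fun r => B r (X r)) 0 T k) {t : ℝ} (ht : t ∈ Icc 0 T) :
    ‖k t‖ ≤ ‖k T‖ * Real.exp (2 * K * T) := by
  have hK := hC.K_nonneg
  refine (hk.norm_le_right hK (fun r hr => hC.B_norm r hr _) ht).trans
    (mul_le_mul_of_nonneg_left (Real.exp_le_exp.2 ?_) (norm_nonneg _))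
  nlinarith [ht.1]

theorem norm_adjoint_sol_le (hC : Coeffs S b B T K) {X p : ℝ → H}
    (hp : IsLinSol (fun r => -ContinuousLinearMap.adjoint (B r (X r))) 0 T p) {t : ℝ}
    (ht : t ∈ Icc 0 T) : ‖p t‖ ≤ ‖p 0‖ * Real.exp (2 * K * T) := by
  have hK := hC.K_nonneg
  refine (hp.norm_le_left hK (fun r hr => by
    rw [norm_neg, LinearIsometryEquiv.norm_map]; exact hC.B_norm r hr _) ht).trans
    (mul_le_mul_of_nonneg_left (Real.exp_le_exp.2 ?_) (norm_nonneg _))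
  nlinarith [ht.2]

theorem norm_dB_apply_le (hC : Coeffs S b B T K) {r : ℝ} (hr : r ∈ Icc 0 T) (x d k : H) :
    ‖fderiv ℝ (B r) x d k‖ ≤ K * ‖d‖ * ‖k‖ :=
  ContinuousLinearMap.le_of_opNorm_le _
    ((fderiv ℝ (B r) x).le_of_opNorm_le (hC.dB_norm r hr x) d) k

theorem abs_ibpValue_le {f : H → ℝ} {Cf Ck : ℝ} (hf : ∀ y, |f y| ≤ Cf) {w' : H} {X k : ℝ → H}
    (hk : ‖k 0‖ ≤ Ck) : |ibpValue f w' T X k| ≤ Cf * (‖w'‖ * Ck) := by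
  rw [ibpValue, abs_mul]
  exact mul_le_mul (hf _) ((abs_real_inner_le_norm _ _).trans
    (mul_le_mul_of_nonneg_left hk (norm_nonneg _))) (abs_nonneg _) ((abs_nonneg _).trans (hf 0))

theorem abs_ibpDeriv_le (hC : Coeffs S b B T K) {f : H → ℝ} {Cf Cf' D Ck Cp : ℝ}
    (hf : ∀ y, |f y| ≤ Cf) (hf' : ∀ y, ‖fderiv ℝ f y‖ ≤ Cf') {w' : H} {X χ k p : ℝ → H}
    (hχ : ∀ t ∈ Icc 0 T, ‖χ t‖ ≤ D) (hk : ∀ t ∈ Icc 0 T, ‖k t‖ ≤ Ck)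
    (hp : ∀ t ∈ Icc 0 T, ‖p t‖ ≤ Cp) :
    |ibpDeriv f B w' T X χ k p| ≤ (Cf' * (‖w'‖ * Ck) + Cf * (T * (Cp * (K * Ck)))) * D := by
  have hT := hC.T_nonneg
  have hK := hC.K_nonneg
  have h0 : (0 : ℝ) ∈ Icc 0 T := ⟨le_rfl, hT⟩
  have hTT : T ∈ Icc 0 T := ⟨hT, le_rfl⟩
  have hD := (norm_nonneg _).trans (hχ 0 h0)
  have hCk := (norm_nonneg _).trans (hk 0 h0)
  have hCp := (norm_nonneg _).trans (hp 0 h0)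
  have hCf := (abs_nonneg _).trans (hf 0)
  have hCf' := (norm_nonneg _).trans (hf' 0)
  have h1 : |fderiv ℝ f (X T) (χ T) * ⟪w', k 0⟫_ℝ| ≤ (Cf' * D) * (‖w'‖ * Ck) := by
    rw [abs_mul]
    refine mul_le_mul ?_ ((abs_real_inner_le_norm _ _).trans
      (mul_le_mul_of_nonneg_left (hk 0 h0) (norm_nonneg _))) (abs_nonneg _) (by positivity)
    exact ((fderiv ℝ f (X T)).le_of_opNorm_le (hf' _) _).trans
      (mul_le_mul_of_nonneg_left (hχ T hTT) hCf')
  have h2 : |∫ r in (0 : ℝ)..T, ⟪p r, fderiv ℝ (B r) (X r) (χ r) (k r)⟫_ℝ| ≤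
      Cp * (K * D * Ck) * |T - 0| := by
    rw [← Real.norm_eq_abs]
    refine intervalIntegral.norm_integral_le_of_norm_le_const fun r hr => ?_
    rw [uIoc_of_le hT] at hr
    have hr' : r ∈ Icc 0 T := ⟨hr.1.le, hr.2⟩
    refine (norm_inner_le_norm _ _).trans (mul_le_mul (hp r hr') ?_ (norm_nonneg _) hCp)
    refine (norm_dB_apply_le hC hr' _ _ _).trans ?_
    gcongr
    exacts [hχ r hr', hk r hr']
  rw [sub_zero, abs_of_nonneg hT] at h2
  rw [ibpDeriv]
  refine (abs_sub _ _).trans ?_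
  rw [abs_mul (f (X T))]
  have h3 := mul_le_mul (hf (X T)) h2 (abs_nonneg _) hCf
  linarith

theorem intervalIntegrable_dB (hC : Coeffs S b B T K) {X χ k p : ℝ → H} (hX : Measurable X)
    (hχm : Measurable χ) (hkm : Measurable k) (hpm : Measurable p) {D Ck Cp : ℝ}
    (hχ : ∀ t ∈ Icc 0 T, ‖χ t‖ ≤ D) (hk : ∀ t ∈ Icc 0 T, ‖k t‖ ≤ Ck)
    (hp : ∀ t ∈ Icc 0 T, ‖p t‖ ≤ Cp) :
    IntervalIntegrable (fun r => ⟪p r, fderiv ℝ (B r) (X r) (χ r) (k r)⟫_ℝ) volume 0 T := by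
  have hT := hC.T_nonneg
  have hK := hC.K_nonneg
  have h0 : (0 : ℝ) ∈ Icc 0 T := ⟨le_rfl, hT⟩
  have hD := (norm_nonneg _).trans (hχ 0 h0)
  have hCp := (norm_nonneg _).trans (hp 0 h0)
  refine (intervalIntegrable_const (c := Cp * (K * D * Ck))).mono_fun' ?_ ?_
  · rw [uIoc_of_le hT]
    exact (hpm.aestronglyMeasurable.inner (𝕜 := ℝ) (hC.aesm_dB hX hχm hkm)).mono_measure
      (Measure.restrict_mono Ioc_subset_Icc_self le_rfl)
  · rw [EventuallyLE, ae_restrict_iff' measurableSet_uIoc, uIoc_of_le hT]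
    refine ae_of_all _ fun r hr => ?_
    have hr' : r ∈ Icc 0 T := ⟨hr.1.le, hr.2⟩
    refine (norm_inner_le_norm _ _).trans (mul_le_mul (hp r hr') ?_ (norm_nonneg _) hCp)
    refine (norm_dB_apply_le hC hr' _ _ _).trans ?_
    gcongr
    exacts [hχ r hr', hk r hr']

theorem measurable_ibpDeriv (hC : Coeffs S b B T K) {Θ : Type*} [MeasurableSpace Θ] {f : H → ℝ}
    (hf : ContDiff ℝ 1 f) (w' : H) {X χ k p : ℝ → Θ → H}
    (hX : Measurable fun q : ℝ × Θ => X q.1 q.2) (hχ : Measurable fun q : ℝ × Θ => χ q.1 q.2)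
    (hk : Measurable fun q : ℝ × Θ => k q.1 q.2) (hp : Measurable fun q : ℝ × Θ => p q.1 q.2) :
    Measurable fun θ => ibpDeriv f B w' T (fun r => X r θ) (fun r => χ r θ) (fun r => k r θ)
      (fun r => p r θ) := by
  have hX' : ∀ t, Measurable (X t) := fun t => hX.comp measurable_prodMk_left
  have hχ' : ∀ t, Measurable (χ t) := fun t => hχ.comp measurable_prodMk_left
  have hk' : ∀ t, Measurable (k t) := fun t => hk.comp measurable_prodMk_left
  unfold ibpDeriv
  refine (Measurable.mul ?_ (measurable_const.inner (hk' 0))).sub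
    ((hf.continuous.measurable.comp (hX' T)).mul ?_)
  · exact (hf.continuous_fderiv_apply one_ne_zero).measurable.comp
      (f := fun θ => (X T θ, χ T θ)) ((hX' T).prodMk (hχ' T))
  · have h1 : Measurable fun q : Θ × ℝ => ⟪p q.2 q.1,
        fderiv ℝ (B (q.2.toNNReal : ℝ)) (X q.2 q.1) (χ q.2 q.1) (k q.2 q.1)⟫_ℝ :=
      (hp.comp measurable_swap).inner (hC.dB_meas.comp
        (f := fun q : Θ × ℝ => (((q.2.toNNReal, X q.2 q.1), χ q.2 q.1), k q.2 q.1))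
        (((measurable_snd.real_toNNReal.prodMk (hX.comp measurable_swap)).prodMk
          (hχ.comp measurable_swap)).prodMk (hk.comp measurable_swap)))
    have h2 := measurable_intervalIntegral (a := fun _ : Θ => (0 : ℝ)) (b := fun _ => T)
      measurable_const measurable_const (f := fun θ r => ⟪p r θ,
        fderiv ℝ (B (r.toNNReal : ℝ)) (X r θ) (χ r θ) (k r θ)⟫_ℝ) h1
    convert h2 using 2 with θ
    refine intervalIntegral.integral_congr fun r hr => ?_
    rw [uIcc_of_le hC.T_nonneg] at hr
    simp only [Real.coe_toNNReal _ hr.1]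

/-- `ibpDeriv` is the derivative of `ibpValue` along a line of forcings `Y + n • y`. -/
theorem hasDerivAt_ibpValue (hC : Coeffs S b B T K) {f : H → ℝ} (hf : ContDiff ℝ 1 f)
    {Y y χ : ℝ → H} {X : ℝ → ℝ → H} (hXm : ∀ n, Measurable (X n))
    (hX : ∀ n, IsMildSol S b 0 T (fun t => Y t + n • y t) (X n)) {δ : ℝ}
    (hy : ∀ t ∈ Icc 0 T, ‖y t‖ ≤ δ) {n : ℝ} (hχm : Measurable χ)
    (hχ : IsMildSol S (fun s d => fderiv ℝ (b s) (X n s) d) 0 T y χ)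
    {k : ℝ → ℝ → H} {w w' : H} (hkm : ∀ n, Measurable (k n)) (hkT : ∀ n, k n T = w)
    (hk : ∀ n, IsLinSol (fun r => B r (X n r)) 0 T (k n)) {p : ℝ → H} (hpm : Measurable p)
    (hp0 : p 0 = w') (hp : IsLinSol (fun r => -ContinuousLinearMap.adjoint (B r (X n r))) 0 T p) :
    HasDerivAt (fun m => ibpValue f w' T (X m) (k m)) (ibpDeriv f B w' T (X n) χ (k n) p) n := by
  have h1 : HasDerivAt (fun m => f (X m T)) (fderiv ℝ f (X n T) (χ T)) n :=
    ((hf.differentiable one_ne_zero) (X n T)).hasFDerivAt.comp_hasDerivAt n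
      (hC.hasDerivAt_mildSol hXm hX hy hχm hχ ⟨hC.T_nonneg, le_rfl⟩)
  have h2 := hC.hasDerivAt_backward hXm hX hy hχm hχ hkm hkT hk hpm hp
  rw [hp0] at h2
  exact (h1.fun_mul h2).congr_deriv (by rw [ibpDeriv]; ring)

end Pathwise

section OneStep

variable {Ω H ι : Type*} [mΩ : MeasurableSpace Ω] [NormedAddCommGroup H] [InnerProductSpace ℝ H]
  [CompleteSpace H] [SecondCountableTopology H] [MeasurableSpace H] [BorelSpace H]
  {W : ℝ≥0 → H → Ω → ℝ} {V : ℝ → Ω → H} {ℓ : StieltjesFunction ℝ} {P : Measure Ω}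
  [IsProbabilityMeasure P]
  {S : ℝ → H →L[ℝ] H} {b : ℝ → H → H} {σ : ℝ → H →L[ℝ] H} {B : ℝ → H → H →L[ℝ] H} {T K : ℝ}
  {x : H} {X Y : ℝ → Ω → H}

/-- Gaussian integration by parts along a line of solutions, in the real variable `N` which is
independent of the remaining randomness `φ`. -/
theorem Coeffs.exists_integral_mul_gaussian (e : HilbertBasis ι ℝ H) (hC : Coeffs S b B T K)
    {Θ : Type*} [MeasurableSpace Θ] {φ : Ω → Θ} (hφ : Measurable φ) {N : Ω → ℝ}
    (hN : Measurable N) (hind : IndepFun φ N P) {v : ℝ≥0} (hv : v ≠ 0)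
    (hγ : P.map N = gaussianReal 0 v) {X : ℝ → Θ × ℝ → H}
    (hX : Measurable fun q : ℝ × Θ × ℝ => X q.1 q.2) {Y : ℝ × Θ → H} {y : ℝ → H}
    (hy : Measurable y) {δ : ℝ} (hyδ : ∀ t ∈ Icc 0 T, ‖y t‖ ≤ δ)
    (hsol : ∀ᵐ ω ∂P, ∀ n, IsMildSol S b 0 T (fun t => Y (t, φ ω) + n • y t)
      (fun t => X t (φ ω, n)))
    {ξ : Θ → ℝ} (hξ : Measurable ξ) {Cξ : ℝ} (hξC : ∀ θ, |ξ θ| ≤ Cξ)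
    {f : H → ℝ} (hf : ContDiff ℝ 1 f) {Cf Cf' : ℝ} (hfC : ∀ y, |f y| ≤ Cf)
    (hfC' : ∀ y, ‖fderiv ℝ f y‖ ≤ Cf') (w w' : H) :
    ∃ χ k p : ℝ → Θ × ℝ → H, (Measurable fun q : ℝ × Θ × ℝ => χ q.1 q.2) ∧ (∀ θ,
      IsMildSol S (fun s d => fderiv ℝ (b s) (X s θ) d) 0 T y (fun t => χ t θ) ∧
      (k T θ = w ∧ IsLinSol (fun r => B r (X r θ)) 0 T (fun t => k t θ)) ∧
      (p 0 θ = w' ∧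
        IsLinSol (fun r => -ContinuousLinearMap.adjoint (B r (X r θ))) 0 T (fun t => p t θ))) ∧
      ∫ ω, ξ (φ ω) * N ω * ibpValue f w' T (fun t => X t (φ ω, N ω / v))
        (fun t => k t (φ ω, N ω / v)) ∂P =
      ∫ ω, ξ (φ ω) * ibpDeriv f B w' T (fun t => X t (φ ω, N ω / v))
        (fun t => χ t (φ ω, N ω / v)) (fun t => k t (φ ω, N ω / v))
        (fun t => p t (φ ω, N ω / v)) ∂P := by
  obtain ⟨χ, hχm, hχ⟩ := hC.exists_linMild hX hy hyδ
  obtain ⟨k, hkm, hk⟩ := hC.exists_backward hX w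
  obtain ⟨p, hpm, hp⟩ := hC.exists_adjoint e hX w'
  refine ⟨χ, k, p, hχm, fun θ => ⟨hχ θ, hk θ, hp θ⟩, ?_⟩
  have hv0 : (v : ℝ) ≠ 0 := by exact_mod_cast hv
  have h0T : (0 : ℝ) ∈ Icc 0 T := ⟨le_rfl, hC.T_nonneg⟩
  have hχb : ∀ θ, ∀ t ∈ Icc 0 T, ‖χ t θ‖ ≤ δ * Real.exp (2 * K * T) := fun θ t ht =>
    hC.norm_linMild_le (hχm.comp measurable_prodMk_right) (hχ θ) hyδ ht
  have hkb : ∀ θ, ∀ t ∈ Icc 0 T, ‖k t θ‖ ≤ ‖w‖ * Real.exp (2 * K * T) := fun θ t ht =>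
    (norm_backward_le hC (hk θ).2 ht).trans_eq (by rw [(hk θ).1])
  have hpb : ∀ θ, ∀ t ∈ Icc 0 T, ‖p t θ‖ ≤ ‖w'‖ * Real.exp (2 * K * T) := fun θ t ht =>
    (norm_adjoint_sol_le hC (hp θ).2 ht).trans_eq (by rw [(hp θ).1])
  set F : Θ × ℝ → ℝ := fun θ => ibpValue f w' T (fun t => X t θ) (fun t => k t θ) with hF
  set D : Θ × ℝ → ℝ := fun θ => ibpDeriv f B w' T (fun t => X t θ) (fun t => χ t θ)
    (fun t => k t θ) (fun t => p t θ) with hD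
  have hFm : Measurable F := (hf.continuous.measurable.comp (hX.comp measurable_prodMk_left)).mul
    (measurable_const.inner (hkm.comp measurable_prodMk_left))
  have hDm : Measurable D := measurable_ibpDeriv hC hf w' hX hχm hkm hpm
  obtain ⟨C, hFC, hDC⟩ : ∃ C : ℝ, (∀ θ, |F θ| ≤ C) ∧ ∀ θ, |D θ| ≤ C :=
    ⟨_, fun θ => (abs_ibpValue_le hfC (k := fun t => k t θ) (hkb θ 0 h0T)).trans
        (le_max_left _ _),
      fun θ => (abs_ibpDeriv_le hC hfC hfC' (hχb θ) (hkb θ) (hpb θ)).trans (le_max_right _ _)⟩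
  have hscale : Measurable fun q : Θ × ℝ => (q.1, q.2 / (v : ℝ)) := by fun_prop
  have hstein : ∀ᵐ ω ∂P, ∫ n, ξ (φ ω) * n * F (φ ω, n / v) ∂gaussianReal 0 v =
      ∫ n, ξ (φ ω) * D (φ ω, n / v) ∂gaussianReal 0 v := by
    filter_upwards [hsol] with ω hω
    have hder : ∀ n, HasDerivAt (fun n => F (φ ω, n)) (D (φ ω, n)) n := fun n =>
      hasDerivAt_ibpValue hC hf (X := fun n t => X t (φ ω, n)) (k := fun n t => k t (φ ω, n))
        (fun n => hX.comp measurable_prodMk_right) hω hyδ (hχm.comp measurable_prodMk_right)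
        (hχ _) (w := w) (fun n => hkm.comp measurable_prodMk_right) (fun n => (hk _).1)
        (fun n => (hk _).2) (hpm.comp measurable_prodMk_right) (hp _).1 (hp _).2
    -- the factor `1 / v` cancels the variance in Stein's identity
    have hder' : ∀ n, HasDerivAt (fun n => F (φ ω, n / v)) (D (φ ω, n / v) / v) n := fun n => by
      have := (hder (n / v)).comp n ((hasDerivAt_id n).div_const (v : ℝ))
      rw [mul_one_div] at this
      exact this
    have := integral_mul_gaussianReal hv hder' (C := max C (C / v))
      (fun n => (hFC _).trans (le_max_left _ _)) (fun n => by
        rw [abs_div, abs_of_nonneg v.coe_nonneg]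
        exact (div_le_div_of_nonneg_right (hDC _) v.coe_nonneg).trans (le_max_right _ _))
    simp only [mul_assoc, integral_const_mul]
    rw [this, integral_div, mul_div_cancel₀ _ hv0]
  have h1 := integral_comp_of_indepFun hφ hN hind hγ
    (G := fun q => ξ q.1 * q.2 * F (q.1, q.2 / v))
    (((hξ.comp measurable_fst).mul measurable_snd).mul (hFm.comp hscale))
    (g := fun n => Cξ * C * |n|) (by
      have h := (memLp_id_gaussianReal (μ := 0) (v := v) 1).integrable le_rfl
      exact h.abs.const_mul _) (fun θ n => by
      simp only [abs_mul]
      have hCξ := (abs_nonneg _).trans (hξC θ)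
      calc |ξ θ| * |n| * |F (θ, n / v)| ≤ Cξ * |n| * C := by
            gcongr
            exacts [hξC θ, hFC _]
        _ = Cξ * C * |n| := by ring)
  have h2 := integral_comp_of_indepFun hφ hN hind hγ
    (G := fun q => ξ q.1 * D (q.1, q.2 / v))
    ((hξ.comp measurable_fst).mul (hDm.comp hscale))
    (g := fun n => Cξ * C) (integrable_const _) (fun θ n => by
      simp only [abs_mul]
      have hCξ := (abs_nonneg _).trans (hξC θ)
      gcongr
      exacts [hξC θ, hDC _])
  exact h1.trans ((integral_congr_ae hstein).trans h2.symm)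

theorem integral_sq_increment (hW : IsCylindricalBrownian W P) {a c : ℝ} (hac : a ≤ c)
    (hℓa : 0 ≤ ℓ a) (u : H) {N : Ω → ℝ}
    (hN : N = fun ω => W (ℓ c).toNNReal u ω - W (ℓ a).toNNReal u ω) :
    ∫ ω, N ω * N ω ∂P = (ℓ c - ℓ a) * ‖u‖ ^ 2 := by
  have hle : (ℓ a).toNNReal ≤ (ℓ c).toNNReal := Real.toNNReal_le_toNNReal (ℓ.mono hac)
  have e : ∀ ω, N ω * N ω = W (ℓ c).toNNReal u ω * W (ℓ c).toNNReal u ω -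
      2 * (W (ℓ a).toNNReal u ω * W (ℓ c).toNNReal u ω) +
      W (ℓ a).toNNReal u ω * W (ℓ a).toNNReal u ω := fun ω => by rw [hN]; ring
  simp_rw [e]
  have h1 := hW.integrable_mul (ℓ c).toNNReal (ℓ c).toNNReal u u
  have h2 := (hW.integrable_mul (ℓ a).toNNReal (ℓ c).toNNReal u u).const_mul 2
  have h3 := hW.integrable_mul (ℓ a).toNNReal (ℓ a).toNNReal u u
  have h12 : Integrable (fun ω => W (ℓ c).toNNReal u ω * W (ℓ c).toNNReal u ω -
      2 * (W (ℓ a).toNNReal u ω * W (ℓ c).toNNReal u ω)) P := h1.sub h2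
  rw [integral_add h12 h3, integral_sub h1 h2, integral_const_mul, hW.cov, hW.cov, hW.cov,
    min_self, min_self, min_eq_left hle, real_inner_self_eq_norm_sq,
    Real.coe_toNNReal _ hℓa, Real.coe_toNNReal _ (hℓa.trans (ℓ.mono hac))]
  ring

/-- Integration by parts for the increment of the noise over `(a, c]` in the direction `u`. -/
theorem Model.integral_mul_increment (e : HilbertBasis ι ℝ H)
    (hM : Model W V ℓ P S b σ B T K x X Y) {a c : ℝ} (ha : 0 ≤ a) (hac : a ≤ c) (hc : c ≤ T)
    (u : H) {ξ : Ω → ℝ} (hξ : Measurable[history W V ℓ a] ξ) {Cξ : ℝ} (hξC : ∀ ω, |ξ ω| ≤ Cξ)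
    {f : H → ℝ} (hf : ContDiff ℝ 1 f) {Cf Cf' : ℝ} (hfC : ∀ y, |f y| ≤ Cf)
    (hfC' : ∀ y, ‖fderiv ℝ f y‖ ≤ Cf') {w w' : H} {χ k p : ℝ → Ω → H}
    (hχm : Measurable fun q : ℝ × Ω => χ q.1 q.2)
    (hχ : ∀ ω, IsMildSol S (fun s d => fderiv ℝ (b s) (X s ω) d) 0 T
      (noiseConv S σ ℓ ((Ioc a c).indicator fun _ => u)) (fun t => χ t ω))
    (hk : ∀ ω, k T ω = w ∧ IsLinSol (fun r => B r (X r ω)) 0 T (fun t => k t ω))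
    (hp : ∀ ω, p 0 ω = w' ∧
      IsLinSol (fun r => -ContinuousLinearMap.adjoint (B r (X r ω))) 0 T (fun t => p t ω)) :
    ∫ ω, ξ ω * (W (ℓ c).toNNReal u ω - W (ℓ a).toNNReal u ω) *
      ibpValue f w' T (fun t => X t ω) (fun t => k t ω) ∂P =
    ∫ ω, ξ ω * ibpDeriv f B w' T (fun t => X t ω) (fun t => χ t ω) (fun t => k t ω)
      (fun t => p t ω) ∂P := by
  have hW := hM.brownian
  have hC := hM.coeffs
  have h0T : (0 : ℝ) ∈ Icc 0 T := ⟨le_rfl, hC.T_nonneg⟩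
  have hTT : T ∈ Icc 0 T := ⟨hC.T_nonneg, le_rfl⟩
  obtain ⟨N, hNdef⟩ : ∃ N : Ω → ℝ, N = fun ω => W (ℓ c).toNNReal u ω - W (ℓ a).toNNReal u ω :=
    ⟨_, rfl⟩
  obtain ⟨y, hydef⟩ : ∃ y, y = noiseConv S σ ℓ ((Ioc a c).indicator fun _ => u) := ⟨_, rfl⟩
  have hN : N ∈ noiseSpan W := hNdef ▸ (noiseSpan W).sub_mem (mem_noiseSpan _ _)
    (mem_noiseSpan _ _)
  have hNm : Measurable N := (measurable_of_mem_noiseSpan hN).mono hW.sigmaW_le le_rfl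
  have hs2 := integral_sq_increment hW hac (hM.ℓ_zero ▸ ℓ.mono ha) u hNdef
  have hum : Measurable ((Ioc a c).indicator fun _ => u) := measurable_const.indicator
    measurableSet_Ioc
  have hym : Measurable y := by
    have := measurable_noiseConv (ℓ := ℓ) hC hM.σ_meas (Θ := Unit)
      (g := fun s _ => (Ioc a c).indicator (fun _ => u) s) (hum.comp measurable_fst)
    rw [hydef]
    exact this.comp (f := fun t : ℝ => (t, ())) (by fun_prop)
  have hyδ : ∀ t ∈ Icc 0 T, ‖y t‖ ≤ K * ((ℓ c - ℓ a) * ‖u‖) := by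
    intro t ht
    rw [hydef]
    refine (norm_noiseConv_le hC hM.σ_meas hM.σ_norm hum
      (integrableOn_indicator_const ℓ a c T u) ht).trans_eq ?_
    have e1 : ∀ s, ‖(Ioc a c).indicator (fun _ => u) s‖ =
        (Ioc a c).indicator (fun _ => ‖u‖) s := fun s => norm_indicator_eq_indicator_norm _ _
    simp_rw [e1]
    rw [setIntegral_indicator measurableSet_Ioc, inter_eq_right.2 (Ioc_subset_Ioc ha hc),
      setIntegral_const, measureReal_def, ℓ.measure_Ioc,
      ENNReal.toReal_ofReal (sub_nonneg.2 (ℓ.mono hac)), smul_eq_mul]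
  have hχsec : ∀ ω, Measurable fun t => χ t ω := fun ω => hχm.comp measurable_prodMk_right
  rw [← hydef] at hχ
  have hNapp : ∀ ω, W (ℓ c).toNNReal u ω - W (ℓ a).toNNReal u ω = N ω := fun ω => by rw [hNdef]
  simp_rw [hNapp]
  by_cases hv : ∫ ω, N ω * N ω ∂P = 0
  · -- a degenerate increment: both sides vanish
    have hN0 : N =ᵐ[P] 0 := by
      have := (integral_eq_zero_iff_of_nonneg (fun ω => mul_self_nonneg (N ω))
        ((hW.memLp_span hN).integrable_mul (hW.memLp_span hN))).1 hv
      filter_upwards [this] with ω hω using mul_self_eq_zero.1 hω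
    have hχ0 : ∀ ω, ∀ t ∈ Icc 0 T, ‖χ t ω‖ ≤ 0 := by
      intro ω t ht
      have h1 : (ℓ c - ℓ a) * ‖u‖ = 0 := by
        rw [hs2] at hv
        rcases mul_eq_zero.1 hv with h | h
        · rw [h, zero_mul]
        · rw [pow_eq_zero_iff two_ne_zero] at h; rw [h, mul_zero]
      have := hC.norm_linMild_le (hχsec ω) (hχ ω) hyδ ht
      rwa [h1, mul_zero, zero_mul] at this
    have hD0 : ∀ ω, ibpDeriv f B w' T (fun t => X t ω) (fun t => χ t ω) (fun t => k t ω)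
        (fun t => p t ω) = 0 := fun ω => by
      have := abs_ibpDeriv_le hC hfC hfC' (w' := w') (X := fun t => X t ω) (hχ0 ω)
        (k := fun t => k t ω) (p := fun t => p t ω)
        (fun t ht => norm_backward_le hC (hk ω).2 ht)
        (fun t ht => norm_adjoint_sol_le hC (hp ω).2 ht)
      rw [mul_zero] at this
      exact abs_nonpos_iff.1 this
    simp only [hD0, mul_zero, integral_zero]
    refine integral_eq_zero_of_ae ?_
    filter_upwards [hN0] with ω hω
    rw [hω]
    simp
  set v : ℝ≥0 := (∫ ω, N ω * N ω ∂P).toNNReal with hvdef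
  have hvpos : 0 ≤ ∫ ω, N ω * N ω ∂P := integral_nonneg fun ω => mul_self_nonneg (N ω)
  have hvcoe : (v : ℝ) = ∫ ω, N ω * N ω ∂P := Real.coe_toNNReal _ hvpos
  have hm := complement_le hW hM.V_meas hN
  have hind := indep_complement hW hM.V_meas hM.indep hN hv
  have hind' : @IndepFun Ω Ω ℝ mΩ (complement W V P N) _ id N P :=
    (IndepFun_iff_Indep (mβ := complement W V P N) id N P).2 (by
      rw [MeasurableSpace.comap_id]; exact hind)
  have hξm : Measurable[complement W V P N] ξ := by
    have := history_le_complement (V := V) hW hac u (ℓ := ℓ)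
    rw [← hNdef] at this
    exact hξ.mono this le_rfl
  -- The atom at `T` is there because versions agree only almost everywhere in time, while `X_T`
  -- itself enters the functional.
  set μ : Measure ℝ := volume.restrict (Icc 0 T) + Measure.dirac T with hμ
  obtain ⟨Y', X', hX'm, hX'⟩ := hM.exists_solution_version hm hTT (μ := μ)
    (Measure.absolutelyContinuous_of_le (Measure.le_add_right le_rfl)) hym hyδ
    (N := fun ω => N ω / v) (hNm.div_const _) (by
      rw [hμ, ae_add_measure_iff, ae_restrict_iff' measurableSet_Icc, ae_dirac_eq,
        eventually_pure, hydef, hvcoe]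
      refine ⟨?_, hM.forcing_end.aestronglyMeasurable_complement e hM hTT ha hac u hNdef⟩
      filter_upwards [hM.forcing] with q hq hqT
      exact (hq hqT).aestronglyMeasurable_complement e hM hqT ha hac u hNdef)
  rw [← (BorelSpace.measurable_eq : (Real.measurableSpace : MeasurableSpace ℝ) = borel ℝ)] at hX'm
  obtain ⟨χ', k', p', hχ'm, hsol, hmain⟩ := @Coeffs.exists_integral_mul_gaussian Ω H ι mΩ _ _ _ _
    _ _ P _ S b B T K e hC Ω (complement W V P N) id (measurable_id'' hm) N hNm hind' v
    (by rw [hvdef]; simpa [Real.toNNReal_eq_zero] using lt_of_le_of_ne hvpos (Ne.symm hv))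
    (hW.map_span hN) X' hX'm Y' y hym _ hyδ (hX'.mono fun ω h => h.1) ξ hξm Cξ hξC f hf Cf Cf'
    hfC hfC' w w'
  have hX'm' : Measurable fun q : ℝ × Ω × ℝ => X' q.1 q.2 := hX'm.mono
    (sup_le_sup le_rfl (MeasurableSpace.comap_mono (sup_le_sup (MeasurableSpace.comap_mono hm)
      le_rfl))) le_rfl
  have hχ'm' : Measurable fun q : ℝ × Ω × ℝ => χ' q.1 q.2 := hχ'm.mono
    (sup_le_sup le_rfl (MeasurableSpace.comap_mono (sup_le_sup (MeasurableSpace.comap_mono hm)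
      le_rfl))) le_rfl
  -- at `n = N ω / v` the family of solutions passes through the solution `X`
  have hident : ∀ᵐ ω ∂P,
      ibpValue f w' T (fun t => X' t (ω, N ω / v)) (fun t => k' t (ω, N ω / v)) =
        ibpValue f w' T (fun t => X t ω) (fun t => k t ω) ∧
      ibpDeriv f B w' T (fun t => X' t (ω, N ω / v)) (fun t => χ' t (ω, N ω / v))
        (fun t => k' t (ω, N ω / v)) (fun t => p' t (ω, N ω / v)) =
        ibpDeriv f B w' T (fun t => X t ω) (fun t => χ t ω) (fun t => k t ω)
          (fun t => p t ω) := by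
    filter_upwards [hX'] with ω ⟨_, hω⟩
    rw [hμ, ae_add_measure_iff, ae_restrict_iff' measurableSet_Icc, ae_dirac_eq,
      eventually_pure] at hω
    obtain ⟨hω1, hω2⟩ := hω
    have hXT : X' T (ω, N ω / v) = X T ω := hω2 hTT
    have hXae : ∀ᵐ q, q ∈ Icc 0 T → X' q (ω, N ω / v) = X q ω := by
      filter_upwards [hω1] with q hq hqT using hq hqT hqT
    obtain ⟨s1, ⟨s2, s3⟩, s4, s5⟩ := hsol (ω, N ω / v)
    have hk' : ∀ t ∈ Icc 0 T, k' t (ω, N ω / v) = k t ω := fun t ht =>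
      (s3.congr_ae hC.T_nonneg (by
        filter_upwards [hXae] with q hq hqT using by rw [hq hqT])).eq_of_right (hk ω).2
        (fun t ht => hC.B_norm t ht _) (s2.trans (hk ω).1.symm) ht
    have hp' : ∀ t ∈ Icc 0 T, p' t (ω, N ω / v) = p t ω := fun t ht =>
      (s5.congr_ae hC.T_nonneg (by
        filter_upwards [hXae] with q hq hqT using by rw [hq hqT])).eq_of_left (hp ω).2
        (fun t ht => by
          rw [norm_neg, LinearIsometryEquiv.norm_map]; exact hC.B_norm t ht _)
        (s4.trans (hp ω).1.symm) ht
    have hχ' : ∀ t ∈ Icc 0 T, χ' t (ω, N ω / v) = χ t ω := fun t ht =>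
      hC.mild_unique (fun t ht x y => by
        rw [← map_sub]; exact (fderiv ℝ (b t) (X t ω)).le_of_opNorm_le (hC.db_norm ht _) _)
        (s1.congr_ae hC.T_nonneg (by
          filter_upwards [hXae] with q hq hqT d using by rw [hq hqT])) (hχ ω)
        ((hχ'm'.comp (f := fun t : ℝ => (t, ω, N ω / v)) (by fun_prop)).sub
          (hχsec ω)).aestronglyMeasurable (ae_of_all _ fun _ _ => rfl) ht rfl
    simp only [ibpValue, ibpDeriv]
    rw [hXT, hk' 0 h0T, hχ' T hTT]
    refine ⟨rfl, ?_⟩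
    congr 2
    refine intervalIntegral.integral_congr_ae ?_
    filter_upwards [hXae] with r hr hrT
    rw [uIoc_of_le hC.T_nonneg] at hrT
    have hr' : r ∈ Icc 0 T := ⟨hrT.1.le, hrT.2⟩
    rw [hr hr', hp' r hr', hχ' r hr', hk' r hr']
  refine (integral_congr_ae ?_).trans (hmain.trans (integral_congr_ae ?_))
  · filter_upwards [hident] with ω hω
    simp only [id, hω.1]
  · filter_upwards [hident] with ω hω
    simp only [id, hω.2]

end OneStep

/-! ### Integration by parts for stochastic integrals -/

section Linear

variable {H : Type*} [NormedAddCommGroup H] [InnerProductSpace ℝ H]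
  [CompleteSpace H] [SecondCountableTopology H] [MeasurableSpace H] [BorelSpace H]
  {S : ℝ → H →L[ℝ] H} {b : ℝ → H → H} {B : ℝ → H → H →L[ℝ] H} {T K : ℝ}

theorem IsMildSol.sum_smul (hC : Coeffs S b B T K) {A : ℝ → H →L[ℝ] H} {κ : Type*} (s : Finset κ)
    (ξ : κ → ℝ) {y χ : κ → ℝ → H}
    (h : ∀ j, IsMildSol S (fun s d => A s d) 0 T (y j) (χ j)) :
    IsMildSol S (fun s d => A s d) 0 T (fun t => ∑ j ∈ s, ξ j • y j t)
      (fun t => ∑ j ∈ s, ξ j • χ j t) := by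
  constructor
  · simp only [map_sum, map_smul]
    have := IntervalIntegrable.sum s (f := fun j r => ξ j • A r (χ j r))
      fun j _ => (h j).1.smul (ξ j)
    rwa [Finset.sum_fn] at this
  · intro t ht
    have hsub : uIcc 0 t ⊆ uIcc 0 T := by
      rw [uIcc_of_le ht.1, uIcc_of_le hC.T_nonneg]; exact Icc_subset_Icc_right ht.2
    simp only [map_sum, map_smul]
    rw [intervalIntegral.integral_finsetSum (f := fun j r => ξ j • S (t - r) (A r (χ j r)))
      fun j _ => (hC.intervalIntegrable_S ht.1 ((h j).1.mono_set hsub)).smul (ξ j),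
      ← Finset.sum_add_distrib]
    refine Finset.sum_congr rfl fun j _ => ?_
    rw [intervalIntegral.integral_smul, ← smul_add, ← (h j).2 t ht]

theorem IsMildSol.sub_lin (hC : Coeffs S b B T K) {A : ℝ → H →L[ℝ] H} {y y' χ χ' : ℝ → H}
    (h : IsMildSol S (fun s d => A s d) 0 T y χ) (h' : IsMildSol S (fun s d => A s d) 0 T y' χ') :
    IsMildSol S (fun s d => A s d) 0 T (fun t => y t - y' t) (fun t => χ t - χ' t) := by
  constructor
  · simp only [map_sub]
    exact h.1.sub h'.1
  · intro t ht
    have hsub : uIcc 0 t ⊆ uIcc 0 T := by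
      rw [uIcc_of_le ht.1, uIcc_of_le hC.T_nonneg]; exact Icc_subset_Icc_right ht.2
    simp only [map_sub]
    rw [intervalIntegral.integral_sub (hC.intervalIntegrable_S ht.1 (h.1.mono_set hsub))
      (hC.intervalIntegrable_S ht.1 (h'.1.mono_set hsub)), h.2 t ht, h'.2 t ht]
    abel

theorem ibpDeriv_sum_smul {f : H → ℝ} {w' : H} {X k p : ℝ → H} {κ : Type*} (s : Finset κ)
    (ξ : κ → ℝ) {χ : κ → ℝ → H} (hχ : ∀ j,
      IntervalIntegrable (fun r => ⟪p r, fderiv ℝ (B r) (X r) (χ j r) (k r)⟫_ℝ) volume 0 T) :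
    ibpDeriv f B w' T X (fun t => ∑ j ∈ s, ξ j • χ j t) k p =
      ∑ j ∈ s, ξ j * ibpDeriv f B w' T X (χ j) k p := by
  simp only [ibpDeriv, map_sum, map_smul, sum_apply, smul_apply, inner_sum, inner_smul_right,
    smul_eq_mul]
  rw [intervalIntegral.integral_finsetSum fun j _ => (hχ j).const_mul (ξ j), Finset.sum_mul,
    Finset.mul_sum, ← Finset.sum_sub_distrib]
  refine Finset.sum_congr rfl fun j _ => ?_
  rw [intervalIntegral.integral_const_mul]
  ring

theorem ibpDeriv_sub {f : H → ℝ} {w' : H} {X χ χ' k p : ℝ → H}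
    (hχ : IntervalIntegrable (fun r => ⟪p r, fderiv ℝ (B r) (X r) (χ r) (k r)⟫_ℝ) volume 0 T)
    (hχ' : IntervalIntegrable (fun r => ⟪p r, fderiv ℝ (B r) (X r) (χ' r) (k r)⟫_ℝ) volume 0 T) :
    ibpDeriv f B w' T X (fun t => χ t - χ' t) k p =
      ibpDeriv f B w' T X χ k p - ibpDeriv f B w' T X χ' k p := by
  simp only [ibpDeriv, map_sub, sub_apply, inner_sub_right]
  rw [intervalIntegral.integral_sub hχ hχ']
  ring

end Linear

section StochInt

variable {Ω H ι : Type*} [mΩ : MeasurableSpace Ω] [NormedAddCommGroup H] [InnerProductSpace ℝ H]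
  [CompleteSpace H] [SecondCountableTopology H] [MeasurableSpace H] [BorelSpace H]
  {W : ℝ≥0 → H → Ω → ℝ} {V : ℝ → Ω → H} {ℓ : StieltjesFunction ℝ} {P : Measure Ω}
  [IsProbabilityMeasure P]
  {S : ℝ → H →L[ℝ] H} {b : ℝ → H → H} {σ : ℝ → H →L[ℝ] H} {B : ℝ → H → H →L[ℝ] H} {T K : ℝ}
  {x : H} {X Y : ℝ → Ω → H}

/-- Integration by parts for stochastic integrals: the adjoint of the derivative of the solution
in the direction `∫ h dℓ` of the noise is multiplication by the stochastic integral of `h`. -/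
theorem Model.integral_stochInt_mul (e : HilbertBasis ι ℝ H)
    (hM : Model W V ℓ P S b σ B T K x X Y) {h : ℝ → Ω → H}
    (hhm : Measurable fun q : ℝ × Ω => h q.1 q.2) {Ch : ℝ} (hhC : ∀ t ∈ Icc 0 T, ∀ ω, ‖h t ω‖ ≤ Ch)
    {I : Ω → ℝ} (hI : IsItoIntegral W V ℓ P T h I)
    {f : H → ℝ} (hf : ContDiff ℝ 1 f) {Cf Cf' : ℝ} (hfC : ∀ y, |f y| ≤ Cf)
    (hfC' : ∀ y, ‖fderiv ℝ f y‖ ≤ Cf') {w w' : H} {χ k p : ℝ → Ω → H}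
    (hχm : Measurable fun q : ℝ × Ω => χ q.1 q.2) (hkm : Measurable fun q : ℝ × Ω => k q.1 q.2)
    (hpm : Measurable fun q : ℝ × Ω => p q.1 q.2)
    (hχ : ∀ ω, IsMildSol S (fun s d => fderiv ℝ (b s) (X s ω) d) 0 T
      (noiseConv S σ ℓ (fun s => h s ω)) (fun t => χ t ω))
    (hk : ∀ ω, k T ω = w ∧ IsLinSol (fun r => B r (X r ω)) 0 T (fun t => k t ω))
    (hp : ∀ ω, p 0 ω = w' ∧
      IsLinSol (fun r => -ContinuousLinearMap.adjoint (B r (X r ω))) 0 T (fun t => p t ω)) :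
    ∫ ω, I ω * ibpValue f w' T (fun t => X t ω) (fun t => k t ω) ∂P =
    ∫ ω, ibpDeriv f B w' T (fun t => X t ω) (fun t => χ t ω) (fun t => k t ω)
      (fun t => p t ω) ∂P := by
  have hW := hM.brownian
  have hC := hM.coeffs
  have h0T : (0 : ℝ) ∈ Icc 0 T := ⟨le_rfl, hC.T_nonneg⟩
  set ν := ℓ.measure.restrict (Ioc 0 T) with hν
  set E := Real.exp (2 * K * T) with hE
  set D : (ℝ → Ω → H) → Ω → ℝ := fun χ ω => ibpDeriv f B w' T (fun t => X t ω)
    (fun t => χ t ω) (fun t => k t ω) (fun t => p t ω) with hD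
  set F : Ω → ℝ := fun ω => ibpValue f w' T (fun t => X t ω) (fun t => k t ω) with hF
  have hkb : ∀ ω, ∀ t ∈ Icc 0 T, ‖k t ω‖ ≤ ‖w‖ * E := fun ω t ht =>
    (norm_backward_le hC (hk ω).2 ht).trans_eq (by rw [(hk ω).1])
  have hpb : ∀ ω, ∀ t ∈ Icc 0 T, ‖p t ω‖ ≤ ‖w'‖ * E := fun ω t ht =>
    (norm_adjoint_sol_le hC (hp ω).2 ht).trans_eq (by rw [(hp ω).1])
  have hsec : ∀ {g : ℝ → Ω → H}, (Measurable fun q : ℝ × Ω => g q.1 q.2) →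
      ∀ ω, Measurable fun t => g t ω := fun hg ω => hg.comp measurable_prodMk_right
  have hFm : Measurable F := (hf.continuous.measurable.comp
    (hM.X_meas.comp measurable_prodMk_left)).mul
    (measurable_const.inner (hkm.comp measurable_prodMk_left))
  have hFb : ∀ ω, ‖F ω‖ ≤ Cf * (‖w'‖ * (‖w‖ * E)) := fun ω =>
    abs_ibpValue_le hfC (k := fun t => k t ω) (hkb ω 0 h0T)
  set CD := Cf' * (‖w'‖ * (‖w‖ * E)) + Cf * (T * (‖w'‖ * E * (K * (‖w‖ * E)))) with hCD
  have hDb : ∀ χ ω δ, (∀ t ∈ Icc 0 T, ‖χ t ω‖ ≤ δ) → |D χ ω| ≤ CD * δ := fun χ ω δ hδ =>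
    abs_ibpDeriv_le hC hfC hfC' (w' := w') (X := fun t => X t ω) (χ := fun t => χ t ω)
      (k := fun t => k t ω) (p := fun t => p t ω) hδ (hkb ω) (hpb ω)
  have hlinb : ∀ {g χ : ℝ → Ω → H} ω, (Measurable fun t => g t ω) → (Measurable fun t => χ t ω) →
      IntegrableOn (fun s => g s ω) (Ioc 0 T) ℓ.measure →
      IsMildSol S (fun s d => fderiv ℝ (b s) (X s ω) d) 0 T
        (noiseConv S σ ℓ (fun s => g s ω)) (fun t => χ t ω) →
      ∀ t ∈ Icc 0 T, ‖χ t ω‖ ≤ K * (∫ s, ‖g s ω‖ ∂ν) * E := fun ω hg hχ hgi hsol t ht =>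
    hC.norm_linMild_le hχ hsol (fun t ht => norm_noiseConv_le hC hM.σ_meas hM.σ_norm hg hgi ht) ht
  have hhi : ∀ ω, IntegrableOn (fun s => h s ω) (Ioc 0 T) ℓ.measure := fun ω =>
    Integrable.of_bound (hsec hhm ω).aestronglyMeasurable Ch
      ((ae_restrict_iff' measurableSet_Ioc).2 (ae_of_all _ fun s hs => hhC s ⟨hs.1.le, hs.2⟩ ω))
  have hhint : ∀ ω, ∫ s, ‖h s ω‖ ∂ν ≤ ∫ _, Ch ∂ν := fun ω =>
    integral_mono_ae (hhi ω).norm (integrable_const _)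
      ((ae_restrict_iff' measurableSet_Ioc).2 (ae_of_all _ fun s hs => hhC s ⟨hs.1.le, hs.2⟩ ω))
  have hχb : ∀ ω, ∀ t ∈ Icc 0 T, ‖χ t ω‖ ≤ K * (∫ _, Ch ∂ν) * E := fun ω t ht =>
    (hlinb ω (hsec hhm ω) (hsec hχm ω) (hhi ω) (hχ ω) t ht).trans
      (mul_le_mul_of_nonneg_right (mul_le_mul_of_nonneg_left (hhint ω) hC.K_nonneg)
        (Real.exp_pos _).le)
  have hDm : ∀ {χ : ℝ → Ω → H}, (Measurable fun q : ℝ × Ω => χ q.1 q.2) → Measurable (D χ) :=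
    fun hχ => measurable_ibpDeriv hC hf w' hM.X_meas hχ hkm hpm
  have hDχ : Integrable (D χ) P := Integrable.of_bound (hDm hχm).aestronglyMeasurable _
    (ae_of_all _ fun ω => hDb χ ω _ (hχb ω))
  obtain ⟨-, hI2, Φ, h1, h2⟩ := hI
  -- the claim for each of the approximating simple integrands, up to the error of approximation
  have hsimple : ∀ n, Integrable (fun q : ℝ × Ω => ‖(Φ n).val q.1 q.2 - h q.1 q.2‖) (ν.prod P) ∧
      |∫ ω, (Φ n).stochInt W ℓ ω * F ω ∂P - ∫ ω, D χ ω ∂P| ≤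
      CD * (K * E) * ∫ q : ℝ × Ω, ‖(Φ n).val q.1 q.2 - h q.1 q.2‖ ∂ν.prod P := by
    intro n
    obtain ⟨Cξ, hCξ0, hCξ⟩ := (Φ n).exists_bound
    let g : Fin (Φ n).n → ℝ → H := fun j =>
      (Ioc ((Φ n).left j) ((Φ n).right j)).indicator fun _ => (Φ n).dir j
    have hgm : ∀ j, Measurable (g j) := fun j => measurable_const.indicator measurableSet_Ioc
    have hgi : ∀ j, IntegrableOn (g j) (Ioc 0 T) ℓ.measure := fun j =>
      integrableOn_indicator_const ℓ _ _ T _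
    have hconv : ∀ j, Measurable (noiseConv S σ ℓ (g j)) := fun j =>
      (measurable_noiseConv (ℓ := ℓ) hC hM.σ_meas (Θ := Unit) (g := fun s _ => g j s)
        ((hgm j).comp measurable_fst)).comp (f := fun t : ℝ => (t, ())) (by fun_prop)
    choose χj hχjm hχj using fun j => hC.exists_linMild hM.X_meas (hconv j)
      (fun t ht => norm_noiseConv_le hC hM.σ_meas hM.σ_norm (hgm j) (hgi j) ht)
    have hχjb : ∀ j ω, ∀ t ∈ Icc 0 T, ‖χj j t ω‖ ≤ K * (∫ s, ‖g j s‖ ∂ν) * E := fun j ω =>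
      hlinb (g := fun s _ => g j s) ω (hgm j) (hsec (hχjm j) ω) (hgi j) (hχj j ω)
    have hval : ∀ t ω, (Φ n).val t ω = ∑ j, (Φ n).coef j ω • g j t := fun t ω => by
      refine Finset.sum_congr rfl fun j _ => ?_
      by_cases ht : t ∈ Ioc ((Φ n).left j) ((Φ n).right j)
      · simp only [g, indicator_of_mem ht]
      · simp only [g, indicator_of_notMem ht, smul_zero]
    let χΦ : ℝ → Ω → H := fun t ω => ∑ j, (Φ n).coef j ω • χj j t ω
    have hcm : ∀ j, Measurable ((Φ n).coef j) := fun j => (Φ n).measurable_coef' hW hM.V_meas j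
    have hχΦm : Measurable fun q : ℝ × Ω => χΦ q.1 q.2 :=
      Finset.measurable_fun_sum _ fun j _ => ((hcm j).comp measurable_snd).smul (hχjm j)
    have hΦm : Measurable fun q : ℝ × Ω => (Φ n).val q.1 q.2 := (Φ n).measurable_val hW hM.V_meas
    have hDΦ : ∀ ω, D χΦ ω = ∑ j, (Φ n).coef j ω * D (χj j) ω := fun ω =>
      ibpDeriv_sum_smul Finset.univ (fun j => (Φ n).coef j ω) (χ := fun j t => χj j t ω)
        fun j => intervalIntegrable_dB hC (hsec hM.X_meas ω) (hsec (hχjm j) ω) (hsec hkm ω)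
          (hsec hpm ω) (hχjb j ω) (hkb ω) (hpb ω)
    have hDχj : ∀ j, Integrable (fun ω => (Φ n).coef j ω * D (χj j) ω) P := fun j =>
      Integrable.of_bound ((hcm j).mul (hDm (hχjm j))).aestronglyMeasurable
        (Cξ * (CD * (K * (∫ s, ‖g j s‖ ∂ν) * E))) (ae_of_all _ fun ω => by
          rw [Real.norm_eq_abs, abs_mul]
          exact mul_le_mul (hCξ j ω) (hDb _ _ _ (hχjb j ω)) (abs_nonneg _) hCξ0)
    have hstep : ∫ ω, (Φ n).stochInt W ℓ ω * F ω ∂P = ∫ ω, D χΦ ω ∂P := by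
      simp only [SimpleIntegrand.stochInt, Finset.sum_mul, hDΦ]
      rw [integral_finsetSum _ fun j _ => hDχj j, integral_finsetSum]
      · refine Finset.sum_congr rfl fun j _ => ?_
        exact hM.integral_mul_increment e ((Φ n).left_nonneg j) ((Φ n).left_le_right j)
          ((Φ n).right_le j) ((Φ n).dir j) ((Φ n).measurable_coef j) (hCξ j) hf hfC hfC'
          (hχjm j) (hχj j) hk hp
      · intro j _
        have hN : MemLp (fun ω => W (ℓ ((Φ n).right j)).toNNReal ((Φ n).dir j) ω -
            W (ℓ ((Φ n).left j)).toNNReal ((Φ n).dir j) ω) 2 P :=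
          (hW.memLp _ _).sub (hW.memLp _ _)
        refine (((hN.integrable one_le_two).norm.const_mul Cξ).mul_const
          (Cf * (‖w'‖ * (‖w‖ * E)))).mono'
          (((hcm j).aestronglyMeasurable.mul hN.1).mul hFm.aestronglyMeasurable)
          (ae_of_all _ fun ω => ?_)
        rw [norm_mul, norm_mul]
        exact mul_le_mul (mul_le_mul_of_nonneg_right (hCξ j ω) (norm_nonneg _)) (hFb ω)
          (norm_nonneg _) (mul_nonneg hCξ0 (norm_nonneg _))
    have hΦh2 : Integrable (fun q : ℝ × Ω => ‖(Φ n).val q.1 q.2 - h q.1 q.2‖) (ν.prod P) := by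
      refine Integrable.norm (((SimpleIntegrand.memLp_val hW hM.V_meas (Φ n)).integrable
        one_le_two).sub (Integrable.of_bound hhm.aestronglyMeasurable Ch ?_))
      have h3 : ∀ᵐ t ∂ν, ∀ ω, ‖h t ω‖ ≤ Ch :=
        (ae_restrict_iff' measurableSet_Ioc).2 (ae_of_all _ fun s hs => hhC s ⟨hs.1.le, hs.2⟩)
      exact (Measure.quasiMeasurePreserving_fst.ae h3).mono fun q hq => hq q.2
    refine ⟨hΦh2, ?_⟩
    have hΦi : ∀ ω, IntegrableOn (fun s => (Φ n).val s ω) (Ioc 0 T) ℓ.measure := fun ω => by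
      simp only [hval]
      exact integrable_finsetSum _ fun j _ => (hgi j).smul _
    have hsol : ∀ ω, IsMildSol S (fun s d => fderiv ℝ (b s) (X s ω) d) 0 T
        (noiseConv S σ ℓ (fun s => (Φ n).val s ω - h s ω)) (fun t => χΦ t ω - χ t ω) := by
      intro ω
      have h3 := (IsMildSol.sum_smul hC Finset.univ (fun j => (Φ n).coef j ω)
        (A := fun s => fderiv ℝ (b s) (X s ω)) (χ := fun j t => χj j t ω) fun j => hχj j ω).sub_lin
        hC (hχ ω)
      refine ⟨h3.1, fun t ht => (h3.2 t ht).trans ?_⟩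
      congr 1
      rw [noiseConv_sub hC hM.σ_meas hM.σ_norm (hsec hΦm ω) (hΦi ω) (hsec hhm ω) (hhi ω) ht]
      simp only [hval]
      rw [noiseConv_sum_smul hC hM.σ_meas hM.σ_norm Finset.univ _ hgm hgi ht]
    have hdiff : ∀ ω, ‖D χΦ ω - D χ ω‖ ≤
        CD * (K * E) * ∫ s, ‖(Φ n).val s ω - h s ω‖ ∂ν := by
      intro ω
      have hb := hlinb (g := fun s ω => (Φ n).val s ω - h s ω) (χ := fun t ω => χΦ t ω - χ t ω) ω
        ((hsec hΦm ω).sub (hsec hhm ω)) ((hsec hχΦm ω).sub (hsec hχm ω))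
        ((hΦi ω).sub (hhi ω)) (hsol ω)
      have h4 := hDb (fun t ω => χΦ t ω - χ t ω) ω _ hb
      have h5 : D (fun t ω => χΦ t ω - χ t ω) ω = D χΦ ω - D χ ω := by
        refine ibpDeriv_sub (χ := fun t => χΦ t ω) (χ' := fun t => χ t ω) ?_ ?_
        · refine intervalIntegrable_dB hC (hsec hM.X_meas ω) (hsec hχΦm ω) (hsec hkm ω)
            (hsec hpm ω) (D := ∑ j, Cξ * (K * (∫ s, ‖g j s‖ ∂ν) * E)) (fun t ht => ?_) (hkb ω)
            (hpb ω)
          refine norm_sum_le_of_le _ fun j _ => ?_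
          rw [norm_smul]
          exact mul_le_mul (hCξ j ω) (hχjb j ω t ht) (norm_nonneg _) hCξ0
        · exact intervalIntegrable_dB hC (hsec hM.X_meas ω) (hsec hχm ω) (hsec hkm ω)
            (hsec hpm ω) (hχb ω) (hkb ω) (hpb ω)
      rw [h5] at h4
      rw [Real.norm_eq_abs]
      exact h4.trans_eq (by ring)
    have hDΦi : Integrable (D χΦ) P := by
      have := integrable_finsetSum Finset.univ fun j _ => hDχj j
      exact this.congr (ae_of_all _ fun ω => (hDΦ ω).symm)
    rw [hstep, ← integral_sub hDΦi hDχ, ← Real.norm_eq_abs]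
    refine (norm_integral_le_of_norm_le (hΦh2.integral_prod_right.const_mul _)
      (ae_of_all _ hdiff)).trans_eq ?_
    rw [integral_const_mul, ← integral_prod_symm _ hΦh2]
  have hmem : ∀ n, MemLp (fun q : ℝ × Ω => (Φ n).val q.1 q.2 - h q.1 q.2) 2 (ν.prod P) := by
    intro n
    refine (SimpleIntegrand.memLp_val hW hM.V_meas (Φ n)).sub
      (MemLp.of_bound hhm.aestronglyMeasurable Ch ?_)
    have h3 : ∀ᵐ t ∂ν, ∀ ω, ‖h t ω‖ ≤ Ch :=
      (ae_restrict_iff' measurableSet_Ioc).2 (ae_of_all _ fun s hs => hhC s ⟨hs.1.le, hs.2⟩)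
    exact (Measure.quasiMeasurePreserving_fst.ae h3).mono fun q hq => hq q.2
  rw [← tendsto_eLpNorm_two_iff (μ := ν.prod P)
    (f := fun n (q : ℝ × Ω) => (Φ n).val q.1 q.2 - h q.1 q.2)] at h1
  have herr : Tendsto (fun n => ∫ q : ℝ × Ω, ‖(Φ n).val q.1 q.2 - h q.1 q.2‖ ∂ν.prod P) atTop
      (𝓝 0) := by
    have := tendsto_integral_inner (μ := ν.prod P)
      (f := fun n (q : ℝ × Ω) => ‖(Φ n).val q.1 q.2 - h q.1 q.2‖) (f' := fun _ => (0 : ℝ))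
      (g := fun _ => (1 : ℝ)) (fun n => (hmem n).norm) (memLp_const _) (memLp_const _)
      (by simpa only [sub_zero, eLpNorm_norm] using h1)
    simpa [RCLike.inner_apply] using this
  have hlim1 : Tendsto (fun n => ∫ ω, (Φ n).stochInt W ℓ ω * F ω ∂P) atTop
      (𝓝 (∫ ω, D χ ω ∂P)) := by
    rw [tendsto_iff_norm_sub_tendsto_zero]
    refine squeeze_zero (fun _ => norm_nonneg _) (fun n => (hsimple n).2) ?_
    simpa using herr.const_mul (CD * (K * E))
  have hlim2 := tendsto_integral_inner (fun n => (Φ n).memLp_stochInt hW hM.V_meas) hI2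
    (MemLp.of_bound hFm.aestronglyMeasurable _ (ae_of_all _ hFb)) h2
  simp only [RCLike.inner_apply, RCLike.conj_to_real] at hlim2
  simp only [mul_comm (F _)] at hlim2
  exact tendsto_nhds_unique hlim2 hlim1

end StochInt

/-! ### The shift along the linearized flow -/

section Shift

variable {Ω H ι : Type*} [mΩ : MeasurableSpace Ω] [NormedAddCommGroup H] [InnerProductSpace ℝ H]
  [CompleteSpace H] [SecondCountableTopology H] [MeasurableSpace H] [BorelSpace H]
  {W : ℝ≥0 → H → Ω → ℝ} {V : ℝ → Ω → H} {ℓ : StieltjesFunction ℝ} {P : Measure Ω}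
  [IsProbabilityMeasure P]
  {S : ℝ → H →L[ℝ] H} {b : ℝ → H → H} {σ : ℝ → H →L[ℝ] H} {B : ℝ → H → H →L[ℝ] H} {T K : ℝ}
  {x : H} {X Y : ℝ → Ω → H}

/-- The operator `σ_t⁻¹ e^{At}`; negative times are replaced by `0`, for measurability. -/
def shiftOp (S : ℝ → H →L[ℝ] H) (σ : ℝ → H →L[ℝ] H) (t : ℝ) : H →L[ℝ] H :=
  (Ring.inverse (σ (t.toNNReal : ℝ))).comp (S (t.toNNReal : ℝ))

/-- Shifting the noise along `σ_s⁻¹ e^{As} j_s dℓ(s)`, where `j` solves the linearized equation,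
moves the solution in the direction `ℓ(t) e^{At} j_t`. -/
theorem Model.isMildSol_shift (hM : Model W V ℓ P S b σ B T K x X Y) {w : H} {j : ℝ → Ω → H}
    (hjm : Measurable fun q : ℝ × Ω => j q.1 q.2)
    (hj : ∀ ω, j 0 ω = w ∧ IsLinSol (fun r => B r (X r ω)) 0 T (fun t => j t ω)) (ω : Ω) :
    IsMildSol S (fun s d => fderiv ℝ (b s) (X s ω) d) 0 T
      (noiseConv S σ ℓ (fun s => shiftOp S σ s (j s ω)))
      (fun t => ℓ t • S (t.toNNReal : ℝ) (j t ω)) := by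
  have hC := hM.coeffs
  obtain ⟨-, hjs⟩ := hj ω
  have hjc := hjs.continuousOn
  set β : ℝ → H := fun r => B r (X r ω) (j r ω) with hβ
  have hdrift : ∀ s, 0 ≤ s → fderiv ℝ (b s) (X s ω) (ℓ s • S (s.toNNReal : ℝ) (j s ω)) =
      ℓ s • S s (β s) := fun s hs => by
    rw [Real.coe_toNNReal _ hs, map_smul]
    congr 1
    exact (DFunLike.congr_fun (hC.conj s hs (X s ω)) (j s ω)).symm
  constructor
  · refine (hjs.1.norm.const_mul |ℓ T|).mono_fun' ?_ ?_
    · rw [uIoc_of_le hC.T_nonneg]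
      refine (hC.aesm_db (hM.X_meas.comp measurable_prodMk_right) (χ := fun s : ℝ =>
        ℓ s • S (s.toNNReal : ℝ) (j s ω)) ?_).mono_measure
        (Measure.restrict_mono Ioc_subset_Icc_self le_rfl)
      exact ℓ.mono.measurable.smul (hC.S_meas.comp (f := fun s : ℝ => (s.toNNReal, j s ω))
        (measurable_real_toNNReal.prodMk (hjm.comp measurable_prodMk_right)))
    · rw [EventuallyLE, ae_restrict_iff' measurableSet_uIoc, uIoc_of_le hC.T_nonneg]
      refine ae_of_all _ fun s hs => ?_
      change ‖fderiv ℝ (b s) (X s ω) (ℓ s • S (s.toNNReal : ℝ) (j s ω))‖ ≤ |ℓ T| * ‖β s‖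
      rw [hdrift s hs.1.le, norm_smul]
      have h0 : 0 ≤ ℓ s := hM.ℓ_zero ▸ ℓ.mono hs.1.le
      refine mul_le_mul ?_ (hC.S_apply_le hs.1.le _) (norm_nonneg _) (abs_nonneg _)
      rw [Real.norm_eq_abs]
      exact abs_le_abs_of_nonneg h0 (ℓ.mono hs.2)
  · intro t ht
    have hsub : uIcc 0 t ⊆ uIcc 0 T := by
      rw [uIcc_of_le ht.1, uIcc_of_le hC.T_nonneg]; exact Icc_subset_Icc_right ht.2
    have hSS : ∀ s ∈ Ioc 0 t, ∀ z, S (t - s) (S s z) = S t z := fun s hs z => by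
      have := hC.S_add (t - s) s (sub_nonneg.2 hs.2) hs.1.le
      rw [sub_add_cancel] at this
      rw [this]; rfl
    have hjint : IntegrableOn (fun s => j s ω) (Ioc 0 t) ℓ.measure :=
      ((hjc.mono (Icc_subset_Icc_right ht.2)).integrableOn_compact isCompact_Icc).mono_set
        Ioc_subset_Icc_self
    have e1 : noiseConv S σ ℓ (fun s => shiftOp S σ s (j s ω)) t =
        S t (∫ s in Ioc 0 t, j s ω ∂ℓ.measure) := by
      rw [noiseConv, ← ContinuousLinearMap.integral_comp_comm _ hjint]
      refine setIntegral_congr_fun measurableSet_Ioc fun s hs => ?_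
      simp only [shiftOp, Real.coe_toNNReal _ hs.1.le, ContinuousLinearMap.comp_apply]
      rw [apply_ringInverse_apply (hM.σ_unit s hs.1.le), hSS s hs]
    have hβt : IntervalIntegrable β volume 0 t := hjs.1.mono_set hsub
    obtain ⟨-, e2⟩ := stieltjes_integral_integral ℓ hM.ℓ_zero ht.1 hβt
    have hℓβ : IntervalIntegrable (fun r => ℓ r • β r) volume 0 t := by
      refine (hβt.norm.const_mul |ℓ t|).mono_fun' ?_ ?_
      · exact ℓ.mono.measurable.aestronglyMeasurable.smul hβt.aestronglyMeasurable_restrict_uIoc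
      · rw [EventuallyLE, ae_restrict_iff' measurableSet_uIoc, uIoc_of_le ht.1]
        refine ae_of_all _ fun s hs => ?_
        rw [norm_smul, Real.norm_eq_abs]
        exact mul_le_mul_of_nonneg_right (abs_le_abs_of_nonneg (hM.ℓ_zero ▸ ℓ.mono hs.1.le)
          (ℓ.mono hs.2)) (norm_nonneg _)
    have e3 : ∫ s in (0 : ℝ)..t, S (t - s) (fderiv ℝ (b s) (X s ω)
        (ℓ s • S (s.toNNReal : ℝ) (j s ω))) = S t (∫ r in (0 : ℝ)..t, ℓ r • β r) := by
      rw [← ContinuousLinearMap.intervalIntegral_comp_comm _ hℓβ]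
      refine intervalIntegral.integral_congr_ae (ae_of_all _ fun s hs => ?_)
      rw [uIoc_of_le ht.1] at hs
      rw [hdrift s hs.1.le, map_smul, hSS s hs, map_smul]
    -- integration by parts for `ℓ(t) j_t`: here `β` is the derivative of `j`
    have e4 : ∫ s in Ioc 0 t, (∫ r in s..t, β r) ∂ℓ.measure =
        ℓ t • j t ω - ∫ s in Ioc 0 t, j s ω ∂ℓ.measure := by
      have e5 : ∀ s ∈ Ioc 0 t, ∫ r in s..t, β r = j t ω - j s ω := fun s hs => by
        have hsI : s ∈ uIcc 0 t := by rw [uIcc_of_le ht.1]; exact ⟨hs.1.le, hs.2⟩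
        have h1 := intervalIntegral.integral_add_adjacent_intervals
          (hβt.mono_set (uIcc_subset_uIcc left_mem_uIcc hsI))
          (hβt.mono_set (uIcc_subset_uIcc hsI right_mem_uIcc))
        have h2 : j s ω = j 0 ω + ∫ r in (0 : ℝ)..s, β r :=
          hjs.2 s ⟨hs.1.le, hs.2.trans ht.2⟩
        have h3 : j t ω = j 0 ω + ∫ r in (0 : ℝ)..t, β r := hjs.2 t ht
        rw [h2, h3, ← h1]
        abel
      rw [setIntegral_congr_fun measurableSet_Ioc e5, integral_sub (integrable_const _) hjint,
        setIntegral_const, measureReal_def, ℓ.measure_Ioc, hM.ℓ_zero, sub_zero,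
        ENNReal.toReal_ofReal (hM.ℓ_zero ▸ ℓ.mono ht.1)]
    change ℓ t • S (t.toNNReal : ℝ) (j t ω) = _ + ∫ s in (0 : ℝ)..t, S (t - s)
      (fderiv ℝ (b s) (X s ω) (ℓ s • S (s.toNNReal : ℝ) (j s ω)))
    rw [e1, e3, ← e2, e4, map_sub, Real.coe_toNNReal _ ht.1, map_smul]
    abel

theorem Model.measurable_shiftOp (hM : Model W V ℓ P S b σ B T K x X Y) {α : Type*}
    [MeasurableSpace α] {τ : α → ℝ} (hτ : Measurable τ) {g : α → H} (hg : Measurable g) :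
    Measurable fun a => shiftOp S σ (τ a) (g a) :=
  (measurable_clm_uncurry (A := fun t : ℝ≥0 => Ring.inverse (σ t)) hM.σinv_meas).comp
    (f := fun a => ((τ a).toNNReal, S ((τ a).toNNReal : ℝ) (g a)))
    (hτ.real_toNNReal.prodMk (hM.coeffs.S_meas.comp (f := fun a => ((τ a).toNNReal, g a))
      (hτ.real_toNNReal.prodMk hg)))

theorem Model.norm_shiftOp_le (hM : Model W V ℓ P S b σ B T K x X Y) {t : ℝ}
    (ht : t ∈ Icc 0 T) : ‖shiftOp S σ t‖ ≤ K := by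
  rw [shiftOp, Real.coe_toNNReal _ ht.1]
  refine (ContinuousLinearMap.opNorm_comp_le _ _).trans ?_
  have h1 := hM.coeffs.S_norm t ht.1
  have h2 := hM.σinv_norm t ht
  nlinarith [norm_nonneg (S t), norm_nonneg (Ring.inverse (σ t))]

theorem norm_forward_le (hC : Coeffs S b B T K) {X j : ℝ → H} {w : H} (hj0 : j 0 = w)
    (hj : IsLinSol (fun r => B r (X r)) 0 T j) {t : ℝ} (ht : t ∈ Icc 0 T) :
    ‖j t‖ ≤ ‖w‖ * Real.exp (2 * K * T) := by
  have hK := hC.K_nonneg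
  refine (hj.norm_le_left hK (fun r hr => hC.B_norm r hr _) ht).trans ?_
  rw [hj0]
  refine mul_le_mul_of_nonneg_left (Real.exp_le_exp.2 ?_) (norm_nonneg _)
  nlinarith [ht.2]

/-- The process `j` is bounded, continuous and adapted, so that its image under the deterministic
operators `shiftOp` is a limit of simple integrands. -/
theorem Model.exists_isItoIntegral_shift (e : HilbertBasis ι ℝ H)
    (hM : Model W V ℓ P S b σ B T K x X Y) {w : H} {j : ℝ → Ω → H}
    (hjm : Measurable fun q : ℝ × Ω => j q.1 q.2)
    (hj : ∀ ω, j 0 ω = w ∧ IsLinSol (fun r => B r (X r ω)) 0 T (fun t => j t ω)) :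
    ∃ I, IsItoIntegral W V ℓ P T (fun t ω => shiftOp S σ t (j t ω)) I := by
  have hC := hM.coeffs
  -- outside `[0, T]` nothing bounds `j`
  let j' : ℝ → Ω → H := fun t ω => (Icc 0 T).indicator (fun t => j t ω) t
  have hj' : ∀ t ∈ Icc 0 T, ∀ ω, j' t ω = j t ω := fun t ht ω => indicator_of_mem ht _
  have hj'm : Measurable fun q : ℝ × Ω => j' q.1 q.2 := by
    have : (fun q : ℝ × Ω => j' q.1 q.2) =
        (Prod.fst ⁻¹' Icc 0 T).indicator fun q : ℝ × Ω => j q.1 q.2 := by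
      ext q
      by_cases hq : q.1 ∈ Icc 0 T
      · rw [indicator_of_mem (show q ∈ Prod.fst ⁻¹' Icc 0 T from hq), hj' _ hq]
      · rw [indicator_of_notMem (show q ∉ Prod.fst ⁻¹' Icc 0 T from hq)]
        exact indicator_of_notMem hq _
    rw [this]
    exact hjm.indicator (measurable_fst measurableSet_Icc)
  have hm : Measurable fun q : ℝ × Ω => shiftOp S σ q.1 (j' q.1 q.2) :=
    hM.measurable_shiftOp measurable_fst hj'm
  have happ := isApprox_clm_apply (𝓕 := history W V ℓ) (P := P) (ℓ := ℓ) e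
    (history_le hM.brownian.measurable hM.V_meas ℓ) hC.T_nonneg (R := shiftOp S σ) (j := j')
    (C := ‖w‖ * Real.exp (2 * K * T)) (M := K)
    (fun u => (hM.measurable_shiftOp measurable_id measurable_const).aestronglyMeasurable)
    (fun t ht => hM.norm_shiftOp_le ⟨ht.1.le, ht.2⟩) (fun t ht => by
      obtain ⟨g, hg1, hg2⟩ := hM.aestronglyMeasurable_history_linSol e hj ht
      refine ⟨g, hg1.measurable, ?_⟩
      filter_upwards [hg2] with ω hω
      rw [hj' t ht, hω]) hj'm.aestronglyMeasurable (fun t ω => by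
      by_cases ht : t ∈ Icc 0 T
      · rw [hj' t ht]
        exact norm_forward_le hC (j := fun t => j t ω) (hj ω).1 (hj ω).2 ht
      · simp only [j', indicator_of_notMem ht, norm_zero]
        positivity) (ae_of_all _ fun ω => (hj ω).2.continuousOn.congr fun t ht => hj' t ht ω)
    hm.aestronglyMeasurable
  obtain ⟨I, hI⟩ := happ.exists_isItoIntegral hM.brownian hM.V_meas hM.indep hM.ℓ_zero
    hm.aestronglyMeasurable
  refine ⟨I, hI.congr_ae ?_ (ae_eq_refl _)⟩
  have h3 : ∀ᵐ t ∂ℓ.measure.restrict (Ioc 0 T), ∀ ω, j' t ω = j t ω :=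
    (ae_restrict_iff' measurableSet_Ioc).2 (ae_of_all _ fun s hs => hj' s ⟨hs.1.le, hs.2⟩)
  filter_upwards [Measure.quasiMeasurePreserving_fst.ae h3] with q hq
  rw [hq q.2]

end Shift

/-! ### Hilbert space valued stochastic integrals -/

section HValued

variable {Ω H ι : Type*} [mΩ : MeasurableSpace Ω] [NormedAddCommGroup H] [InnerProductSpace ℝ H]
  [CompleteSpace H] [SecondCountableTopology H] [MeasurableSpace H] [BorelSpace H]
  {W : ℝ≥0 → H → Ω → ℝ} {V : ℝ → Ω → H} {ℓ : StieltjesFunction ℝ} {P : Measure Ω}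
  [IsProbabilityMeasure P] {T : ℝ}

theorem lintegral_tsum_isItoIntegral_le [Countable ι] (hW : IsCylindricalBrownian W P)
    (hV : ∀ t, 0 ≤ t → Measurable (V t)) (hWV : Indep (sigmaW W) (sigmaV V) P) (hℓ0 : ℓ 0 = 0)
    {h : ι → ℝ → Ω → H} {I : ι → Ω → ℝ} (hI : ∀ i, IsItoIntegral W V ℓ P T (h i) (I i)) :
    ∫⁻ ω, ∑' i, ‖I i ω‖ₑ ^ 2 ∂P ≤
      ∫⁻ q, ∑' i, ‖h i q.1 q.2‖ₑ ^ 2 ∂((ℓ.measure.restrict (Ioc 0 T)).prod P) := by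
  rw [lintegral_tsum fun i => ((hI i).2.1.1.enorm.pow_const 2),
    lintegral_tsum fun i => ((hI i).1.enorm.pow_const 2)]
  refine ENNReal.tsum_le_tsum fun i => ?_
  have := (hI i).eLpNorm_le hW hV hWV hℓ0
  rw [← eLpNorm_two_sq, ← eLpNorm_two_sq (f := fun q : ℝ × Ω => h i q.1 q.2)]
  gcongr

/-- An `H`-valued random variable whose coordinates are stochastic integrals of the images of an
orthonormal basis under a Hilbert-Schmidt operator is square integrable. -/
theorem memLp_of_isItoIntegral (e : HilbertBasis ι ℝ H) (hW : IsCylindricalBrownian W P)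
    (hV : ∀ t, 0 ≤ t → Measurable (V t)) (hWV : Indep (sigmaW W) (sigmaV V) P) (hℓ0 : ℓ 0 = 0)
    {h : ι → ℝ → Ω → H} {I : Ω → H} (hIm : AEStronglyMeasurable I P)
    (hI : ∀ i, IsItoIntegral W V ℓ P T (h i) (fun ω => ⟪I ω, e i⟫_ℝ))
    (hfin : ∫⁻ q, ∑' i, ‖h i q.1 q.2‖ₑ ^ 2 ∂((ℓ.measure.restrict (Ioc 0 T)).prod P) ≠ ∞) :
    MemLp I 2 P := by
  have := countable_hilbertBasis e
  refine ⟨hIm, ?_⟩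
  have h1 := lintegral_tsum_isItoIntegral_le hW hV hWV hℓ0 hI
  have h2 : ∀ ω, ∑' i, ‖⟪I ω, e i⟫_ℝ‖ₑ ^ 2 = ‖I ω‖ₑ ^ 2 := fun ω => by
    rw [enorm_sq_eq_tsum e (I ω)]
    simp_rw [real_inner_comm (I ω)]
  simp_rw [h2] at h1
  rw [← eLpNorm_two_sq] at h1
  have h3 : eLpNorm I 2 P ^ 2 < ∞ := lt_of_le_of_lt h1 (lt_top_iff_ne_top.2 hfin)
  exact (ENNReal.pow_lt_top_iff.1 h3).resolve_right two_ne_zero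

/-- A family of real stochastic integrals with square summable integrands consists of the
coordinates of an `H`-valued random variable. -/
theorem exists_isItoIntegral_coords (e : HilbertBasis ι ℝ H) (hW : IsCylindricalBrownian W P)
    (hV : ∀ t, 0 ≤ t → Measurable (V t)) (hWV : Indep (sigmaW W) (sigmaV V) P) (hℓ0 : ℓ 0 = 0)
    {h : ι → ℝ → Ω → H} (hI : ∀ i, ∃ I, IsItoIntegral W V ℓ P T (h i) I)
    (hfin : ∫⁻ q, ∑' i, ‖h i q.1 q.2‖ₑ ^ 2 ∂((ℓ.measure.restrict (Ioc 0 T)).prod P) ≠ ∞) :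
    ∃ I : Ω → H, MemLp I 2 P ∧ ∀ i, IsItoIntegral W V ℓ P T (h i) (fun ω => ⟪I ω, e i⟫_ℝ) := by
  have := countable_hilbertBasis e
  choose J hJ using hI
  have h1 := (lintegral_tsum_isItoIntegral_le hW hV hWV hℓ0 hJ).trans_lt
    (lt_top_iff_ne_top.2 hfin)
  have hae : ∀ᵐ ω ∂P, HasSum (fun i => J i ω • e i) (∑' i, J i ω • e i) := by
    filter_upwards [ae_lt_top' (AEMeasurable.tsum fun i =>
      ((hJ i).2.1.1.enorm.pow_const 2)) h1.ne] with ω hω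
    have h2 := ENNReal.summable_toReal hω.ne
    have h3 : Summable fun i => ‖J i ω‖ ^ 2 := h2.congr fun i => by
      rw [ENNReal.toReal_pow, toReal_enorm]
    have h4 := (e.orthonormal.orthogonalFamily.summable_iff_norm_sq_summable
      (fun i => J i ω)).2 h3
    exact h4.hasSum
  have hcoord : ∀ i, (fun ω => ⟪∑' i, J i ω • e i, e i⟫_ℝ) =ᵐ[P] J i := fun i => by
    filter_upwards [hae] with ω hω
    have h2 := hω.mapL (innerSL ℝ (e i))
    have h3 := h2.unique (hasSum_single i fun k hk => ?_)
    · rw [real_inner_comm]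
      simpa [inner_smul_right, e.orthonormal.1 i] using h3
    · simp [e.orthonormal.2 hk.symm]
  have hIm : AEStronglyMeasurable (fun ω => ∑' i, J i ω • e i) P := by
    refine aestronglyMeasurable_of_tendsto_ae (atTop : Filter (Finset ι))
      (f := fun s ω => ∑ i ∈ s, J i ω • e i) (fun s => ?_) ?_
    · exact Finset.aestronglyMeasurable_fun_sum s fun i _ => (hJ i).2.1.1.smul_const (e i)
    · filter_upwards [hae] with ω hω using hω
  have hI : ∀ i, IsItoIntegral W V ℓ P T (h i) (fun ω => ⟪∑' i, J i ω • e i, e i⟫_ℝ) :=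
    fun i => (hJ i).congr_ae (ae_of_all _ fun _ => rfl) (hcoord i).symm
  exact ⟨_, memLp_of_isItoIntegral e hW hV hWV hℓ0 hIm hI hfin, hI⟩

end HValued

/-! ### The traces in the correction term -/

section Trace

variable {H ι : Type*} [NormedAddCommGroup H] [InnerProductSpace ℝ H] [CompleteSpace H]

theorem hsNormSq_comp_left_ne_top (e : HilbertBasis ι ℝ H) (M : H →L[ℝ] H) {L : H →L[ℝ] H}
    (hL : hsNormSq e L ≠ ∞) : hsNormSq e (M.comp L) ≠ ∞ :=
  ne_top_of_le_ne_top (ENNReal.mul_ne_top (by simp) hL) (hsNormSq_comp_le_left e M L)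

theorem hsNormSq_comp_right_ne_top (e : HilbertBasis ι ℝ H) {L : H →L[ℝ] H}
    (hL : hsNormSq e L ≠ ∞) (M : H →L[ℝ] H) : hsNormSq e (L.comp M) ≠ ∞ :=
  ne_top_of_le_ne_top (ENNReal.mul_ne_top (by simp) hL) (hsNormSq_comp_le_right e L M)

theorem toReal_hsNormSq_comp_le (e : HilbertBasis ι ℝ H) (M : H →L[ℝ] H) {L : H →L[ℝ] H}
    (hL : hsNormSq e L ≠ ∞) {c : ℝ} (hM : ‖M‖ ≤ c) :
    (hsNormSq e (M.comp L)).toReal ≤ c ^ 2 * (hsNormSq e L).toReal ∧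
    (hsNormSq e (L.comp M)).toReal ≤ c ^ 2 * (hsNormSq e L).toReal := by
  have h2 : (‖M‖ₑ ^ 2 * hsNormSq e L).toReal ≤ c ^ 2 * (hsNormSq e L).toReal := by
    rw [ENNReal.toReal_mul, ENNReal.toReal_pow, toReal_enorm]
    gcongr
  have h3 : ‖M‖ₑ ^ 2 * hsNormSq e L ≠ ∞ := ENNReal.mul_ne_top (by simp) hL
  exact ⟨(ENNReal.toReal_mono h3 (hsNormSq_comp_le_left e M L)).trans h2,
    (ENNReal.toReal_mono h3 (hsNormSq_comp_le_right e L M)).trans h2⟩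

/-- Conjugation by an invertible operator does not change the trace of `C L L`, with `L`
Hilbert-Schmidt. -/
theorem trace_conj (e : HilbertBasis ι ℝ H) {L J J' : H →L[ℝ] H} (C : H →L[ℝ] H)
    (hL : hsNormSq e L ≠ ∞) (hJ : ∀ u, J (J' u) = u) {c : ℝ} (hc : ‖J'.comp C‖ ≤ c)
    (hJc : ‖J‖ ≤ c) :
    Summable (fun i => ‖⟪J' (C (L (L (J (e i))))), e i⟫_ℝ‖) ∧
    ∑' i, ‖⟪J' (C (L (L (J (e i))))), e i⟫_ℝ‖ ≤ 2 * c ^ 2 * (hsNormSq e L).toReal ∧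
    ∑' i, ⟪J' (C (L (L (J (e i))))), e i⟫_ℝ = trace e (L.comp (C.comp L)) := by
  have hP := hsNormSq_comp_left_ne_top e (J'.comp C) hL
  have hQ := hsNormSq_comp_right_ne_top e hL J
  obtain ⟨h1, h2⟩ := summable_inner_comp e hP hQ
  refine ⟨h1, h2.trans ?_, (trace_comp_comm e hP hQ).trans ?_⟩
  · have h3 := (toReal_hsNormSq_comp_le e _ hL hc).1
    have h4 := (toReal_hsNormSq_comp_le e _ hL hJc).2
    linarith
  · congr 1
    ext u
    simp only [ContinuousLinearMap.comp_apply, hJ]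

/-- If `L L` is intertwined with `L' L'` by `R` and `J`, the trace of `σ⁻¹ L L (J' C R) σ` is that
of `C L' L'`. -/
theorem trace_intertwine (e : HilbertBasis ι ℝ H) {L L' J J' R s s' : H →L[ℝ] H} (C : H →L[ℝ] H)
    (hL : hsNormSq e L ≠ ∞) (hL' : hsNormSq e L' ≠ ∞) (hJ : ∀ u, J (J' u) = u)
    (hs : ∀ u, s (s' u) = u) (hR : ∀ u, R (L (L u)) = L' (L' (J u))) :
    Summable (fun i => ⟪s' (L (L (J' (C (R (s (e i))))))), e i⟫_ℝ) ∧
    ∑' i, ⟪s' (L (L (J' (C (R (s (e i))))))), e i⟫_ℝ = trace e (L'.comp (C.comp L')) := by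
  set M := J'.comp (C.comp R) with hM
  have hP := hsNormSq_comp_left_ne_top e s' hL
  have hQ := hsNormSq_comp_right_ne_top e hL (M.comp s)
  refine ⟨(summable_inner_comp e hP hQ).1.of_norm, (trace_comp_comm e hP hQ).trans ?_⟩
  have e1 : (L.comp (M.comp s)).comp (s'.comp L) = L.comp (M.comp L) := by
    ext u
    simp only [ContinuousLinearMap.comp_apply, hs]
  rw [e1, trace_comp_comm e hL (hsNormSq_comp_left_ne_top e M hL),
    ← (trace_conj e C hL' hJ (le_max_left ‖J'.comp C‖ ‖J‖) (le_max_right _ _)).2.2, trace]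
  refine tsum_congr fun i => ?_
  simp only [hM, ContinuousLinearMap.comp_apply, hR]

end Trace

section Pathwise

variable {H ι : Type*} [NormedAddCommGroup H] [InnerProductSpace ℝ H]
  [CompleteSpace H] [SecondCountableTopology H] [MeasurableSpace H] [BorelSpace H]
  {S : ℝ → H →L[ℝ] H} {b : ℝ → H → H} {B : ℝ → H → H →L[ℝ] H} {σ : ℝ → H →L[ℝ] H} {T K : ℝ}

/-- `‖e^{At}‖_HS` is nonincreasing in `t`, so that local integrability makes it finite for `t > 0`.
-/
theorem hsNormSq_semigroup_ne_top (e : HilbertBasis ι ℝ H) (hC : Coeffs S b B T K)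
    (hHS : ∀ t₀ : ℝ, 0 < t₀ → ∫⁻ t in Ioc 0 t₀, hsNormSq e (S t) ≠ ∞) {t : ℝ} (ht : 0 < t) :
    hsNormSq e (S t) ≠ ∞ := by
  intro h
  refine hHS t ht ?_
  rw [setLIntegral_congr_fun measurableSet_Ioc (g := fun _ => ∞) fun s hs => ?_]
  · simp [ht]
  · have h1 := hC.S_add (t - s) s (sub_nonneg.2 hs.2) hs.1.le
    rw [sub_add_cancel] at h1
    by_contra h2
    exact hsNormSq_comp_left_ne_top e (S (t - s)) h2 (h1 ▸ h)

theorem S_half (hC : Coeffs S b B T K) {t : ℝ} (ht : 0 ≤ t) (u : H) :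
    S t u = S (t / 2) (S (t / 2) u) := by
  have h1 := hC.S_add (t / 2) (t / 2) (by linarith) (by linarith)
  rw [add_halves] at h1
  rw [h1]
  rfl

/-- The operator `w ↦ (∇_w B_r)(X_r) J_{r,T}⁻¹ v`. -/
def corrDir (B : ℝ → H → H →L[ℝ] H) (T : ℝ) (X : ℝ → H) (J : ℝ → ℝ → H →L[ℝ] H) (v : H) (r : ℝ) :
    H →L[ℝ] H :=
  (fderiv ℝ (B r) (X r)).flip (Ring.inverse (J r T) v)

/-- The trace of `e^{Ar/2} C_r e^{Ar/2}`, where `C_r` is the operator `corrDir`. -/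
def corrTrace (e : HilbertBasis ι ℝ H) (S : ℝ → H →L[ℝ] H) (B : ℝ → H → H →L[ℝ] H) (T : ℝ)
    (X : ℝ → H) (J : ℝ → ℝ → H →L[ℝ] H) (v : H) (r : ℝ) : ℝ :=
  trace e ((S (r / 2)).comp ((corrDir B T X J v r).comp (S (r / 2))))

variable {X X' : ℝ → H} {J Jt : ℝ → ℝ → H →L[ℝ] H}

theorem measurable_B_path (hC : Coeffs S b B T K) (hX' : Measurable X') :
    Measurable fun q : ℝ × H => B (q.1.toNNReal : ℝ) (X' q.1.toNNReal) q.2 :=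
  hC.B_meas.comp (f := fun q : ℝ × H => ((q.1.toNNReal, X' q.1.toNNReal), q.2))
    ((measurable_fst.real_toNNReal.prodMk (hX'.comp
      measurable_fst.real_toNNReal.coe_nnreal_real)).prodMk measurable_snd)

/-- A flow along `X`, seen along the measurable modification `X'` and with the coefficients
extended to negative times in a measurable way. -/
theorem IsFlow.isLinFlow_path (hJ : IsFlow B T X J)
    (hXX' : ∀ᵐ t, t ∈ Icc 0 T → X t = X' t) :
    IsLinFlow (fun r => B (r.toNNReal : ℝ) (X' r.toNNReal)) T J :=
  hJ.isLinFlow (by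
    filter_upwards [hXX'] with t ht htT
    rw [Real.coe_toNNReal _ htT.1, ht htT])

theorem norm_B_path (hC : Coeffs S b B T K) {t : ℝ} (ht : t ∈ Icc 0 T) :
    ‖B (t.toNNReal : ℝ) (X' t.toNNReal)‖ ≤ K := by
  rw [Real.coe_toNNReal _ ht.1]; exact hC.B_norm t ht _

theorem exists_measurable_eqOn {f : ℝ → H} {t r : ℝ} (htr : t ≤ r) (hf : ContinuousOn f (Icc t r)) :
    ∃ g, Measurable g ∧ EqOn f g (Icc t r) ∧ ∃ M, ∀ q ∈ Icc t r, ‖f q‖ ≤ M := by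
  refine ⟨IccExtend htr ((Icc t r).domRestrict f), ?_, fun q hq => ?_,
    isCompact_Icc.exists_bound_of_continuousOn hf⟩
  · exact (continuousOn_iff_continuous_domRestrict.1 hf).Icc_extend'.measurable
  · rw [IccExtend_of_mem _ _ hq]; rfl

theorem intervalIntegrable_db (hC : Coeffs S b B T K) (hX' : Measurable X')
    (hXX' : ∀ᵐ t, t ∈ Icc 0 T → X t = X' t) {t : ℝ} (ht : t ∈ Icc 0 T) {χ χ' : ℝ → H}
    (hχ' : Measurable χ') (hχχ' : EqOn χ χ' (Icc t T)) {M : ℝ} (hM : ∀ q ∈ Icc t T, ‖χ q‖ ≤ M) :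
    IntervalIntegrable (fun q => fderiv ℝ (b q) (X q) (χ q)) volume t T := by
  refine (intervalIntegrable_const (c := K * M)).mono_fun' ?_ ?_
  · rw [uIoc_of_le ht.2]
    refine ((hC.aesm_db hX' hχ').mono_measure
      (Measure.restrict_mono (Ioc_subset_Icc_self.trans (Icc_subset_Icc_left ht.1))
        le_rfl)).congr ?_
    rw [EventuallyEq, ae_restrict_iff' measurableSet_Ioc]
    filter_upwards [hXX'] with q hq hqt
    rw [hq ⟨ht.1.trans hqt.1.le, hqt.2⟩, hχχ' ⟨hqt.1.le, hqt.2⟩]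
  · rw [EventuallyLE, ae_restrict_iff' measurableSet_uIoc, uIoc_of_le ht.2]
    refine ae_of_all _ fun q hq => ?_
    refine ((fderiv ℝ (b q) (X q)).le_of_opNorm_le
      (hC.db_norm ⟨ht.1.trans hq.1.le, hq.2⟩ _) _).trans ?_
    exact mul_le_mul_of_nonneg_left (hM q ⟨hq.1.le, hq.2⟩) hC.K_nonneg

/-- `J̃_{t,r} e^{At} = e^{Ar} J_{t,r}`. -/
theorem mildFlow_comp (hC : Coeffs S b B T K) (hX' : Measurable X')
    (hXX' : ∀ᵐ t, t ∈ Icc 0 T → X t = X' t)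
    (hJ : IsFlow B T X J) (hJt : IsMildFlow S b T X Jt) {t r : ℝ} (ht : 0 ≤ t) (htr : t ≤ r)
    (hr : r ≤ T) (u : H) : Jt t r (S t u) = S r (J t r u) := by
  have htT : t ∈ Icc 0 T := ⟨ht, htr.trans hr⟩
  obtain ⟨hc1, h1⟩ := hJt t htT (S t u)
  obtain ⟨hc2, h2⟩ := hJ t htT u
  have hSS : ∀ s q z, 0 ≤ s → s ≤ q → S (q - s) (S s z) = S q z := fun s q z hs hsq => by
    have := hC.S_add (q - s) s (sub_nonneg.2 hsq) hs
    rw [sub_add_cancel] at this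
    rw [this]; rfl
  have hdrift : ∀ q, t ≤ q → fderiv ℝ (b q) (X q) (S q (J t q u)) = S q (B q (X q) (J t q u)) :=
    fun q hq => (DFunLike.congr_fun (hC.conj q (ht.trans hq) (X q)) (J t q u)).symm
  obtain ⟨g1, hg1, hfg1, M1, hM1⟩ := exists_measurable_eqOn htT.2 hc1
  obtain ⟨g2, hg2, hfg2, M2, hM2⟩ := exists_measurable_eqOn htT.2 hc2
  have hg2' : Measurable fun q : ℝ => S (q.toNNReal : ℝ) (g2 q) :=
    hC.S_meas.comp (f := fun q : ℝ => (q.toNNReal, g2 q)) (measurable_real_toNNReal.prodMk hg2)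
  have hfg2' : EqOn (fun q => S q (J t q u)) (fun q => S (q.toNNReal : ℝ) (g2 q)) (Icc t T) :=
    fun q hq => by
      simp only [Real.coe_toNNReal _ (ht.trans hq.1), ← hfg2 hq]
  have s1 : IsMildSol S (fun q d => fderiv ℝ (b q) (X q) d) t T (fun q => S (q - t) (S t u))
      (fun q => Jt t q (S t u)) :=
    ⟨intervalIntegrable_db hC hX' hXX' htT hg1 hfg1 hM1, fun q hq => (h1 q hq).2⟩
  have s2 : IsMildSol S (fun q d => fderiv ℝ (b q) (X q) d) t T (fun q => S (q - t) (S t u))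
      (fun q => S q (J t q u)) := by
    refine ⟨intervalIntegrable_db hC hX' hXX' htT hg2' hfg2' (M := M2) fun q hq =>
      (hC.S_apply_le (ht.trans hq.1) _).trans (hM2 q hq), fun q hq => ?_⟩
    obtain ⟨hi, he⟩ := h2 q hq
    change S q (J t q u) = S (q - t) (S t u) +
      ∫ s in t..q, S (q - s) (fderiv ℝ (b s) (X s) (S s (J t s u)))
    rw [hSS t q u ht hq.1, he, map_add, ← ContinuousLinearMap.intervalIntegral_comp_comm _ hi]
    congr 1
    refine intervalIntegral.integral_congr fun s hs => ?_
    rw [uIcc_of_le hq.1] at hs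
    change S q (B s (X s) (J t s u)) = S (q - s) (fderiv ℝ (b s) (X s) (S s (J t s u)))
    rw [hdrift s hs.1, hSS s q _ (ht.trans hs.1) hs.2]
  refine hC.mild_unique (fun q hq x y => ?_) s1 s2 ?_ (ae_of_all _ fun _ _ => rfl) ⟨htr, hr⟩ rfl
  · rw [← map_sub]
    exact (fderiv ℝ (b q) (X q)).le_of_opNorm_le (hC.db_norm ⟨ht.trans hq.1, hq.2⟩ _) _
  · refine (hg1.sub hg2').aestronglyMeasurable.congr ?_
    rw [EventuallyEq, ae_restrict_iff' measurableSet_Ioc]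
    refine ae_of_all _ fun q hq => ?_
    have hq' : q ∈ Icc t T := ⟨hq.1.le, hq.2⟩
    have e1 := hfg1 hq'
    have e2 := hfg2' hq'
    change S q (J t q u) = S (q.toNNReal : ℝ) (g2 q) at e2
    simp only [Pi.sub_apply, e1, e2]

/-- The trace in the correction term does not depend on the earlier time `t`. -/
theorem trace_correctionOp (e : HilbertBasis ι ℝ H) (hC : Coeffs S b B T K)
    (hHS : ∀ t₀ : ℝ, 0 < t₀ → ∫⁻ t in Ioc 0 t₀, hsNormSq e (S t) ≠ ∞)
    (hσ : ∀ t, 0 ≤ t → IsUnit (σ t)) (hX' : Measurable X')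
    (hXX' : ∀ᵐ t, t ∈ Icc 0 T → X t = X' t) (hJ : IsFlow B T X J) (hJt : IsMildFlow S b T X Jt)
    (v : H) {t r : ℝ} (ht : 0 < t) (htr : t ≤ r) (hr : r ≤ T) :
    Summable (fun i => ⟪correctionOp S σ B T X J Jt v t r (e i), e i⟫_ℝ) ∧
      trace e (correctionOp S σ B T X J Jt v t r) = corrTrace e S B T X J v r := by
  have hu := (hJ.isLinFlow_path hXX').isUnit (measurable_B_path hC hX')
    (fun q hq => norm_B_path hC hq) ht.le htr hr
  have h := trace_intertwine e (s := σ t) (s' := Ring.inverse (σ t)) (J := J t r)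
    (J' := Ring.inverse (J t r)) (R := Jt t r) (corrDir B T X J v r)
    (hsNormSq_semigroup_ne_top e hC hHS (half_pos ht))
    (hsNormSq_semigroup_ne_top e hC hHS (half_pos (ht.trans_le htr)))
    (apply_ringInverse_apply hu) (apply_ringInverse_apply (hσ t ht.le)) (fun u => by
      rw [← S_half hC ht.le, ← S_half hC (ht.le.trans htr),
        mildFlow_comp hC hX' hXX' hJ hJt ht.le htr hr])
  simp only [← S_half hC ht.le] at h
  exact h

/-- In terms of solutions of the linearized equation and of its adjoint, the trace in the correction
term is the sum of the derivatives in the integration by parts formula. -/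
theorem corrTrace_eq_tsum (e : HilbertBasis ι ℝ H) (hC : Coeffs S b B T K)
    (hHS : ∀ t₀ : ℝ, 0 < t₀ → ∫⁻ t in Ioc 0 t₀, hsNormSq e (S t) ≠ ∞) (hX' : Measurable X')
    (hXX' : ∀ᵐ t, t ∈ Icc 0 T → X t = X' t) (hJ : IsFlow B T X J) {v : H}
    {j p : ι → ℝ → H} {k : ℝ → H}
    (hj : ∀ i, j i 0 = e i ∧ IsLinSol (fun r => B r (X' r)) 0 T (j i))
    (hp : ∀ i, p i 0 = e i ∧
      IsLinSol (fun r => -ContinuousLinearMap.adjoint (B r (X' r))) 0 T (p i))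
    (hk : k T = v ∧ IsLinSol (fun r => B r (X' r)) 0 T k) {r : ℝ} (hr : r ∈ Ioc 0 T)
    (hXr : X r = X' r) :
    HasSum (fun i => ⟪p i r, fderiv ℝ (B r) (X' r) (S (r.toNNReal : ℝ) (j i r)) (k r)⟫_ℝ)
      (corrTrace e S B T X J v r) ∧
    ∀ s : Finset ι, ∑ i ∈ s,
      |⟪p i r, fderiv ℝ (B r) (X' r) (S (r.toNNReal : ℝ) (j i r)) (k r)⟫_ℝ| ≤
      2 * (Real.exp (2 * K * T) * (1 + K * (Real.exp (2 * K * T) * ‖v‖))) ^ 2 *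
        (hsNormSq e (S (r / 2))).toReal := by
  have hr' : r ∈ Icc 0 T := ⟨hr.1.le, hr.2⟩
  have hT := hC.T_nonneg
  have hK := hC.K_nonneg
  set E := Real.exp (2 * K * T) with hE
  have hE0 : 0 < E := Real.exp_pos _
  have hflow := hJ.isLinFlow_path hXX'
  have hBm := measurable_B_path hC hX'
  have hBn : ∀ q ∈ Icc 0 T, ‖B (q.toNNReal : ℝ) (X' q.toNNReal)‖ ≤ K := fun q hq =>
    norm_B_path hC hq
  have hcongr : ∀ {d : ℝ → H}, IsLinSol (fun r => B r (X' r)) 0 T d →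
      IsLinSol (fun r => B (r.toNNReal : ℝ) (X' r.toNNReal)) 0 T d := fun hd =>
    hd.congr_ae hT (ae_of_all _ fun q hq => by rw [Real.coe_toNNReal _ hq.1])
  have hu := hflow.isUnit hBm hBn le_rfl hr'.1 hr'.2
  have hjr : ∀ i, J 0 r (e i) = j i r := fun i => by
    rw [← (hj i).1]
    exact hflow.apply_eq hBn le_rfl hr'.1 hr'.2 ((hcongr (hj i).2).mono ⟨le_rfl, hT⟩ hr')
  have hkr : Ring.inverse (J r T) v = k r := by
    rw [← hk.1]
    exact hflow.inverse_apply hBm hBn hr'.1 hr'.2 le_rfl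
      ((hcongr hk.2).mono hr' ⟨hT, le_rfl⟩)
  -- the adjoint solution `p` undoes the flow: `p_r = (J_{0,r}⁻¹)^* e_i`
  have hpr : ∀ i z, ⟪p i r, z⟫_ℝ = ⟪Ring.inverse (J 0 r) z, e i⟫_ℝ := fun i z => by
    rw [hflow.inner_adjoint_sol hBm hBn ((hp i).2.congr_ae hT (ae_of_all _ fun q hq => by
      rw [Real.coe_toNNReal _ hq.1])) hr' z, (hp i).1, real_inner_comm]
  have hterm : ∀ i, ⟪p i r, fderiv ℝ (B r) (X' r) (S (r.toNNReal : ℝ) (j i r)) (k r)⟫_ℝ =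
      ⟪Ring.inverse (J 0 r) (corrDir B T X J v r (S (r / 2) (S (r / 2) (J 0 r (e i))))),
        e i⟫_ℝ := fun i => by
    rw [hpr, ← S_half hC hr'.1, hjr, corrDir, hkr, hXr, Real.coe_toNNReal _ hr'.1]
    rfl
  have hCn : ‖corrDir B T X J v r‖ ≤ K * (E * ‖v‖) := by
    refine ContinuousLinearMap.opNorm_le_bound _ (by positivity) fun u => ?_
    have h1 : ‖Ring.inverse (J r T) v‖ ≤ E * ‖v‖ := ContinuousLinearMap.le_of_opNorm_le _
      (hflow.norm_inverse_le hBm hBn hr'.1 hr'.2 le_rfl) v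
    calc ‖corrDir B T X J v r u‖ ≤ K * ‖u‖ * ‖Ring.inverse (J r T) v‖ :=
          norm_dB_apply_le hC hr' _ _ _
      _ ≤ K * ‖u‖ * (E * ‖v‖) := by gcongr
      _ = K * (E * ‖v‖) * ‖u‖ := by ring
  have hc1 : ‖(Ring.inverse (J 0 r)).comp (corrDir B T X J v r)‖ ≤ E * (1 + K * (E * ‖v‖)) := by
    refine (ContinuousLinearMap.opNorm_comp_le _ _).trans ?_
    refine mul_le_mul (hflow.norm_inverse_le hBm hBn le_rfl hr'.1 hr'.2) ?_ (norm_nonneg _) hE0.le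
    linarith
  have hc2 : ‖J 0 r‖ ≤ E * (1 + K * (E * ‖v‖)) := by
    refine (hflow.norm_apply_le hBn le_rfl hr'.1 hr'.2).trans ?_
    have : 0 ≤ K * (E * ‖v‖) := by positivity
    nlinarith
  obtain ⟨h1, h2, h3⟩ := trace_conj e (corrDir B T X J v r)
    (hsNormSq_semigroup_ne_top e hC hHS (half_pos hr.1)) (apply_ringInverse_apply hu) hc1 hc2
  simp only [hterm]
  refine ⟨?_, fun s => (h1.sum_le_tsum s fun i _ => norm_nonneg _).trans h2⟩
  rw [corrTrace, ← h3]
  exact h1.of_norm.hasSum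

theorem intervalIntegrable_hsNormSq_half (e : HilbertBasis ι ℝ H) (hC : Coeffs S b B T K)
    (hHS : ∀ t₀ : ℝ, 0 < t₀ → ∫⁻ t in Ioc 0 t₀, hsNormSq e (S t) ≠ ∞) :
    IntervalIntegrable (fun r => (hsNormSq e (S (r / 2))).toReal) volume 0 T := by
  rcases hC.T_nonneg.eq_or_lt with hT | hT
  · rw [← hT]
  have h1 : IntervalIntegrable (fun r => (hsNormSq e (S r)).toReal) volume 0 (T / 2) := by
    rw [intervalIntegrable_iff_integrableOn_Ioc_of_le (half_pos hT).le]
    refine integrable_toReal_of_lintegral_ne_top ?_ (hHS _ (half_pos hT))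
    refine (((measurable_hsNormSq e hC.S_cont).comp
      measurable_real_toNNReal).aemeasurable).congr ?_
    rw [EventuallyEq, ae_restrict_iff' measurableSet_Ioc]
    exact ae_of_all _ fun r hr => by
      simp only [Function.comp_apply, Real.coe_toNNReal _ hr.1.le]
  have h2 := h1.comp_mul_left (c := 1 / 2)
  rw [zero_div, show T / 2 / (1 / 2) = T by ring] at h2
  simpa only [one_div_mul_eq_div] using h2

end Pathwise

section CorrectionPath

variable {H ι : Type*} [NormedAddCommGroup H] [InnerProductSpace ℝ H]
  [CompleteSpace H] [SecondCountableTopology H] [MeasurableSpace H] [BorelSpace H]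
  {S : ℝ → H →L[ℝ] H} {b : ℝ → H → H} {B : ℝ → H → H →L[ℝ] H} {σ : ℝ → H →L[ℝ] H} {T K : ℝ}
  {X X' : ℝ → H} {J Jt : ℝ → ℝ → H →L[ℝ] H}

/-- Summation over the orthonormal basis may be interchanged with integration over time. -/
theorem exists_tendsto_sum_integral (e : HilbertBasis ι ℝ H) (hC : Coeffs S b B T K)
    (hHS : ∀ t₀ : ℝ, 0 < t₀ → ∫⁻ t in Ioc 0 t₀, hsNormSq e (S t) ≠ ∞) (ℓ : StieltjesFunction ℝ)
    (hℓ0 : ℓ 0 = 0) (v : H) :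
    ∃ M : ℝ, ∀ {X X' : ℝ → H} {J : ℝ → ℝ → H →L[ℝ] H} {j p : ι → ℝ → H} {k : ℝ → H},
      Measurable X' → (∀ᵐ t, t ∈ Icc 0 T → X t = X' t) → IsFlow B T X J →
      (∀ i, Measurable (j i)) → (∀ i, Measurable (p i)) → Measurable k →
      (∀ i, j i 0 = e i ∧ IsLinSol (fun r => B r (X' r)) 0 T (j i)) →
      (∀ i, p i 0 = e i ∧
        IsLinSol (fun r => -ContinuousLinearMap.adjoint (B r (X' r))) 0 T (p i)) →
      (k T = v ∧ IsLinSol (fun r => B r (X' r)) 0 T k) →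
      IntervalIntegrable (corrTrace e S B T X J v) volume 0 T ∧
      Tendsto (fun s : Finset ι => ∑ i ∈ s, ∫ r in (0 : ℝ)..T,
        ℓ r * ⟪p i r, fderiv ℝ (B r) (X' r) (S (r.toNNReal : ℝ) (j i r)) (k r)⟫_ℝ) atTop
        (𝓝 (∫ r in (0 : ℝ)..T, ℓ r * corrTrace e S B T X J v r)) ∧
      ∀ s : Finset ι, |∑ i ∈ s, ∫ r in (0 : ℝ)..T,
        ℓ r * ⟪p i r, fderiv ℝ (B r) (X' r) (S (r.toNNReal : ℝ) (j i r)) (k r)⟫_ℝ| ≤ M := by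
  have hcount := countable_hilbertBasis e
  have hT := hC.T_nonneg
  set c := 2 * (Real.exp (2 * K * T) * (1 + K * (Real.exp (2 * K * T) * ‖v‖))) ^ 2 with hc
  set hs : ℝ → ℝ := fun r => (hsNormSq e (S (r / 2))).toReal with hhs
  refine ⟨∫ r in (0 : ℝ)..T, ℓ T * (c * hs r), ?_⟩
  intro X X' J j p k hX' hXX' hJ hjm hpm hkm hj hp hk
  set g : ι → ℝ → ℝ := fun i r =>
    ⟪p i r, fderiv ℝ (B r) (X' r) (S (r.toNNReal : ℝ) (j i r)) (k r)⟫_ℝ with hg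
  set μ := (volume : Measure ℝ).restrict (Ioc 0 T) with hμ
  have hmain : ∀ᵐ r ∂μ, r ∈ Ioc 0 T ∧ HasSum (fun i => g i r) (corrTrace e S B T X J v r) ∧
      ∀ s : Finset ι, ∑ i ∈ s, |g i r| ≤ c * hs r := by
    rw [hμ, ae_restrict_iff' measurableSet_Ioc]
    filter_upwards [hXX'] with r hr hrT
    exact ⟨hrT, corrTrace_eq_tsum e hC hHS hX' hXX' hJ hj hp hk hrT (hr ⟨hrT.1.le, hrT.2⟩)⟩
  have hsum : ∀ᵐ r ∂μ, ∀ s : Finset ι, |∑ i ∈ s, g i r| ≤ c * hs r := by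
    filter_upwards [hmain] with r hr s
    exact (Finset.abs_sum_le_sum_abs _ _).trans (hr.2.2 s)
  have hgm : ∀ i, AEStronglyMeasurable (g i) μ := fun i =>
    ((hpm i).aestronglyMeasurable.inner (𝕜 := ℝ) (hC.aesm_dB hX' (χ := fun r : ℝ =>
      S (r.toNNReal : ℝ) (j i r)) (hC.S_meas.comp (f := fun r : ℝ => (r.toNNReal, j i r))
        (measurable_real_toNNReal.prodMk (hjm i))) hkm)).mono_measure
      (Measure.restrict_mono Ioc_subset_Icc_self le_rfl)
  -- the dominating function: `‖e^{Ar/2}‖_HS²` is integrable in `r`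
  have hbd : Integrable (fun r => c * hs r) μ :=
    ((intervalIntegrable_iff_integrableOn_Ioc_of_le hT).1
      (intervalIntegrable_hsNormSq_half e hC hHS)).const_mul c
  have hτm : AEStronglyMeasurable (corrTrace e S B T X J v) μ :=
    aestronglyMeasurable_of_tendsto_ae (atTop : Filter (Finset ι))
      (f := fun s r => ∑ i ∈ s, g i r)
      (fun s => Finset.aestronglyMeasurable_fun_sum s fun i _ => hgm i)
      (by filter_upwards [hmain] with r hr using hr.2.1)
  have hτ : Integrable (corrTrace e S B T X J v) μ := by
    refine hbd.mono' hτm ?_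
    filter_upwards [hmain, hsum] with r hr hr'
    have h1 : Tendsto (fun s : Finset ι => ∑ i ∈ s, g i r) atTop
      (𝓝 (corrTrace e S B T X J v r)) := hr.2.1
    exact le_of_tendsto h1.norm (Eventually.of_forall hr')
  have hℓm : Measurable ℓ := ℓ.mono.measurable
  have hℓT : ∀ r ∈ Ioc 0 T, |ℓ r| ≤ ℓ T := fun r hr => by
    rw [abs_of_nonneg (hℓ0 ▸ ℓ.mono hr.1.le)]
    exact ℓ.mono hr.2
  have hbound : ∀ s : Finset ι, ∀ᵐ r ∂μ, ‖∑ i ∈ s, ℓ r * g i r‖ ≤ ℓ T * (c * hs r) := fun s => by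
    filter_upwards [hmain, hsum] with r hr hr'
    rw [← Finset.mul_sum, norm_mul]
    exact mul_le_mul (hℓT r hr.1) (hr' s) (abs_nonneg _) ((abs_nonneg _).trans (hℓT r hr.1))
  have hgint : ∀ i, Integrable (fun r => ℓ r * g i r) μ := fun i =>
    (hbd.const_mul (ℓ T)).mono' (hℓm.aestronglyMeasurable.mul (hgm i)) (by
      filter_upwards [hbound {i}] with r hr
      simpa only [Finset.sum_singleton] using hr)
  have hsumint : ∀ s : Finset ι, ∑ i ∈ s, ∫ r in (0 : ℝ)..T, ℓ r * g i r =
      ∫ r, ∑ i ∈ s, ℓ r * g i r ∂μ := fun s => by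
    rw [integral_finsetSum _ fun i _ => hgint i]
    simp only [intervalIntegral.integral_of_le hT, hμ]
  refine ⟨(intervalIntegrable_iff_integrableOn_Ioc_of_le hT).2 hτ, ?_, fun s => ?_⟩
  · refine Tendsto.congr (fun s => (hsumint s).symm) ?_
    rw [intervalIntegral.integral_of_le hT]
    refine tendsto_integral_filter_of_dominated_convergence (fun r => ℓ T * (c * hs r))
      (Eventually.of_forall fun s => Finset.aestronglyMeasurable_fun_sum s fun i _ =>
        (hgint i).1) (Eventually.of_forall hbound) (hbd.const_mul (ℓ T)) ?_
    filter_upwards [hmain] with r hr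
    have h1 : HasSum (fun i => ℓ r * g i r) (ℓ r * corrTrace e S B T X J v r) :=
      hr.2.1.mul_left (ℓ r)
    exact h1
  · rw [hsumint, intervalIntegral.integral_of_le hT, ← Real.norm_eq_abs]
    exact norm_integral_le_of_norm_le (hbd.const_mul (ℓ T)) (hbound s)

/-- The correction term converges, and is a single integral against `ℓ(r) dr`. -/
theorem correctionConverges_path (e : HilbertBasis ι ℝ H) (hC : Coeffs S b B T K)
    (hHS : ∀ t₀ : ℝ, 0 < t₀ → ∫⁻ t in Ioc 0 t₀, hsNormSq e (S t) ≠ ∞) {ℓ : StieltjesFunction ℝ}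
    (hℓ0 : ℓ 0 = 0) (hσ : ∀ t, 0 ≤ t → IsUnit (σ t)) (hX' : Measurable X')
    (hXX' : ∀ᵐ t, t ∈ Icc 0 T → X t = X' t) (hJ : IsFlow B T X J) (hJt : IsMildFlow S b T X Jt)
    {v : H} (hτ : IntervalIntegrable (corrTrace e S B T X J v) volume 0 T) :
    CorrectionConverges e ℓ T (correctionOp S σ B T X J Jt v) ∧
    ∫ t in Ioc 0 T, (∫ r in t..T, trace e (correctionOp S σ B T X J Jt v t r)) ∂ℓ.measure =
      ∫ r in (0 : ℝ)..T, ℓ r * corrTrace e S B T X J v r := by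
  have htr : ∀ t ∈ Ioc 0 T, ∀ r ∈ Icc t T,
      Summable (fun i => ⟪correctionOp S σ B T X J Jt v t r (e i), e i⟫_ℝ) ∧
      trace e (correctionOp S σ B T X J Jt v t r) = corrTrace e S B T X J v r := fun t ht r hr =>
    trace_correctionOp e hC hHS hσ hX' hXX' hJ hJt v ht.1 hr.1 hr.2
  have hint : ∀ t ∈ Ioc 0 T, (∫ r in t..T, trace e (correctionOp S σ B T X J Jt v t r)) =
      ∫ r in t..T, corrTrace e S B T X J v r := fun t ht =>
    intervalIntegral.integral_congr fun r hr => by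
      rw [uIcc_of_le ht.2] at hr
      exact (htr t ht r hr).2
  obtain ⟨h1, h2⟩ := stieltjes_integral_integral ℓ hℓ0 hC.T_nonneg hτ
  refine ⟨⟨fun t ht r hr => (htr t ht r hr).1, fun t ht => ?_, ?_⟩, ?_⟩
  · refine (hτ.mono_set ?_).congr fun r hr => ?_
    · rw [uIcc_of_le ht.2, uIcc_of_le hC.T_nonneg]
      exact Icc_subset_Icc_left ht.1.le
    · rw [uIoc_of_le ht.2] at hr
      exact (htr t ht r ⟨hr.1.le, hr.2⟩).2.symm
  · exact h1.congr_fun (fun t ht => (hint t ht).symm) measurableSet_Ioc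
  · rw [setIntegral_congr_fun measurableSet_Ioc hint, h2]
    simp only [smul_eq_mul]

end CorrectionPath

/-! ### The stochastic integral in the weight -/

section WeightIntegral

variable {Ω H ι : Type*} [mΩ : MeasurableSpace Ω] [NormedAddCommGroup H] [InnerProductSpace ℝ H]
  [CompleteSpace H] [SecondCountableTopology H] [MeasurableSpace H] [BorelSpace H]
  {W : ℝ≥0 → H → Ω → ℝ} {V : ℝ → Ω → H} {ℓ : StieltjesFunction ℝ} {P : Measure Ω}
  [IsProbabilityMeasure P]
  {S : ℝ → H →L[ℝ] H} {b : ℝ → H → H} {σ : ℝ → H →L[ℝ] H} {B : ℝ → H → H →L[ℝ] H} {T K : ℝ}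
  {x : H} {X X' Y : ℝ → Ω → H} {J Jt : Ω → ℝ → ℝ → H →L[ℝ] H}

/-- Along the model path, the flow `J` acts on vectors as the measurable solutions of the
linearized equation do. -/
theorem Model.ae_flow_apply (hM : Model W V ℓ P S b σ B T K x X' Y)
    (hXX' : ∀ᵐ ω ∂P, ∀ᵐ t, t ∈ Icc 0 T → X t ω = X' t ω)
    (hJ : ∀ᵐ ω ∂P, IsFlow B T (fun t => X t ω) (J ω)) {w : H} {j : ℝ → Ω → H}
    (hj : ∀ ω, j 0 ω = w ∧ IsLinSol (fun r => B r (X' r ω)) 0 T (fun t => j t ω)) :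
    ∀ᵐ ω ∂P, ∀ t ∈ Icc 0 T, J ω 0 t w = j t ω ∧ ‖J ω 0 t‖ ≤ Real.exp (2 * K * T) := by
  have hC := hM.coeffs
  filter_upwards [hXX', hJ] with ω hω hJω t ht
  have hflow := hJω.isLinFlow_path hω
  have hn : ∀ q ∈ Icc 0 T, ‖B (q.toNNReal : ℝ) (X' q.toNNReal ω)‖ ≤ K := fun q hq =>
    norm_B_path (X' := fun t => X' t ω) hC hq
  refine ⟨?_, hflow.norm_apply_le hn le_rfl ht.1 ht.2⟩
  rw [← (hj ω).1]
  refine hflow.apply_eq hn (d := fun t => j t ω) le_rfl ht.1 ht.2 (((hj ω).2.congr_ae hC.T_nonneg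
    (ae_of_all _ fun q hq => ?_)).mono ⟨le_rfl, hC.T_nonneg⟩ ht)
  rw [Real.coe_toNNReal _ hq.1]

theorem ae_prod_of_ae {p : ℝ → Ω → Prop} (h : ∀ᵐ ω ∂P, ∀ t ∈ Icc 0 T, p t ω) :
    ∀ᵐ q ∂(ℓ.measure.restrict (Ioc 0 T)).prod P, q.1 ∈ Icc 0 T ∧ p q.1 q.2 := by
  have h1 : ∀ᵐ t ∂ℓ.measure.restrict (Ioc 0 T), t ∈ Icc 0 T :=
    (ae_restrict_iff' measurableSet_Ioc).2 (ae_of_all _ fun s hs => ⟨hs.1.le, hs.2⟩)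
  filter_upwards [Measure.quasiMeasurePreserving_fst.ae h1,
    Measure.quasiMeasurePreserving_snd.ae h] with q hq1 hq2
  exact ⟨hq1, hq2 q.1 hq1⟩

/-- The integrand of the weight is square integrable in Hilbert-Schmidt norm. -/
theorem Model.lintegral_shiftOp_ne_top (e : HilbertBasis ι ℝ H)
    (hM : Model W V ℓ P S b σ B T K x X' Y)
    (hℓ_start : ∫⁻ t in Ioc 0 T, hsNormSq e (S t) ∂ℓ.measure ≠ ∞)
    (hXX' : ∀ᵐ ω ∂P, ∀ᵐ t, t ∈ Icc 0 T → X t ω = X' t ω)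
    (hJ : ∀ᵐ ω ∂P, IsFlow B T (fun t => X t ω) (J ω)) {j : ι → ℝ → Ω → H}
    (hj : ∀ i ω, j i 0 ω = e i ∧ IsLinSol (fun r => B r (X' r ω)) 0 T (fun t => j i t ω)) :
    ∫⁻ q, ∑' i, ‖shiftOp S σ q.1 (j i q.1 q.2)‖ₑ ^ 2
      ∂((ℓ.measure.restrict (Ioc 0 T)).prod P) ≠ ∞ := by
  have hcount := countable_hilbertBasis e
  rcases isEmpty_or_nonempty ι with hι | ⟨⟨i₀⟩⟩
  · simp
  set E := Real.exp (2 * K * T)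
  set c : ℝ≥0∞ := ENNReal.ofReal E ^ 2 * ENNReal.ofReal K ^ 2 with hc
  have h1 : ∀ᵐ ω ∂P, ∀ t ∈ Icc 0 T, ∑' i, ‖shiftOp S σ t (j i t ω)‖ₑ ^ 2 ≤
      c * hsNormSq e (S t) := by
    filter_upwards [ae_all_iff.2 fun i => hM.ae_flow_apply hXX' hJ (hj i)] with ω hω t ht
    have h2 : ∑' i, ‖shiftOp S σ t (j i t ω)‖ₑ ^ 2 =
        hsNormSq e ((shiftOp S σ t).comp (J ω 0 t)) := tsum_congr fun i => by
      rw [← (hω i t ht).1]; rfl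
    rw [h2, hc, mul_assoc]
    refine (hsNormSq_comp_le_right e _ _).trans (mul_le_mul' ?_ ?_)
    · rw [← ofReal_norm]
      gcongr
      exact (hω i₀ t ht).2
    · rw [shiftOp, Real.coe_toNNReal _ ht.1]
      refine (hsNormSq_comp_le_left e _ _).trans (mul_le_mul' ?_ le_rfl)
      rw [← ofReal_norm]
      gcongr
      exact hM.σinv_norm t ht
  refine ne_top_of_le_ne_top ?_ ((lintegral_mono_ae ((ae_prod_of_ae h1).mono fun q hq =>
    hq.2)).trans (lintegral_prod_le _))
  simp only [lintegral_const, measure_univ, mul_one]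
  rw [lintegral_const_mul' _ _ (by simp [hc, ENNReal.mul_eq_top])]
  exact ENNReal.mul_ne_top (by simp [hc, ENNReal.mul_eq_top]) hℓ_start

/-- The `H`-valued stochastic integral in the weight exists. -/
theorem Model.exists_isItoIntegralH (e : HilbertBasis ι ℝ H)
    (hM : Model W V ℓ P S b σ B T K x X' Y)
    (hℓ_start : ∫⁻ t in Ioc 0 T, hsNormSq e (S t) ∂ℓ.measure ≠ ∞)
    (hXX' : ∀ᵐ ω ∂P, ∀ᵐ t, t ∈ Icc 0 T → X t ω = X' t ω)
    (hJ : ∀ᵐ ω ∂P, IsFlow B T (fun t => X t ω) (J ω)) :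
    ∃ I : Ω → H, IsItoIntegralH W V ℓ P T (fun t ω => ContinuousLinearMap.adjoint
      ((Ring.inverse (σ t)).comp ((S t).comp (J ω 0 t)))) I := by
  have hW := hM.brownian
  have hC := hM.coeffs
  choose j hjm hj using fun i => hC.exists_forward hM.X_meas (e i)
  obtain ⟨I, hI2, hI⟩ := exists_isItoIntegral_coords e hW hM.V_meas hM.indep hM.ℓ_zero
    (fun i => hM.exists_isItoIntegral_shift e (hjm i) (hj i))
    (hM.lintegral_shiftOp_ne_top e hℓ_start hXX' hJ hj)
  refine ⟨I, hI2.1, fun y => ?_⟩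
  obtain ⟨d, hdm, hd⟩ := hC.exists_forward hM.X_meas y
  have hdy := hM.ae_flow_apply hXX' hJ hd
  suffices h : IsItoIntegral W V ℓ P T (fun t ω => shiftOp S σ t (d t ω)) (fun ω => ⟪I ω, y⟫_ℝ) by
    refine h.congr_ae ?_ (ae_eq_refl _)
    filter_upwards [ae_prod_of_ae hdy] with q ⟨hq1, hq2, _⟩
    rw [ContinuousLinearMap.adjoint_adjoint, shiftOp, Real.coe_toNNReal _ hq1.1, ← hq2]
    rfl
  have hcount := countable_hilbertBasis e
  have hrepr := e.hasSum_repr y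
  simp only [HilbertBasis.repr_apply_apply] at hrepr
  let a : Finset ι → ℝ := fun s => ‖(∑ i ∈ s, ⟪e i, y⟫_ℝ • e i) - y‖
  have ha : Tendsto a atTop (𝓝 0) := by
    have h1 : Tendsto (fun s : Finset ι => ∑ i ∈ s, ⟪e i, y⟫_ℝ • e i) atTop (𝓝 y) := hrepr
    simpa only [sub_self, norm_zero] using (h1.sub_const y).norm
  have hscale : ∀ (C : ℝ≥0∞) (D : ℝ), C ≠ ∞ →
      Tendsto (fun s => C * ENNReal.ofReal (D * a s)) atTop (𝓝 0) := fun C D hC => by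
    have h1 := ENNReal.tendsto_ofReal (ha.const_mul D)
    rw [mul_zero, ENNReal.ofReal_zero] at h1
    simpa only [mul_zero] using ENNReal.Tendsto.const_mul h1 (Or.inr hC)
  refine IsItoIntegral.of_approx hW hM.V_meas
    (hM.measurable_shiftOp measurable_fst hdm).aestronglyMeasurable
    (hI2.inner_const y) fun ε hε => ?_
  set μ := (ℓ.measure.restrict (Ioc 0 T)).prod P with hμ
  obtain ⟨s, hs1, hs2⟩ := (((hscale (μ univ ^ (2 : ℝ≥0∞).toReal⁻¹) (K * Real.exp (2 * K * T))
    (ENNReal.rpow_ne_top_of_nonneg (by simp) (measure_ne_top _ _))).eventually_le_const hε).and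
    ((hscale (eLpNorm I 2 P) 1 hI2.2.ne).eventually_le_const hε)).exists
  refine ⟨_, _, IsItoIntegral.sum s hW hM.V_meas fun i => (hI i).const_smul ⟪e i, y⟫_ℝ, ?_, ?_⟩
  · refine (eLpNorm_le_of_ae_bound ?_).trans hs1
    filter_upwards [ae_prod_of_ae hdy, ae_all_iff.2 fun i =>
      ae_prod_of_ae (ℓ := ℓ) (hM.ae_flow_apply hXX' hJ (hj i))] with q ⟨hq1, hq2, hq3⟩ hq
    have h1 : (∑ i ∈ s, ⟪e i, y⟫_ℝ • shiftOp S σ q.1 (j i q.1 q.2)) - shiftOp S σ q.1 (d q.1 q.2) =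
        shiftOp S σ q.1 (J q.2 0 q.1 ((∑ i ∈ s, ⟪e i, y⟫_ℝ • e i) - y)) := by
      simp only [map_sub, map_sum, map_smul, (hq _).2.1, hq2]
    rw [h1, mul_assoc]
    exact ContinuousLinearMap.le_of_opNorm_le_of_le _ (hM.norm_shiftOp_le hq1)
      (ContinuousLinearMap.le_of_opNorm_le _ hq3 _)
  · refine (eLpNorm_le_mul_eLpNorm_of_ae_le_mul (g := I) (c := 1 * a s)
      (ae_of_all _ fun ω => ?_) 2).trans ((mul_comm _ _).trans_le hs2)
    have h1 : (∑ i ∈ s, ⟪e i, y⟫_ℝ * ⟪I ω, e i⟫_ℝ) - ⟪I ω, y⟫_ℝ =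
        ⟪I ω, (∑ i ∈ s, ⟪e i, y⟫_ℝ • e i) - y⟫_ℝ := by
      simp only [inner_sub_right, inner_sum, real_inner_smul_right]
    rw [h1, one_mul, mul_comm]
    exact norm_inner_le_norm _ _

end WeightIntegral

theorem norm_sum_inner_smul_le {E ι : Type*} [NormedAddCommGroup E] [InnerProductSpace ℝ E]
    {e : ι → E} (he : Orthonormal ℝ e) (s : Finset ι) (y : E) :
    ‖∑ i ∈ s, ⟪e i, y⟫_ℝ • e i‖ ≤ ‖y‖ := by
  refine (pow_le_pow_iff_left₀ (norm_nonneg _) (norm_nonneg _) two_ne_zero).1 ?_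
  rw [← real_inner_self_eq_norm_sq, he.inner_sum]
  refine le_trans (le_of_eq (Finset.sum_congr rfl fun i _ => ?_))
    (he.sum_inner_products_le y (s := s))
  simp [sq]

/-! ### The integration by parts formula -/

section Formula

variable {Ω H ι : Type*} [mΩ : MeasurableSpace Ω] [NormedAddCommGroup H] [InnerProductSpace ℝ H]
  [CompleteSpace H] [SecondCountableTopology H] [MeasurableSpace H] [BorelSpace H]
  {W : ℝ≥0 → H → Ω → ℝ} {V : ℝ → Ω → H} {ℓ : StieltjesFunction ℝ} {P : Measure Ω}
  [IsProbabilityMeasure P]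
  {S : ℝ → H →L[ℝ] H} {b : ℝ → H → H} {σ : ℝ → H →L[ℝ] H} {B : ℝ → H → H →L[ℝ] H} {T K : ℝ}
  {x : H} {X X' Y : ℝ → Ω → H} {J Jt : Ω → ℝ → ℝ → H →L[ℝ] H}

/-- The value at time `0` of the backward solution `k` with `k_T = v` is `J_{0,T}⁻¹ v`. -/
theorem Model.ae_flow_backward (hM : Model W V ℓ P S b σ B T K x X' Y)
    (hXX' : ∀ᵐ ω ∂P, ∀ᵐ t, t ∈ Icc 0 T → X t ω = X' t ω)
    (hJ : ∀ᵐ ω ∂P, IsFlow B T (fun t => X t ω) (J ω)) {v : H} {k : ℝ → Ω → H}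
    (hk : ∀ ω, k T ω = v ∧ IsLinSol (fun r => B r (X' r ω)) 0 T (fun t => k t ω)) :
    ∀ᵐ ω ∂P, J ω 0 T (k 0 ω) = v ∧ Ring.inverse (J ω 0 T) v = k 0 ω := by
  have hC := hM.coeffs
  filter_upwards [hXX', hJ] with ω hω hJω
  have hflow := hJω.isLinFlow_path hω
  have hn : ∀ q ∈ Icc 0 T, ‖B (q.toNNReal : ℝ) (X' q.toNNReal ω)‖ ≤ K := fun q hq =>
    norm_B_path (X' := fun t => X' t ω) hC hq
  have hm := measurable_B_path hC (X' := fun t => X' t ω) (hM.X_meas.comp measurable_prodMk_right)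
  have hd := (hk ω).2.congr_ae hC.T_nonneg (A' := fun q : ℝ =>
    B (q.toNNReal : ℝ) (X' q.toNNReal ω)) (ae_of_all _ fun q hq => by
      rw [Real.coe_toNNReal _ hq.1])
  rw [← (hk ω).1]
  exact ⟨hflow.apply_eq hn le_rfl hC.T_nonneg le_rfl hd,
    hflow.inverse_apply hm hn le_rfl hC.T_nonneg le_rfl hd⟩

/-- Integration by parts, with the weight expressed through a measurable solution `k` of the
backward linearized equation. The one-dimensional formula is applied for every basis vector `e i`
to the integrand `σ_t⁻¹ S_t J_{0,t} e_i` and the functional `f(X_T) ⟨e_i, k_0⟩`. -/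
theorem Model.integral_mul_backward (e : HilbertBasis ι ℝ H)
    (hM : Model W V ℓ P S b σ B T K x X' Y)
    (hHS : ∀ t₀ : ℝ, 0 < t₀ → ∫⁻ t in Ioc 0 t₀, hsNormSq e (S t) ≠ ∞)
    (hℓ_start : ∫⁻ t in Ioc 0 T, hsNormSq e (S t) ∂ℓ.measure ≠ ∞)
    (hXX' : ∀ᵐ ω ∂P, ∀ᵐ t, t ∈ Icc 0 T → X t ω = X' t ω)
    (hJ : ∀ᵐ ω ∂P, IsFlow B T (fun t => X t ω) (J ω)) {I : Ω → H}
    (hI : IsItoIntegralH W V ℓ P T (fun t ω => ContinuousLinearMap.adjoint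
      ((Ring.inverse (σ t)).comp ((S t).comp (J ω 0 t)))) I) {v : H} {k : ℝ → Ω → H}
    (hkm : Measurable fun q : ℝ × Ω => k q.1 q.2)
    (hk : ∀ ω, k T ω = v ∧ IsLinSol (fun r => B r (X' r ω)) 0 T (fun t => k t ω))
    {f : H → ℝ} (hf : ContDiff ℝ 1 f) {Cf Cf' : ℝ} (hfC : ∀ y, |f y| ≤ Cf)
    (hfC' : ∀ y, ‖fderiv ℝ f y‖ ≤ Cf') :
    Integrable (fun ω => f (X' T ω) * (⟪I ω, k 0 ω⟫_ℝ +
      ∫ r in (0 : ℝ)..T, ℓ r * corrTrace e S B T (fun t => X t ω) (J ω) v r)) P ∧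
    ∫ ω, f (X' T ω) * (⟪I ω, k 0 ω⟫_ℝ +
      ∫ r in (0 : ℝ)..T, ℓ r * corrTrace e S B T (fun t => X t ω) (J ω) v r) ∂P =
      ℓ T * ∫ ω, fderiv ℝ f (X' T ω) (S T v) ∂P := by
  have hC := hM.coeffs
  have hT := hC.T_nonneg
  have h0T : (0 : ℝ) ∈ Icc 0 T := ⟨le_rfl, hT⟩
  have hTT : T ∈ Icc 0 T := ⟨hT, le_rfl⟩
  have hcount := countable_hilbertBasis e
  have hℓT : 0 ≤ ℓ T := hM.ℓ_zero ▸ ℓ.mono hT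
  have hCf : 0 ≤ Cf := (abs_nonneg _).trans (hfC 0)
  have hCf' : 0 ≤ Cf' := (norm_nonneg _).trans (hfC' 0)
  set E := Real.exp (2 * K * T) with hE
  have hK := hC.K_nonneg
  choose j hjm hj using fun i => hC.exists_forward hM.X_meas (e i)
  choose p hpm hp using fun i => hC.exists_adjoint e hM.X_meas (e i)
  have hflow := ae_all_iff.2 fun i => hM.ae_flow_apply hXX' hJ (hj i)
  have hIi : ∀ i, IsItoIntegral W V ℓ P T (fun t ω => shiftOp S σ t (j i t ω))
      (fun ω => ⟪I ω, e i⟫_ℝ) := fun i => by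
    refine (hI.2 (e i)).congr_ae ?_ (ae_eq_refl _)
    filter_upwards [ae_prod_of_ae (hM.ae_flow_apply hXX' hJ (hj i))] with q ⟨hq1, hq2, _⟩
    rw [ContinuousLinearMap.adjoint_adjoint, shiftOp, Real.coe_toNNReal _ hq1.1, ← hq2]
    rfl
  have hI2 : MemLp I 2 P := memLp_of_isItoIntegral e hM.brownian hM.V_meas hM.indep hM.ℓ_zero hI.1
    hIi (hM.lintegral_shiftOp_ne_top e hℓ_start hXX' hJ hj)
  obtain ⟨M, hMb⟩ := exists_tendsto_sum_integral e hC hHS ℓ hM.ℓ_zero v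
  let g : ι → Ω → ℝ := fun i ω => ∫ r in (0 : ℝ)..T, ℓ r *
    ⟪p i r ω, fderiv ℝ (B r) (X' r ω) (S (r.toNNReal : ℝ) (j i r ω)) (k r ω)⟫_ℝ
  let χ : ι → ℝ → Ω → H := fun i t ω => ℓ t • S (t.toNNReal : ℝ) (j i t ω)
  let q : Finset ι → Ω → H := fun s ω => ∑ i ∈ s, ⟪e i, k 0 ω⟫_ℝ • e i
  let L : ι → Ω → ℝ := fun i ω =>
    ⟪I ω, e i⟫_ℝ * ibpValue f (e i) T (fun t => X' t ω) (fun t => k t ω)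
  let D : ι → Ω → ℝ := fun i ω => ibpDeriv f B (e i) T (fun t => X' t ω) (fun t => χ i t ω)
    (fun t => k t ω) (fun t => p i t ω)
  let A : ι → Ω → ℝ := fun i ω => fderiv ℝ f (X' T ω) (χ i T ω) * ⟪e i, k 0 ω⟫_ℝ
  have hsec : ∀ {h : ℝ → Ω → H}, (Measurable fun q : ℝ × Ω => h q.1 q.2) →
      ∀ ω, Measurable fun t => h t ω := fun hg ω => hg.comp measurable_prodMk_right
  have hsec' : ∀ {h : ℝ → Ω → H}, (Measurable fun q : ℝ × Ω => h q.1 q.2) →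
      ∀ t, Measurable (h t) := fun hg t => hg.comp measurable_prodMk_left
  have hkb : ∀ ω, ∀ t ∈ Icc 0 T, ‖k t ω‖ ≤ ‖v‖ * E := fun ω t ht =>
    (norm_backward_le hC (hk ω).2 ht).trans_eq (by rw [(hk ω).1])
  have hpb : ∀ i ω, ∀ t ∈ Icc 0 T, ‖p i t ω‖ ≤ ‖e i‖ * E := fun i ω t ht =>
    (norm_adjoint_sol_le hC (hp i ω).2 ht).trans_eq (by rw [(hp i ω).1])
  have hjb : ∀ i ω, ∀ t ∈ Icc 0 T, ‖j i t ω‖ ≤ ‖e i‖ * E := fun i ω t ht =>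
    norm_forward_le hC (hj i ω).1 (hj i ω).2 ht
  have hχb : ∀ i ω, ∀ t ∈ Icc 0 T, ‖χ i t ω‖ ≤ ℓ T * (‖e i‖ * E) := fun i ω t ht => by
    have h1 : |ℓ t| ≤ ℓ T := by
      rw [abs_of_nonneg (hM.ℓ_zero ▸ ℓ.mono ht.1)]
      exact ℓ.mono ht.2
    have h2 := (S (t.toNNReal : ℝ)).le_of_opNorm_le (hC.S_norm _ (NNReal.coe_nonneg _)) (j i t ω)
    rw [one_mul] at h2
    rw [norm_smul, Real.norm_eq_abs]
    exact mul_le_mul h1 (h2.trans (hjb i ω t ht)) (norm_nonneg _) hℓT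
  have hχm : ∀ i, Measurable fun q : ℝ × Ω => χ i q.1 q.2 := fun i =>
    (ℓ.mono.measurable.comp measurable_fst).smul (hC.S_meas.comp
      (f := fun q : ℝ × Ω => (q.1.toNNReal, j i q.1 q.2))
      ((measurable_real_toNNReal.comp measurable_fst).prodMk (hjm i)))
  have hq : ∀ s ω, ‖q s ω‖ ≤ ‖v‖ * E := fun s ω =>
    (norm_sum_inner_smul_le e.orthonormal s _).trans (hkb ω 0 h0T)
  have hqlim : ∀ ω, Tendsto (fun s => q s ω) atTop (𝓝 (k 0 ω)) := fun ω => by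
    have h1 := e.hasSum_repr (k 0 ω)
    simp only [HilbertBasis.repr_apply_apply] at h1
    exact h1
  have hkey : ∀ i, ∫ ω, L i ω ∂P = ∫ ω, D i ω ∂P := fun i =>
    hM.integral_stochInt_mul e (h := fun t ω => shiftOp S σ t (j i t ω))
      (Ch := K * (‖e i‖ * E)) (hM.measurable_shiftOp measurable_fst (hjm i))
      (fun t ht ω => ContinuousLinearMap.le_of_opNorm_le_of_le _ (hM.norm_shiftOp_le ht)
        (hjb i ω t ht)) (hIi i) hf hfC hfC' (hχm i) hkm (hpm i)
      (fun ω => hM.isMildSol_shift (hjm i) (hj i) ω) hk (hp i)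
  -- `D` consists of the term `A` with the derivative of `f` and of the term with `∇B`.
  have hADg : ∀ i ω, A i ω - D i ω = f (X' T ω) * g i ω := fun i ω => by
    have h1 : (∫ r in (0 : ℝ)..T,
        ⟪p i r ω, fderiv ℝ (B r) (X' r ω) (χ i r ω) (k r ω)⟫_ℝ) = g i ω :=
      intervalIntegral.integral_congr fun r _ => by
        simp only [χ, map_smul, smul_apply, real_inner_smul_right]
    simp only [A, D, ibpDeriv, h1, sub_sub_cancel]
  have hLint : ∀ i, Integrable (L i) P := fun i => by
    refine Integrable.mul_bdd (c := Cf * (‖e i‖ * (‖v‖ * E)))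
      ((hI2.inner_const (e i)).integrable one_le_two) ?_ (ae_of_all _ fun ω => ?_)
    · exact ((hf.continuous.measurable.comp (hsec' hM.X_meas T)).mul
        (measurable_const.inner (hsec' hkm 0))).aestronglyMeasurable
    · exact abs_ibpValue_le hfC (k := fun t => k t ω) (hkb ω 0 h0T)
  have hDint : ∀ i, Integrable (D i) P := fun i =>
    Integrable.of_bound (measurable_ibpDeriv hC hf (e i) hM.X_meas (hχm i) hkm
      (hpm i)).aestronglyMeasurable _ (ae_of_all _ fun ω =>
        abs_ibpDeriv_le hC hfC hfC' (w' := e i) (X := fun t => X' t ω) (χ := fun t => χ i t ω)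
          (k := fun t => k t ω) (p := fun t => p i t ω) (hχb i ω) (hkb ω) (hpb i ω))
  have hAint : ∀ i, Integrable (A i) P := fun i => by
    refine Integrable.of_bound (C := Cf' * (ℓ T * (‖e i‖ * E)) * (‖e i‖ * (‖v‖ * E)))
      (((hf.continuous_fderiv_apply one_ne_zero).measurable.comp
        (f := fun ω => (X' T ω, χ i T ω)) ((hsec' hM.X_meas T).prodMk (hsec' (hχm i) T))).mul
        (measurable_const.inner (hsec' hkm 0))).aestronglyMeasurable (ae_of_all _ fun ω => ?_)
    rw [norm_mul]
    refine mul_le_mul (ContinuousLinearMap.le_of_opNorm_le_of_le _ (hfC' _) (hχb i ω T hTT))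
      ((norm_inner_le_norm _ _).trans (mul_le_mul_of_nonneg_left (hkb ω 0 h0T) (norm_nonneg _)))
      (norm_nonneg _) (by positivity)
  have hNint : ∀ i, Integrable (fun ω => L i ω + (A i ω - D i ω)) P := fun i =>
    (hLint i).add ((hAint i).sub (hDint i))
  -- As `L` and `D` have the same integral, so have the sums of `L + (A - D)` and of `A` over finite
  -- sets of basis vectors. Only after summation do the two integrands have bounds that are uniform
  -- in the set, which allows dominated convergence on both sides.
  have hsum : ∀ s : Finset ι, ∫ ω, ∑ i ∈ s, (L i ω + (A i ω - D i ω)) ∂P =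
      ∫ ω, ∑ i ∈ s, A i ω ∂P := fun s => by
    rw [integral_finsetSum _ fun i _ => hNint i,
      integral_finsetSum _ fun i _ => hAint i]
    refine Finset.sum_congr rfl fun i _ => ?_
    have h1 : ∫ ω, (L i ω + (A i ω - D i ω)) ∂P = (∫ ω, L i ω ∂P) + ∫ ω, (A i ω - D i ω) ∂P :=
      integral_add (hLint i) ((hAint i).sub (hDint i))
    rw [h1, integral_sub (hAint i) (hDint i), hkey, add_sub_cancel]
  have hN : ∀ s ω, ∑ i ∈ s, (L i ω + (A i ω - D i ω)) =
      f (X' T ω) * (⟪I ω, q s ω⟫_ℝ + ∑ i ∈ s, g i ω) := fun s ω => by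
    simp only [q, inner_sum, real_inner_smul_right, ← Finset.sum_add_distrib, Finset.mul_sum]
    refine Finset.sum_congr rfl fun i _ => ?_
    rw [hADg]
    simp only [L, ibpValue]
    ring
  have hR : ∀ᵐ ω ∂P, ∀ s, ∑ i ∈ s, A i ω =
      ℓ T * fderiv ℝ f (X' T ω) (S T (J ω 0 T (q s ω))) := by
    filter_upwards [hflow] with ω hω s
    simp only [A, χ, q, map_sum, map_smul, smul_eq_mul, Finset.mul_sum, Real.coe_toNNReal _ hT,
      (hω _ T hTT).1]
    exact Finset.sum_congr rfl fun i _ => by ring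
  have hpath : ∀ᵐ ω ∂P, Tendsto (fun s => ∑ i ∈ s, g i ω) atTop
      (𝓝 (∫ r in (0 : ℝ)..T, ℓ r * corrTrace e S B T (fun t => X t ω) (J ω) v r)) ∧
      ∀ s : Finset ι, |∑ i ∈ s, g i ω| ≤ M := by
    filter_upwards [hXX', hJ] with ω hω hJω
    exact (hMb (X' := fun t => X' t ω) (j := fun i t => j i t ω) (p := fun i t => p i t ω)
      (k := fun t => k t ω) (hsec hM.X_meas ω) hω hJω (fun i => hsec (hjm i) ω)
      (fun i => hsec (hpm i) ω) (hsec hkm ω) (fun i => hj i ω) (fun i => hp i ω) (hk ω)).2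
  have hNlim : ∀ᵐ ω ∂P, Tendsto (fun s => ∑ i ∈ s, (L i ω + (A i ω - D i ω))) atTop
      (𝓝 (f (X' T ω) * (⟪I ω, k 0 ω⟫_ℝ +
        ∫ r in (0 : ℝ)..T, ℓ r * corrTrace e S B T (fun t => X t ω) (J ω) v r))) := by
    filter_upwards [hpath] with ω hω
    simp only [hN]
    exact ((tendsto_const_nhds.inner (hqlim ω)).add hω.1).const_mul _
  have hNb : ∀ s : Finset ι, ∀ᵐ ω ∂P, ‖∑ i ∈ s, (L i ω + (A i ω - D i ω))‖ ≤
      Cf * (‖I ω‖ * (‖v‖ * E) + M) := fun s => by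
    filter_upwards [hpath] with ω hω
    rw [hN, norm_mul]
    refine mul_le_mul (hfC _) ((norm_add_le _ _).trans (add_le_add ((norm_inner_le_norm _ _).trans
      (mul_le_mul_of_nonneg_left (hq s ω) (norm_nonneg _))) (hω.2 s))) (norm_nonneg _) hCf
  have hbint : Integrable (fun ω => Cf * (‖I ω‖ * (‖v‖ * E) + M)) P :=
    (((hI2.integrable one_le_two).norm.mul_const _).add (integrable_const M)).const_mul Cf
  have hNm : ∀ s : Finset ι, AEStronglyMeasurable
      (fun ω => ∑ i ∈ s, (L i ω + (A i ω - D i ω))) P := fun s =>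
    (integrable_finsetSum s fun i _ => hNint i).1
  have hRlim : ∀ᵐ ω ∂P, Tendsto (fun s => ∑ i ∈ s, A i ω) atTop
      (𝓝 (ℓ T * fderiv ℝ f (X' T ω) (S T v))) := by
    filter_upwards [hR, hM.ae_flow_backward hXX' hJ hk] with ω hω hω'
    simp only [hω]
    rw [← hω'.1]
    exact (((fderiv ℝ f (X' T ω)).comp ((S T).comp (J ω 0 T))).continuous.tendsto _
      |>.comp (hqlim ω)).const_mul (ℓ T)
  have hRb : ∀ s : Finset ι, ∀ᵐ ω ∂P, ‖∑ i ∈ s, A i ω‖ ≤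
      ℓ T * (Cf' * (1 * (E * (‖v‖ * E)))) := fun s => by
    filter_upwards [hR, hXX', hJ] with ω hω hω1 hω2
    have h1 : ‖J ω 0 T‖ ≤ E := (hω2.isLinFlow_path hω1).norm_apply_le
      (fun q hq => norm_B_path (X' := fun t => X' t ω) hC hq) le_rfl hT le_rfl
    rw [hω, norm_mul, Real.norm_of_nonneg hℓT]
    refine mul_le_mul_of_nonneg_left ?_ hℓT
    exact ContinuousLinearMap.le_of_opNorm_le_of_le _ (hfC' _)
      (ContinuousLinearMap.le_of_opNorm_le_of_le _ (hC.S_norm T hT)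
        (ContinuousLinearMap.le_of_opNorm_le_of_le _ h1 (hq s ω)))
  refine ⟨hbint.mono' (aestronglyMeasurable_of_tendsto_ae atTop hNm hNlim) ?_, ?_⟩
  · filter_upwards [hNlim, ae_all_iff.2 hNb] with ω h1 h2
    exact le_of_tendsto h1.norm (Eventually.of_forall h2)
  · have h1 := tendsto_integral_filter_of_dominated_convergence _ (Eventually.of_forall hNm)
      (Eventually.of_forall hNb) hbint hNlim
    have h2 := tendsto_integral_filter_of_dominated_convergence _
      (Eventually.of_forall fun s : Finset ι => (integrable_finsetSum s fun i _ => hAint i).1)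
      (Eventually.of_forall hRb) (integrable_const _) hRlim
    simp only [hsum] at h1
    rw [← integral_const_mul]
    exact tendsto_nhds_unique h1 h2

/-- The correction term of the weight converges almost surely, and the weight has the form to which
the integration by parts formula applies. -/
theorem Model.ae_correctionConverges (e : HilbertBasis ι ℝ H)
    (hM : Model W V ℓ P S b σ B T K x X' Y)
    (hHS : ∀ t₀ : ℝ, 0 < t₀ → ∫⁻ t in Ioc 0 t₀, hsNormSq e (S t) ≠ ∞)
    (hXX' : ∀ᵐ ω ∂P, ∀ᵐ t, t ∈ Icc 0 T → X t ω = X' t ω)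
    (hJ : ∀ᵐ ω ∂P, IsFlow B T (fun t => X t ω) (J ω))
    (hJt : ∀ᵐ ω ∂P, IsMildFlow S b T (fun t => X t ω) (Jt ω)) (v : H) :
    ∀ᵐ ω ∂P, CorrectionConverges e ℓ T
        (correctionOp S σ B T (fun t => X t ω) (J ω) (Jt ω) v) ∧
      ∫ t in Ioc 0 T, (∫ r in t..T,
        trace e (correctionOp S σ B T (fun t => X t ω) (J ω) (Jt ω) v t r)) ∂ℓ.measure =
        ∫ r in (0 : ℝ)..T, ℓ r * corrTrace e S B T (fun t => X t ω) (J ω) v r := by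
  have hC := hM.coeffs
  choose j hjm hj using fun i => hC.exists_forward hM.X_meas (e i)
  choose p hpm hp using fun i => hC.exists_adjoint e hM.X_meas (e i)
  obtain ⟨k, hkm, hk⟩ := hC.exists_backward hM.X_meas v
  have hsec : ∀ {h : ℝ → Ω → H}, (Measurable fun q : ℝ × Ω => h q.1 q.2) →
      ∀ ω, Measurable fun t => h t ω := fun hg ω => hg.comp measurable_prodMk_right
  obtain ⟨M, hMb⟩ := exists_tendsto_sum_integral e hC hHS ℓ hM.ℓ_zero v
  filter_upwards [hXX', hJ, hJt] with ω hω hJω hJtω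
  exact correctionConverges_path (X' := fun t => X' t ω) e hC hHS hM.ℓ_zero hM.σ_unit
    (hsec hM.X_meas ω) hω hJω hJtω
    (hMb (X' := fun t => X' t ω) (j := fun i t => j i t ω) (p := fun i t => p i t ω)
      (k := fun t => k t ω) (hsec hM.X_meas ω) hω hJω (fun i => hsec (hjm i) ω)
      (fun i => hsec (hpm i) ω) (hsec hkm ω) (fun i => hj i ω) (fun i => hp i ω) (hk ω)).1

/-- Integration by parts for the weight itself; it differs from `Model.integral_mul_backward` by the
factor `ℓ(T)⁻¹` and by null sets. -/
theorem Model.integral_mul_weight (e : HilbertBasis ι ℝ H)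
    (hM : Model W V ℓ P S b σ B T K x X' Y)
    (hHS : ∀ t₀ : ℝ, 0 < t₀ → ∫⁻ t in Ioc 0 t₀, hsNormSq e (S t) ≠ ∞)
    (hℓT : 0 < ℓ T) (hℓ_start : ∫⁻ t in Ioc 0 T, hsNormSq e (S t) ∂ℓ.measure ≠ ∞)
    (hXX' : ∀ᵐ ω ∂P, ∀ᵐ t, t ∈ Icc 0 T → X t ω = X' t ω) (hXT : X T =ᵐ[P] X' T)
    (hJ : ∀ᵐ ω ∂P, IsFlow B T (fun t => X t ω) (J ω))
    (hJt : ∀ᵐ ω ∂P, IsMildFlow S b T (fun t => X t ω) (Jt ω)) {I : Ω → H}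
    (hI : IsItoIntegralH W V ℓ P T (fun t ω => ContinuousLinearMap.adjoint
      ((Ring.inverse (σ t)).comp ((S t).comp (J ω 0 t)))) I) (v : H)
    {f : H → ℝ} (hf : ContDiff ℝ 1 f) {Cf Cf' : ℝ} (hfC : ∀ y, |f y| ≤ Cf)
    (hfC' : ∀ y, ‖fderiv ℝ f y‖ ≤ Cf') :
    Integrable (fun ω => f (X T ω) *
      weight e ℓ S σ B T (fun t => X t ω) (J ω) (Jt ω) (I ω) v) P ∧
    ∫ ω, fderiv ℝ f (X T ω) (S T v) ∂P =
      ∫ ω, f (X T ω) * weight e ℓ S σ B T (fun t => X t ω) (J ω) (Jt ω) (I ω) v ∂P := by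
  obtain ⟨k, hkm, hk⟩ := hM.coeffs.exists_backward hM.X_meas v
  obtain ⟨h1, h2⟩ := hM.integral_mul_backward e hHS hℓ_start hXX' hJ hI hkm hk hf hfC hfC'
  have hw : (fun ω => f (X T ω) *
      weight e ℓ S σ B T (fun t => X t ω) (J ω) (Jt ω) (I ω) v) =ᵐ[P]
      fun ω => (ℓ T)⁻¹ * (f (X' T ω) * (⟪I ω, k 0 ω⟫_ℝ +
        ∫ r in (0 : ℝ)..T, ℓ r * corrTrace e S B T (fun t => X t ω) (J ω) v r)) := by
    filter_upwards [hXT, hM.ae_flow_backward hXX' hJ hk,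
      hM.ae_correctionConverges e hHS hXX' hJ hJt v] with ω hω1 hω2 hω3
    rw [weight, hω1, hω2.2, hω3.2]
    ring
  refine ⟨(h1.const_mul _).congr hw.symm, ?_⟩
  rw [integral_congr_ae hw, integral_const_mul, h2, inv_mul_cancel_left₀ hℓT.ne']
  exact integral_congr_ae (hXT.mono fun ω hω => by simp only [hω])

end Formula

end SubordinateIBP

end

theorem theorem2p1 {Ω H ι : Type*} [MeasurableSpace Ω]
    [NormedAddCommGroup H] [InnerProductSpace ℝ H] [CompleteSpace H]
    [TopologicalSpace.SeparableSpace H] [MeasurableSpace H] [BorelSpace H]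
    (e : HilbertBasis ι ℝ H)
    (P : Measure Ω) [IsProbabilityMeasure P]
    -- the linear part: a contraction semigroup of injective, Hilbert-Schmidt operators
    (A : H →ₗ.[ℝ] H) (S : ℝ → H →L[ℝ] H)
    (hS : SubordinateIBP.IsContractionSemigroup A S)
    (hS_HS : ∀ t₀ : ℝ, 0 < t₀ → ∫⁻ t in Ioc 0 t₀, SubordinateIBP.hsNormSq e (S t) ≠ ∞)
    (hS_inj : ∀ t, 0 ≤ t → Function.Injective (S t))
    -- the coefficients
    (b : ℝ → H → H) (σ : ℝ → H →L[ℝ] H) (B : ℝ → H → H →L[ℝ] H)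
    (hbσ : SubordinateIBP.StandingAssumptions b σ)
    (hH1 : SubordinateIBP.AssumptionH1 S b B)
    (hH2 : SubordinateIBP.AssumptionH2 σ)
    -- the noise
    (W : ℝ≥0 → H → Ω → ℝ) (hW : SubordinateIBP.IsCylindricalBrownian W P)
    (V : ℝ → Ω → H) (hV : SubordinateIBP.IsCadlagProcess V P)
    (hWV : Indep (SubordinateIBP.sigmaW W) (SubordinateIBP.sigmaV V) P)
    -- the deterministic time change
    (T : ℝ) (hT : 0 < T) (ℓ : StieltjesFunction ℝ) (hℓ0 : ℓ 0 = 0) (hℓT : 0 < ℓ T)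
    (hℓ_jumps : {t ∈ Ioc 0 T | Function.leftLim ℓ t < ℓ t}.Finite)
    (hℓ_end : ∫⁻ t in Ioc 0 T, SubordinateIBP.hsNormSq e (S (T - t)) ∂ℓ.measure ≠ ∞)
    (hℓ_start : ∫⁻ t in Ioc 0 T, SubordinateIBP.hsNormSq e (S t) ∂ℓ.measure ≠ ∞)
    -- the solution started at `x`, and its linearizations
    (x : H) (X : ℝ → Ω → H) (hX : SubordinateIBP.IsMildSolution e W V ℓ P S b σ T x X)
    (J Jt : Ω → ℝ → ℝ → H →L[ℝ] H)
    (hJ : ∀ᵐ ω ∂P, SubordinateIBP.IsFlow B T (fun t => X t ω) (J ω))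
    (hJt : ∀ᵐ ω ∂P, SubordinateIBP.IsMildFlow S b T (fun t => X t ω) (Jt ω)) :
    -- the stochastic integral in the weight exists
    (∃ I : Ω → H, SubordinateIBP.IsItoIntegralH W V ℓ P T
      (fun t ω => ContinuousLinearMap.adjoint
        ((Ring.inverse (σ t)).comp ((S t).comp (J ω 0 t)))) I) ∧
    -- the correction term in the weight converges
    (∀ v : H, ∀ᵐ ω ∂P, SubordinateIBP.CorrectionConverges e ℓ T
      (SubordinateIBP.correctionOp S σ B T (fun t => X t ω) (J ω) (Jt ω) v)) ∧
    -- the integration by parts formula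
    ∀ I : Ω → H, SubordinateIBP.IsItoIntegralH W V ℓ P T
        (fun t ω => ContinuousLinearMap.adjoint
          ((Ring.inverse (σ t)).comp ((S t).comp (J ω 0 t)))) I →
      ∀ (v : H) (f : H → ℝ), ContDiff ℝ 1 f → (∃ C, ∀ y, |f y| ≤ C) →
        (∃ C, ∀ y, ‖fderiv ℝ f y‖ ≤ C) →
        Integrable (fun ω => f (X T ω) *
          SubordinateIBP.weight e ℓ S σ B T (fun t => X t ω) (J ω) (Jt ω) (I ω) v) P ∧
        ∫ ω, fderiv ℝ f (X T ω) (S T v) ∂P =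
          ∫ ω, f (X T ω) *
            SubordinateIBP.weight e ℓ S σ B T (fun t => X t ω) (J ω) (Jt ω) (I ω) v ∂P := by
  have : SecondCountableTopology H := UniformSpace.secondCountable_of_separable H
  obtain ⟨K, X', Y, hM, hXX', hXT⟩ :=
    SubordinateIBP.exists_model e hS hS_HS hS_inj hbσ hH1 hH2 hW hV hWV hT hℓ0 hℓ_end hX
  refine ⟨hM.exists_isItoIntegralH e hℓ_start hXX' hJ, fun v => ?_, ?_⟩
  · exact (hM.ae_correctionConverges e hS_HS hXX' hJ hJt v).mono fun ω hω => hω.1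
  · rintro I hI v f hf ⟨Cf, hfC⟩ ⟨Cf', hfC'⟩
    exact hM.integral_mul_weight e hS_HS hℓT hℓ_start hXX' hXT hJ hJt hI v hf hfC hfC'
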